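/- Let $N\ge 2$ be an integer and let $R$ be a commutative ring whose characteristic divides $N$. For an $\mathfrak{sl}(N)$ MOY graph $\Gamma\subset\mathbb R^2$, let $\mathscr F_N(\Gamma;R)$ be the quotient of the free $R$-module on dotted $\mathfrak{sl}(N)$ foams $\mathbf F\colon\emptyset\to\Gamma$ by the kernel of the bilinear pairing $\langle \mathbf F,\mathbf G\rangle_R=\langle \mathbf F\cup\overline{\mathbf G}\rangle_R$. Here $\overline{\mathbf G}$ is the mirror image of $\mathbf G$, and $\langle\,\cdot\,\rangle_R$ is the image of the Robert–Wagner evaluation $\langle\,\cdot\,\rangle\in\mathbb Z[X_1,\dots,X_N]^{\mathfrak S_N}$ of closed dotted foams under the map $\mathbb Z[X_1,\dots,X_N]\to R$ that sends every $X_i$ to $0$. A dot of weight $w$ on a facet with label $\ell$ (where $1\le w\le\ell$) stands for the elementary symmetric polynomial $e_w$ in $\ell$ variables that belong to the facet; so a dotted foam is written $PF$, with $F$ a foam without dots and $P$ a product of such polynomials. The weight $1$ basepoint operator of a basepoint on an edge of $\Gamma$ labelled $1$ adds a dot of weight $1$ to the facet whose boundary contains the basepoint. The operator $\nabla$ is given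 by $\nabla(PF)=\nabla(P)F$, where $\nabla(P)$ is the sum of all first order partial derivatives of $P$. **(a)** Let $\Gamma$ be an $\mathfrak{sl}(N)$ MOY graph. The evaluations $\langle\mathbf F\cup\overline{\mathbf G}\rangle$ used above are indeed symmetric polynomials with integral coefficients. For any two basepoints on edges of $\Gamma$ labelled $1$, their weight $1$ basepoint operators $X,Y$ and the operator $\nabla$ descend to $\mathscr F_N(\Gamma;R)$, and the composition of the $R$-linear maps $$X^{N-1}\mathscr F_N(\Gamma;R)\xrightarrow{\;Y^{N-1}\nabla^{N-1}\;}Y^{N-1}\mathscr F_N(\Gamma;R)\xrightarrow{\;X^{N-1}\nabla^{N-1}\;}X^{N-1}\mathscr F_N(\Gamma;R)$$ is $$(X^{N-1}\nabla^{N-1})\circ(Y^{N-1}\nabla^{N-1})=\begin{cases}\mathrm{Id}& N\text{ is prime},\\ 0& N\text{ is composite}.\end{cases}$$ **(b)** Let $D$ be a diagram of an oriented link with two basepoints away from the crossings. Let $\mathrm{KRC}_N(D;R)=\bigoplus_v\mathscr F_N(D_v;R)$ be the $R$-module underlying the $\mathfrak{sl}(N)$ chain complex of $D$, where $D_v$ is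 the MOY graph of the complete resolution $v$ of $D$. Let $X$, $Y$, $\nabla$ be the direct sums over all $v$ of the weight $1$ basepoint operators of the two basepoints and of the operators $\nabla$ on $\mathscr F_N(D_v;R)$. Then the composition of the maps $Y^{N-1}\nabla^{N-1}\colon X^{N-1}\mathrm{KRC}_N(D;R)\to Y^{N-1}\mathrm{KRC}_N(D;R)$ and $X^{N-1}\nabla^{N-1}\colon Y^{N-1}\mathrm{KRC}_N(D;R)\to X^{N-1}\mathrm{KRC}_N(D;R)$ is the identity if $N$ is prime and zero if $N$ is composite. -/

import Mathlib

noncomputable section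

namespace SlFoam

/-! ### Piecewise linear MOY graphs in the plane -/

/-- The plane. -/
abbrev Plane := Fin 2 → ℝ

/-- Three-dimensional space. -/
abbrev Space := Fin 3 → ℝ

/-- A family of directed straight segments in the plane, labelled by natural numbers. The pair
`(a, b)` is the segment directed from `a` to `b`. The values of `label` off `edges` are irrelevant. -/
structure PlaneGraph where
  edges : Set (Plane × Plane)
  label : Plane × Plane → ℕ

/-- `Γ` is an `sl(N)` MOY graph: an oriented trivalent graph, piecewise linearly embedded in the
plane, labelled by `0, …, N`, without sources and sinks, and with the sum of the incoming labels
equal to the sum of the outgoing labels at each vertex. Edges of the MOY graph are polygonal, so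
that bivalent corners (one segment in, one segment out, of the same label) are allowed; an edge of
the MOY graph is a maximal chain of segments joined at bivalent corners. Self-loops, multiple
edges and circles without vertices are allowed (as polygons). -/
structure PlaneGraph.IsMOY (N : ℕ) (Γ : PlaneGraph) : Prop where
  finite : Γ.edges.Finite
  ne : ∀ a b, (a, b) ∈ Γ.edges → a ≠ b
  label_le : ∀ e ∈ Γ.edges, Γ.label e ≤ N
  embedded : ∀ e ∈ Γ.edges, ∀ f ∈ Γ.edges, e ≠ f →
    segment ℝ e.1 e.2 ∩ segment ℝ f.1 f.2 ⊆ {e.1, e.2} ∩ {f.1, f.2}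
  vertex : ∀ x, (∃ y, (x, y) ∈ Γ.edges ∨ (y, x) ∈ Γ.edges) →
    (∃ a b, {y | (y, x) ∈ Γ.edges} = {a} ∧ {y | (x, y) ∈ Γ.edges} = {b} ∧
      Γ.label (a, x) = Γ.label (x, b)) ∨
    (∃ a b c, a ≠ b ∧ {y | (y, x) ∈ Γ.edges} = {a, b} ∧ {y | (x, y) ∈ Γ.edges} = {c} ∧
      Γ.label (a, x) + Γ.label (b, x) = Γ.label (x, c)) ∨
    (∃ a b c, b ≠ c ∧ {y | (y, x) ∈ Γ.edges} = {a} ∧ {y | (x, y) ∈ Γ.edges} = {b, c} ∧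
      Γ.label (a, x) = Γ.label (x, b) + Γ.label (x, c))

/-! ### Labelled complexes of oriented triangles -/

/-- An oriented triangle; the three cyclic rotations of a triple stand for the same one. -/
abbrev Triangle := Space × Space × Space

/-- A family of oriented labelled triangles in space. The values of `label` off `tri` are
irrelevant. -/
structure LabelledComplex where
  tri : Set Triangle
  label : Triangle → ℕ

/-- `LeftCyclic u x y z`: the half-planes bounded by the line through `u`, containing `x`, `y`, `z`
respectively, occur in the cyclic order `x, y, z` around the axis `u` by the left-hand rule
(thumb along `u`). For three distinct half-planes this holds for exactly one of the two cyclic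
orders: a step of less than a half turn from `x` to `y` has `det (u, x, y) < 0`, and at least
two of the three steps are less than a half turn. -/
def LeftCyclic (u x y z : Space) : Prop :=
  let d : Space → Space → ℝ := fun s t => Matrix.det (Matrix.of ![u, s, t])
  (d x y < 0 ∧ d y z < 0) ∨ (d y z < 0 ∧ d z x < 0) ∨ (d z x < 0 ∧ d x y < 0)

namespace LabelledComplex

/-- The apexes of the triangles whose boundary orientation runs along the edge from `a` to `b`. -/
def star (C : LabelledComplex) (a b : Space) : Set Space := {c | (a, b, c) ∈ C.tri}

/-- The edge `ab` lies in exactly two triangles, `abp` and `baq`, whose orientations match. -/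
def IsRegular (C : LabelledComplex) (a b p q : Space) : Prop :=
  C.star a b = {p} ∧ C.star b a = {q}

/-- The edge `ab` lies in exactly three triangles: it is part of a binding. The binding, directed
from `a` to `b`, agrees with the orientations of the triangles `abp`, `abq`, and disagrees with that
of the triangle `bar`. -/
def IsBinding (C : LabelledComplex) (a b p q r : Space) : Prop :=
  p ≠ q ∧ C.star a b = {p, q} ∧ C.star b a = {r}

/-- The edge `ab` lies in exactly one triangle, `abp`. -/
def IsBoundaryEdge (C : LabelledComplex) (a b p : Space) : Prop :=
  C.star a b = {p} ∧ C.star b a = ∅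

/-! The link of a vertex `v` is a graph on a small sphere around `v`. Its edges are the pairs
`(b, c)` with `vbc` an oriented triangle, its nodes are the edges of the complex at `v`. -/

/-- The edges of the link of `v`. -/
def linkEdges (C : LabelledComplex) (v : Space) : Set (Space × Space) := {e | (v, e.1, e.2) ∈ C.tri}

/-- Two link edges are consecutive at a bivalent node of the link. -/
def LinkStep (C : LabelledComplex) (v : Space) (e f : Space × Space) : Prop :=
  e.2 = f.1 ∧ C.IsRegular v e.2 f.2 e.1

/-- Two link edges are in the same sector: the intersection of the sphere with one sheet at `v`. -/
def SameSector (C : LabelledComplex) (v : Space) : Space × Space → Space × Space → Prop :=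
  Relation.EqvGen (C.LinkStep v)

/-- `p` is a trivalent node of the link of `v`: the edge `vp` is part of a binding. -/
def IsTrivalentNode (C : LabelledComplex) (v p : Space) : Prop :=
  ∃ x y z, C.IsBinding v p x y z ∨ C.IsBinding p v x y z

/-- `e` is a link edge of `v` between the nodes `p` and `x`. -/
def IsEdgeBetween (C : LabelledComplex) (v p x : Space) (e : Space × Space) : Prop :=
  e ∈ C.linkEdges v ∧ (e = (p, x) ∨ e = (x, p))

/-- A sector at `v` leads from the node `p`, first towards `x`, to the node `q`, at last
from `y`. -/
def Joins (C : LabelledComplex) (v p x q y : Space) : Prop :=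
  ∃ e f, C.IsEdgeBetween v p x e ∧ C.IsEdgeBetween v q y f ∧ C.SameSector v e f

/-- The sector of the link edge `e` has the node `p` as an end. -/
def Touches (C : LabelledComplex) (v : Space) (e : Space × Space) (p : Space) : Prop :=
  ∃ f x, C.SameSector v e f ∧ C.IsEdgeBetween v p x f

/-- Local model at a point of a facet: the link is connected, without trivalent nodes. It is a circle
at an inner point, and an arc at a point on the boundary. -/
def IsFacetPoint (C : LabelledComplex) (v : Space) : Prop :=
  (∀ b, ¬ C.IsTrivalentNode v b) ∧
    ∀ e ∈ C.linkEdges v, ∀ f ∈ C.linkEdges v, C.SameSector v e f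

/-- Local model at an inner point of a binding (an interval times a tripod in the plane):
the link is a theta graph drawn on the sphere. So it has two trivalent nodes
`p, q`, each sector joins them, and the cyclic orders of the sectors at `p` and at `q`, seen from
`v`, are opposite. -/
def IsBindingPoint (C : LabelledComplex) (v : Space) : Prop :=
  ∃ p q, p ≠ q ∧ (∀ b, C.IsTrivalentNode v b ↔ b = p ∨ b = q) ∧
    (∀ e ∈ C.linkEdges v, C.Touches v e p ∧ C.Touches v e q) ∧
    ∀ x₁ x₂ x₃ y₁ y₂ y₃, C.Joins v p x₁ q y₁ → C.Joins v p x₂ q y₂ → C.Joins v p x₃ q y₃ →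
      LeftCyclic (p - v) (x₁ - v) (x₂ - v) (x₃ - v) → LeftCyclic (q - v) (y₁ - v) (y₃ - v) (y₂ - v)

/-- Local model at a singular point (the cone on the one-skeleton of a tetrahedron): the link is the
complete graph on four trivalent nodes `t 0, …, t 3`, drawn on the sphere as the one-skeleton of a
tetrahedron. So any two nodes are joined by a sector, and if the sectors at `t i` to `t j, t k, t l`
have this cyclic order, then those at `t j` to `t i, t l, t k` have this cyclic order. -/
def IsSingularPoint (C : LabelledComplex) (v : Space) : Prop :=
  ∃ t : Fin 4 → Space, Function.Injective t ∧ (∀ b, C.IsTrivalentNode v b ↔ ∃ i, b = t i) ∧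
    (∀ e ∈ C.linkEdges v, ∃ i, C.Touches v e (t i)) ∧
    (∀ i j, i ≠ j → ∃ x y, C.Joins v (t i) x (t j) y) ∧
    ∀ i j k l, i ≠ j → i ≠ k → i ≠ l → j ≠ k → j ≠ l → k ≠ l →
      ∀ xj xk xl yi yk yl wk wl zk zl,
        C.Joins v (t i) xj (t j) yi → C.Joins v (t i) xk (t k) wk → C.Joins v (t i) xl (t l) wl →
        C.Joins v (t j) yk (t k) zk → C.Joins v (t j) yl (t l) zl →
        LeftCyclic (t i - v) (xj - v) (xk - v) (xl - v) →
        LeftCyclic (t j - v) (yi - v) (yl - v) (yk - v)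

/-- Local model at a boundary point `v` (in the plane `z = 0`, the complex lying below it) at a
trivalent vertex of the boundary graph: the link is a tripod drawn on the lower hemisphere, with one
trivalent node `p` and three legs that end in the plane. So the cyclic order of the legs at `p` is
that of their ends in the plane (both are expressed here around an axis that points down). -/
def IsBoundaryVertex (C : LabelledComplex) (v : Space) : Prop :=
  ∃ p, (∀ b, C.IsTrivalentNode v b ↔ b = p) ∧
    (∀ e ∈ C.linkEdges v, C.Touches v e p ∧ ∃ n : Space, n 2 = 0 ∧ C.Touches v e n) ∧
    ∀ x₁ x₂ x₃ n₁ n₂ n₃ y₁ y₂ y₃, n₁ 2 = 0 → n₂ 2 = 0 → n₃ 2 = 0 →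
      C.Joins v p x₁ n₁ y₁ → C.Joins v p x₂ n₂ y₂ → C.Joins v p x₃ n₃ y₃ →
      LeftCyclic (p - v) (x₁ - v) (x₂ - v) (x₃ - v) →
      LeftCyclic ![0, 0, -1] (n₁ - v) (n₂ - v) (n₃ - v)

end LabelledComplex

/-! ### Foams with boundary a MOY graph -/

/-- The plane as the horizontal plane `z = 0` in space. -/
def incl (x : Plane) : Space := ![x 0, x 1, 0]

/-- The vertical projection of space to the plane. -/
def proj (a : Space) : Plane := ![a 0, a 1]

/-- A (piecewise linear) `sl(N)` foam from the empty graph to `Γ`. It lies in the half-space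
`z ≤ 0` and meets the plane `z = 0` transversely in `Γ`. It is given by an embedded finite
simplicial complex with oriented labelled triangles. The *facets* are the classes of triangles under
adjacency along regular edges; orientations and labels are constant on them. The *bindings* consist
of the edges in exactly three triangles, the *singular points* are the vertices where the link has
four trivalent nodes. -/
structure Foam (N : ℕ) (Γ : PlaneGraph) extends LabelledComplex where
  finite : tri.Finite
  rotate : ∀ a b c, (a, b, c) ∈ tri → (b, c, a) ∈ tri
  label_rotate : ∀ a b c, (a, b, c) ∈ tri → label (b, c, a) = label (a, b, c)
  label_le : ∀ t ∈ tri, label t ≤ N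
  /-- Each triangle carries only one orientation. -/
  oriented : ∀ a b c, (a, b, c) ∈ tri → (b, a, c) ∉ tri
  nondegenerate : ∀ a b c, (a, b, c) ∈ tri → AffineIndependent ℝ ![a, b, c]
  /-- Two triangles meet in a common face (vertex, edge, or not at all), or are equal. -/
  embedded : ∀ a b c a' b' c', (a, b, c) ∈ tri → (a', b', c') ∈ tri →
    convexHull ℝ {a, b, c} ∩ convexHull ℝ {a', b', c'} ⊆
      convexHull ℝ (({a, b, c} : Set Space) ∩ {a', b', c'})
  below : ∀ a b c, (a, b, c) ∈ tri → a 2 ≤ 0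
  /-- The edges in the plane `z = 0` are the segments of `Γ`, with the induced direction. -/
  boundary : ∀ x y, (x, y) ∈ Γ.edges ↔ ∃ c, (incl x, incl y, c) ∈ tri
  /-- Near a segment of `Γ` the foam consists of one triangle below the plane, of the same label. -/
  collar : ∀ x y, (x, y) ∈ Γ.edges → ∃ c : Space, c 2 < 0 ∧
    toLabelledComplex.IsBoundaryEdge (incl x) (incl y) c ∧
    label (incl x, incl y, c) = Γ.label (x, y)
  /-- The vertices in the plane `z = 0` are those of `Γ`. -/
  boundary_vertex : ∀ a b c, (a, b, c) ∈ tri → a 2 = 0 →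
    ∃ y, (proj a, y) ∈ Γ.edges ∨ (y, proj a) ∈ Γ.edges
  /-- Each other edge is regular, or part of a binding in one of the two directions. -/
  edge : ∀ a b c, (a, b, c) ∈ tri → ¬ (a 2 = 0 ∧ b 2 = 0) →
    (∃ p q, toLabelledComplex.IsRegular a b p q) ∨
    (∃ p q r, toLabelledComplex.IsBinding a b p q r) ∨
    (∃ p q r, toLabelledComplex.IsBinding b a p q r)
  label_regular : ∀ a b p q, toLabelledComplex.IsRegular a b p q → label (a, b, p) = label (b, a, q)
  label_binding : ∀ a b p q r, toLabelledComplex.IsBinding a b p q r →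
    label (a, b, p) + label (a, b, q) = label (b, a, r)
  inner_point : ∀ v b c, (v, b, c) ∈ tri → v 2 < 0 →
    toLabelledComplex.IsFacetPoint v ∨ toLabelledComplex.IsBindingPoint v ∨
      toLabelledComplex.IsSingularPoint v
  boundary_point : ∀ v b c, (v, b, c) ∈ tri → v 2 = 0 →
    toLabelledComplex.IsFacetPoint v ∨ toLabelledComplex.IsBoundaryVertex v

/-! ### Dots -/

/-- A possible dot: a triangle that carries the dot, and the weight `w` with `1 ≤ w ≤ ℓ`, where `ℓ`
is the label of the triangle. -/
def LabelledComplex.Dot (C : LabelledComplex) : Type :=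
  {d : Triangle × ℕ // d.1 ∈ C.tri ∧ 1 ≤ d.2 ∧ d.2 ≤ C.label d.1}

/-- A dotted foam: a foam with a finite multiset of dots. Dots are free to move in their facet; this
identification takes place in the state space below, since the evaluation only depends on
the facets that carry the dots. -/
abbrev DottedFoam (N : ℕ) (Γ : PlaneGraph) : Type :=
  (F : Foam N Γ) × (F.Dot →₀ ℕ)

/-- The free `R`-module on the dotted foams from the empty graph to `Γ`. Isotopic foams are not
identified here, but in the state space below. -/
abbrev FoamModule (N : ℕ) (Γ : PlaneGraph) (R : Type*) [CommRing R] : Type _ :=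
  DottedFoam N Γ →₀ R

section Nabla

variable (R : Type*) [CommRing R]

/-- A dot of weight `w` stands for the elementary symmetric polynomial `e_w` in `ℓ` variables that
belong to the facet. `lowerDot d` stands for `e_(w-1)`; it is `1` for a dot of weight one. -/
def lowerDot (C : LabelledComplex) (d : C.Dot) : MvPolynomial C.Dot R :=
  if h : 2 ≤ d.1.2 then
    MvPolynomial.X ⟨(d.1.1, d.1.2 - 1), d.2.1, by omega, by have := d.2.2.2; dsimp only; omega⟩
  else 1

/-- The operator `∇` on polynomials in the dots: the derivation with
`∇ e_w = (ℓ - w + 1) e_(w-1)`. By `toVariables_nablaDots` below, this is the sum of all partial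
derivatives with respect to the variables of the facets. -/
def nablaDots (C : LabelledComplex) :
    Derivation R (MvPolynomial C.Dot R) (MvPolynomial C.Dot R) :=
  MvPolynomial.mkDerivation R fun d => ((C.label d.1.1 - d.1.2 + 1 : ℕ) : R) • lowerDot R C d

/-- The polynomial ring with `ℓ(t)` variables for each triangle `t`. -/
abbrev Variables (C : LabelledComplex) : Type := (t : C.tri) × Fin (C.label t)

/-- The sum of all first order partial derivatives on a polynomial ring: the derivation that maps
each variable to `1`. -/
def nabla (σ : Type*) : Derivation R (MvPolynomial σ R) (MvPolynomial σ R) :=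
  MvPolynomial.mkDerivation R fun _ => 1

/-- The symmetric polynomial for which a polynomial in the dots stands: a dot of weight `w`
becomes `e_w`. -/
def toVariables (C : LabelledComplex) :
    MvPolynomial C.Dot R →ₐ[R] MvPolynomial (Variables C) R :=
  MvPolynomial.aeval fun d =>
    ∑ s ∈ (Finset.univ : Finset (Fin (C.label d.1.1))).powersetCard d.1.2,
      ∏ i ∈ s, MvPolynomial.X ⟨⟨d.1.1, d.2.1⟩, i⟩

theorem nabla_esymm {σ ι : Type*} (g : ι → σ) (S : Finset ι) (w : ℕ) (hw : w < S.card) :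
    nabla R σ (∑ s ∈ S.powersetCard (w + 1), ∏ i ∈ s, MvPolynomial.X (g i)) =
      ((S.card - w : ℕ) : R) • ∑ s ∈ S.powersetCard w, ∏ i ∈ s, MvPolynomial.X (g i) := by
  classical
  have main : ∀ (S : Finset ι) (w : ℕ),
      nabla R σ (∑ s ∈ S.powersetCard (w + 1), ∏ i ∈ s, MvPolynomial.X (g i)) =
      ((S.card : MvPolynomial σ R) - (w : MvPolynomial σ R)) *
        ∑ s ∈ S.powersetCard w, ∏ i ∈ s, MvPolynomial.X (g i) := by
    intro S
    induction S using Finset.induction_on with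
    | empty =>
      intro w
      have h0 : ∀ n, (∅ : Finset ι).powersetCard (n + 1) = ∅ := fun n =>
        Finset.powersetCard_eq_empty.2 (by simp)
      rcases w with _ | w
      · simp [h0]
      · simp [h0]
    | insert a S ha ih =>
      have key : ∀ w, ∑ s ∈ (insert a S).powersetCard (w + 1),
            ∏ i ∈ s, (MvPolynomial.X (g i) : MvPolynomial σ R) =
          ∑ s ∈ S.powersetCard (w + 1), ∏ i ∈ s, MvPolynomial.X (g i) +
          MvPolynomial.X (g a) * ∑ s ∈ S.powersetCard w, ∏ i ∈ s, MvPolynomial.X (g i) := by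
        intro w
        rw [Finset.powersetCard_succ_insert ha, Finset.sum_union, Finset.sum_image, Finset.mul_sum]
        · congr 1
          refine Finset.sum_congr rfl fun s hs => ?_
          rw [Finset.prod_insert fun h => ha ((Finset.mem_powersetCard.1 hs).1 h)]
        · intro s hs t ht h
          have h1 : a ∉ s := fun h => ha ((Finset.mem_powersetCard.1 hs).1 h)
          have h2 : a ∉ t := fun h => ha ((Finset.mem_powersetCard.1 ht).1 h)
          rw [← Finset.erase_insert h1, ← Finset.erase_insert h2, h]
        · rw [Finset.disjoint_left]
          intro s hs ht
          obtain ⟨t, -, rfl⟩ := Finset.mem_image.1 ht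
          exact ha ((Finset.mem_powersetCard.1 hs).1 (Finset.mem_insert_self _ _))
      intro w
      have hX : nabla R σ (MvPolynomial.X (g a)) = 1 := MvPolynomial.mkDerivation_X _ _ _
      rcases w with _ | w
      · rw [key, map_add, Derivation.leibniz, ih, hX]
        simp [Finset.card_insert_of_notMem ha]
      · rw [key, map_add, Derivation.leibniz, ih, ih, hX, key, Finset.card_insert_of_notMem ha]
        simp only [smul_eq_mul]
        push_cast
        ring
  rw [main, MvPolynomial.smul_eq_C_mul, Nat.cast_sub hw.le]
  simp

/-- `∇` on the dots is the sum of the partial derivatives with respect to the variables of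
the facets. -/
theorem toVariables_nablaDots (C : LabelledComplex) (P : MvPolynomial C.Dot R) :
    toVariables R C (nablaDots R C P) = nabla R (Variables C) (toVariables R C P) := by
  have hX : ∀ d : C.Dot, toVariables R C (nablaDots R C (MvPolynomial.X d)) =
      nabla R (Variables C) (toVariables R C (MvPolynomial.X d)) := by
    rintro ⟨⟨t, w⟩, ht, h1, hw⟩
    obtain ⟨w, rfl⟩ : ∃ v, w = v + 1 := ⟨w - 1, by simp only at h1; omega⟩
    simp only at hw
    have h := nabla_esymm R (fun i : Fin (C.label t) => (⟨⟨t, ht⟩, i⟩ : Variables C))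
      Finset.univ w (by simpa using hw)
    have e1 : toVariables R C (MvPolynomial.X ⟨(t, w + 1), ht, h1, hw⟩) =
        ∑ s ∈ (Finset.univ : Finset (Fin (C.label t))).powersetCard (w + 1),
          ∏ i ∈ s, MvPolynomial.X (⟨⟨t, ht⟩, i⟩ : Variables C) := MvPolynomial.aeval_X _ _
    have e2 : nablaDots R C (MvPolynomial.X ⟨(t, w + 1), ht, h1, hw⟩) =
        ((C.label t - (w + 1) + 1 : ℕ) : R) • lowerDot R C ⟨(t, w + 1), ht, h1, hw⟩ :=
      MvPolynomial.mkDerivation_X _ _ _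
    rw [e1, e2, h, map_smul]
    have hc : C.label t - (w + 1) + 1 = (Finset.univ : Finset (Fin (C.label t))).card - w := by
      simp; omega
    rw [hc]
    congr 1
    unfold lowerDot
    rcases w with _ | w
    · simp
    · rw [dif_pos (by simp)]
      exact MvPolynomial.aeval_X _ _
  induction P using MvPolynomial.induction_on with
  | C a => simp [toVariables, nablaDots, nabla]
  | add p q hp hq => simp only [map_add, hp, hq]
  | mul_X p d hp => rw [Derivation.leibniz, map_mul, Derivation.leibniz, map_add, ← hX, ← hp]; simp

/-- The combination of dotted foams `P F`, for a foam `F` and a polynomial `P` in the dots: a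
monomial in the dots is a set of dots. -/
def decorate {N : ℕ} {Γ : PlaneGraph} (F : Foam N Γ) :
    MvPolynomial F.Dot R →ₗ[R] FoamModule N Γ R :=
  (MvPolynomial.basisMonomials F.Dot R).constr R fun k => Finsupp.single ⟨F, k⟩ 1

/-- The operator `∇` on combinations of dotted foams, `∇ (P F) = ∇ (P) F`. -/
def nablaFoam (N : ℕ) (Γ : PlaneGraph) : Module.End R (FoamModule N Γ R) :=
  Finsupp.linearCombination R fun φ : DottedFoam N Γ =>
    decorate R φ.1 (nablaDots R φ.1.toLabelledComplex (MvPolynomial.monomial φ.2 1))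

end Nabla

/-- The dot of weight `w` on the facet whose boundary contains the segment `e` of `Γ`. -/
def Foam.boundaryDot {N : ℕ} {Γ : PlaneGraph} (F : Foam N Γ) (e : Plane × Plane) (he : e ∈ Γ.edges)
    (w : ℕ) (h1 : 1 ≤ w) (hw : w ≤ Γ.label e) : F.Dot :=
  ⟨((incl e.1, incl e.2, (F.collar e.1 e.2 he).choose), w), by
    obtain ⟨-, h, h'⟩ := (F.collar e.1 e.2 he).choose_spec
    refine ⟨?_, h1, ?_⟩
    · change _ ∈ F.star (incl e.1) (incl e.2)
      rw [h.1]
      rfl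
    · exact hw.trans h'.ge⟩

/-- The weight `w` basepoint operator on combinations of dotted foams: it adds a dot of weight `w` to
the facet whose boundary contains the basepoint. The basepoint is specified by a segment `e` of `Γ`
on which it lies. -/
def basepointFoam (N : ℕ) (Γ : PlaneGraph) (R : Type*) [CommRing R] (e : Plane × Plane)
    (he : e ∈ Γ.edges) (w : ℕ) (h1 : 1 ≤ w) (hw : w ≤ Γ.label e) :
    Module.End R (FoamModule N Γ R) :=
  Finsupp.linearCombination R fun φ : DottedFoam N Γ =>
    Finsupp.single ⟨φ.1, φ.2 + Finsupp.single (φ.1.boundaryDot e he w h1 hw) 1⟩ 1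

/-! ### The Robert–Wagner evaluation -/

/-- A coloring of a closed foam by subsets of the set of pigments: a subset of `ℓ(f)` elements for
each facet `f`, with `c(f) ∪ c(g) = c(h)` at each binding where `f, g, h` meet and
`ℓ(f) + ℓ(g) = ℓ(h)`. Pigments are numbered from `0` here. The last condition only fixes irrelevant
values. -/
structure IsColoring (N : ℕ) (C : LabelledComplex) (c : Triangle → Finset (Fin N)) : Prop where
  card : ∀ t ∈ C.tri, (c t).card = C.label t
  rotate : ∀ x y z, (x, y, z) ∈ C.tri → c (y, z, x) = c (x, y, z)
  regular : ∀ a b p q, C.IsRegular a b p q → c (a, b, p) = c (b, a, q)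
  binding : ∀ a b p q r, C.IsBinding a b p q r → c (a, b, p) ∪ c (a, b, q) = c (b, a, r)
  off : ∀ t, t ∉ C.tri → c t = ∅

/-- The Euler characteristic of the closed subcomplex spanned by a set of triangles:
vertices minus edges plus triangles. -/
def eulerChar (S : Set Triangle) : ℤ :=
  (((fun t : Triangle => t.1) '' S).ncard : ℤ) - ((fun t : Triangle => s(t.1, t.2.1)) '' S).ncard +
    ((fun t : Triangle => ({t.1, t.2.1, t.2.2} : Set Space)) '' S).ncard

section Evaluation

variable {N : ℕ} (C : LabelledComplex) (c : Triangle → Finset (Fin N))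

/-- The monochrome surface of the pigment `i`. -/
def monochrome (i : Fin N) : Set Triangle := {t ∈ C.tri | i ∈ c t}

/-- The bichrome surface of the pigments `i, j`. -/
def bichrome (i j : Fin N) : Set Triangle := {t ∈ C.tri | Xor (i ∈ c t) (j ∈ c t)}

/-- The edge from `a` to `b` is part of a binding that is positive with respect to `i < j`. The
binding is directed as the two facets `f ∋ i`, `g ∋ j` whose labels add up to that of `h`, and the
cyclic order of the facets is `f, g, h` by the left-hand rule. -/
def IsPositive (i j : Fin N) (a b : Space) : Prop :=
  ∃ p q r, C.IsBinding a b p q r ∧ i ∈ c (a, b, p) ∧ j ∈ c (a, b, q) ∧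
    LeftCyclic (b - a) (p - a) (q - a) (r - a)

/-- The number of simple closed curves that the positive bindings with respect to `i < j` form: the
number of components of their union. -/
def theta (i j : Fin N) : ℕ :=
  Nat.card (SimpleGraph.fromRel fun a b :
    {a : Space // ∃ b, IsPositive C c i j a b ∨ IsPositive C c i j b a} =>
      IsPositive C c i j a b).ConnectedComponent

/-- The pairs of pigments `i < j`. -/
def pigmentPairs (N : ℕ) : Finset (Fin N × Fin N) := Finset.univ.filter fun p => p.1 < p.2

/-- The exponent of the sign. The pigment `i` has the number `i + 1`. -/
def signExponent : ℤ :=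
  ∑ i : Fin N, ((i : ℤ) + 1) * (eulerChar (monochrome C c i) / 2) +
    ∑ p ∈ pigmentPairs N, (theta C c p.1 p.2 : ℤ)

/-- The field of rational functions in the variables `X_i` of the pigments `i`. -/
abbrev RatFunc (N : ℕ) : Type := FractionRing (MvPolynomial (Fin N) ℤ)

/-- The denominator `∏_{i < j} (X_i - X_j) ^ (χ / 2)`, where `χ` is the Euler characteristic of the
bichrome surface. -/
def denominator : RatFunc N :=
  ∏ p ∈ pigmentPairs N,
    (algebraMap (MvPolynomial (Fin N) ℤ) (RatFunc N)
      (MvPolynomial.X p.1 - MvPolynomial.X p.2)) ^ (eulerChar (bichrome C c p.1 p.2) / 2)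

/-- The numerator: each dot of weight `w` gives the elementary symmetric polynomial `e_w` in
the variables `X_i`, where `i` runs over the color of its facet. -/
def numerator (k : Triangle × ℕ →₀ ℕ) : MvPolynomial (Fin N) ℤ :=
  k.prod fun d m => (∑ s ∈ (c d.1).powersetCard d.2, ∏ i ∈ s, MvPolynomial.X i) ^ m

/-- The Robert–Wagner evaluation of a closed foam with dots, as a rational function. -/
def evaluation (N : ℕ) (C : LabelledComplex) (k : Triangle × ℕ →₀ ℕ) : RatFunc N :=
  ∑ᶠ c ∈ {c | IsColoring N C c}, (-1) ^ signExponent C c *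
    algebraMap (MvPolynomial (Fin N) ℤ) (RatFunc N) (numerator c k) / denominator C c

end Evaluation

open Classical in
/-- The image in `R` of a rational function, if it is a polynomial with integral coefficients, under
the substitution of `0` for each variable. -/
def valueAtZero {N : ℕ} (R : Type*) [CommRing R] (x : RatFunc N) : R :=
  if h : ∃ P : MvPolynomial (Fin N) ℤ, algebraMap _ (RatFunc N) P = x then
    ((MvPolynomial.constantCoeff h.choose : ℤ) : R)
  else 0

/-! ### The universal construction -/

/-- The reflection of space in the plane `z = 0`. -/
def mirror (a : Space) : Space := ![a 0, a 1, -a 2]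

/-- The mirror image of an oriented triangle, with the reversed orientation. -/
def mirrorTriangle (t : Triangle) : Triangle := (mirror t.2.1, mirror t.1, mirror t.2.2)

open Classical in
/-- The complex `F ∪ G'` obtained by gluing `F` to the mirror image `G'` of `G`. Orientations of the
mirror image are reversed, so that they match along the plane `z = 0`. -/
def glue (F G : LabelledComplex) : LabelledComplex where
  tri := F.tri ∪ mirrorTriangle ⁻¹' G.tri
  label t := if t ∈ F.tri then F.label t else G.label (mirrorTriangle t)

variable {N : ℕ} {Γ : PlaneGraph}

/-- The dots on `F ∪ G'`. -/
def glueDots (φ ψ : DottedFoam N Γ) : Triangle × ℕ →₀ ℕ :=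
  φ.2.mapDomain (fun d => d.1) + ψ.2.mapDomain fun d => (mirrorTriangle d.1.1, d.1.2)

/-- The evaluation of `F ∪ G'`, as a rational function. -/
def pairing (φ ψ : DottedFoam N Γ) : RatFunc N :=
  evaluation N (glue φ.1.toLabelledComplex ψ.1.toLabelledComplex) (glueDots φ ψ)

variable (N Γ) (R : Type*) [CommRing R]

/-- The kernel of the bilinear pairing `⟨F, G⟩ = ⟨F ∪ G'⟩` with values in `R`. -/
def pairingKernel : Submodule R (FoamModule N Γ R) :=
  ⨅ ψ : DottedFoam N Γ, LinearMap.ker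
    (Finsupp.linearCombination R fun φ : DottedFoam N Γ => valueAtZero R (pairing φ ψ))

/-- The state space of `Γ`: combinations of dotted foams from the empty graph to `Γ`, modulo
the kernel of the pairing. -/
def StateSpace : Type _ := FoamModule N Γ R ⧸ pairingKernel N Γ R

instance : AddCommGroup (StateSpace N Γ R) :=
  inferInstanceAs (AddCommGroup (FoamModule N Γ R ⧸ pairingKernel N Γ R))

instance : Module R (StateSpace N Γ R) :=
  inferInstanceAs (Module R (FoamModule N Γ R ⧸ pairingKernel N Γ R))

variable {N Γ R}

/-- An operator on combinations of dotted foams descends to the state space. -/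
def Descends (f : Module.End R (FoamModule N Γ R)) : Prop :=
  pairingKernel N Γ R ≤ (pairingKernel N Γ R).comap f

/-- The induced operator on the state space. -/
def Descends.induced {f : Module.End R (FoamModule N Γ R)} (hf : Descends f) :
    Module.End R (StateSpace N Γ R) :=
  (pairingKernel N Γ R).mapQ (pairingKernel N Γ R) f hf

/-- For operators `X, Y, D` on a module `M`, the map `Y ^ n D ^ n : X ^ n M → Y ^ n M`. -/
def transfer {M : Type*} [AddCommGroup M] [Module R M] (D X Y : Module.End R M) (n : ℕ) :
    LinearMap.range (X ^ n) →ₗ[R] LinearMap.range (Y ^ n) :=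
  (Y ^ n).rangeRestrict ∘ₗ (D ^ n) ∘ₗ (LinearMap.range (X ^ n)).subtype

/-! ### Link diagrams -/

/-- A piecewise linear diagram of an oriented link. Each crossing `c` is presented in a small
parallelogram with the center `center c` and the half-sides `right c`, `up c`, in which the two
strands are the diagonals, directed upwards. The crossing is positive if the strand from the lower
left to the upper right corner is the upper strand, otherwise negative. Outside these
parallelograms, the diagram consists of the directed segments `arcs`. -/
structure LinkDiagram where
  crossings : ℕ
  center : Fin crossings → Plane
  right : Fin crossings → Plane
  up : Fin crossings → Plane
  frame : ∀ c, 0 < right c 0 * up c 1 - right c 1 * up c 0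
  positive : Fin crossings → Bool
  arcs : Set (Plane × Plane)
  finite : arcs.Finite
  ne : ∀ a b, (a, b) ∈ arcs → a ≠ b
  embedded : ∀ e ∈ arcs, ∀ f ∈ arcs, e ≠ f →
    segment ℝ e.1 e.2 ∩ segment ℝ f.1 f.2 ⊆ {e.1, e.2} ∩ {f.1, f.2}
  /-- The parallelograms are disjoint. -/
  boxes : ∀ c d, c ≠ d → Disjoint
    {x | ∃ s ∈ Set.Icc (-1 : ℝ) 1, ∃ t ∈ Set.Icc (-1 : ℝ) 1, x = center c + s • right c + t • up c}
    {x | ∃ s ∈ Set.Icc (-1 : ℝ) 1, ∃ t ∈ Set.Icc (-1 : ℝ) 1, x = center d + s • right d + t • up d}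
  /-- The segments outside meet the parallelograms at most in corners. -/
  outside : ∀ e ∈ arcs, ∀ c, ∀ s ∈ Set.Icc (-1 : ℝ) 1, ∀ t ∈ Set.Icc (-1 : ℝ) 1,
    center c + s • right c + t • up c ∈ segment ℝ e.1 e.2 →
      (s = -1 ∨ s = 1) ∧ (t = -1 ∨ t = 1) ∧
        (center c + s • right c + t • up c = e.1 ∨ center c + s • right c + t • up c = e.2)
  /-- At each end of a segment or strand, one of them ends and one of them begins. -/
  vertex : ∀ x,
    let strands : Set (Plane × Plane) := arcs ∪
      {e | ∃ c, e = (center c - right c - up c, center c + right c + up c) ∨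
        e = (center c + right c - up c, center c - right c + up c)}
    (∃ y, (x, y) ∈ strands ∨ (y, x) ∈ strands) →
      ∃ a b, {y | (y, x) ∈ strands} = {a} ∧ {y | (x, y) ∈ strands} = {b}

namespace LinkDiagram

/-- The point with coordinates `s, t` in the parallelogram of `c`. -/
def point (D : LinkDiagram) (c : Fin D.crossings) (s t : ℝ) : Plane :=
  D.center c + s • D.right c + t • D.up c

/-- The complete resolution `v` resolves the crossing `c` by an edge labelled `2`, rather than by the
oriented smoothing: this is the `0`-resolution of a positive crossing and the `1`-resolution of a
negative crossing. -/
def IsWide (D : LinkDiagram) (v : Fin D.crossings → Fin 2) (c : Fin D.crossings) : Prop :=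
  (D.positive c = true ∧ v c = 0) ∨ (D.positive c = false ∧ v c = 1)

/-- The edge labelled `2` that may replace the crossing `c`. -/
def wideEdge (D : LinkDiagram) (c : Fin D.crossings) : Plane × Plane :=
  (D.point c 0 (-1 / 2), D.point c 0 (1 / 2))

open Classical in
/-- The MOY graph of a complete resolution. -/
def resolve (D : LinkDiagram) (v : Fin D.crossings → Fin 2) : PlaneGraph where
  edges := D.arcs ∪
    {e | ∃ c, ¬ D.IsWide v c ∧ e ∈ ({(D.point c (-1) (-1), D.point c (-1) 1),
      (D.point c 1 (-1), D.point c 1 1)} : Set (Plane × Plane))} ∪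
    {e | ∃ c, D.IsWide v c ∧ e ∈ ({(D.point c (-1) (-1), D.point c 0 (-1 / 2)),
      (D.point c 1 (-1), D.point c 0 (-1 / 2)), D.wideEdge c,
      (D.point c 0 (1 / 2), D.point c (-1) 1),
      (D.point c 0 (1 / 2), D.point c 1 1)} : Set (Plane × Plane))}
  label e := if ∃ c, e = D.wideEdge c then 2 else 1

theorem mem_edges_resolve (D : LinkDiagram) (v : Fin D.crossings → Fin 2) {e : Plane × Plane}
    (he : e ∈ D.arcs) : e ∈ (D.resolve v).edges := Or.inl (Or.inl he)

theorem label_resolve (D : LinkDiagram) (v : Fin D.crossings → Fin 2) {e : Plane × Plane}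
    (he : e ∈ D.arcs) : (D.resolve v).label e = 1 := by
  have : ¬ ∃ c, e = D.wideEdge c := by
    rintro ⟨c, rfl⟩
    have h := D.outside _ he c 0 (by norm_num) (-1 / 2) (by norm_num) (left_mem_segment ℝ _ _)
    rcases h.1 with h | h <;> norm_num at h
  exact if_neg this

/-- The `R`-module that underlies the `sl(N)` chain complex of the diagram: the direct sum of
the state spaces of all complete resolutions. -/
def KRC (D : LinkDiagram) (N : ℕ) (R : Type*) [CommRing R] : Type _ :=
  DirectSum (Fin D.crossings → Fin 2) fun v => StateSpace N (D.resolve v) R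

instance (D : LinkDiagram) (N : ℕ) (R : Type*) [CommRing R] : AddCommGroup (D.KRC N R) :=
  inferInstanceAs (AddCommGroup (DirectSum _ _))

instance (D : LinkDiagram) (N : ℕ) (R : Type*) [CommRing R] : Module R (D.KRC N R) :=
  inferInstanceAs (Module R (DirectSum _ _))

/-- The direct sum of operators on the state spaces of all complete resolutions. -/
def sumOperator (D : LinkDiagram) {N : ℕ} {R : Type*} [CommRing R]
    (f : ∀ v, Module.End R (StateSpace N (D.resolve v) R)) : Module.End R (D.KRC N R) :=
  DirectSum.lmap f

end LinkDiagram

end SlFoam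

end

/-!
The composition is a computation in a Weyl algebra. On dotted foams `∇` is a derivation with
`∇ X = X ∇ + 1` and `∇ Y = Y ∇ + 1`, since a dot of weight `1` on a facet with label `1` is a
variable of the facet (`nablaFoam_basepointFoam`), and `X`, `Y` commute. Moreover `X ^ N = 0` on
the state space and `N = 0` in `R`. Normal ordering of
`X ^ (N - 1) ∇ ^ (N - 1) Y ^ (N - 1) ∇ ^ (N - 1) X ^ (N - 1)` gives terms with natural
coefficients. For composite `N` all of them are divisible by `N` (`dvd_factorial_mul`). For prime
`N` only the term `((N - 1)!) ^ 2 X ^ (N - 1)` survives, and its coefficient is `1` modulo `N` by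
Wilson's theorem (`transfer_comp_transfer`).

The operators descend to the state space because of their behaviour with respect to the pairing.
Basepoint operators are self-adjoint, as the two facets at a point of the graph become one
(`pairing_boundaryDot`). The derivation `∇ = ∑ ∂/∂X_i` of the ring of polynomials kills the
denominators of the evaluation, products of differences `X_i - X_j`, so
`⟨∇φ, ψ⟩ + ⟨φ, ∇ψ⟩ = ∇⟨φ, ψ⟩` (`nabla_pairingPoly`); and the constant coefficient of `∇ P` is
divisible by `N` for symmetric `P` (`constantCoeff_nabla_of_isSymmetric`), so `-∇` is adjoint to
`∇`. Finally, the dot of a facet with label `1` takes one of the values `X_1, …, X_N`, a root of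
`∏ (T - X_k)`. Hence its power `N` is a combination of lower powers whose coefficients are
symmetric without constant coefficient, and `X ^ N = 0` (`exists_pow_eq_sum`,
`constantCoeff_pairingPoly_nsmul`).

All this presupposes that the evaluation of a closed foam is a symmetric polynomial with integral
coefficients (`exists_polynomial_evaluation`). The tool is the Kempe move, which exchanges
adjacent pigments `i`, `j` of a coloring on a union `S` of components of the bichrome surface of
`i` and `j`. It changes the sign of a coloring by `(-1) ^ (χ(S) / 2)`
(`neg_one_zpow_signExponent_kempe`). This reduces to the parity of the number of circles in which
two sheets of a foam cross, which is the sign of a permutation: the surface in which the sheets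
differ is described by its darts, the cycles of a product of the flip and of the rotation are its
vertices, and the cycles of the rotation on the boundary are the crossing circles (`sgn_crossOn`).
The local models of a foam enter through the connectedness of the links of closed surfaces and
through the statement that at each vertex the sheets split and merge at most once, with the same
cyclic order (`CrossFork.exists_partner`).

The Kempe move on the whole bichrome surface gives symmetry (`permute_swap_evaluation`). For
integrality, group the colorings by Kempe moves on sets of components
(`sum_powerset_coloringTerm_mem`). The sum over such a group is a product over the components `K`,
and the factor of `K` has a pole of order at most `χ(K) / 2 ≤ 1` along `X_i = X_j`
(`IsComponent.eulerChar_le`), which cancels if `χ(K) = 2`. So the evaluation has no pole along any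
`X_i = X_j`, and these are the only possible ones (`evaluation_mem_residuePairs`,
`exists_polynomial_of_prod`).

The union of a foam with the mirror image of another one is a closed foam in the sense of the
local models (`IsGluing.isClosedFoam`). At the plane, facets glue to facets, and two tripods glue
to a theta graph (`GlueAt.isBindingPoint`).
-/

noncomputable section
namespace SlFoam

/-! ### Normal ordering in a Weyl algebra -/

section Weyl

variable {A : Type*} [Ring A]

/-- Leibniz rule. -/
theorem pow_mul_pow_of_comm_eq_one {D X : A} (h : D * X = X * D + 1) (n m : ℕ) :
    D ^ n * X ^ m = ∑ k ∈ Finset.range (n + 1),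
      ((n.choose k * m.descFactorial k : ℕ) : A) * (X ^ (m - k) * D ^ (n - k)) := by
  have h1 : ∀ m : ℕ, D * X ^ m = X ^ m * D + (m : A) * X ^ (m - 1) := by
    intro m
    induction m with
    | zero => simp
    | succ m ih =>
      rw [pow_succ, ← mul_assoc, ih, add_mul, mul_assoc, h, mul_add, mul_one, ← mul_assoc]
      rcases m with _ | m
      · simp
      · rw [Nat.add_sub_cancel, mul_assoc _ (X ^ m) X, Nat.add_sub_cancel, ← pow_succ]
        push_cast
        noncomm_ring
  induction n with
  | zero => simp
  | succ n ih =>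
    rw [pow_succ', mul_assoc, ih, Finset.mul_sum]
    have step : ∀ k ∈ Finset.range (n + 1),
        D * (((n.choose k * m.descFactorial k : ℕ) : A) * (X ^ (m - k) * D ^ (n - k))) =
        ((n.choose k * m.descFactorial k : ℕ) : A) * (X ^ (m - k) * D ^ (n + 1 - k)) +
        ((n.choose k * m.descFactorial (k + 1) : ℕ) : A) *
          (X ^ (m - (k + 1)) * D ^ (n + 1 - (k + 1))) := by
      intro k hk
      have hk' : k ≤ n := Nat.lt_succ_iff.1 (Finset.mem_range.1 hk)
      rw [← mul_assoc, ← Nat.cast_comm, mul_assoc, ← mul_assoc D, h1, Nat.descFactorial_succ,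
        add_mul, mul_add, mul_assoc (X ^ _), ← pow_succ', Nat.sub_add_comm hk',
        Nat.add_sub_add_right, Nat.sub_sub]
      congr 1
      rw [Nat.mul_comm (m - k), ← Nat.mul_assoc, Nat.cast_mul _ (m - k)]
      simp only [mul_assoc]
    rw [Finset.sum_congr rfl step, Finset.sum_add_distrib, Finset.sum_range_succ' _ (n + 1)]
    have : ∀ k ∈ Finset.range (n + 1),
        ((((n + 1).choose (k + 1)) * m.descFactorial (k + 1) : ℕ) : A) *
          (X ^ (m - (k + 1)) * D ^ (n + 1 - (k + 1))) =
        ((n.choose k * m.descFactorial (k + 1) : ℕ) : A) *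
          (X ^ (m - (k + 1)) * D ^ (n + 1 - (k + 1))) +
        ((n.choose (k + 1) * m.descFactorial (k + 1) : ℕ) : A) *
          (X ^ (m - (k + 1)) * D ^ (n + 1 - (k + 1))) := by
      intro k _
      rw [Nat.choose_succ_succ, add_mul, Nat.cast_add, add_mul]
    rw [Finset.sum_congr rfl this, Finset.sum_add_distrib, add_comm, add_assoc]
    congr 1
    rw [Finset.sum_range_succ', Finset.sum_range_succ _ n]
    simp

/-- The arithmetic behind the composition: the coefficients of the normal form. -/
theorem mul_pow_sandwich {D X Y : A} (hX : D * X = X * D + 1) (hY : D * Y = Y * D + 1)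
    (hXY : X * Y = Y * X) (n : ℕ) (h0 : X ^ (n + 1) = 0) :
    X ^ n * D ^ n * (Y ^ n * D ^ n) * X ^ n = ∑ k ∈ Finset.range (n + 1),
      ((n.choose k * n.descFactorial k * ((n - k + n).choose n * n.factorial) : ℕ) : A) *
        (X ^ n * (Y ^ (n - k) * D ^ (n - k))) := by
  have hz : ∀ m, n < m → X ^ m = 0 := fun m hm => by
    obtain ⟨d, rfl⟩ := Nat.exists_eq_add_of_le hm
    rw [pow_add, h0, zero_mul]
  have key : ∀ l, X ^ n * D ^ (l + n) * X ^ n =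
      (((l + n).choose n * n.factorial : ℕ) : A) * (X ^ n * D ^ l) := by
    intro l
    rw [mul_assoc, pow_mul_pow_of_comm_eq_one hX, Finset.mul_sum,
      Finset.sum_eq_single_of_mem n (Finset.mem_range.2 (by omega))]
    · rw [Nat.descFactorial_self, ← mul_assoc, ← Nat.cast_comm, mul_assoc]
      simp
    · intro k _ hk
      rcases lt_or_gt_of_ne hk with hk | hk
      · rw [← mul_assoc, ← Nat.cast_comm, mul_assoc, ← mul_assoc (X ^ n), ← pow_add,
          hz _ (by omega)]
        simp
      · rw [Nat.descFactorial_of_lt hk]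
        simp
  have e : X ^ n * D ^ n * (Y ^ n * D ^ n) * X ^ n = X ^ n * (D ^ n * Y ^ n) * (D ^ n * X ^ n) := by
    noncomm_ring
  rw [e, pow_mul_pow_of_comm_eq_one hY, Finset.mul_sum, Finset.sum_mul]
  refine Finset.sum_congr rfl fun k hk => ?_
  have c : X ^ n * Y ^ (n - k) = Y ^ (n - k) * X ^ n := (Commute.pow_pow hXY n (n - k)).eq
  calc X ^ n * (((n.choose k * n.descFactorial k : ℕ) : A) * (Y ^ (n - k) * D ^ (n - k))) *
        (D ^ n * X ^ n)
      = ((n.choose k * n.descFactorial k : ℕ) : A) *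
          (X ^ n * Y ^ (n - k) * (D ^ (n - k) * D ^ n) * X ^ n) := by
        rw [← mul_assoc (X ^ n), ← Nat.cast_comm]; simp only [mul_assoc]
    _ = ((n.choose k * n.descFactorial k : ℕ) : A) *
          (Y ^ (n - k) * (X ^ n * D ^ (n - k + n) * X ^ n)) := by
        rw [c, ← pow_add]; noncomm_ring
    _ = _ := by
        rw [key, ← mul_assoc (Y ^ _), ← Nat.cast_comm, mul_assoc, ← mul_assoc (Y ^ _), ← c,
          mul_assoc (X ^ n), Nat.cast_mul (n.choose k * n.descFactorial k), mul_assoc]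

/-- For composite `N ≠ 4`, already `(N - 1)!` is divisible by `N`; for `N = 4` the other factors of
the coefficient are needed. -/
theorem dvd_factorial_mul {N : ℕ} (hN : 2 ≤ N) (hp : ¬ N.Prime) (k : ℕ) (hk : k ≤ N - 1) :
    N ∣ (N - 1).choose k * (N - 1).descFactorial k *
      ((N - 1 - k + (N - 1)).choose (N - 1) * (N - 1).factorial) := by
  by_cases h4 : N = 4
  · subst h4
    interval_cases k <;> decide
  · refine Dvd.dvd.mul_left (Dvd.dvd.mul_left ?_ _) _
    obtain ⟨a, ha⟩ := Nat.exists_dvd_of_not_prime hN hp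
    obtain ⟨⟨b, hb⟩, ha1, haN⟩ := ha
    have hb1 : b ≠ 1 := by rintro rfl; omega
    have hb0 : b ≠ 0 := by rintro rfl; omega
    have ha0 : a ≠ 0 := by rintro rfl; omega
    have haN' : a ≤ N - 1 := by
      have := Nat.mul_le_mul_left a (show 2 ≤ b by omega); omega
    have hbN' : b ≤ N - 1 := by
      have := Nat.mul_le_mul_right b (show 2 ≤ a by omega); omega
    rcases eq_or_ne a b with rfl | hab
    · -- `N = a ^ 2` with `a ≥ 3`, and `a` and `2 a` are two factors of `(N - 1)!`
      have h3 : 3 ≤ a := by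
        by_contra h
        have : a = 2 := by omega
        subst this; omega
      have h2a : 2 * a ≤ N - 1 := by
        have := Nat.mul_le_mul_right a h3; omega
      have : a * (2 * a) ∣ (N - 1).factorial := by
        have h : a.factorial * (2 * a - 1 + 1) ∣ (2 * a).factorial := by
          rw [show 2 * a = (2 * a - 1) + 1 by omega, Nat.factorial_succ, mul_comm]
          exact Nat.mul_dvd_mul (by simp) (Nat.factorial_dvd_factorial (by omega))
        rw [show 2 * a - 1 + 1 = 2 * a by omega] at h
        exact (Nat.mul_dvd_mul (Nat.dvd_factorial (by omega) le_rfl) dvd_rfl).trans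
          (h.trans (Nat.factorial_dvd_factorial h2a))
      exact (Dvd.intro 2 (by rw [hb]; ring)).trans this
    · have key : ∀ a b : ℕ, 0 < a → a < b → b ≤ N - 1 → a * b ∣ (N - 1).factorial := by
        intro a b ha hab hbN
        have h : a * b ∣ b.factorial := by
          obtain ⟨b, rfl⟩ : ∃ c, b = c + 1 := ⟨b - 1, by omega⟩
          rw [Nat.factorial_succ, mul_comm]
          exact Nat.mul_dvd_mul_left _ (Nat.dvd_factorial ha (by omega))
        exact h.trans (Nat.factorial_dvd_factorial hbN)
      rcases lt_or_gt_of_ne hab with h | h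
      · exact hb.dvd.trans (key a b (by omega) h hbN')
      · exact (hb.trans (mul_comm a b)).dvd.trans (key b a (by omega) h haN')

theorem prime_dvd_choose_mul {N : ℕ} (hp : N.Prime) (k : ℕ) (hk : k < N - 1) :
    N ∣ (N - 1 - k + (N - 1)).choose (N - 1) :=
  hp.dvd_choose (by omega) (by omega) (by omega)

end Weyl

section Transfer

variable {R M : Type*} [CommRing R] [AddCommGroup M] [Module R M]

/-- The composition of the two transfer maps, for operators that generate a quotient of a Weyl
algebra in which the characteristic divides `N`. -/
theorem transfer_comp_transfer {N : ℕ} (hN : 2 ≤ N) (hR : (N : R) = 0) {D X Y : Module.End R M}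
    (hX : D * X = X * D + 1) (hY : D * Y = Y * D + 1) (hXY : X * Y = Y * X) (h0 : X ^ N = 0) :
    (N.Prime → transfer D Y X (N - 1) ∘ₗ transfer D X Y (N - 1) = LinearMap.id) ∧
      (¬ N.Prime → transfer D Y X (N - 1) ∘ₗ transfer D X Y (N - 1) = 0) := by
  have hz : ∀ a : ℕ, N ∣ a → (a : Module.End R M) = 0 := by
    rintro a ⟨b, rfl⟩
    ext m
    have : ((N * b : ℕ) : Module.End R M) m = ((N * b : ℕ) : R) • m := by
      rw [Module.End.natCast_apply, Nat.cast_smul_eq_nsmul]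
    rw [this]
    simp [hR]
  have hs := mul_pow_sandwich hX hY hXY (N - 1) (by rwa [Nat.sub_add_cancel (by omega)])
  have red : ∀ x : LinearMap.range (X ^ (N - 1)), ∃ v : M, (x : M) = (X ^ (N - 1)) v ∧
      ((transfer D Y X (N - 1) ∘ₗ transfer D X Y (N - 1)) x : M) =
      (X ^ (N - 1) * D ^ (N - 1) * (Y ^ (N - 1) * D ^ (N - 1)) * X ^ (N - 1)) v := by
    rintro ⟨_, v, rfl⟩
    exact ⟨v, rfl, rfl⟩
  constructor
  · intro hp
    have := Fact.mk hp
    ext x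
    obtain ⟨v, hv, hx⟩ := red x
    rw [hx, hs, Finset.sum_range_succ, Finset.sum_eq_zero]
    · have hw : (((N - 1).factorial : ℕ) : Module.End R M) = -1 := by
        have : N ∣ (N - 1).factorial + 1 := by
          rw [← ZMod.natCast_eq_zero_iff]
          push_cast
          rw [ZMod.wilsons_lemma]
          simp
        have := hz _ this
        push_cast at this
        exact eq_neg_of_add_eq_zero_left this
      simp only [Nat.choose_self, Nat.descFactorial_self, Nat.sub_self, zero_add, pow_zero,
        one_mul, mul_one, Nat.cast_mul, hw]
      rw [LinearMap.id_apply, hv]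
      simp
    · intro k hk
      rw [hz _ (Dvd.dvd.mul_left (Dvd.dvd.mul_right
        (prime_dvd_choose_mul hp k (Finset.mem_range.1 hk)) _) _), zero_mul]
  · intro hp
    ext x
    obtain ⟨v, hv, hx⟩ := red x
    rw [hx, hs, Finset.sum_eq_zero]
    · rfl
    · intro k hk
      rw [hz _ (dvd_factorial_mul hN hp k (by have := Finset.mem_range.1 hk; omega)), zero_mul]

end Transfer
end SlFoam
end

noncomputable section
namespace SlFoam

/-! ### Signs of permutations -/

section Perms

open Equiv Equiv.Perm

/-- The sign of a permutation is determined by the number of its orbits, here the fibres of `f`. -/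
theorem sign_eq_of_orbits {α β : Type*} [Fintype α] [DecidableEq α] [Fintype β] (σ : Perm α)
    (f : α → β) (hf : Function.Surjective f) (h : ∀ x y, f x = f y ↔ σ.SameCycle x y) :
    sign σ = (-1) ^ (Fintype.card α + Fintype.card β) := by
  classical
  let g : α → Perm α ⊕ α := fun x => if σ x = x then Sum.inr x else Sum.inl (σ.cycleOf x)
  have hg : ∀ x y, g x = g y ↔ f x = f y := by
    intro x y
    rw [h]
    by_cases hx : σ x = x <;> by_cases hy : σ y = y <;> simp only [g, hx, hy, if_true, if_false]
    · rw [Sum.inr.injEq]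
      exact ⟨fun h => h ▸ SameCycle.refl _ _, fun h => h.eq_of_left hx⟩
    · refine ⟨fun h => (by cases h), fun h => (hy ?_).elim⟩
      rw [← h.eq_of_left hx, hx]
    · refine ⟨fun h => (by cases h), fun h => (hx ?_).elim⟩
      rw [h.eq_of_right hy, hy]
    · rw [Sum.inl.injEq,
        sameCycle_iff_cycleOf_eq_of_mem_support (by simpa using hx) (by simpa using hy)]
  have hcard : Fintype.card β = σ.cycleFactorsFinset.card +
      (Finset.univ.filter fun x => σ x = x).card := by
    have h1 : (Finset.univ.image g) = σ.cycleFactorsFinset.disjSum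
        (Finset.univ.filter fun x => σ x = x) := by
      ext z
      simp only [Finset.mem_image, Finset.mem_univ, true_and]
      constructor
      · rintro ⟨x, rfl⟩
        by_cases hx : σ x = x
        · simp [g, hx]
        · simp only [g, hx, if_false]
          rw [Finset.inl_mem_disjSum, cycleOf_mem_cycleFactorsFinset_iff]
          simpa using hx
      · rcases z with c | x
        · rw [Finset.inl_mem_disjSum]
          intro hc
          obtain ⟨x, hx⟩ := (mem_cycleFactorsFinset_iff.1 hc).1.nonempty_support
          have hx' : σ x ≠ x := by
            have := mem_cycleFactorsFinset_support_le hc hx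
            simpa using this
          refine ⟨x, ?_⟩
          simp only [g, hx', if_false]
          rw [cycle_is_cycleOf hx hc]
        · rw [Finset.inr_mem_disjSum]
          intro hx
          refine ⟨x, ?_⟩
          simp only [g, (Finset.mem_filter.1 hx).2, if_true]
    have h2 : (Finset.univ.image g).card = (Finset.univ.image f).card := by
      obtain ⟨s, hs⟩ := hf.hasRightInverse
      have h3 : Finset.univ.image g = (Finset.univ.image f).image (g ∘ s) := by
        rw [Finset.image_image]
        refine Finset.image_congr fun x _ => ((hg _ _).2 ?_).symm
        exact hs _
      rw [h3, Finset.card_image_of_injective]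
      intro a b hab
      simpa [hs a, hs b] using (hg _ _).1 hab
    rw [← Finset.card_disjSum, ← h1, h2, Finset.image_univ_of_surjective hf, Finset.card_univ]
  rw [sign_of_cycleType, hcard, sum_cycleType]
  have : Fintype.card α = σ.support.card + (Finset.univ.filter fun x => σ x = x).card := by
    rw [← Finset.card_univ, add_comm, ← Finset.card_filter_add_card_filter_not (fun x => σ x = x)]
    congr 2
  rw [this, cycleType_def, Multiset.card_map]
  rw [show ∀ a b c : ℕ, a + b + (c + b) = a + c + 2 * b by intros; ring, pow_add _ _ (2 * _),
    pow_mul _ 2]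
  simp

/-- Exchanging the values of two permutations on a set `W`, if this gives permutations again, keeps
the product of their signs. -/
theorem sign_mul_sign_of_swap_on {α : Type*} [Fintype α] [DecidableEq α] (W : Set α)
    (p q p' q' : Perm α) (hp : ∀ v ∈ W, p' v = q v) (hp' : ∀ v, v ∉ W → p' v = p v)
    (hq : ∀ v ∈ W, q' v = p v) (hq' : ∀ v, v ∉ W → q' v = q v) :
    sign p' * sign q' = sign p * sign q := by
  have hfix : ∀ v, v ∉ W → (p⁻¹ * p') v = v := fun v hv => by simp [hp' v hv]
  have hW : ∀ v ∈ W, (p⁻¹ * p') v ∈ W := by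
    intro v hv
    by_contra h
    have := hfix _ h
    exact h (((p⁻¹ * p').injective this).symm ▸ hv)
  have key : q' * (p⁻¹ * p') = q := by
    ext v
    by_cases hv : v ∈ W
    · have := hq _ (hW v hv)
      simp only [Perm.mul_apply] at this ⊢
      rw [this]
      simp [hp v hv]
    · have := hfix v hv
      rw [Perm.mul_apply, this, hq' v hv]
  have := congrArg sign key
  simp only [Perm.sign_mul, sign_inv] at this
  rw [← this]
  have h1 : sign p * sign p = 1 := Int.units_mul_self _
  calc sign p' * sign q' = (sign p * sign p) * (sign p' * sign q') := by rw [h1, one_mul]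
    _ = _ := by ac_rfl

end Perms

/-! ### Euler characteristics of connected surfaces -/

section Euler

/-- The Euler characteristic of a connected closed surface is at most two. The surface is given by
its flags `t : T` (a face with a directed edge), the rotation `r` in the faces, and the maps to
vertices, edges and faces. -/
theorem card_add_card_le_of_connected {T V E F : Type*} [Fintype T] [Fintype V] [Fintype E]
    [Fintype F] (r : Equiv.Perm T) (v : T → V) (e : T → E) (f : T → F)
    (hv : Function.Surjective v) (he : Function.Surjective e) (hf : Function.Surjective f)
    (hr : ∀ t, f (r t) = f t)
    (hends : ∀ t u, e t = e u → s(v t, v (r t)) = s(v u, v (r u)))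
    (hflip : ∀ t, ∃ u, u ≠ t ∧ ∀ w, e w = e t ↔ w = t ∨ w = u)
    (hV : ∀ x : V → ZMod 2, (∀ t, x (v t) = x (v (r t))) → ∀ a b, x a = x b)
    (hF : ∀ g : F → ZMod 2, (∀ t u, e t = e u → g (f t) = g (f u)) → ∀ a b, g a = g b) :
    Fintype.card V + Fintype.card F ≤ Fintype.card E + 2 := by
  classical
  rcases isEmpty_or_nonempty T with hT | ⟨⟨t₀⟩⟩
  · have := hv.isEmpty
    have := hf.isEmpty
    simp
  obtain ⟨s, hs⟩ := he.hasRightInverse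
  -- the cochain complex over `ZMod 2`: `δ` is the coboundary of vertices, and `d` is the dual of
  -- the coboundary of edges, so that `χ ≤ dim ker δ + dim ker d ≤ 2`
  let δ : (V → ZMod 2) →ₗ[ZMod 2] (E → ZMod 2) :=
    { toFun := fun x i => x (v (s i)) + x (v (r (s i)))
      map_add' := fun x y => by ext i; simp; ring
      map_smul' := fun c x => by ext i; simp; ring }
  have hδ : ∀ x t, δ x (e t) = x (v t) + x (v (r t)) := by
    intro x t
    have := hends (s (e t)) t (hs _)
    change x (v (s (e t))) + x (v (r (s (e t)))) = _
    rcases Sym2.eq_iff.1 this with ⟨h1, h2⟩ | ⟨h1, h2⟩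
    · rw [h1, h2]
    · rw [h1, h2, add_comm]
  let d : (F → ZMod 2) →ₗ[ZMod 2] Module.Dual (ZMod 2) (E → ZMod 2) :=
    { toFun := fun g =>
        { toFun := fun h => ∑ t, h (e t) * g (f t)
          map_add' := fun x y => by simp [add_mul, Finset.sum_add_distrib]
          map_smul' := fun c x => by simp [Finset.mul_sum, mul_assoc] }
      map_add' := fun x y => by ext i; simp [mul_add, Finset.sum_add_distrib]
      map_smul' := fun c x => by ext i; simp [Finset.mul_sum]; congr 1; ext; ring }
  have hd : ∀ g h, d g h = ∑ t, h (e t) * g (f t) := fun _ _ => rfl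
  have h2 : ∀ a b : ZMod 2, a + b = 0 → a = b := by decide
  have hcomp : LinearMap.range d ≤ LinearMap.ker δ.dualMap := by
    rintro _ ⟨g, rfl⟩
    rw [LinearMap.mem_ker]
    ext1 x
    refine LinearMap.ext fun y => ?_
    change ∑ t, δ _ (e t) * g (f t) = 0
    simp only [hδ, add_mul, Finset.sum_add_distrib]
    rw [← Equiv.sum_comp r (fun t => _ * g (f t))]
    simp only [hr]
    exact CharTwo.add_self_eq_zero _
  -- both kernels consist of constant functions, as the surface is connected
  have kerδ : Module.finrank (ZMod 2) (LinearMap.ker δ) ≤ 1 := by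
    have hinj : Function.Injective ((LinearMap.proj (v t₀)).domRestrict (LinearMap.ker δ) :
        LinearMap.ker δ →ₗ[ZMod 2] ZMod 2) := by
      refine (injective_iff_map_eq_zero _).2 fun ⟨x, hx⟩ h0 => ?_
      have hx' := hV x fun t => h2 _ _ (by rw [← hδ]; rw [LinearMap.mem_ker.1 hx]; rfl)
      ext b
      exact (hx' b (v t₀)).trans h0
    simpa using LinearMap.finrank_le_finrank_of_injective hinj
  have kerd : Module.finrank (ZMod 2) (LinearMap.ker d) ≤ 1 := by
    have hc : ∀ g, d g = 0 → ∀ t u, e t = e u → g (f t) = g (f u) := by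
      intro g hg t u htu
      obtain ⟨w, hwt, hw⟩ := hflip t
      rcases (hw u).1 htu.symm with rfl | rfl
      · rfl
      have := congrArg (fun l => l (Pi.single (e t) 1)) hg
      simp only [hd, Pi.single_apply, LinearMap.zero_apply, ite_mul, one_mul, zero_mul, hw] at this
      rw [← Finset.sum_filter] at this
      have e1 : (Finset.univ.filter fun x => x = t ∨ x = u) = {t, u} := by ext; simp
      rw [e1, Finset.sum_pair hwt.symm] at this
      exact h2 _ _ this
    have hinj : Function.Injective ((LinearMap.proj (f t₀)).domRestrict (LinearMap.ker d) :
        LinearMap.ker d →ₗ[ZMod 2] ZMod 2) := by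
      refine (injective_iff_map_eq_zero _).2 fun ⟨g, hg⟩ h0 => ?_
      ext b
      exact (hF g (hc g (LinearMap.mem_ker.1 hg)) b (f t₀)).trans h0
    simpa using LinearMap.finrank_le_finrank_of_injective hinj
  -- rank and nullity, with `rank d ≤ dim ker δᵀ = |E| - rank δ`
  have r1 := LinearMap.finrank_range_add_finrank_ker δ
  have r2 := LinearMap.finrank_range_add_finrank_ker d
  have r3 := LinearMap.finrank_range_add_finrank_ker δ.dualMap
  have r4 := LinearMap.finrank_range_dualMap_eq_finrank_range δ
  have r5 := Submodule.finrank_mono hcomp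
  rw [Subspace.dual_finrank_eq] at r3
  simp only [Module.finrank_fintype_fun_eq_card] at r1 r2 r3
  omega

end Euler
end SlFoam
end

noncomputable section
namespace SlFoam

/-! ### Closed foams, sheets and links -/

/-- The combinatorial conditions on a closed foam, such as `F ∪ G'`. -/
structure IsClosedFoam (C : LabelledComplex) : Prop where
  finite : C.tri.Finite
  rotate : ∀ a b c, (a, b, c) ∈ C.tri → (b, c, a) ∈ C.tri
  oriented : ∀ a b c, (a, b, c) ∈ C.tri → (b, a, c) ∉ C.tri
  ne : ∀ a b c, (a, b, c) ∈ C.tri → a ≠ b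
  edge : ∀ a b c, (a, b, c) ∈ C.tri →
    (∃ p q, C.IsRegular a b p q) ∨ (∃ p q r, C.IsBinding a b p q r) ∨
      (∃ p q r, C.IsBinding b a p q r)
  /-- The three half-planes at a binding are distinct, so that they have a cyclic order. -/
  apart : ∀ a b p q r, C.IsBinding a b p q r →
    LeftCyclic (b - a) (p - a) (q - a) (r - a) ∨ LeftCyclic (b - a) (q - a) (p - a) (r - a)
  label_binding : ∀ a b p q r, C.IsBinding a b p q r →
    C.label (a, b, p) + C.label (a, b, q) = C.label (b, a, r)
  point : ∀ v b c, (v, b, c) ∈ C.tri →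
    C.IsFacetPoint v ∨ C.IsBindingPoint v ∨ C.IsSingularPoint v

/-- A union of facets that is a closed oriented surface, such as a monochrome surface: at a binding
it contains the facet of the largest label and one of the other two, or none of the three. -/
structure IsSheet (C : LabelledComplex) (P : Set Triangle) : Prop where
  subset : P ⊆ C.tri
  rotate : ∀ a b c, (a, b, c) ∈ P → (b, c, a) ∈ P
  regular : ∀ a b p q, C.IsRegular a b p q → ((a, b, p) ∈ P ↔ (b, a, q) ∈ P)
  binding : ∀ a b p q r, C.IsBinding a b p q r →
    ((b, a, r) ∈ P ↔ (a, b, p) ∈ P ∨ (a, b, q) ∈ P) ∧ ¬ ((a, b, p) ∈ P ∧ (a, b, q) ∈ P)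

/-- A union of facets that is a closed surface, such as a bichrome surface: at a binding it contains
two of the three facets, or none. -/
structure IsClosedSurface (C : LabelledComplex) (E : Set Triangle) : Prop where
  subset : E ⊆ C.tri
  rotate : ∀ a b c, (a, b, c) ∈ E → (b, c, a) ∈ E
  regular : ∀ a b p q, C.IsRegular a b p q → ((a, b, p) ∈ E ↔ (b, a, q) ∈ E)
  binding : ∀ a b p q r, C.IsBinding a b p q r →
    ((b, a, r) ∈ E ↔ (a, b, p) ∈ E ∧ (a, b, q) ∉ E ∨ (a, b, q) ∈ E ∧ (a, b, p) ∉ E)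

theorem IsSheet.isClosedSurface {C : LabelledComplex} {P : Set Triangle} (h : IsSheet C P) :
    IsClosedSurface C P where
  subset := h.subset
  rotate := h.rotate
  regular := h.regular
  binding a b p q r hb := by
    have := h.binding a b p q r hb
    tauto

theorem IsSheet.symmDiff {C : LabelledComplex} {P Q : Set Triangle} (hP : IsSheet C P)
    (hQ : IsSheet C Q) : IsClosedSurface C (symmDiff P Q) where
  subset := by
    rintro t (ht | ht)
    exacts [hP.subset ht.1, hQ.subset ht.1]
  rotate a b c := by
    have h1 : ∀ {P : Set Triangle}, IsSheet C P → ((a, b, c) ∈ P ↔ (b, c, a) ∈ P) := fun h =>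
      ⟨h.rotate _ _ _, fun h' => h.rotate _ _ _ (h.rotate _ _ _ h')⟩
    simp only [Set.mem_symmDiff, h1 hP, h1 hQ, imp_self]
  regular a b p q hr := by
    simp only [Set.mem_symmDiff, hP.regular _ _ _ _ hr, hQ.regular _ _ _ _ hr]
  binding a b p q r hb := by
    have h1 := hP.binding a b p q r hb
    have h2 := hQ.binding a b p q r hb
    simp only [Set.mem_symmDiff]
    tauto

theorem isSheet_empty (C : LabelledComplex) : IsSheet C ∅ where
  subset := Set.empty_subset _
  rotate := by simp
  regular := by simp
  binding := by simp

/-- The edges in the link of `v` of the triangles in `P`. -/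
def linkOf (P : Set Triangle) (v : Space) : Set (Space × Space) := {e | (v, e.1, e.2) ∈ P}

/-- The directed link edge between the node `p` and `x`, which starts at `p` if `s` is true. -/
def arm (s : Bool) (p x : Space) : Space × Space := if s then (p, x) else (x, p)

/-- Two link edges have a node in common. -/
def ShareNode (e f : Space × Space) : Prop := e.1 = f.1 ∨ e.1 = f.2 ∨ e.2 = f.1 ∨ e.2 = f.2

namespace LabelledComplex

variable {C : LabelledComplex} {v : Space}

/-- A trivalent node `p` of the link of `v`. The binding is directed away from `v` if `s` is true.
The link edges at `p` are the arms towards `x` and `y`, which point away from `p` if `s` is true,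
and the arm towards `z` in the other direction. -/
def Fork (C : LabelledComplex) (v : Space) (s : Bool) (p x y z : Space) : Prop :=
  if s then C.IsBinding v p x y z else C.IsBinding p v x y z

theorem isTrivalentNode_iff {p : Space} :
    C.IsTrivalentNode v p ↔ ∃ s x y z, C.Fork v s p x y z := by
  constructor
  · rintro ⟨x, y, z, h | h⟩
    exacts [⟨true, x, y, z, h⟩, ⟨false, x, y, z, h⟩]
  · rintro ⟨s, x, y, z, h⟩
    cases s
    exacts [⟨x, y, z, Or.inr h⟩, ⟨x, y, z, Or.inl h⟩]

theorem Fork.swap {s : Bool} {p x y z : Space} (h : C.Fork v s p x y z) : C.Fork v s p y x z := by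
  cases s
  · exact ⟨h.1.symm, h.2.1.trans (Set.pair_comm _ _), h.2.2⟩
  · exact ⟨h.1.symm, h.2.1.trans (Set.pair_comm _ _), h.2.2⟩

theorem mem_linkOf_arm {P : Set Triangle} (hr : ∀ a b c, (a, b, c) ∈ P → (b, c, a) ∈ P)
    {s : Bool} {p x : Space} :
    arm s p x ∈ linkOf P v ↔ (if s then (v, p, x) ∈ P else (p, v, x) ∈ P) := by
  cases s
  · exact ⟨fun h => hr _ _ _ (hr _ _ _ h), fun h => hr _ _ _ h⟩
  · exact Iff.rfl

theorem Fork.ne {s : Bool} {p x y z : Space} (h : C.Fork v s p x y z) : x ≠ y := by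
  cases s <;> exact h.1

theorem Fork.mem_iff (hr : ∀ a b c, (a, b, c) ∈ C.tri → (b, c, a) ∈ C.tri)
    {s : Bool} {p x y z w : Space} (h : C.Fork v s p x y z) :
    (arm s p w ∈ C.linkEdges v ↔ w = x ∨ w = y) ∧ (arm (!s) p w ∈ C.linkEdges v ↔ w = z) := by
  have e1 := @mem_linkOf_arm v C.tri hr s p w
  have e2 := @mem_linkOf_arm v C.tri hr (!s) p w
  change (arm s p w ∈ C.linkEdges v ↔ _) at e1
  change (arm (!s) p w ∈ C.linkEdges v ↔ _) at e2
  rw [e1, e2]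
  cases s
  all_goals
    have h1 := Set.ext_iff.1 h.2.1 w
    have h2 := Set.ext_iff.1 h.2.2 w
    exact ⟨h1, h2⟩

theorem exists_arm {e : Space × Space} {p : Space} (he : e.1 = p ∨ e.2 = p) :
    ∃ s x, e = arm s p x := by
  rcases e with ⟨a, b⟩
  rcases he with rfl | rfl
  exacts [⟨true, b, rfl⟩, ⟨false, a, rfl⟩]

theorem arm_inj {s s' : Bool} {p x x' : Space} (hp : p ≠ x) :
    arm s p x = arm s' p x' ↔ s = s' ∧ x = x' := by
  cases s <;> cases s' <;> simp [arm, Prod.ext_iff] <;> tauto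

theorem arm_right_inj {s : Bool} {p x x' : Space} : arm s p x = arm s p x' ↔ x = x' := by
  cases s <;> simp [arm]

theorem shareNode_arm {s s' : Bool} {p x x' : Space} : ShareNode (arm s p x) (arm s' p x') := by
  cases s <;> cases s' <;> simp [arm, ShareNode]

theorem Fork.eq_arm (hr : ∀ a b c, (a, b, c) ∈ C.tri → (b, c, a) ∈ C.tri)
    {s : Bool} {p x y z : Space} (h : C.Fork v s p x y z) {e : Space × Space}
    (he : e ∈ C.linkEdges v) (hp : e.1 = p ∨ e.2 = p) :
    e = arm s p x ∨ e = arm s p y ∨ e = arm (!s) p z := by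
  obtain ⟨s', w, rfl⟩ := exists_arm hp
  by_cases hs : s' = s
  · subst hs
    rcases (h.mem_iff hr).1.1 he with rfl | rfl
    exacts [Or.inl rfl, Or.inr (Or.inl rfl)]
  · obtain rfl : s' = !s := by cases s <;> cases s' <;> simp_all
    rw [(h.mem_iff hr).2.1 he]
    exact Or.inr (Or.inr rfl)

theorem isEdgeBetween_iff {p x : Space} {e : Space × Space} :
    C.IsEdgeBetween v p x e ↔ e ∈ C.linkEdges v ∧ ∃ s, e = arm s p x := by
  unfold IsEdgeBetween arm
  simp [or_comm]

/-! ### Sectors -/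

theorem LinkStep.right_unique : Relator.RightUnique (C.LinkStep v) := by
  rintro ⟨a, b⟩ ⟨c, d⟩ ⟨c', d'⟩ ⟨h1, h2⟩ ⟨h1', h2'⟩
  dsimp only at *
  subst h1 h1'
  have := h2.1.symm.trans h2'.1
  rw [Set.singleton_eq_singleton_iff] at this
  rw [this]

theorem LinkStep.left_unique : Relator.LeftUnique (C.LinkStep v) := by
  rintro ⟨a, b⟩ ⟨a', b'⟩ ⟨c, d⟩ ⟨h1, h2⟩ ⟨h1', h2'⟩
  dsimp only at *
  subst h1 h1'
  have := h2.2.symm.trans h2'.2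
  rw [Set.singleton_eq_singleton_iff] at this
  rw [this]

theorem SameSector.total {e f : Space × Space} (h : C.SameSector v e f) :
    Relation.ReflTransGen (C.LinkStep v) e f ∨ Relation.ReflTransGen (C.LinkStep v) f e := by
  have hl : Relator.RightUnique (Function.swap (C.LinkStep v)) := fun a b c h h' =>
    LinkStep.left_unique h h'
  induction h with
  | rel _ _ h => exact Or.inl (Relation.ReflTransGen.single h)
  | refl => exact Or.inl Relation.ReflTransGen.refl
  | symm _ _ _ ih => exact ih.symm
  | trans a b c _ _ h1 h2 =>
    rcases h1 with h1 | h1 <;> rcases h2 with h2 | h2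
    · exact Or.inl (h1.trans h2)
    · rcases Relation.ReflTransGen.total_of_right_unique hl h1.swap h2.swap with h | h
      · exact Or.inr h.swap
      · exact Or.inl h.swap
    · exact Relation.ReflTransGen.total_of_right_unique LinkStep.right_unique h1 h2
    · exact Or.inr (h2.trans h1)

theorem SameSector.refl (e : Space × Space) : C.SameSector v e e := Relation.EqvGen.refl _

theorem SameSector.symm {e f : Space × Space} (h : C.SameSector v e f) : C.SameSector v f e :=
  Relation.EqvGen.symm _ _ h

theorem SameSector.trans {e f g : Space × Space} (h : C.SameSector v e f)
    (h' : C.SameSector v f g) : C.SameSector v e g := Relation.EqvGen.trans _ _ _ h h'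

/-- The node `p` ends the sectors that reach it. -/
def IsEnd (C : LabelledComplex) (v p : Space) : Prop := ∀ x y, ¬ C.IsRegular v p x y

theorem IsTrivalentNode.isEnd {p : Space} (h : C.IsTrivalentNode v p) : C.IsEnd v p := by
  rintro a b ⟨h1, h2⟩
  obtain ⟨x, y, z, hne, h3, h4⟩ | ⟨x, y, z, hne, h3, h4⟩ : (∃ x y z, C.IsBinding v p x y z) ∨
      ∃ x y z, C.IsBinding p v x y z := by
    obtain ⟨x, y, z, h | h⟩ := h
    exacts [Or.inl ⟨x, y, z, h⟩, Or.inr ⟨x, y, z, h⟩]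
  · have := h3.symm.trans h1
    exact hne ((this ▸ Set.mem_insert x {y} : x ∈ ({a} : Set Space)).trans
      (this ▸ Set.mem_insert_of_mem x rfl : y ∈ ({a} : Set Space)).symm)
  · have := h3.symm.trans h2
    exact hne ((this ▸ Set.mem_insert x {y} : x ∈ ({b} : Set Space)).trans
      (this ▸ Set.mem_insert_of_mem x rfl : y ∈ ({b} : Set Space)).symm)

theorem SameSector.eq_of_head {e f : Space × Space} (h : C.SameSector v e f)
    (he : C.IsEnd v e.2) (hf : C.IsEnd v f.2) : e = f := by
  rcases h.total with h | h
  · rcases Relation.ReflTransGen.cases_head h with h | ⟨g, hg, -⟩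
    · exact h
    · exact (he _ _ hg.2).elim
  · rcases Relation.ReflTransGen.cases_head h with h | ⟨g, hg, -⟩
    · exact h.symm
    · exact (hf _ _ hg.2).elim

theorem SameSector.eq_of_tail {e f : Space × Space} (h : C.SameSector v e f)
    (he : C.IsEnd v e.1) (hf : C.IsEnd v f.1) : e = f := by
  rcases h.total with h | h
  · rcases Relation.ReflTransGen.cases_tail h with h | ⟨g, -, hg⟩
    · exact h.symm
    · exact (hf _ _ (hg.1 ▸ hg.2)).elim
  · rcases Relation.ReflTransGen.cases_tail h with h | ⟨g, -, hg⟩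
    · exact h
    · exact (he _ _ (hg.1 ▸ hg.2)).elim

/-- A sector has at most one end at which it starts, and one at which it stops. -/
theorem SameSector.eq_of_arm {s : Bool} {p q x y : Space}
    (h : C.SameSector v (arm s p x) (arm s q y)) (hp : C.IsEnd v p) (hq : C.IsEnd v q) :
    arm s p x = arm s q y := by
  cases s
  · exact h.eq_of_head hp hq
  · exact h.eq_of_tail hp hq

theorem SameSector.eq_of_arm' {s : Bool} {p q x y : Space}
    (h : C.SameSector v (arm s p x) (arm s q y)) (hp : C.IsEnd v p) (hq : C.IsEnd v q) :
    p = q ∧ x = y := by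
  have := h.eq_of_arm hp hq
  cases s <;> simp [arm] at this <;> tauto

/-- The other end of a sector. -/
theorem SameSector.arm_not {s s' : Bool} {p q x y : Space} (hpq : p ≠ q)
    (h : C.SameSector v (arm s p x) (arm s' q y)) (hp : C.IsEnd v p) (hq : C.IsEnd v q) :
    s' = !s := by
  by_contra hs
  obtain rfl : s' = s := by cases s <;> cases s' <;> simp_all
  exact hpq (h.eq_of_arm' hp hq).1

theorem mem_iff_of_sameSector {U : Set (Space × Space)}
    (hU : ∀ e f, C.LinkStep v e f → (e ∈ U ↔ f ∈ U)) {e f : Space × Space}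
    (h : C.SameSector v e f) : e ∈ U ↔ f ∈ U := by
  induction h with
  | rel _ _ h => exact hU _ _ h
  | refl => rfl
  | symm _ _ _ ih => exact ih.symm
  | trans _ _ _ _ _ h1 h2 => exact h1.trans h2

end LabelledComplex

open LabelledComplex

variable {C : LabelledComplex} {v : Space} {E P Q : Set Triangle}

theorem IsClosedSurface.rotate' (hE : IsClosedSurface C E) {a b c : Space} :
    (a, b, c) ∈ E ↔ (b, c, a) ∈ E :=
  ⟨hE.rotate _ _ _, fun h => hE.rotate _ _ _ (hE.rotate _ _ _ h)⟩

theorem IsClosedSurface.sameSector (hE : IsClosedSurface C E) {e f : Space × Space}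
    (h : C.SameSector v e f) : e ∈ linkOf E v ↔ f ∈ linkOf E v := by
  refine mem_iff_of_sameSector ?_ h
  rintro ⟨a, b⟩ ⟨c, d⟩ ⟨rfl, h⟩
  change (v, a, b) ∈ E ↔ (v, b, d) ∈ E
  rw [hE.regular _ _ _ _ h, hE.rotate', hE.rotate']

theorem IsClosedSurface.fork (hE : IsClosedSurface C E) {s : Bool} {p x y z : Space}
    (h : C.Fork v s p x y z) : arm (!s) p z ∈ linkOf E v ↔
      arm s p x ∈ linkOf E v ∧ arm s p y ∉ linkOf E v ∨
        arm s p y ∈ linkOf E v ∧ arm s p x ∉ linkOf E v := by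
  simp only [mem_linkOf_arm hE.rotate]
  cases s <;> exact hE.binding _ _ _ _ _ h

theorem IsSheet.fork (hE : IsSheet C P) {s : Bool} {p x y z : Space}
    (h : C.Fork v s p x y z) : (arm (!s) p z ∈ linkOf P v ↔
      arm s p x ∈ linkOf P v ∨ arm s p y ∈ linkOf P v) ∧
      ¬ (arm s p x ∈ linkOf P v ∧ arm s p y ∈ linkOf P v) := by
  simp only [mem_linkOf_arm hE.rotate]
  cases s <;> exact hE.binding _ _ _ _ _ h

theorem IsClosedSurface.linkOf_subset (hE : IsClosedSurface C E) :
    linkOf E v ⊆ C.linkEdges v := fun _ h => hE.subset h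

/-- A closed surface has at most two link edges at each node. -/
theorem IsClosedSurface.eq_or_eq_of_shareNode (hC : IsClosedFoam C) (hE : IsClosedSurface C E)
    {p : Space} {e f g : Space × Space} (he : e ∈ linkOf E v) (hf : f ∈ linkOf E v)
    (hg : g ∈ linkOf E v) (hep : e.1 = p ∨ e.2 = p) (hfp : f.1 = p ∨ f.2 = p)
    (hgp : g.1 = p ∨ g.2 = p) : e = f ∨ e = g ∨ f = g := by
  by_cases htri : C.IsTrivalentNode v p
  · obtain ⟨s, x, y, z, h⟩ := isTrivalentNode_iff.1 htri
    have h0 := hE.fork h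
    rcases h.eq_arm hC.rotate (hE.linkOf_subset he) hep with rfl | rfl | rfl <;>
    rcases h.eq_arm hC.rotate (hE.linkOf_subset hf) hfp with rfl | rfl | rfl <;>
    rcases h.eq_arm hC.rotate (hE.linkOf_subset hg) hgp with rfl | rfl | rfl <;>
    first
    | exact Or.inl rfl
    | exact Or.inr (Or.inl rfl)
    | exact Or.inr (Or.inr rfl)
    | (exfalso; tauto)
  · have hreg : ∃ x y, C.IsRegular v p x y := by
      have h1 : ∃ c, (v, p, c) ∈ C.tri ∨ (p, v, c) ∈ C.tri := by
        rcases e with ⟨a, b⟩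
        rcases hep with rfl | rfl
        · exact ⟨b, Or.inl (hE.subset he)⟩
        · exact ⟨a, Or.inr (hC.rotate _ _ _ (hC.rotate _ _ _ (hE.subset he)))⟩
      obtain ⟨c, h1 | h1⟩ := h1
      · rcases hC.edge _ _ _ h1 with h | ⟨x, y, z, h⟩ | ⟨x, y, z, h⟩
        exacts [h, (htri ⟨x, y, z, Or.inl h⟩).elim, (htri ⟨x, y, z, Or.inr h⟩).elim]
      · rcases hC.edge _ _ _ h1 with ⟨x, y, h⟩ | ⟨x, y, z, h⟩ | ⟨x, y, z, h⟩
        exacts [⟨y, x, h.2, h.1⟩, (htri ⟨x, y, z, Or.inr h⟩).elim, (htri ⟨x, y, z, Or.inl h⟩).elim]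
    obtain ⟨x, y, h1, h2⟩ := hreg
    have key : ∀ e ∈ C.linkEdges v, e.1 = p ∨ e.2 = p → e = (p, x) ∨ e = (y, p) := by
      rintro ⟨a, b⟩ he (rfl | rfl)
      · have : b ∈ C.star v a := he
        rw [h1] at this
        exact Or.inl (by rw [Set.mem_singleton_iff.1 this])
      · have : a ∈ C.star b v := hC.rotate _ _ _ (hC.rotate _ _ _ he)
        rw [h2] at this
        exact Or.inr (by rw [Set.mem_singleton_iff.1 this])
    rcases key _ (hE.subset he) hep with rfl | rfl <;>
    rcases key _ (hE.subset hf) hfp with rfl | rfl <;>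
    rcases key _ (hE.subset hg) hgp with rfl | rfl <;> simp

theorem ne_of_arm_mem (hC : IsClosedFoam C) {s : Bool} {p x : Space}
    (h : arm s p x ∈ C.linkEdges v) : p ≠ x := by
  cases s
  · exact (hC.ne _ _ _ (hC.rotate _ _ _ h)).symm
  · exact hC.ne _ _ _ (hC.rotate _ _ _ h)

theorem LabelledComplex.Fork.arm_ne (hC : IsClosedFoam C) {s : Bool} {p x y z : Space}
    (h : C.Fork v s p x y z) : arm s p x ≠ arm (!s) p z := by
  have h1 := (h.mem_iff hC.rotate).1.2 (Or.inl rfl)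
  have hpx := ne_of_arm_mem hC h1
  rw [Ne, arm_inj hpx]
  simp

theorem not_four_of_three {α : Type*} {e A B D X Y Z : α} (a0 : e = X ∨ e = Y ∨ e = Z)
    (a1 : A = X ∨ A = Y ∨ A = Z) (a2 : B = X ∨ B = Y ∨ B = Z) (a3 : D = X ∨ D = Y ∨ D = Z)
    (n1 : A ≠ B) (n2 : A ≠ D) (n3 : B ≠ D) (b1 : e ≠ A) (b2 : e ≠ B) (b3 : e ≠ D) : False := by
  grind

/-! ### Singular points -/

/-- The sectors at a singular point: `e i j` is the link edge at the node `t i` on the sector to the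
node `t j`. -/
theorem exists_sectors_of_isSingularPoint (hC : IsClosedFoam C) (h : C.IsSingularPoint v) :
    ∃ (t : Fin 4 → Space) (o : Fin 4 → Fin 4 → Bool) (x : Fin 4 → Fin 4 → Space),
      Function.Injective t ∧ (∀ b, C.IsTrivalentNode v b ↔ ∃ i, b = t i) ∧
      (∀ e ∈ C.linkEdges v, ∃ i, C.Touches v e (t i)) ∧
      (∀ i j, i ≠ j → arm (o i j) (t i) (x i j) ∈ C.linkEdges v ∧
        C.SameSector v (arm (o i j) (t i) (x i j)) (arm (o j i) (t j) (x j i)) ∧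
        o j i = !(o i j)) ∧
      (∀ i e, e ∈ C.linkEdges v → e.1 = t i ∨ e.2 = t i →
        ∃ j, i ≠ j ∧ e = arm (o i j) (t i) (x i j)) ∧
      (∀ i j k, i ≠ j → i ≠ k → j ≠ k →
        arm (o i j) (t i) (x i j) ≠ arm (o i k) (t i) (x i k)) ∧
      ∀ i j k l, i ≠ j → i ≠ k → i ≠ l → j ≠ k → j ≠ l → k ≠ l →
        LeftCyclic (t i - v) (x i j - v) (x i k - v) (x i l - v) →
        LeftCyclic (t j - v) (x j i - v) (x j l - v) (x j k - v) := by
  obtain ⟨t, hinj, htri, htouch, hjoin, hcyc⟩ := h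
  have hend : ∀ i, C.IsEnd v (t i) := fun i => ((htri _).2 ⟨i, rfl⟩).isEnd
  have h1 : ∀ i j, ∃ o x o' y, i ≠ j → arm o (t i) x ∈ C.linkEdges v ∧
      arm o' (t j) y ∈ C.linkEdges v ∧ C.SameSector v (arm o (t i) x) (arm o' (t j) y) := by
    intro i j
    by_cases hij : i = j
    · exact ⟨true, v, true, v, fun h => (h hij).elim⟩
    · obtain ⟨x, y, e, f, he, hf, hs⟩ := hjoin i j hij
      obtain ⟨he, o, rfl⟩ := isEdgeBetween_iff.1 he
      obtain ⟨hf, o', rfl⟩ := isEdgeBetween_iff.1 hf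
      exact ⟨o, x, o', y, fun _ => ⟨he, hf, hs⟩⟩
  choose o x o' y h1 using h1
  have ho' : ∀ i j, i ≠ j → o' i j = !(o i j) := fun i j hij =>
    (h1 i j hij).2.2.arm_not (hinj.ne hij) (hend _) (hend _)
  -- a sector has only two ends
  have three : ∀ i j k e, i ≠ j → i ≠ k → j ≠ k → ∀ s s' s'' a b c,
      C.SameSector v e (arm s (t i) a) → C.SameSector v e (arm s' (t j) b) →
      C.SameSector v e (arm s'' (t k) c) → False := by
    intro i j k e hij hik hjk s s' s'' a b c ha hb hc
    have e1 := (ha.symm.trans hb).arm_not (hinj.ne hij) (hend _) (hend _)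
    have e2 := (ha.symm.trans hc).arm_not (hinj.ne hik) (hend _) (hend _)
    have e3 := (hb.symm.trans hc).arm_not (hinj.ne hjk) (hend _) (hend _)
    subst e1 e2
    cases s <;> simp at e3
  have hne : ∀ i j k, i ≠ j → i ≠ k → j ≠ k →
      arm (o i j) (t i) (x i j) ≠ arm (o i k) (t i) (x i k) := by
    intro i j k hij hik hjk heq
    exact three i j k _ hij hik hjk _ _ _ _ _ _ (SameSector.refl (arm (o i j) (t i) (x i j)))
      (h1 i j hij).2.2 (heq ▸ (h1 i k hik).2.2)
  have hall : ∀ i e, e ∈ C.linkEdges v → e.1 = t i ∨ e.2 = t i →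
        ∃ j, i ≠ j ∧ e = arm (o i j) (t i) (x i j) := by
    intro i e he hei
    obtain ⟨j, k, l, hij, hik, hil, hjk, hjl, hkl⟩ : ∃ j k l : Fin 4,
        i ≠ j ∧ i ≠ k ∧ i ≠ l ∧ j ≠ k ∧ j ≠ l ∧ k ≠ l := by
      clear * -; revert i; decide
    obtain ⟨s, X, Y, Z, hf⟩ := isTrivalentNode_iff.1 ((htri _).2 ⟨i, rfl⟩)
    have hmem : ∀ s x, (arm s (t i) x).1 = t i ∨ (arm s (t i) x).2 = t i := by
      intro s x; cases s <;> simp [arm]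
    have a1 := hf.eq_arm hC.rotate (h1 i j hij).1 (hmem _ _)
    have a2 := hf.eq_arm hC.rotate (h1 i k hik).1 (hmem _ _)
    have a3 := hf.eq_arm hC.rotate (h1 i l hil).1 (hmem _ _)
    have n1 := hne i j k hij hik hjk
    have n2 := hne i j l hij hil hjl
    have n3 := hne i k l hik hil hkl
    have a0 := hf.eq_arm hC.rotate he hei
    by_contra hcon
    push Not at hcon
    have b1 := hcon j hij
    have b2 := hcon k hik
    have b3 := hcon l hil
    generalize arm (o i j) (t i) (x i j) = A at *
    generalize arm (o i k) (t i) (x i k) = B at *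
    generalize arm (o i l) (t i) (x i l) = D at *
    exact not_four_of_three a0 a1 a2 a3 n1 n2 n3 b1 b2 b3
  have hback : ∀ i j, i ≠ j → arm (o' i j) (t j) (y i j) = arm (o j i) (t j) (x j i) := by
    intro i j hij
    obtain ⟨k, hjk, hk⟩ := hall j _ (h1 i j hij).2.1 (by cases o' i j <;> simp [arm])
    by_cases hki : k = i
    · rw [hk, hki]
    · have h2 := (h1 j k hjk).2.2
      rw [← hk] at h2
      exact (three i j k _ hij (Ne.symm hki) hjk _ _ _ _ _ _
        (SameSector.refl (arm (o i j) (t i) (x i j))) (h1 i j hij).2.2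
        ((h1 i j hij).2.2.trans h2)).elim
  refine ⟨t, o, x, hinj, htri, htouch, ?_, hall, hne, ?_⟩
  · intro i j hij
    have := (h1 i j hij).2.2
    rw [hback i j hij] at this
    refine ⟨(h1 i j hij).1, this, this.arm_not (hinj.ne hij) (hend _) (hend _)⟩
  · have hJ : ∀ i j, i ≠ j → C.Joins v (t i) (x i j) (t j) (x j i) := by
      intro i j hij
      refine ⟨_, _, isEdgeBetween_iff.2 ⟨(h1 i j hij).1, _, rfl⟩,
        isEdgeBetween_iff.2 ⟨(h1 j i hij.symm).1, _, rfl⟩, ?_⟩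
      have := (h1 i j hij).2.2
      rwa [hback i j hij] at this
    intro i j k l hij hik hil hjk hjl hkl
    exact hcyc i j k l hij hik hil hjk hjl hkl _ _ _ _ _ _ _ _ _ _ (hJ i j hij) (hJ i k hik)
      (hJ i l hil) (hJ j k hjk) (hJ j l hjl)

/-! ### Connectedness of the links of closed surfaces -/

/-- The link of a closed surface at each point of a closed foam is connected. -/
theorem IsClosedSurface.link_connected (hC : IsClosedFoam C) (hE : IsClosedSurface C E)
    {U : Set (Space × Space)} (hne : U.Nonempty) (hsub : U ⊆ linkOf E v)
    (hU : ∀ e ∈ U, ∀ f ∈ linkOf E v, ShareNode e f → f ∈ U) : linkOf E v ⊆ U := by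
  obtain ⟨e₀, he₀⟩ := hne
  have hsec : ∀ {e f}, C.SameSector v e f → (e ∈ U ↔ f ∈ U) := by
    intro e f h
    refine mem_iff_of_sameSector ?_ h
    rintro e f hs
    have h1 := hE.sameSector (v := v) (Relation.EqvGen.rel _ _ hs : C.SameSector v e f)
    have hsh : ShareNode e f := Or.inr (Or.inr (Or.inl hs.1))
    have hsh' : ShareNode f e := Or.inr (Or.inl hs.1.symm)
    exact ⟨fun h => hU e h f (h1.1 (hsub h)) hsh, fun h => hU f h e (h1.2 (hsub h)) hsh'⟩
  have htouch : ∀ {e p}, e ∈ linkOf E v → C.Touches v e p →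
      ∃ s x, arm s p x ∈ linkOf E v ∧ (e ∈ U ↔ arm s p x ∈ U) := by
    rintro e p he ⟨f, x, hs, hf⟩
    obtain ⟨-, s, rfl⟩ := isEdgeBetween_iff.1 hf
    exact ⟨s, x, (hE.sameSector hs).1 he, hsec hs⟩
  have hnode : ∀ {s s' p x x'}, arm s p x ∈ U → arm s' p x' ∈ linkOf E v → arm s' p x' ∈ U :=
    fun h h' => hU _ h _ h' shareNode_arm
  intro f hf
  rcases hC.point _ _ _ (hE.subset hf) with h | ⟨p, q, hpq, htri, ht, -⟩ | h
  · exact (hsec (h.2 _ (hE.subset (hsub he₀)) _ (hE.subset hf))).1 he₀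
  · obtain ⟨s, x, -, h2⟩ := htouch (hsub he₀) (ht _ (hE.subset (hsub he₀))).1
    obtain ⟨s', x', h1', h2'⟩ := htouch hf (ht _ (hE.subset hf)).1
    exact h2'.2 (hnode (h2.1 he₀) h1')
  · obtain ⟨t, o, x, hinj, htri, ht, hs, hall, hneq, -⟩ := exists_sectors_of_isSingularPoint hC h
    have hE' : ∀ i j, i ≠ j → (arm (o i j) (t i) (x i j) ∈ linkOf E v ↔
        arm (o j i) (t j) (x j i) ∈ linkOf E v) := fun i j hij => hE.sameSector (hs i j hij).2.1
    have hU' : ∀ i j, i ≠ j → (arm (o i j) (t i) (x i j) ∈ U ↔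
        arm (o j i) (t j) (x j i) ∈ U) := fun i j hij => hsec (hs i j hij).2.1
    have hreach : ∀ e ∈ linkOf E v, ∃ i j, i ≠ j ∧ arm (o i j) (t i) (x i j) ∈ linkOf E v ∧
        (e ∈ U ↔ arm (o i j) (t i) (x i j) ∈ U) := by
      intro e he
      obtain ⟨i, hi⟩ := ht e (hE.subset he)
      obtain ⟨s, y, h1, h2⟩ := htouch he hi
      obtain ⟨j, hij, hj⟩ := hall i _ (hE.subset h1) (by cases s <;> simp [arm])
      exact ⟨i, j, hij, hj ▸ h1, hj ▸ h2⟩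
    obtain ⟨a, b, hab, h1, h2⟩ := hreach e₀ (hsub he₀)
    obtain ⟨c, d, hcd, h1', h2'⟩ := hreach f hf
    have hu := h2.1 he₀
    refine h2'.2 ?_
    by_cases hca : c = a
    · subst hca; exact hnode hu h1'
    by_cases hcb : c = b
    · subst hcb; exact hnode ((hU' _ _ hab).1 hu) h1'
    by_cases hda : d = a
    · subst hda; exact (hU' _ _ hcd).2 (hnode hu ((hE' _ _ hcd).1 h1'))
    by_cases hdb : d = b
    · subst hdb; exact (hU' _ _ hcd).2 (hnode ((hU' _ _ hab).1 hu) ((hE' _ _ hcd).1 h1'))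
    -- at `a`, the surface also contains the sector to `c` or to `d`
    have hex : arm (o a c) (t a) (x a c) ∈ linkOf E v ∨ arm (o a d) (t a) (x a d) ∈ linkOf E v := by
      obtain ⟨s, X, Y, Z, hfk⟩ := isTrivalentNode_iff.1 ((htri _).2 ⟨a, rfl⟩)
      have hx := hE.fork hfk
      obtain ⟨e, he, hne', hnode'⟩ : ∃ e ∈ linkOf E v, e ≠ arm (o a b) (t a) (x a b) ∧
          (e.1 = t a ∨ e.2 = t a) := by
        have hm : ∀ s x, (arm s (t a) x).1 = t a ∨ (arm s (t a) x).2 = t a := by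
          intro s x; cases s <;> simp [arm]
        have n1 : arm s (t a) X ≠ arm s (t a) Y := fun h => hfk.ne (arm_right_inj.1 h)
        have n2 : arm s (t a) X ≠ arm (!s) (t a) Z := hfk.arm_ne hC
        have n3 : arm s (t a) Y ≠ arm (!s) (t a) Z := hfk.swap.arm_ne hC
        rcases hfk.eq_arm hC.rotate (hE.subset h1) (hm _ _) with h | h | h
        · rw [h] at h1 ⊢
          by_cases hy : arm s (t a) Y ∈ linkOf E v
          · exact ⟨_, hy, n1.symm, hm _ _⟩
          · exact ⟨_, hx.2 (Or.inl ⟨h1, hy⟩), n2.symm, hm _ _⟩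
        · rw [h] at h1 ⊢
          by_cases hy : arm s (t a) X ∈ linkOf E v
          · exact ⟨_, hy, n1, hm _ _⟩
          · exact ⟨_, hx.2 (Or.inr ⟨h1, hy⟩), n3.symm, hm _ _⟩
        · rw [h] at h1 ⊢
          rcases hx.1 h1 with h3 | h3
          · exact ⟨_, h3.1, n2, hm _ _⟩
          · exact ⟨_, h3.1, n3, hm _ _⟩
      obtain ⟨j, haj, rfl⟩ := hall a e (hE.subset he) hnode'
      have : j = c ∨ j = d := by
        have hjb : j ≠ b := by rintro rfl; exact hne' rfl
        clear * - haj hjb hab hcd hca hcb hda hdb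
        omega
      rcases this with rfl | rfl
      exacts [Or.inl he, Or.inr he]
    rcases hex with hex | hex
    · exact hnode ((hU' _ _ (Ne.symm hca)).1 (hnode hu hex)) h1'
    · exact (hU' _ _ hcd).2 (hnode ((hU' _ _ (Ne.symm hda)).1 (hnode hu hex)) ((hE' _ _ hcd).1 h1'))

end SlFoam
end

noncomputable section
namespace SlFoam
open LabelledComplex

variable {C : LabelledComplex} {v : Space} {P Q : Set Triangle}

/-! ### Cyclic orders -/

theorem LeftCyclic.rotate {u x y z : Space} (h : LeftCyclic u x y z) : LeftCyclic u y z x := by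
  unfold LeftCyclic at *
  tauto

theorem LeftCyclic.not_swap {u x y z : Space} (h : LeftCyclic u x y z) :
    ¬ LeftCyclic u y x z := by
  have e : ∀ s t : Space, Matrix.det (Matrix.of ![u, s, t]) =
      - Matrix.det (Matrix.of ![u, t, s]) := by
    intro s t
    simp [Matrix.det_fin_three]
    ring
  simp only [LeftCyclic] at *
  rw [e y x, e x z, e z y]
  rintro (h' | h' | h') <;> rcases h with h | h | h <;> linarith

theorem leftCyclic_reverse {p v x y z : Space} :
    LeftCyclic (v - p) (x - p) (y - p) (z - p) ↔ LeftCyclic (p - v) (y - v) (x - v) (z - v) := by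
  have e : ∀ s t : Space, Matrix.det (Matrix.of ![v - p, s - p, t - p]) =
      Matrix.det (Matrix.of ![p - v, t - v, s - v]) := by
    intro s t
    simp [Matrix.det_fin_three]
    ring
  simp only [LeftCyclic, e]
  tauto

/-- The cyclic order of the half-planes through `x`, `y`, `z` around the axis from `v` to `p`. -/
def Cyc (v p x y z : Space) : Prop := LeftCyclic (p - v) (x - v) (y - v) (z - v)

theorem Cyc.rotate {p x y z : Space} (h : Cyc v p x y z) : Cyc v p y z x := LeftCyclic.rotate h

theorem LabelledComplex.Fork.cyc_or (hC : IsClosedFoam C) {s : Bool} {p x y z : Space}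
    (h : C.Fork v s p x y z) : Cyc v p x y z ∨ Cyc v p y x z := by
  cases s
  · exact ((hC.apart _ _ _ _ _ h).imp leftCyclic_reverse.1 leftCyclic_reverse.1).symm
  · exact hC.apart _ _ _ _ _ h

theorem LabelledComplex.Fork.cyc_swap (hC : IsClosedFoam C) {s : Bool} {p x y z : Space}
    (h : C.Fork v s p x y z) : Cyc v p y x z ↔ ¬ Cyc v p x y z :=
  ⟨fun h => h.not_swap, fun h' => (h.cyc_or hC).resolve_left h'⟩

/-! ### Crossings of two sheets -/

/-- The sheets `P` and `Q` split or merge at the node `p` of the link of `v`: the arm towards `x`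
lies in `P`, the arm towards `y` in `Q`, and the arm towards `z` in both. -/
structure CrossFork (C : LabelledComplex) (P Q : Set Triangle) (v : Space) (s : Bool)
    (p x y z : Space) : Prop where
  fork : C.Fork v s p x y z
  left : arm s p x ∈ linkOf P v
  right : arm s p y ∈ linkOf Q v

theorem fst_or_snd_arm (s : Bool) (p x : Space) : (arm s p x).1 = p ∨ (arm s p x).2 = p := by
  cases s <;> simp [arm]

theorem CrossFork.cover (hC : IsClosedFoam C) (hP : IsSheet C P)
    {s : Bool} {p x y z : Space} (h : CrossFork C P Q v s p x y z) {s' : Bool} {w : Space}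
    (he : arm s' p w ∈ C.linkEdges v) : arm s' p w ∈ linkOf P v ∨ arm s' p w ∈ linkOf Q v := by
  rcases h.fork.eq_arm hC.rotate he (fst_or_snd_arm _ _ _) with h1 | h1 | h1
  · exact Or.inl (h1 ▸ h.left)
  · exact Or.inr (h1 ▸ h.right)
  · exact Or.inl (h1 ▸ (hP.fork h.fork).1.2 (Or.inl h.left))

/-- Two arms in the same direction at a trivalent node are the first two arms of the fork. -/
theorem fork_of_arms (hC : IsClosedFoam C) {p : Space} (hp : C.IsTrivalentNode v p)
    {s s' : Bool} {x y z : Space} (hx : arm s p x ∈ C.linkEdges v) (hy : arm s p y ∈ C.linkEdges v)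
    (hz : arm s' p z ∈ C.linkEdges v) (hxy : x ≠ y) (hxz : arm s p x ≠ arm s' p z)
    (hyz : arm s p y ≠ arm s' p z) : s' = (!s) ∧ C.Fork v s p x y z := by
  obtain ⟨r, X, Y, Z, h⟩ := isTrivalentNode_iff.1 hp
  have a1 := h.eq_arm hC.rotate hx (fst_or_snd_arm _ _ _)
  have a2 := h.eq_arm hC.rotate hy (fst_or_snd_arm _ _ _)
  have a3 := h.eq_arm hC.rotate hz (fst_or_snd_arm _ _ _)
  have px := ne_of_arm_mem hC hx
  have py := ne_of_arm_mem hC hy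
  have pz := ne_of_arm_mem hC hz
  have hxy' : arm s p x ≠ arm s p y := fun h => hxy (arm_right_inj.1 h)
  rw [arm_inj px, arm_inj px, arm_inj px] at a1
  rw [arm_inj py, arm_inj py, arm_inj py] at a2
  rw [arm_inj pz, arm_inj pz, arm_inj pz] at a3
  rcases a1 with ⟨rfl, rfl⟩ | ⟨rfl, rfl⟩ | ⟨rfl, rfl⟩ <;>
  rcases a2 with ⟨h2, rfl⟩ | ⟨h2, rfl⟩ | ⟨h2, rfl⟩ <;>
  rcases a3 with ⟨rfl, rfl⟩ | ⟨rfl, rfl⟩ | ⟨rfl, rfl⟩ <;>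
  first
  | exact ⟨rfl, h⟩
  | exact ⟨rfl, h.swap⟩
  | exact (hxy rfl).elim
  | exact (hxz rfl).elim
  | exact (hyz rfl).elim
  | (simp at h2)

theorem LabelledComplex.Fork.eq_of_fork {s s' : Bool} {p x y z x' y' z' : Space}
    (h : C.Fork v s p x y z) (h' : C.Fork v s' p x' y' z') : s = s' := by
  have key : ∀ {x y z x' y' z'}, C.IsBinding v p x y z → C.IsBinding p v x' y' z' → False := by
    rintro x y z x' y' z' ⟨h1, h2, h3⟩ ⟨h1', h2', h3'⟩
    have := h2.symm.trans h3'
    exact h1 ((this ▸ Set.mem_insert x {y} : x ∈ ({z'} : Set Space)).trans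
      (this ▸ Set.mem_insert_of_mem x rfl : y ∈ ({z'} : Set Space)).symm)
  cases s <;> cases s'
  · rfl
  · exact (key h' h).elim
  · exact (key h h').elim
  · rfl

theorem LabelledComplex.Fork.eq_or_eq (hC : IsClosedFoam C) {s : Bool} {p x y z x' y' z' : Space}
    (h : C.Fork v s p x y z) (h' : C.Fork v s p x' y' z') :
    z' = z ∧ (x' = x ∧ y' = y ∨ x' = y ∧ y' = x) := by
  have m1 := (h.mem_iff hC.rotate).1.1 ((h'.mem_iff hC.rotate).1.2 (Or.inl rfl))
  have m2 := (h.mem_iff hC.rotate).1.1 ((h'.mem_iff hC.rotate).1.2 (Or.inr rfl))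
  have m3 := (h.mem_iff hC.rotate).2.1 ((h'.mem_iff hC.rotate).2.2 rfl)
  have := h'.ne
  refine ⟨m3, ?_⟩
  rcases m1 with rfl | rfl <;> rcases m2 with rfl | rfl <;> tauto

theorem CrossFork.unique (hC : IsClosedFoam C) (hP : IsSheet C P)
    {s s' : Bool} {p x y z x' y' z' : Space}
    (h : CrossFork C P Q v s p x y z) (h' : CrossFork C P Q v s' p x' y' z') :
    s' = s ∧ x' = x ∧ y' = y ∧ z' = z := by
  obtain rfl := h.fork.eq_of_fork h'.fork
  obtain ⟨rfl, ⟨rfl, rfl⟩ | ⟨rfl, rfl⟩⟩ := h.fork.eq_or_eq hC h'.fork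
  · simp
  · exact ((hP.fork h.fork).2 ⟨h.left, h'.left⟩).elim

/-- The two ends of the three sectors of a theta graph, with matching cyclic orders. -/
theorem CrossFork.transport (hC : IsClosedFoam C) (hP : IsSheet C P) (hQ : IsSheet C Q)
    {s s₀ : Bool} {p q x y z x' y' z' X Y Z : Space} (h : C.Fork v s p x y z)
    (h' : C.Fork v (!s) q x' y' z') (hx : C.SameSector v (arm s p x) (arm (!s) q x'))
    (hy : C.SameSector v (arm s p y) (arm (!s) q y'))
    (hc : Cyc v p x y z ↔ Cyc v q y' x' z') (hcr : CrossFork C P Q v s₀ p X Y Z) :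
    ∃ X' Y' Z', CrossFork C P Q v (!s₀) q X' Y' Z' ∧ (Cyc v p X Y Z ↔ Cyc v q Y' X' Z') := by
  obtain rfl := h.eq_of_fork hcr.fork
  obtain ⟨rfl, ⟨rfl, rfl⟩ | ⟨rfl, rfl⟩⟩ := h.eq_or_eq hC hcr.fork
  · exact ⟨x', y', z', ⟨h', (hP.isClosedSurface.sameSector hx).1 hcr.left,
      (hQ.isClosedSurface.sameSector hy).1 hcr.right⟩, hc⟩
  · refine ⟨y', x', z', ⟨h'.swap, (hP.isClosedSurface.sameSector hy).1 hcr.left,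
      (hQ.isClosedSurface.sameSector hx).1 hcr.right⟩, ?_⟩
    rw [h.cyc_swap hC, hc, h'.cyc_swap hC, not_not]

theorem iff_of_imp_of_imp {A A' B B' : Prop} (h : A → B) (h' : A' → B') (hA : A ∨ A')
    (hB : B' → ¬ B) : A ↔ B := by
  tauto

/-- The condition on a sheet at a trivalent node whose arms have the directions `o₁`, `o₂`, `o₃`:
the arms are not all in the same direction, and `p₁`, `p₂`, `p₃` (whether the arm lies in the sheet)
satisfy the condition at a binding. -/
def ValidNode (o₁ o₂ o₃ p₁ p₂ p₃ : Bool) : Prop :=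
  (o₁ = o₂ → o₃ = (!o₁) ∧ (p₃ = (p₁ || p₂)) ∧ (p₁ && p₂) = false) ∧
  (o₁ = o₃ → o₂ = (!o₁) ∧ (p₂ = (p₁ || p₃)) ∧ (p₁ && p₃) = false) ∧
  (o₂ = o₃ → o₁ = (!o₂) ∧ (p₁ = (p₂ || p₃)) ∧ (p₂ && p₃) = false)

instance (o₁ o₂ o₃ p₁ p₂ p₃ : Bool) : Decidable (ValidNode o₁ o₂ o₃ p₁ p₂ p₃) :=
  inferInstanceAs (Decidable (_ ∧ _))

set_option synthInstance.maxSize 2000 in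
set_option synthInstance.maxHeartbeats 400000 in
/-- The possible positions of two sheets `p, q` on the six sectors at a singular point with nodes
`a, b, c, d`, if the sheets split at `a` into the sectors to `b` and to `c`. -/
theorem sheets_at_singular_point : ∀ s obc obd ocd pbc pbd pcd qbc qbd qcd : Bool,
    ValidNode (!s) obc obd true pbc pbd → ValidNode (!s) obc obd false qbc qbd →
    ValidNode (!s) (!obc) ocd false pbc pcd → ValidNode (!s) (!obc) ocd true qbc qcd →
    ValidNode s (!obd) (!ocd) true pbd pcd → ValidNode s (!obd) (!ocd) true qbd qcd →
    (obd = s ∧ ocd = s ∧ pbd = true ∧ qcd = true ∧ pbc = false ∧ qbc = false) ∨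
    (obc = (!s) ∧ qbc = true ∧ obd = s ∧ pcd = false ∧ qcd = false) ∨
    (obc = s ∧ pbc = true ∧ ocd = s ∧ pbd = false ∧ qbd = false) := by
  decide +kernel

/-- At each point, two sheets split and merge at most once, and with the same cyclic order. -/
theorem CrossFork.exists_partner (hC : IsClosedFoam C) (hP : IsSheet C P) (hQ : IsSheet C Q)
    {s : Bool} {p x y z : Space} (h : CrossFork C P Q v s p x y z) :
    ∃ q x' y' z', CrossFork C P Q v (!s) q x' y' z' ∧ (Cyc v p x y z ↔ Cyc v q y' x' z') ∧
      ∀ s' p' X Y Z, CrossFork C P Q v s' p' X Y Z → p' = p ∨ p' = q := by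
  have hnode := isTrivalentNode_iff.2 ⟨s, x, y, z, h.fork⟩
  have hmem := hP.subset h.left
  rcases hC.point _ _ _ hmem with hf | ⟨p₁, q₁, hpq, htri, ht, hcyc⟩ | hs
  · exact (hf.1 _ hnode).elim
  · -- the link is a theta graph: its three sectors carry the fork from one node to the other
    obtain ⟨r, X, Y, Z, hX⟩ := isTrivalentNode_iff.1 ((htri p₁).2 (Or.inl rfl))
    have hq := (htri q₁).2 (Or.inr rfl)
    have hmX := (hX.mem_iff hC.rotate).1.2 (Or.inl rfl)
    have hmY := (hX.mem_iff hC.rotate).1.2 (Or.inr rfl)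
    have hmZ := (hX.mem_iff hC.rotate).2.2 rfl
    have he : C.IsEnd v p₁ := ((htri p₁).2 (Or.inl rfl)).isEnd
    have htq : ∀ {s x}, arm s p₁ x ∈ C.linkEdges v → ∃ x', arm (!s) q₁ x' ∈ C.linkEdges v ∧
        C.SameSector v (arm s p₁ x) (arm (!s) q₁ x') := by
      intro s x hm
      obtain ⟨f, x', h1, h2⟩ := (ht _ hm).2
      obtain ⟨h3, s', rfl⟩ := isEdgeBetween_iff.1 h2
      obtain rfl := h1.arm_not hpq he hq.isEnd
      exact ⟨x', h3, h1⟩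
    obtain ⟨X', mX, sX⟩ := htq hmX
    obtain ⟨Y', mY, sY⟩ := htq hmY
    obtain ⟨Z', mZ, sZ⟩ := htq hmZ
    have hne : ∀ {s s' x x' y y'}, arm (!s) q₁ x' ∈ C.linkEdges v →
        C.SameSector v (arm s p₁ x) (arm (!s) q₁ x') →
        C.SameSector v (arm s' p₁ y) (arm (!s') q₁ y') → arm s p₁ x ≠ arm s' p₁ y →
        arm (!s) q₁ x' ≠ arm (!s') q₁ y' := by
      intro s s' x x' y y' hm h1 h2 h3 h4
      by_cases hss : s = s'
      · subst hss
        exact h3 ((h1.trans (h4 ▸ h2.symm)).eq_of_arm he he)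
      · rw [arm_inj (ne_of_arm_mem hC hm)] at h4
        exact hss (by simpa using h4.1)
    obtain ⟨-, hX'⟩ := fork_of_arms hC hq mX mY mZ
      (fun h => hne mX sX sY (fun h => hX.ne (arm_right_inj.1 h)) (by rw [h]))
      (hne mX sX sZ (hX.arm_ne hC)) (hne mY sY sZ (hX.swap.arm_ne hC))
    have jX : C.Joins v p₁ X q₁ X' := ⟨_, _, isEdgeBetween_iff.2 ⟨hmX, _, rfl⟩,
      isEdgeBetween_iff.2 ⟨mX, _, rfl⟩, sX⟩
    have jY : C.Joins v p₁ Y q₁ Y' := ⟨_, _, isEdgeBetween_iff.2 ⟨hmY, _, rfl⟩,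
      isEdgeBetween_iff.2 ⟨mY, _, rfl⟩, sY⟩
    have jZ : C.Joins v p₁ Z q₁ Z' := ⟨_, _, isEdgeBetween_iff.2 ⟨hmZ, _, rfl⟩,
      isEdgeBetween_iff.2 ⟨mZ, _, rfl⟩, sZ⟩
    have hc : Cyc v p₁ X Y Z ↔ Cyc v q₁ Y' X' Z' := by
      refine iff_of_imp_of_imp (fun h => ?_) (fun h => ?_) (hX.cyc_or hC)
        (B' := Cyc v q₁ X' Y' Z') (fun h => h.not_swap)
      · exact Cyc.rotate (Cyc.rotate (hcyc _ _ _ _ _ _ jX jY jZ h))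
      · exact Cyc.rotate (Cyc.rotate (hcyc _ _ _ _ _ _ jY jX jZ h))
    rcases (htri p).1 hnode with rfl | rfl
    · obtain ⟨x', y', z', h1, h2⟩ := h.transport hC hP hQ hX hX' sX sY hc
      exact ⟨q₁, x', y', z', h1, h2, fun s' p' _ _ _ h' =>
        (htri p').1 (isTrivalentNode_iff.2 ⟨_, _, _, _, h'.fork⟩)⟩
    · obtain ⟨x', y', z', h1, h2⟩ := h.transport hC hP hQ hX' (by rwa [Bool.not_not])
        (by rw [Bool.not_not]; exact sX.symm) (by rw [Bool.not_not]; exact sY.symm)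
        (by rw [hX.cyc_swap hC, hc, hX'.cyc_swap hC, not_not])
      exact ⟨p₁, x', y', z', h1, h2, fun s' p' _ _ _ h' =>
        ((htri p').1 (isTrivalentNode_iff.2 ⟨_, _, _, _, h'.fork⟩)).symm⟩
  · -- the link is the complete graph on four nodes: the fork is at `t a`, and its arms start the
    -- sectors to `t b` (in `P`), to `t c` (in `Q`) and to `t d` (in both)
    obtain ⟨t, o, w, hinj, htri, -, hsec, hall, hneq, hcyc⟩ :=
      exists_sectors_of_isSingularPoint hC hs
    obtain ⟨a, rfl⟩ := (htri p).1 hnode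
    have hmX := (h.fork.mem_iff hC.rotate).1.2 (Or.inl rfl)
    have hmY := (h.fork.mem_iff hC.rotate).1.2 (Or.inr rfl)
    have hmZ := (h.fork.mem_iff hC.rotate).2.2 rfl
    obtain ⟨b, hab, hb⟩ := hall a _ hmX (fst_or_snd_arm _ _ _)
    obtain ⟨c, hac, hc⟩ := hall a _ hmY (fst_or_snd_arm _ _ _)
    obtain ⟨d, had, hd⟩ := hall a _ hmZ (fst_or_snd_arm _ _ _)
    have hbc : b ≠ c := by
      rintro rfl; exact h.fork.ne (arm_right_inj.1 (hb.trans hc.symm))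
    have hbd : b ≠ d := by
      rintro rfl; exact h.fork.arm_ne hC (hb.trans hd.symm)
    have hcd : c ≠ d := by
      rintro rfl; exact h.fork.swap.arm_ne hC (hc.trans hd.symm)
    rw [arm_inj (ne_of_arm_mem hC hmX)] at hb
    rw [arm_inj (ne_of_arm_mem hC hmY)] at hc
    rw [arm_inj (ne_of_arm_mem hC hmZ)] at hd
    obtain ⟨hb, rfl⟩ := hb
    obtain ⟨hc, rfl⟩ := hc
    obtain ⟨hd, rfl⟩ := hd
    classical
    -- which of the six sectors lie in `P`, and which in `Q`
    let π : Fin 4 → Fin 4 → Bool := fun i j => decide (arm (o i j) (t i) (w i j) ∈ linkOf P v)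
    let κ : Fin 4 → Fin 4 → Bool := fun i j => decide (arm (o i j) (t i) (w i j) ∈ linkOf Q v)
    have hπ : ∀ i j, i ≠ j → π j i = π i j := fun i j hij => by
      simp only [π, hP.isClosedSurface.sameSector (hsec i j hij).2.1]
    have hκ : ∀ i j, i ≠ j → κ j i = κ i j := fun i j hij => by
      simp only [κ, hQ.isClosedSurface.sameSector (hsec i j hij).2.1]
    have ho : ∀ i j, i ≠ j → o j i = !(o i j) := fun i j hij => (hsec i j hij).2.2
    have hfork : ∀ i j k l, i ≠ j → i ≠ k → i ≠ l → j ≠ k → j ≠ l → k ≠ l → o i j = o i k →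
        o i l = (!(o i j)) ∧ C.Fork v (o i j) (t i) (w i j) (w i k) (w i l) := by
      intro i j k l hij hik hil hjk hjl hkl he
      have n1 := hneq i j k hij hik hjk
      have n2 := hneq i j l hij hil hjl
      have n3 := hneq i k l hik hil hkl
      have m2 := (hsec i k hik).1
      rw [← he] at n1 n3 m2
      exact fork_of_arms hC ((htri _).2 ⟨i, rfl⟩) (hsec i j hij).1 m2 (hsec i l hil).1
        (fun h => n1 (by rw [h])) n2 n3
    have hv1 : ∀ (T : Set Triangle), IsSheet C T → ∀ i j k l, i ≠ j → i ≠ k → i ≠ l → j ≠ k →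
        j ≠ l → k ≠ l → o i j = o i k → o i l = (!(o i j)) ∧
        (decide (arm (o i l) (t i) (w i l) ∈ linkOf T v) =
          (decide (arm (o i j) (t i) (w i j) ∈ linkOf T v) ||
          decide (arm (o i k) (t i) (w i k) ∈ linkOf T v))) ∧
        (decide (arm (o i j) (t i) (w i j) ∈ linkOf T v) &&
          decide (arm (o i k) (t i) (w i k) ∈ linkOf T v)) = false := by
      intro T hT i j k l hij hik hil hjk hjl hkl he
      obtain ⟨h1, h2⟩ := hfork i j k l hij hik hil hjk hjl hkl he
      have h3 := hT.fork h2
      rw [← he, h1]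
      refine ⟨rfl, ?_, ?_⟩
      · rw [← Bool.decide_or, decide_eq_decide]; exact h3.1
      · rw [← Bool.decide_and, decide_eq_false_iff_not]; exact h3.2
    have pab : π a b = true := by simpa [π, ← hb] using h.left
    have qac : κ a c = true := by simpa [κ, ← hc] using h.right
    have hv0P := hv1 P hP a b c d hab hac had hbc hbd hcd (hb ▸ hc)
    have hv0Q := hv1 Q hQ a b c d hab hac had hbc hbd hcd (hb ▸ hc)
    have pac : π a c = false := by
      have := hv0P.2.2
      change (π a b && π a c) = false at this
      simpa [pab] using this
    have qab : κ a b = false := by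
      have := hv0Q.2.2
      change (κ a b && κ a c) = false at this
      simpa [qac] using this
    have pad : π a d = true := by
      have := hv0P.2.1
      change π a d = (π a b || π a c) at this
      simpa [pab] using this
    have qad : κ a d = true := by
      have := hv0Q.2.1
      change κ a d = (κ a b || κ a c) at this
      simpa [qac] using this
    have hval : ∀ (T : Set Triangle), IsSheet C T → ∀ i j k l, i ≠ j → i ≠ k → i ≠ l → j ≠ k →
        j ≠ l → k ≠ l → _ := fun T hT i j k l hij hik hil hjk hjl hkl =>
      And.intro (hv1 T hT i j k l hij hik hil hjk hjl hkl)
        (And.intro (hv1 T hT i j l k hij hil hik hjl hjk hkl.symm)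
          (hv1 T hT i k l j hik hil hij hkl hjk.symm hjl.symm))
    have bP : ValidNode (o b a) (o b c) (o b d) (π b a) (π b c) (π b d) :=
      hval P hP b a c d hab.symm hbc hbd hac had hcd
    have bQ : ValidNode (o b a) (o b c) (o b d) (κ b a) (κ b c) (κ b d) :=
      hval Q hQ b a c d hab.symm hbc hbd hac had hcd
    have cP : ValidNode (o c a) (o c b) (o c d) (π c a) (π c b) (π c d) :=
      hval P hP c a b d hac.symm hbc.symm hcd hab had hbd
    have cQ : ValidNode (o c a) (o c b) (o c d) (κ c a) (κ c b) (κ c d) :=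
      hval Q hQ c a b d hac.symm hbc.symm hcd hab had hbd
    have dP : ValidNode (o d a) (o d b) (o d c) (π d a) (π d b) (π d c) :=
      hval P hP d a b c had.symm hbd.symm hcd.symm hab hac hbc
    have dQ : ValidNode (o d a) (o d b) (o d c) (κ d a) (κ d b) (κ d c) :=
      hval Q hQ d a b c had.symm hbd.symm hcd.symm hab hac hbc
    have oba : o b a = !s := by rw [ho a b hab, ← hb]
    have oca : o c a = !s := by rw [ho a c hac, ← hc]
    have oda : o d a = s := by rw [ho a d had, ← hd, Bool.not_not]
    rw [oba, hπ a b hab, pab] at bP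
    rw [oba, hκ a b hab, qab] at bQ
    rw [oca, hπ a c hac, pac, hπ b c hbc, ho b c hbc] at cP
    rw [oca, hκ a c hac, qac, hκ b c hbc, ho b c hbc] at cQ
    rw [oda, hπ a d had, pad, hπ b d hbd, hπ c d hcd, ho b d hbd, ho c d hcd] at dP
    rw [oda, hκ a d had, qad, hκ b d hbd, hκ c d hcd, ho b d hbd, ho c d hcd] at dQ
    have node : ∀ {i}, i = a ∨ i = b ∨ i = c ∨ i = d := by
      intro i; clear * - hab hac had hbc hbd hcd; omega
    -- two sheets that fork at a node cover its three arms together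
    have uncovered : ∀ i j, i ≠ j → π i j = false → κ i j = false →
        ∀ s' X Y Z, ¬ CrossFork C P Q v s' (t i) X Y Z := by
      intro i j hij h1 h2 s' X Y Z h'
      have := h'.cover hC hP (hsec i j hij).1
      simp only [π, κ, decide_eq_false_iff_not] at h1 h2
      exact this.elim h1 h2
    -- the other fork is at the node `t d`, `t b` or `t c`, respectively
    rcases sheets_at_singular_point s (o b c) (o b d) (o c d) (π b c) (π b d) (π c d)
      (κ b c) (κ b d) (κ c d) bP bQ cP cQ dP dQ with
      ⟨h1, h2, h3, h4, h5, h6⟩ | ⟨h1, h2, h3, h5, h6⟩ | ⟨h1, h2, h3, h5, h6⟩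
    · have odb : o d b = !s := by rw [ho b d hbd, h1]
      have odc : o d c = !s := by rw [ho c d hcd, h2]
      obtain ⟨-, hf⟩ := hfork d b c a hbd.symm hcd.symm had.symm hbc hab.symm hac.symm
        (odb.trans odc.symm)
      rw [odb] at hf
      have m1 : π d b = true := (hπ b d hbd).trans h3
      have m2 : κ d c = true := (hκ c d hcd).trans h4
      simp only [π, κ, decide_eq_true_eq, odb, odc] at m1 m2
      refine ⟨t d, w d b, w d c, w d a, ⟨hf, m1, m2⟩, ?_, ?_⟩
      · refine iff_of_imp_of_imp (fun h => ?_) (fun h => ?_) (h.fork.cyc_or hC)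
          (B' := Cyc v (t d) (w d b) (w d c) (w d a)) (fun h => h.not_swap)
        · exact Cyc.rotate (hcyc a d b c had hab hac hbd.symm hcd.symm hbc
            (Cyc.rotate (Cyc.rotate h)))
        · exact Cyc.rotate (hcyc a d c b had hac hab hcd.symm hbd.symm hbc.symm
            (Cyc.rotate (Cyc.rotate h)))
      · intro s' p' X Y Z h'
        obtain ⟨i, rfl⟩ := (htri p').1 (isTrivalentNode_iff.2 ⟨_, _, _, _, h'.fork⟩)
        rcases @node i with rfl | rfl | rfl | rfl
        · exact Or.inl rfl
        · exact (uncovered _ c hbc h5 h6 _ _ _ _ h').elim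
        · exact (uncovered _ b hbc.symm ((hπ b _ hbc).trans h5) ((hκ b _ hbc).trans h6)
            _ _ _ _ h').elim
        · exact Or.inr rfl
    · obtain ⟨-, hf⟩ := hfork b a c d hab.symm hbc hbd hac had hcd (oba.trans h1.symm)
      rw [oba] at hf
      have m1 : π b a = true := (hπ a b hab).trans pab
      simp only [π, κ, decide_eq_true_eq, oba, h1] at m1 h2
      refine ⟨t b, w b a, w b c, w b d, ⟨hf, m1, h2⟩, ?_, ?_⟩
      · refine iff_of_imp_of_imp (fun h => ?_) (fun h => ?_) (h.fork.cyc_or hC)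
          (B' := Cyc v (t b) (w b a) (w b c) (w b d)) (fun h => h.not_swap)
        · exact Cyc.rotate (Cyc.rotate (hcyc a b c d hab hac had hbc hbd hcd h))
        · exact hcyc a b d c hab had hac hbd hbc hcd.symm (Cyc.rotate h)
      · intro s' p' X Y Z h'
        obtain ⟨i, rfl⟩ := (htri p').1 (isTrivalentNode_iff.2 ⟨_, _, _, _, h'.fork⟩)
        rcases @node i with rfl | rfl | rfl | rfl
        · exact Or.inl rfl
        · exact Or.inr rfl
        · exact (uncovered _ d hcd h5 h6 _ _ _ _ h').elim
        · exact (uncovered _ c hcd.symm ((hπ c _ hcd).trans h5) ((hκ c _ hcd).trans h6)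
            _ _ _ _ h').elim
    · have ocb : o c b = !s := by rw [ho b c hbc, h1]
      obtain ⟨-, hf⟩ := hfork c b a d hbc.symm hac.symm hcd hab.symm hbd had (ocb.trans oca.symm)
      rw [ocb] at hf
      have m1 : π c b = true := (hπ b c hbc).trans h2
      have m2 : κ c a = true := (hκ a c hac).trans qac
      simp only [π, κ, decide_eq_true_eq, ocb, oca] at m1 m2
      refine ⟨t c, w c b, w c a, w c d, ⟨hf, m1, m2⟩, ?_, ?_⟩
      · refine iff_of_imp_of_imp (fun h => ?_) (fun h => ?_) (h.fork.cyc_or hC)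
          (B' := Cyc v (t c) (w c b) (w c a) (w c d)) (fun h => h.not_swap)
        · exact hcyc a c d b hac had hab hcd hbc.symm hbd.symm (Cyc.rotate h)
        · exact Cyc.rotate (Cyc.rotate (hcyc a c b d hac hab had hbc.symm hcd hbd h))
      · intro s' p' X Y Z h'
        obtain ⟨i, rfl⟩ := (htri p').1 (isTrivalentNode_iff.2 ⟨_, _, _, _, h'.fork⟩)
        rcases @node i with rfl | rfl | rfl | rfl
        · exact Or.inl rfl
        · exact (uncovered _ d hbd h5 h6 _ _ _ _ h').elim
        · exact Or.inr rfl
        · exact (uncovered _ b hbd.symm ((hπ b _ hbd).trans h5) ((hκ b _ hbd).trans h6)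
            _ _ _ _ h').elim

end SlFoam
end

noncomputable section
namespace SlFoam
open LabelledComplex

/-! ### Closed curves -/

/-- A relation `r a b` (the next point after `a` is `b`) that describes a disjoint union of directed
closed curves with points in `S`. -/
structure IsCurve {α : Type*} (S : Set α) (r : α → α → Prop) : Prop where
  mem : ∀ a b, r a b → a ∈ S
  out : ∀ a b c, r a b → r a c → b = c
  into : ∀ a b c, r a c → r b c → a = b
  exists_into : ∀ a b, r a b → ∃ c, r c a
  exists_out : ∀ a b, r a b → ∃ c, r b c

theorem IsCurve.mem_right {α : Type*} {S : Set α} {r : α → α → Prop} (h : IsCurve S r) {a b : α}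
    (hab : r a b) : b ∈ S :=
  (h.exists_out _ _ hab).elim fun _ h' => h.mem _ _ h'

section Curve

variable {α : Type*} {S : Set α} [Finite S] {r r' : α → α → Prop}

open Classical in
/-- The permutation of `S` that moves each point of the curves to the next one. -/
def IsCurve.perm (h : IsCurve S r) : Equiv.Perm S :=
  Equiv.ofBijective
    (fun a : S => if ha : ∃ b, r a b then
      ⟨ha.choose, (h.exists_out _ _ ha.choose_spec).elim fun _ h' => h.mem _ _ h'⟩ else a) <| by
    rw [← Finite.injective_iff_bijective]
    have key : ∀ a : S, (∃ b, r a b) → ∀ c : S, (¬ ∃ b, r c b) → ∀ x, r a x → x ≠ c := by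
      rintro a - c hc x hx rfl
      exact hc (h.exists_out _ _ hx)
    intro a b hab
    by_cases ha : ∃ x, r a x <;> by_cases hb : ∃ x, r b x <;>
      simp only [ha, hb, dif_pos, dif_neg, not_false_eq_true] at hab
    · have := congrArg Subtype.val hab
      simp only at this
      have h1 := ha.choose_spec
      rw [this] at h1
      exact Subtype.ext (h.into _ _ _ h1 hb.choose_spec)
    · exact (key a ha b hb _ ha.choose_spec (congrArg Subtype.val hab)).elim
    · exact (key b hb a ha _ hb.choose_spec (congrArg Subtype.val hab).symm).elim
    · exact hab

open Classical in
theorem IsCurve.perm_eq (h : IsCurve S r) {a b : S} (hab : r a b) : h.perm a = b := by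
  have ha : ∃ b, r a b := ⟨b, hab⟩
  have : h.perm a = if ha : ∃ b, r a b then
      ⟨ha.choose, (h.exists_out _ _ ha.choose_spec).elim fun _ h' => h.mem _ _ h'⟩ else a := rfl
  rw [this, dif_pos ha]
  exact Subtype.ext (h.out _ _ _ ha.choose_spec hab)

open Classical in
theorem IsCurve.perm_eq_self (h : IsCurve S r) {a : S} (ha : ¬ ∃ b, r a b) : h.perm a = a := by
  have : h.perm a = if ha : ∃ b, r a b then
      ⟨ha.choose, (h.exists_out _ _ ha.choose_spec).elim fun _ h' => h.mem _ _ h'⟩ else a := rfl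
  rw [this, dif_neg ha]

theorem IsCurve.rel_perm (h : IsCurve S r) {a : S} (ha : ∃ b, r a b) : r a (h.perm a) := by
  obtain ⟨b, hb⟩ := ha
  rw [h.perm_eq (b := ⟨b, h.mem_right hb⟩) hb]
  exact hb

theorem IsCurve.exists_rel_perm_iff (h : IsCurve S r) (a : S) :
    (∃ b, r (h.perm a) b) ↔ ∃ b, r a b := by
  constructor
  · intro h'
    by_contra ha
    rw [h.perm_eq_self ha] at h'
    exact ha h'
  · intro ha
    exact h.exists_out _ _ (h.rel_perm ha)

open Classical in
/-- The sign of the permutation of closed curves, which is the parity of the number of points plus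
the number of curves. -/
def IsCurve.sgn (h : IsCurve S r) : ℤˣ :=
  letI := Fintype.ofFinite S
  Equiv.Perm.sign h.perm

theorem IsCurve.sgn_def [Fintype S] [DecidableEq S] (h : IsCurve S r) :
    h.sgn = Equiv.Perm.sign h.perm := by
  unfold IsCurve.sgn
  congr!

/-- The cycles of the permutation of a family of closed curves are the curves, so its sign is given
by the number of curves. -/
theorem IsCurve.sgn_eq (h : IsCurve S r) : h.sgn = (-1) ^ ({a | ∃ b, r a b}.ncard +
    Nat.card (SimpleGraph.fromRel fun a b : {a : α // ∃ b, r a b ∨ r b a} =>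
      r a b).ConnectedComponent) := by
  classical
  have := Fintype.ofFinite S
  let G := SimpleGraph.fromRel fun a b : {a : α // ∃ b, r a b ∨ r b a} => r a b
  change _ = (-1) ^ (_ + Nat.card G.ConnectedComponent)
  let p : S → Prop := fun a => ∃ b, r a b
  let σ := h.perm.subtypePerm (p := p) fun a => (h.exists_rel_perm_iff a)
  have hσ : ∀ x : {a : S // p a}, r x.1 (σ x).1 := fun x => h.rel_perm x.2
  let f : {a : S // p a} → G.ConnectedComponent := fun x =>
    G.connectedComponentMk ⟨x.1.1, x.2.elim fun b hb => ⟨b, Or.inl hb⟩⟩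
  have hp : ∀ a : {a : α // ∃ b, r a b ∨ r b a}, ∃ ha : a.1 ∈ S, p ⟨a.1, ha⟩ := by
    rintro ⟨a, b, hb | hb⟩
    · exact ⟨h.mem _ _ hb, b, hb⟩
    · exact ⟨h.mem_right hb, h.exists_out _ _ hb⟩
  have hstep : ∀ x, f (σ x) = f x := by
    intro x
    have hx := hσ x
    refine SimpleGraph.ConnectedComponent.sound ?_
    by_cases hne : σ x = x
    · rw [hne]
    · refine SimpleGraph.Adj.reachable ?_
      rw [SimpleGraph.fromRel_adj]
      refine ⟨fun h' => hne ?_, Or.inr hx⟩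
      exact Subtype.ext (Subtype.ext (Subtype.mk.inj h'))
  have hsurj : Function.Surjective f := by
    intro y
    induction y using SimpleGraph.ConnectedComponent.ind with
    | _ a =>
      obtain ⟨ha, hpa⟩ := hp a
      exact ⟨⟨⟨a.1, ha⟩, hpa⟩, rfl⟩
  have horb : ∀ x y, f x = f y ↔ σ.SameCycle x y := by
    intro x y
    constructor
    · intro hxy
      obtain ⟨w⟩ := SimpleGraph.ConnectedComponent.exact hxy
      have : ∀ (a b : {a : α // ∃ b, r a b ∨ r b a}), G.Walk a b → ∀ x y : {a : S // p a},
          x.1.1 = a.1 → y.1.1 = b.1 → σ.SameCycle x y := by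
        intro a b w
        induction w with
        | nil =>
          intro x y hx hy
          rw [Subtype.ext (Subtype.ext (hx.trans hy.symm))]
        | @cons a b c hab _ ih =>
          intro x y hx hy
          obtain ⟨hb, hpb⟩ := hp b
          refine Equiv.Perm.SameCycle.trans ?_ (ih ⟨⟨b.1, hb⟩, hpb⟩ y rfl hy)
          rw [SimpleGraph.fromRel_adj] at hab
          rcases hab.2 with h1 | h1
          · have : σ x = ⟨⟨b.1, hb⟩, hpb⟩ := by
              have h2 := hσ x
              rw [hx] at h2
              exact Subtype.ext (Subtype.ext (h.out _ _ _ h2 h1))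
            rw [← this]
            exact Equiv.Perm.sameCycle_apply_right.2 (Equiv.Perm.SameCycle.refl _ _)
          · have : σ ⟨⟨b.1, hb⟩, hpb⟩ = x := by
              have h2 := hσ ⟨⟨b.1, hb⟩, hpb⟩
              rw [← hx] at h1
              exact Subtype.ext (Subtype.ext (h.out _ _ _ h2 h1))
            rw [← this]
            exact Equiv.Perm.sameCycle_apply_left.2 (Equiv.Perm.SameCycle.refl _ _)
      exact this _ _ w x y rfl rfl
    · rintro ⟨n, rfl⟩
      have hn : ∀ (n : ℕ) x, f ((σ ^ n) x) = f x := by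
        intro n
        induction n with
        | zero => intro x; rfl
        | succ n ih => intro x; rw [pow_succ, Equiv.Perm.mul_apply, ih, hstep]
      rcases n with n | n
      · exact (hn n x).symm
      · rw [zpow_negSucc]
        have := hn (n + 1) ((σ ^ (n + 1))⁻¹ x)
        rw [← Equiv.Perm.mul_apply, mul_inv_cancel, Equiv.Perm.one_apply] at this
        exact this
  have hfin : Finite G.ConnectedComponent := Finite.of_surjective f hsurj
  have := Fintype.ofFinite G.ConnectedComponent
  rw [h.sgn_def, ← Equiv.Perm.sign_subtypePerm h.perm (p := p) (fun a => (h.exists_rel_perm_iff a))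
    fun a ha => by by_contra hp; exact ha (h.perm_eq_self hp)]
  change Equiv.Perm.sign σ = _
  rw [sign_eq_of_orbits σ f hsurj horb, Nat.card_eq_fintype_card]
  congr 2
  rw [← Nat.card_eq_fintype_card, ← Nat.card_coe_set_eq]
  refine Nat.card_congr ⟨fun x => ⟨x.1.1, x.2⟩, fun x => ⟨⟨x.1, x.2.elim fun _ h' => h.mem _ _ h'⟩, x.2⟩,
    fun _ => rfl, fun _ => rfl⟩

/-- The sign of a disjoint union of two families of curves. -/
theorem IsCurve.sgn_or (h : IsCurve S r) (h' : IsCurve S r')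
    (hd : ∀ a b c, r a b → r' a c → False) (h'' : IsCurve S fun a b => r a b ∨ r' a b) :
    h''.sgn = h.sgn * h'.sgn := by
  classical
  have := Fintype.ofFinite S
  rw [h.sgn_def, h'.sgn_def, h''.sgn_def, ← Equiv.Perm.sign_mul]
  congr 1
  ext1 a
  rw [Equiv.Perm.mul_apply]
  by_cases h1 : ∃ b, r' a b
  · have h2 := h'.rel_perm h1
    rw [h''.perm_eq (Or.inr h2), h.perm_eq_self]
    rintro ⟨c, hc⟩
    obtain ⟨d, hd'⟩ := h'.exists_out _ _ h2
    exact hd _ _ _ hc hd'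
  · rw [h'.perm_eq_self h1]
    by_cases h2 : ∃ b, r a b
    · rw [h''.perm_eq (Or.inl (h.rel_perm h2))]
    · rw [h.perm_eq_self h2, h''.perm_eq_self]
      rintro ⟨b, hb | hb⟩
      exacts [h2 ⟨b, hb⟩, h1 ⟨b, hb⟩]

/-- Two families of curves may be interchanged on a set of points. -/
theorem IsCurve.sgn_mul_sgn_of_swap {p q p' q' : α → α → Prop} (hp : IsCurve S p)
    (hq : IsCurve S q) (hp' : IsCurve S p') (hq' : IsCurve S q') (W : Set α)
    (h1 : ∀ a ∈ W, ∀ b, (p' a b ↔ q a b) ∧ (q' a b ↔ p a b))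
    (h2 : ∀ a, a ∉ W → ∀ b, (p' a b ↔ p a b) ∧ (q' a b ↔ q a b)) :
    hp'.sgn * hq'.sgn = hp.sgn * hq.sgn := by
  classical
  have := Fintype.ofFinite S
  have key : ∀ {r r' : α → α → Prop} (h : IsCurve S r) (h' : IsCurve S r') (a : S),
      (∀ b, r a b ↔ r' a b) → h.perm a = h'.perm a := by
    intro r r' h h' a e
    by_cases ha : ∃ b, r a b
    · exact (h'.perm_eq ((e _).1 (h.rel_perm ha))).symm
    · rw [h.perm_eq_self ha, h'.perm_eq_self]
      rintro ⟨b, hb⟩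
      exact ha ⟨b, (e _).2 hb⟩
  rw [hp.sgn_def, hq.sgn_def, hp'.sgn_def, hq'.sgn_def]
  exact sign_mul_sign_of_swap_on {a : S | a.1 ∈ W} _ _ _ _
    (fun v hv => key hp' hq v fun b => (h1 v hv b).1)
    (fun v hv => key hp' hp v fun b => (h2 v hv b).1)
    (fun v hv => key hq' hp v fun b => (h1 v hv b).2)
    (fun v hv => key hq' hq v fun b => (h2 v hv b).2)

end Curve

/-! ### The crossing curves of two sheets -/

variable {C : LabelledComplex} {v : Space} {E P Q : Set Triangle}

/-- The vertices of a set of triangles that is closed under rotation. -/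
def verts (S : Set Triangle) : Set Space := {v | ∃ b c, (v, b, c) ∈ S}

/-- The binding from `a` to `b` separates `P` from `Q`. -/
def Cross (C : LabelledComplex) (P Q : Set Triangle) (a b : Space) : Prop :=
  ∃ p q r, C.IsBinding a b p q r ∧ (a, b, p) ∈ P ∧ (a, b, q) ∈ Q

/-- The binding from `a` to `b` separates `P` from `Q` and is positive. -/
def PosCross (C : LabelledComplex) (P Q : Set Triangle) (a b : Space) : Prop :=
  ∃ p q r, C.IsBinding a b p q r ∧ (a, b, p) ∈ P ∧ (a, b, q) ∈ Q ∧
    LeftCyclic (b - a) (p - a) (q - a) (r - a)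

theorem PosCross.cross {a b : Space} (h : PosCross C P Q a b) : Cross C P Q a b := by
  obtain ⟨p, q, r, h1, h2, h3, -⟩ := h
  exact ⟨p, q, r, h1, h2, h3⟩

theorem Cross.symm {a b : Space} (h : Cross C P Q a b) : Cross C Q P a b := by
  obtain ⟨p, q, r, h1, h2, h3⟩ := h
  exact ⟨q, p, r, ⟨h1.1.symm, h1.2.1.trans (Set.pair_comm _ _), h1.2.2⟩, h3, h2⟩

theorem cross_iff_crossFork (hP : IsSheet C P) (hQ : IsSheet C Q) {b : Space} :
    (Cross C P Q v b ↔ ∃ x y z, CrossFork C P Q v true b x y z) ∧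
    (Cross C P Q b v ↔ ∃ x y z, CrossFork C P Q v false b x y z) := by
  refine ⟨⟨?_, ?_⟩, ⟨?_, ?_⟩⟩
  · rintro ⟨p, q, r, h1, h2, h3⟩
    exact ⟨p, q, r, h1, h2, h3⟩
  · rintro ⟨p, q, r, h1, h2, h3⟩
    exact ⟨p, q, r, h1, h2, h3⟩
  · rintro ⟨p, q, r, h1, h2, h3⟩
    exact ⟨p, q, r, h1, (mem_linkOf_arm hP.rotate).2 h2, (mem_linkOf_arm hQ.rotate).2 h3⟩
  · rintro ⟨p, q, r, h1, h2, h3⟩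
    exact ⟨p, q, r, h1, (mem_linkOf_arm hP.rotate).1 h2, (mem_linkOf_arm hQ.rotate).1 h3⟩

theorem CrossFork.posCross_iff (hC : IsClosedFoam C) (hP : IsSheet C P) {b x y z : Space}
    (h : CrossFork C P Q v true b x y z) : PosCross C P Q v b ↔ Cyc v b x y z := by
  constructor
  · rintro ⟨p, q, r, h1, h2, h3, h4⟩
    obtain ⟨-, rfl, rfl, rfl⟩ := h.unique hC hP (⟨h1, h2, h3⟩ : CrossFork C P Q v true b p q r)
    exact h4
  · intro h'
    exact ⟨x, y, z, h.fork, h.left, h.right, h'⟩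

theorem CrossFork.posCross_iff' (hC : IsClosedFoam C) (hP : IsSheet C P) (hQ : IsSheet C Q)
    {b x y z : Space} (h : CrossFork C P Q v false b x y z) :
    PosCross C P Q b v ↔ Cyc v b y x z := by
  constructor
  · rintro ⟨p, q, r, h1, h2, h3, h4⟩
    have h' : CrossFork C P Q v false b p q r :=
      ⟨h1, (mem_linkOf_arm hP.rotate).2 h2, (mem_linkOf_arm hQ.rotate).2 h3⟩
    obtain ⟨-, rfl, rfl, rfl⟩ := h.unique hC hP h'
    exact leftCyclic_reverse.1 h4
  · intro h'
    exact ⟨x, y, z, h.fork, (mem_linkOf_arm hP.rotate).1 h.left,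
      (mem_linkOf_arm hQ.rotate).1 h.right, leftCyclic_reverse.2 h'⟩

theorem Cross.mem {a b : Space} (hP : IsSheet C P) (h : Cross C P Q a b) : a ∈ verts C.tri := by
  obtain ⟨p, q, r, -, h2, -⟩ := h
  exact ⟨b, p, hP.subset h2⟩

theorem Cross.exists_into (hC : IsClosedFoam C) (hP : IsSheet C P) (hQ : IsSheet C Q) {b : Space}
    (h : Cross C P Q v b) : ∃ a, Cross C P Q a v ∧ (PosCross C P Q a v ↔ PosCross C P Q v b) ∧
      ∀ b', Cross C P Q v b' → b' = b := by
  obtain ⟨x, y, z, h⟩ := (cross_iff_crossFork hP hQ).1.1 h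
  obtain ⟨q, x', y', z', h1, h2, h3⟩ := h.exists_partner hC hP hQ
  refine ⟨q, (cross_iff_crossFork hP hQ).2.2 ⟨_, _, _, h1⟩, ?_, ?_⟩
  · rw [h.posCross_iff hC hP, CrossFork.posCross_iff' hC hP hQ h1, h2]
  · intro b' hb'
    obtain ⟨X, Y, Z, h4⟩ := (cross_iff_crossFork hP hQ).1.1 hb'
    rcases h3 _ _ _ _ _ h4 with rfl | rfl
    · rfl
    · exact absurd (h1.unique hC hP h4).1 (by decide)

theorem Cross.exists_out (hC : IsClosedFoam C) (hP : IsSheet C P) (hQ : IsSheet C Q) {a : Space}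
    (h : Cross C P Q a v) : ∃ b, Cross C P Q v b ∧ (PosCross C P Q v b ↔ PosCross C P Q a v) ∧
      ∀ a', Cross C P Q a' v → a' = a := by
  obtain ⟨x, y, z, h⟩ := (cross_iff_crossFork hP hQ).2.1 h
  obtain ⟨q, x', y', z', h1, h2, h3⟩ := h.exists_partner hC hP hQ
  refine ⟨q, (cross_iff_crossFork hP hQ).1.2 ⟨_, _, _, h1⟩, ?_, ?_⟩
  · rw [CrossFork.posCross_iff' hC hP hQ h, CrossFork.posCross_iff hC hP h1,
      h.fork.cyc_swap hC, h2, CrossFork.fork h1 |>.cyc_swap hC, not_not]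
  · intro b' hb'
    obtain ⟨X, Y, Z, h4⟩ := (cross_iff_crossFork hP hQ).2.1 hb'
    rcases h3 _ _ _ _ _ h4 with rfl | rfl
    · rfl
    · exact absurd (h1.unique hC hP h4).1 (by decide)

theorem isCurve_cross (hC : IsClosedFoam C) (hP : IsSheet C P) (hQ : IsSheet C Q) :
    IsCurve (verts C.tri) (Cross C P Q) where
  mem _ _ h := h.mem hP
  out _ _ _ h h' := by
    obtain ⟨-, -, -, h3⟩ := h.exists_into hC hP hQ
    exact (h3 _ h').symm
  into _ _ _ h h' := by
    obtain ⟨-, -, -, h3⟩ := h.exists_out hC hP hQ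
    exact (h3 _ h').symm
  exists_into _ _ h := (h.exists_into hC hP hQ).imp fun _ h => h.1
  exists_out _ _ h := (h.exists_out hC hP hQ).imp fun _ h => h.1

theorem isCurve_posCross (hC : IsClosedFoam C) (hP : IsSheet C P) (hQ : IsSheet C Q) :
    IsCurve (verts C.tri) (PosCross C P Q) where
  mem _ _ h := h.cross.mem hP
  out _ _ _ h h' := (isCurve_cross hC hP hQ).out _ _ _ h.cross h'.cross
  into _ _ _ h h' := (isCurve_cross hC hP hQ).into _ _ _ h.cross h'.cross
  exists_into _ _ h := (h.cross.exists_into hC hP hQ).imp fun _ h' => h'.2.1.2 h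
  exists_out _ _ h := (h.cross.exists_out hC hP hQ).imp fun _ h' => h'.2.1.2 h

theorem cross_iff (hC : IsClosedFoam C) {a b : Space} :
    Cross C P Q a b ↔ PosCross C P Q a b ∨ PosCross C Q P a b := by
  constructor
  · rintro ⟨p, q, r, h1, h2, h3⟩
    rcases hC.apart _ _ _ _ _ h1 with h | h
    · exact Or.inl ⟨p, q, r, h1, h2, h3, h⟩
    · exact Or.inr ⟨q, p, r, ⟨h1.1.symm, h1.2.1.trans (Set.pair_comm _ _), h1.2.2⟩, h3, h2, h⟩
  · rintro (h | h)
    exacts [h.cross, h.cross.symm]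

theorem PosCross.not_posCross (hC : IsClosedFoam C) (hP : IsSheet C P) (hQ : IsSheet C Q)
    {a b c : Space} (h : PosCross C P Q a b) : ¬ PosCross C Q P a c := by
  intro h'
  obtain rfl := (isCurve_cross hC hP hQ).out _ _ _ h.cross h'.cross.symm
  obtain ⟨p, q, r, h1, h2, h3, h4⟩ := h
  obtain ⟨q', p', r', h1', h2', h3', h4'⟩ := h'
  have e1 : CrossFork C P Q a true b p q r := ⟨h1, h2, h3⟩
  have e2 : CrossFork C P Q a true b p' q' r' :=
    ⟨⟨h1'.1.symm, h1'.2.1.trans (Set.pair_comm _ _), h1'.2.2⟩, h3', h2'⟩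
  obtain ⟨-, rfl, rfl, rfl⟩ := e1.unique hC hP e2
  exact h4.not_swap h4'

end SlFoam
end

noncomputable section
namespace SlFoam
open LabelledComplex

variable {C : LabelledComplex} {v : Space} {E P Q S : Set Triangle}

/-! ### Euler characteristics of closed surfaces -/

theorem IsClosedFoam.ne_all (hC : IsClosedFoam C) {a b c : Space} (h : (a, b, c) ∈ C.tri) :
    a ≠ b ∧ b ≠ c ∧ c ≠ a :=
  ⟨hC.ne _ _ _ h, hC.ne _ _ _ (hC.rotate _ _ _ h), hC.ne _ _ _ (hC.rotate _ _ _ (hC.rotate _ _ _ h))⟩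

theorem IsClosedSurface.finite (hC : IsClosedFoam C) (hE : IsClosedSurface C E) : E.Finite :=
  hC.finite.subset hE.subset

theorem IsClosedSurface.finite_verts (hC : IsClosedFoam C) (hE : IsClosedSurface C E) :
    (verts E).Finite := by
  refine ((hE.finite hC).image fun t => t.1).subset ?_
  rintro v ⟨b, c, h⟩
  exact ⟨_, h, rfl⟩

theorem verts_eq_image (S : Set Triangle) : verts S = (fun t : Triangle => t.1) '' S := by
  ext v
  constructor
  · rintro ⟨b, c, h⟩
    exact ⟨_, h, rfl⟩
  · rintro ⟨⟨a, b, c⟩, h, rfl⟩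
    exact ⟨b, c, h⟩

/-- Each edge of a closed surface lies in exactly two triangles. -/
theorem IsClosedSurface.exists_flip (hC : IsClosedFoam C) (hE : IsClosedSurface C E)
    {t : Triangle} (ht : t ∈ E) : ∃ u ∈ E, u ≠ t ∧
      ∀ w ∈ E, s(w.1, w.2.1) = s(t.1, t.2.1) ↔ w = t ∨ w = u := by
  obtain ⟨a, b, x⟩ := t
  have hab := hC.ne _ _ _ (hE.subset ht)
  have hlink : ∀ w : Triangle, s(w.1, w.2.1) = s(a, b) →
      w = (a, b, w.2.2) ∨ w = (b, a, w.2.2) := by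
    rintro ⟨c, d, y⟩ h
    rcases Sym2.eq_iff.1 h with ⟨h1, h2⟩ | ⟨h1, h2⟩
    · left; dsimp only at h1 h2; rw [h1, h2]
    · right; dsimp only at h1 h2; rw [h1, h2]
  -- triangles at the edge are link edges at the node `b` in the link of `a`
  have hex : ∃ u ∈ E, u ≠ (a, b, x) ∧ s(u.1, u.2.1) = s(a, b) := by
    rcases hC.edge _ _ _ (hE.subset ht) with ⟨p, q, h⟩ | ⟨p, q, r, h⟩ | ⟨p, q, r, h⟩
    · have hx : x ∈ C.star a b := hE.subset ht
      rw [h.1] at hx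
      obtain rfl := Set.mem_singleton_iff.1 hx
      exact ⟨(b, a, q), (hE.regular _ _ _ _ h).1 ht, by simp [hab.symm], Sym2.eq_swap⟩
    · have hx : x ∈ C.star a b := hE.subset ht
      rw [h.2.1] at hx
      have h1 := hE.binding _ _ _ _ _ h
      rcases hx with rfl | hx
      · by_cases hq : (a, b, q) ∈ E
        · exact ⟨_, hq, by simp [h.1.symm], rfl⟩
        · exact ⟨_, h1.2 (Or.inl ⟨ht, hq⟩), by simp [hab.symm], Sym2.eq_swap⟩
      · obtain rfl := Set.mem_singleton_iff.1 hx
        by_cases hq : (a, b, p) ∈ E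
        · exact ⟨_, hq, by simp [h.1], rfl⟩
        · exact ⟨_, h1.2 (Or.inr ⟨ht, hq⟩), by simp [hab.symm], Sym2.eq_swap⟩
    · have hx : x ∈ C.star a b := hE.subset ht
      rw [h.2.2] at hx
      obtain rfl := Set.mem_singleton_iff.1 hx
      rcases (hE.binding _ _ _ _ _ h).1 ht with h1 | h1
      · exact ⟨_, h1.1, by simp [hab.symm], Sym2.eq_swap⟩
      · exact ⟨_, h1.1, by simp [hab.symm], Sym2.eq_swap⟩
  obtain ⟨u, hu, hne, hs⟩ := hex
  refine ⟨u, hu, hne, fun w hw => ⟨fun h => ?_, ?_⟩⟩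
  · -- pass to the link of `a`
    let g : Triangle → Space × Space := fun w => if w.1 = a then (w.2.1, w.2.2) else (w.2.2, w.1)
    have hg : ∀ w ∈ E, s(w.1, w.2.1) = s(a, b) →
        g w ∈ linkOf E a ∧ ((g w).1 = b ∨ (g w).2 = b) := by
      rintro w hw h
      rcases hlink w h with h | h
      · rw [h] at hw ⊢
        simp [g, linkOf, hw]
      · rw [h] at hw ⊢
        simp only [g, hab.symm, if_false, or_true, and_true]
        exact hE.rotate _ _ _ hw
    have hinj : ∀ w w', s(w.1, w.2.1) = s(a, b) → s(w'.1, w'.2.1) = s(a, b) → w ∈ E → w' ∈ E →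
        g w = g w' → w = w' := by
      intro w w' h h' hw hw'
      rcases hlink w h with h | h <;> rcases hlink w' h' with h' | h' <;> rw [h] at hw ⊢ <;>
        rw [h'] at hw' ⊢ <;> simp only [g, hab.symm, if_true, if_false, Prod.mk.injEq, true_and,
          and_true, imp_self]
      · rintro ⟨h1, h2⟩
        exact ((hC.ne_all (hE.subset hw')).2.2 h1.symm).elim
      · rintro ⟨h1, h2⟩
        exact ((hC.ne_all (hE.subset hw)).2.2 h1).elim
    obtain ⟨a1, a2⟩ := hg _ ht rfl
    obtain ⟨b1, b2⟩ := hg _ hu hs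
    obtain ⟨c1, c2⟩ := hg _ hw h
    rcases hE.eq_or_eq_of_shareNode hC a1 b1 c1 a2 b2 c2 with h1 | h1 | h1
    · exact (hne (hinj _ _ rfl hs ht hu h1).symm).elim
    · exact Or.inl (hinj _ _ rfl h ht hw h1).symm
    · exact Or.inr (hinj _ _ hs h hu hw h1).symm
  · rintro (rfl | rfl)
    exacts [rfl, hs]

theorem ncard_eq_mul_ncard_image {α β : Type*} {s : Set α} (hs : s.Finite) (f : α → β) (k : ℕ)
    (h : ∀ a ∈ s, {b ∈ s | f b = f a}.ncard = k) : s.ncard = k * (f '' s).ncard := by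
  classical
  lift s to Finset α using hs
  rw [← Finset.coe_image, Set.ncard_coe_finset, Set.ncard_coe_finset,
    Finset.card_eq_sum_card_image f s, Finset.sum_const_nat, mul_comm]
  intro b hb
  obtain ⟨a, ha, rfl⟩ := Finset.mem_image.1 hb
  rw [← h a ha, ← Set.ncard_coe_finset]
  congr 1
  ext
  simp

/-- Only the three rotations of a triangle of a surface have the same set of vertices: triangles of
opposite orientation do not both occur. -/
theorem IsClosedSurface.faces (hC : IsClosedFoam C) (hE : IsClosedSurface C E)
    {a b c : Space} (ht : (a, b, c) ∈ E) {w : Triangle} (hw : w ∈ E) :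
    ({w.1, w.2.1, w.2.2} : Set Space) = {a, b, c} ↔
      w = (a, b, c) ∨ w = (b, c, a) ∨ w = (c, a, b) := by
  obtain ⟨x, y, z⟩ := w
  have h1 := hC.ne_all (hE.subset ht)
  have h2 := hC.ne_all (hE.subset hw)
  have o1 := hC.oriented _ _ _ (hE.subset ht)
  have o2 := hC.oriented _ _ _ (hE.subset (hE.rotate _ _ _ ht))
  have o3 := hC.oriented _ _ _ (hE.subset (hE.rotate _ _ _ (hE.rotate _ _ _ ht)))
  have hw' := hE.subset hw
  constructor
  · intro h
    have hx : x ∈ ({a, b, c} : Set Space) := h ▸ Set.mem_insert _ _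
    have hy : y ∈ ({a, b, c} : Set Space) := h ▸ Set.mem_insert_of_mem _ (Set.mem_insert _ _)
    have hz : z ∈ ({a, b, c} : Set Space) :=
      h ▸ Set.mem_insert_of_mem _ (Set.mem_insert_of_mem _ rfl)
    simp only [Set.mem_insert_iff, Set.mem_singleton_iff] at hx hy hz
    rcases hx with rfl | rfl | rfl <;> rcases hy with rfl | rfl | rfl <;>
      rcases hz with rfl | rfl | rfl <;> simp_all
  · rintro (h | h | h) <;> cases h <;> dsimp only
    · ext; simp; tauto
    · ext; simp; tauto

/-- Counting flags: the Euler characteristic of a closed surface in terms of vertices and flags. -/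
theorem IsClosedSurface.six_mul_eulerChar (hC : IsClosedFoam C) (hE : IsClosedSurface C E) :
    6 * eulerChar E = 6 * ((verts E).ncard : ℤ) - E.ncard := by
  have hfin := hE.finite hC
  have hedge : E.ncard = 2 * ((fun t : Triangle => s(t.1, t.2.1)) '' E).ncard := by
    refine ncard_eq_mul_ncard_image hfin _ 2 fun t ht => ?_
    obtain ⟨u, hu, hne, hw⟩ := hE.exists_flip hC ht
    have : {b ∈ E | s(b.1, b.2.1) = s(t.1, t.2.1)} = {t, u} := by
      ext w
      constructor
      · rintro ⟨h1, h2⟩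
        exact (hw w h1).1 h2
      · rintro (rfl | rfl)
        · exact ⟨ht, rfl⟩
        · exact ⟨hu, (hw _ hu).2 (Or.inr rfl)⟩
    rw [this, Set.ncard_pair hne.symm]
  have hface : E.ncard =
      3 * ((fun t : Triangle => ({t.1, t.2.1, t.2.2} : Set Space)) '' E).ncard := by
    refine ncard_eq_mul_ncard_image hfin _ 3 fun t ht => ?_
    obtain ⟨a, b, c⟩ := t
    have h1 := hC.ne_all (hE.subset ht)
    have : {w ∈ E | ({w.1, w.2.1, w.2.2} : Set Space) = {a, b, c}} =
        {(a, b, c), (b, c, a), (c, a, b)} := by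
      ext w
      constructor
      · rintro ⟨h1, h2⟩
        exact (hE.faces hC ht h1).1 h2
      · intro hw
        have hw' : w ∈ E := by
          rcases hw with rfl | rfl | rfl
          exacts [ht, hE.rotate _ _ _ ht, hE.rotate _ _ _ (hE.rotate _ _ _ ht)]
        exact ⟨hw', (hE.faces hC ht hw').2 hw⟩
    rw [this, Set.ncard_eq_toFinset_card', Set.toFinset_insert, Set.toFinset_insert,
      Set.toFinset_singleton, Finset.card_eq_three.2 ⟨_, _, _, ?_, ?_, ?_, rfl⟩]
    · simp [h1.1]
    · simp [h1.2.2.symm]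
    · simp [h1.2.1]
  unfold eulerChar
  rw [← verts_eq_image]
  omega

/-! ### Unions of components of a closed surface -/

/-- `S` is a union of connected components of the surface `E`. -/
structure IsComponentUnion (E S : Set Triangle) : Prop where
  subset : S ⊆ E
  rotate : ∀ a b c, (a, b, c) ∈ S → (b, c, a) ∈ S
  same : ∀ a b x y, (a, b, x) ∈ S → (a, b, y) ∈ E → (a, b, y) ∈ S
  opposite : ∀ a b x y, (a, b, x) ∈ S → (b, a, y) ∈ E → (b, a, y) ∈ S

theorem IsComponentUnion.isClosedSurface (hE : IsClosedSurface C E) (hS : IsComponentUnion E S) :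
    IsClosedSurface C S where
  subset := hS.subset.trans hE.subset
  rotate := hS.rotate
  regular a b p q h := ⟨fun h' => hS.opposite _ _ _ _ h' ((hE.regular _ _ _ _ h).1 (hS.subset h')),
    fun h' => hS.opposite _ _ _ _ h' ((hE.regular _ _ _ _ h).2 (hS.subset h'))⟩
  binding a b p q r h := by
    by_cases h0 : (a, b, p) ∈ S ∨ (a, b, q) ∈ S ∨ (b, a, r) ∈ S
    · have e : ((a, b, p) ∈ S ↔ (a, b, p) ∈ E) ∧ ((a, b, q) ∈ S ↔ (a, b, q) ∈ E) ∧
          ((b, a, r) ∈ S ↔ (b, a, r) ∈ E) := by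
        rcases h0 with h0 | h0 | h0
        · exact ⟨⟨@hS.subset _, hS.same _ _ _ _ h0⟩, ⟨@hS.subset _, hS.same _ _ _ _ h0⟩,
            ⟨@hS.subset _, hS.opposite _ _ _ _ h0⟩⟩
        · exact ⟨⟨@hS.subset _, hS.same _ _ _ _ h0⟩, ⟨@hS.subset _, hS.same _ _ _ _ h0⟩,
            ⟨@hS.subset _, hS.opposite _ _ _ _ h0⟩⟩
        · exact ⟨⟨@hS.subset _, hS.opposite _ _ _ _ h0⟩, ⟨@hS.subset _, hS.opposite _ _ _ _ h0⟩,
            ⟨@hS.subset _, hS.same _ _ _ _ h0⟩⟩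
      rw [e.1, e.2.1, e.2.2]
      exact hE.binding _ _ _ _ _ h
    · push Not at h0
      simp [h0]

theorem isComponentUnion_self (hE : IsClosedSurface C E) : IsComponentUnion E E :=
  ⟨subset_rfl, hE.rotate, fun _ _ _ _ _ h => h, fun _ _ _ _ _ h => h⟩

/-- The components of a surface do not touch, since the link at each vertex is connected. -/
theorem IsComponentUnion.star (hC : IsClosedFoam C) (hE : IsClosedSurface C E) (hS : IsComponentUnion E S)
    {b c b' c' : Space} (h : (v, b, c) ∈ S) (h' : (v, b', c') ∈ E) : (v, b', c') ∈ S := by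
  refine hE.link_connected hC (v := v) (U := linkOf S v) ⟨(b, c), h⟩
    (fun e he => hS.subset he) ?_ (show (b', c') ∈ linkOf E v from h')
  rintro ⟨a, b⟩ he ⟨c, d⟩ hf hs
  have he' : (v, a, b) ∈ S := he
  have hf' : (v, c, d) ∈ E := hf
  change (v, c, d) ∈ S
  rcases hs with h | h | h | h <;> dsimp only at h <;> subst h
  · exact hS.same _ _ _ _ he' hf'
  · exact hS.rotate _ _ _ (hS.opposite _ _ _ _ he' (hE.rotate _ _ _ (hE.rotate _ _ _ hf')))
  · exact hS.opposite _ _ _ _ (hS.rotate _ _ _ (hS.rotate _ _ _ he')) hf'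
  · exact hS.rotate _ _ _ (hS.same _ _ _ _ (hS.rotate _ _ _ (hS.rotate _ _ _ he'))
      (hE.rotate _ _ _ (hE.rotate _ _ _ hf')))

end SlFoam
end

noncomputable section
namespace SlFoam
open LabelledComplex

variable {C : LabelledComplex} {v : Space} {E P Q S : Set Triangle}

/-! ### The parity of the number of crossing curves -/

theorem IsSheet.rotate' (hP : IsSheet C P) {a b c : Space} : (a, b, c) ∈ P ↔ (b, c, a) ∈ P :=
  hP.isClosedSurface.rotate'

theorem IsSheet.eq_of_mem (hC : IsClosedFoam C) (hP : IsSheet C P) {a b x y : Space}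
    (hx : (a, b, x) ∈ P) (hy : (a, b, y) ∈ P) : x = y := by
  have mx : x ∈ C.star a b := hP.subset hx
  have my : y ∈ C.star a b := hP.subset hy
  rcases hC.edge _ _ _ (hP.subset hx) with ⟨p, q, h⟩ | ⟨p, q, r, h⟩ | ⟨p, q, r, h⟩
  · rw [h.1] at mx my
    exact (Set.mem_singleton_iff.1 mx).trans (Set.mem_singleton_iff.1 my).symm
  · rw [h.2.1] at mx my
    have := (hP.binding _ _ _ _ _ h).2
    rcases mx with rfl | rfl <;> rcases my with rfl | rfl <;> tauto
  · rw [h.2.2] at mx my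
    exact (Set.mem_singleton_iff.1 mx).trans (Set.mem_singleton_iff.1 my).symm

theorem Cross.triangles (hP : IsSheet C P) (hQ : IsSheet C Q) {a b : Space}
    (h : Cross C P Q a b) : ∃ p q r, ((a, b, p) ∈ P ∧ (a, b, p) ∉ Q) ∧
      ((a, b, q) ∈ Q ∧ (a, b, q) ∉ P) ∧ (b, a, r) ∈ P ∧ (b, a, r) ∈ Q ∧ C.star b a = {r} := by
  obtain ⟨p, q, r, hb, h1, h2⟩ := h
  have h3 := hP.binding _ _ _ _ _ hb
  have h4 := hQ.binding _ _ _ _ _ hb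
  exact ⟨p, q, r, ⟨h1, fun h => h4.2 ⟨h, h2⟩⟩, ⟨h2, fun h => h3.2 ⟨h1, h⟩⟩, h3.1.2 (Or.inl h1),
    h4.1.2 (Or.inr h2), hb.2.2⟩

/-- The part of `P` off `Q` continues across an edge, except at a crossing. -/
theorem IsSheet.exists_flip_or_cross (hC : IsClosedFoam C) (hP : IsSheet C P) (hQ : IsSheet C Q)
    {a b x : Space} (hx : (a, b, x) ∈ P) (hx' : (a, b, x) ∉ Q) :
    (∃ y, (b, a, y) ∈ P ∧ (b, a, y) ∉ Q) ∨ Cross C P Q a b := by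
  have mx : x ∈ C.star a b := hP.subset hx
  rcases hC.edge _ _ _ (hP.subset hx) with ⟨p, q, h⟩ | ⟨p, q, r, h⟩ | ⟨p, q, r, h⟩
  · rw [h.1] at mx
    obtain rfl := Set.mem_singleton_iff.1 mx
    exact Or.inl ⟨q, (hP.regular _ _ _ _ h).1 hx, fun h' => hx' ((hQ.regular _ _ _ _ h).2 h')⟩
  · rw [h.2.1] at mx
    have h1 := (hP.binding _ _ _ _ _ h).1
    have h2 := (hQ.binding _ _ _ _ _ h).1
    by_cases hr : (b, a, r) ∈ Q
    · right
      rcases mx with rfl | hx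
      · exact ⟨x, q, r, h, hx, (h2.1 hr).resolve_left hx'⟩
      · obtain rfl := Set.mem_singleton_iff.1 hx
        exact ⟨x, p, r, ⟨h.1.symm, h.2.1.trans (Set.pair_comm _ _), h.2.2⟩, ‹_›,
          (h2.1 hr).resolve_right hx'⟩
    · refine Or.inl ⟨r, h1.2 ?_, hr⟩
      rcases mx with rfl | hx
      · exact Or.inl ‹_›
      · obtain rfl := Set.mem_singleton_iff.1 hx
        exact Or.inr ‹_›
  · rw [h.2.2] at mx
    obtain rfl := Set.mem_singleton_iff.1 mx
    have h1 := (hP.binding _ _ _ _ _ h).1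
    have h2 := (hQ.binding _ _ _ _ _ h).1
    rcases h1.1 hx with h3 | h3
    · exact Or.inl ⟨p, h3, fun h4 => hx' (h2.2 (Or.inl h4))⟩
    · exact Or.inl ⟨q, h3, fun h4 => hx' (h2.2 (Or.inr h4))⟩

/-- The crossings of `P` and `Q` on `S`. -/
def CrossOn (C : LabelledComplex) (P Q S : Set Triangle) (a b : Space) : Prop :=
  Cross C P Q a b ∧ a ∈ verts S

theorem CrossOn.mem_right (hC : IsClosedFoam C) (hP : IsSheet C P) (hQ : IsSheet C Q)
    (hS : IsComponentUnion (symmDiff P Q) S) {a b : Space} (h : CrossOn C P Q S a b) :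
    b ∈ verts S := by
  obtain ⟨p, q, r, h1, -⟩ := h.1.triangles hP hQ
  obtain ⟨c, d, h2⟩ := h.2
  exact ⟨_, _, hS.rotate _ _ _ (hS.star hC (hP.symmDiff hQ) h2 (Or.inl h1))⟩

theorem Cross.mem_left (hC : IsClosedFoam C) (hP : IsSheet C P) (hQ : IsSheet C Q)
    (hS : IsComponentUnion (symmDiff P Q) S) {a b : Space} (h : Cross C P Q a b)
    (hb : b ∈ verts S) : a ∈ verts S := by
  obtain ⟨p, q, r, h1, -⟩ := h.triangles hP hQ
  obtain ⟨c, d, h2⟩ := hb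
  have h3 : (b, p, a) ∈ symmDiff P Q := Or.inl ⟨hP.rotate _ _ _ h1.1, fun h => h1.2 (hQ.rotate'.2 h)⟩
  exact ⟨_, _, hS.rotate _ _ _ (hS.rotate _ _ _ (hS.star hC (hP.symmDiff hQ) h2 h3))⟩

theorem isCurve_crossOn (hC : IsClosedFoam C) (hP : IsSheet C P) (hQ : IsSheet C Q)
    (hS : IsComponentUnion (symmDiff P Q) S) : IsCurve (verts C.tri) (CrossOn C P Q S) where
  mem _ _ h := h.1.mem hP
  out _ _ _ h h' := (isCurve_cross hC hP hQ).out _ _ _ h.1 h'.1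
  into _ _ _ h h' := (isCurve_cross hC hP hQ).into _ _ _ h.1 h'.1
  exists_into _ _ h := (h.1.exists_into hC hP hQ).imp fun _ h' => ⟨h'.1, h'.1.mem_left hC hP hQ hS h.2⟩
  exists_out _ _ h := (h.1.exists_out hC hP hQ).imp fun _ h' => ⟨h'.1, h.mem_right hC hP hQ hS⟩

theorem IsClosedFoam.finite_verts (hC : IsClosedFoam C) : (verts C.tri).Finite := by
  rw [verts_eq_image]
  exact hC.finite.image _

/-- The flags of the surface with boundary `S ∩ P`, and its boundary points. The boundary point `b`
stands for the boundary edge that starts at `b`, with the surface on its other side. -/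
abbrev Dart (C : LabelledComplex) (P Q S : Set Triangle) : Type :=
  {t : Triangle // t ∈ S ∧ t ∈ P} ⊕ {v : Space // ∃ b, CrossOn C P Q S v b}

/-- The two darts belong to the two sides of an edge. -/
def Dart.IsFlip : Dart C P Q S → Dart C P Q S → Prop
  | Sum.inl t, Sum.inl u => u.1.1 = t.1.2.1 ∧ u.1.2.1 = t.1.1
  | Sum.inl t, Sum.inr b => Cross C P Q t.1.1 t.1.2.1 ∧ b.1 = t.1.2.1
  | Sum.inr b, Sum.inl t => Cross C P Q t.1.1 t.1.2.1 ∧ b.1 = t.1.2.1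
  | Sum.inr _, Sum.inr _ => False

/-- The vertex at which a dart starts. -/
def Dart.origin : Dart C P Q S → Space
  | Sum.inl t => t.1.1
  | Sum.inr b => b.1

theorem Dart.IsFlip.symm {x y : Dart C P Q S} (h : x.IsFlip y) : y.IsFlip x := by
  rcases x with x | x <;> rcases y with y | y
  · exact ⟨h.2.symm, h.1.symm⟩
  · exact h
  · exact h
  · exact h

theorem Dart.ext_inl (hC : IsClosedFoam C) (hP : IsSheet C P)
    {t u : {t : Triangle // t ∈ S ∧ t ∈ P}} (h1 : t.1.1 = u.1.1) (h2 : t.1.2.1 = u.1.2.1) :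
    t = u := by
  obtain ⟨⟨a, b, x⟩, ht⟩ := t
  obtain ⟨⟨a', b', x'⟩, hu⟩ := u
  dsimp only at h1 h2
  subst h1 h2
  simp [hP.eq_of_mem hC ht.2 hu.2]

theorem Dart.notMem (hS : IsComponentUnion (symmDiff P Q) S)
    (t : {t : Triangle // t ∈ S ∧ t ∈ P}) : t.1 ∉ Q := by
  rcases hS.subset t.2.1 with h | h
  · exact h.2
  · exact (h.2 t.2.2).elim

theorem Dart.not_cross (hP : IsSheet C P) (hQ : IsSheet C Q)
    (hS : IsComponentUnion (symmDiff P Q) S) {t u : {t : Triangle // t ∈ S ∧ t ∈ P}}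
    (h1 : t.1.1 = u.1.2.1) (h2 : t.1.2.1 = u.1.1) : ¬ Cross C P Q u.1.1 u.1.2.1 := by
  have h3 := Dart.notMem hS t
  obtain ⟨⟨a, b, x⟩, ht⟩ := t
  obtain ⟨⟨a', b', x'⟩, hu⟩ := u
  intro h4
  dsimp only at h1 h2 h3 h4
  subst h1 h2
  obtain ⟨p, q, r, -, -, h5, h6, h7⟩ := h4.triangles hP hQ
  have : x ∈ C.star a b := hP.subset ht.2
  rw [h7] at this
  obtain rfl := Set.mem_singleton_iff.1 this
  exact h3 h6

theorem Dart.IsFlip.unique (hC : IsClosedFoam C) (hP : IsSheet C P) (hQ : IsSheet C Q)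
    (hS : IsComponentUnion (symmDiff P Q) S) {x y z : Dart C P Q S} (h : x.IsFlip y)
    (h' : x.IsFlip z) : y = z := by
  rcases x with x | x <;> rcases y with y | y <;> rcases z with z | z
  · exact congrArg Sum.inl (Dart.ext_inl hC hP (h.1.trans h'.1.symm) (h.2.trans h'.2.symm))
  · exact (Dart.not_cross hP hQ hS h.1 h.2 h'.1).elim
  · exact (Dart.not_cross hP hQ hS h'.1 h'.2 h.1).elim
  · exact congrArg Sum.inr (Subtype.ext (h.2.trans h'.2.symm))
  · refine congrArg Sum.inl (Dart.ext_inl hC hP ?_ (h.2.symm.trans h'.2))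
    have e : y.1.2.1 = z.1.2.1 := h.2.symm.trans h'.2
    exact (isCurve_cross hC hP hQ).into _ _ _ h.1 (e ▸ h'.1)
  · exact h'.elim
  · exact h.elim
  · exact h.elim

theorem Dart.exists_isFlip (hC : IsClosedFoam C) (hP : IsSheet C P) (hQ : IsSheet C Q)
    (hS : IsComponentUnion (symmDiff P Q) S) (x : Dart C P Q S) : ∃ y, x.IsFlip y := by
  rcases x with ⟨⟨a, b, x⟩, hx⟩ | ⟨b, c, hb⟩
  · have hxQ := Dart.notMem hS ⟨_, hx⟩
    rcases hP.exists_flip_or_cross hC hQ hx.2 hxQ with ⟨y, h1, h2⟩ | h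
    · exact ⟨Sum.inl ⟨(b, a, y), hS.opposite _ _ _ _ hx.1 (Or.inl ⟨h1, h2⟩), h1⟩, rfl, rfl⟩
    · have h1 : CrossOn C P Q S a b := ⟨h, _, _, hx.1⟩
      exact ⟨Sum.inr ⟨b, (isCurve_crossOn hC hP hQ hS).exists_out _ _ h1⟩, h, rfl⟩
  · obtain ⟨a, ha⟩ := (isCurve_crossOn hC hP hQ hS).exists_into _ _ hb
    obtain ⟨p, q, r, h1, -⟩ := ha.1.triangles hP hQ
    obtain ⟨d, e, h2⟩ := ha.2
    exact ⟨Sum.inl ⟨(a, b, p), hS.star hC (hP.symmDiff hQ) h2 (Or.inl h1), h1.1⟩, ha.1, rfl⟩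

theorem Dart.IsFlip.ne (hC : IsClosedFoam C) (hP : IsSheet C P) {x y : Dart C P Q S}
    (h : x.IsFlip y) : y ≠ x := by
  rintro rfl
  rcases y with ⟨⟨a, b, x⟩, hx⟩ | y
  · exact hC.ne _ _ _ (hP.subset hx.2) h.1
  · exact h

/-- The parity of the number of crossing curves of `P` and `Q` on `S`: a surface with boundary is
turned into a permutation of its darts whose cycles are its vertices. -/
theorem sgn_crossOn (hC : IsClosedFoam C) (hP : IsSheet C P) (hQ : IsSheet C Q)
    (hS : IsComponentUnion (symmDiff P Q) S) :
    have : Finite (verts C.tri) := hC.finite_verts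
    Even ((S ∩ P).ncard + {v | ∃ b, CrossOn C P Q S v b}.ncard) ∧
    (isCurve_crossOn hC hP hQ hS).sgn =
      (-1) ^ (((S ∩ P).ncard + {v | ∃ b, CrossOn C P Q S v b}.ncard) / 2 +
        (verts (S ∩ P)).ncard) := by
  classical
  intro hfinv
  have := Fintype.ofFinite (verts C.tri)
  have hE := hP.symmDiff hQ
  set hcur := isCurve_crossOn hC hP hQ hS with hcur_def
  have hAfin : Finite {t : Triangle // t ∈ S ∧ t ∈ P} :=
    (hC.finite.subset fun t ht => hP.subset ht.2 : (S ∩ P).Finite)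
  have hMfin : Finite {v : Space // ∃ b, CrossOn C P Q S v b} :=
    (hC.finite_verts.subset fun v ⟨b, hb⟩ => hcur.mem _ _ hb :
      ({v | ∃ b, CrossOn C P Q S v b} : Set Space).Finite)
  have := Fintype.ofFinite {t : Triangle // t ∈ S ∧ t ∈ P}
  have := Fintype.ofFinite {v : Space // ∃ b, CrossOn C P Q S v b}
  have hcardD : Fintype.card (Dart C P Q S) =
      (S ∩ P).ncard + {v | ∃ b, CrossOn C P Q S v b}.ncard := by
    rw [Fintype.card_sum, ← Nat.card_eq_fintype_card, ← Nat.card_eq_fintype_card]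
    rfl
  -- the flip `α` across an edge is an involution without fixed points
  choose α hα using fun x : Dart C P Q S => Dart.exists_isFlip hC hP hQ hS x
  have hαα : Function.Involutive α := fun x =>
    ((hα (α x)).unique hC hP hQ hS (hα x).symm)
  let αp : Equiv.Perm (Dart C P Q S) := hαα.toPerm
  have hα2 : αp ^ 2 = 1 := by
    ext1 x
    rw [pow_two]
    exact hαα x
  have hfix : Fintype.card (Function.fixedPoints αp) = 0 := by
    rw [Fintype.card_eq_zero_iff]
    exact ⟨fun ⟨x, hx⟩ => (hα x).ne hC hP hx⟩
  have hsignα : Equiv.Perm.sign αp = (-1) ^ (Fintype.card (Dart C P Q S) / 2) := by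
    have := Equiv.Perm.sign_of_pow_two_eq_one hα2
    rw [hfix, Nat.sub_zero] at this
    exact this
  have heven : Even (Fintype.card (Dart C P Q S)) := by
    have h1 := Equiv.Perm.two_dvd_card_support hα2
    have h2 : αp.support = Finset.univ := by
      ext x
      simp only [Equiv.Perm.mem_support, Finset.mem_univ, iff_true]
      exact (hα x).ne hC hP
    rw [h2, Finset.card_univ] at h1
    exact even_iff_two_dvd.2 h1
  -- the rotation `ρ` in the triangles has order three, so its sign is `1`
  have hrA : ∀ t : Triangle, t ∈ S ∧ t ∈ P → (t.2.1, t.2.2, t.1) ∈ S ∧ (t.2.1, t.2.2, t.1) ∈ P :=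
    fun t ht => ⟨hS.rotate _ _ _ ht.1, hP.rotate _ _ _ ht.2⟩
  let ρ : Equiv.Perm {t : Triangle // t ∈ S ∧ t ∈ P} :=
    { toFun := fun t => ⟨_, hrA t.1 t.2⟩
      invFun := fun t => ⟨_, hrA _ (hrA t.1 t.2)⟩
      left_inv := fun t => rfl
      right_inv := fun t => rfl }
  have hsignρ : Equiv.Perm.sign ρ = 1 := by
    have h3 : ρ ^ 3 = 1 := by
      ext1 t
      rfl
    have := congrArg Equiv.Perm.sign h3
    rw [map_pow, map_one] at this
    rcases Int.units_eq_one_or (Equiv.Perm.sign ρ) with h | h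
    · exact h
    · rw [h] at this
      exact absurd this (by decide)
  -- the permutation `β` of the boundary by the crossing curves has the sign that is to be computed
  have hβmem : ∀ v : verts C.tri, (∃ b, CrossOn C P Q S (hcur.perm v) b) ↔
      ∃ b, CrossOn C P Q S v b := hcur.exists_rel_perm_iff
  have hMV : ∀ v : {v : Space // ∃ b, CrossOn C P Q S v b}, v.1 ∈ verts C.tri := fun v =>
    v.2.elim fun b hb => hcur.mem _ _ hb
  let ε : {v : verts C.tri // ∃ b, CrossOn C P Q S v b} ≃
      {v : Space // ∃ b, CrossOn C P Q S v b} :=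
    ⟨fun v => ⟨v.1.1, v.2⟩, fun v => ⟨⟨v.1, hMV v⟩, v.2⟩, fun _ => rfl, fun _ => rfl⟩
  let β : Equiv.Perm {v : Space // ∃ b, CrossOn C P Q S v b} :=
    ε.permCongr (hcur.perm.subtypePerm hβmem)
  have hβ : ∀ v, CrossOn C P Q S v.1 (β v).1 := fun v => hcur.rel_perm (a := ⟨v.1, hMV v⟩) v.2
  have hsignβ : Equiv.Perm.sign β = hcur.sgn := by
    rw [hcur.sgn_def, Equiv.Perm.sign_permCongr]
    exact Equiv.Perm.sign_subtypePerm _ _ fun a ha => by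
      by_contra hp
      exact ha (hcur.perm_eq_self hp)
  -- `φ * α` turns a dart about its origin; its cycles will be the vertices of `S ∩ P`
  let φ : Equiv.Perm (Dart C P Q S) := Equiv.Perm.sumCongr ρ β⁻¹
  let σ : Equiv.Perm (Dart C P Q S) := φ * αp
  have hφo : ∀ t h, Dart.origin (φ (Sum.inl ⟨t, h⟩) : Dart C P Q S) = t.2.1 := fun _ _ => rfl
  have hφr : ∀ a b, Cross C P Q a b.1 → Dart.origin (φ (Sum.inr b) : Dart C P Q S) = a := by
    intro a b hab
    have h1 := hβ (β⁻¹ b)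
    rw [← Equiv.Perm.mul_apply, mul_inv_cancel, Equiv.Perm.one_apply] at h1
    exact (isCurve_cross hC hP hQ).into _ _ _ h1.1 hab
  have hσo : ∀ x : Dart C P Q S, Dart.origin (σ x) = Dart.origin x := by
    intro x
    have hx := hα x
    change Dart.origin (φ (α x)) = _
    rcases x with x | x <;> rcases hax : α _ with y | y <;> rw [hax] at hx
    · exact hx.2
    · exact hφr _ _ (hx.2 ▸ hx.1)
    · exact hx.2.symm
    · exact hx.elim
  have hσinl : ∀ a b c h, (∃ y h', σ (Sum.inl ⟨(a, b, c), h⟩) = Sum.inl ⟨(a, y, b), h'⟩) ∨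
      ∃ w, σ (Sum.inl ⟨(a, b, c), h⟩) = Sum.inr w := by
    intro a b c h
    rcases hax : α (Sum.inl ⟨(a, b, c), h⟩) with ⟨⟨b', a', y⟩, hy⟩ | y
    · have hx := hα (Sum.inl ⟨(a, b, c), h⟩)
      rw [hax] at hx
      obtain ⟨h1, h2⟩ := hx
      dsimp only at h1 h2
      subst h1 h2
      refine Or.inl ⟨y, hrA _ hy, ?_⟩
      change φ (α _) = _
      rw [hax]
      rfl
    · refine Or.inr ⟨β⁻¹ y, ?_⟩
      change φ (α _) = _
      rw [hax]
      rfl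
  have hσinv : ∀ a b c h, (∃ y h', σ (Sum.inl ⟨(a, c, y), h'⟩) = Sum.inl ⟨(a, b, c), h⟩) ∨
      ∃ w, σ (Sum.inr w) = Sum.inl ⟨(a, b, c), h⟩ := by
    intro a b c h
    have hφ : φ (Sum.inl ⟨(c, a, b), hrA _ (hrA _ h)⟩) = Sum.inl ⟨(a, b, c), h⟩ := rfl
    rcases hax : α (Sum.inl ⟨(c, a, b), hrA _ (hrA _ h)⟩) with ⟨⟨a', c', y⟩, hy⟩ | y
    · have hx := hα (Sum.inl ⟨(c, a, b), hrA _ (hrA _ h)⟩)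
      rw [hax] at hx
      obtain ⟨h1, h2⟩ := hx
      dsimp only at h1 h2
      subst h1 h2
      refine Or.inl ⟨y, hy, ?_⟩
      change φ (α _) = _
      rw [← hax, hαα]
      exact hφ
    · refine Or.inr ⟨y, ?_⟩
      change φ (α _) = _
      rw [← hax, hαα]
      exact hφ
  -- a cycle that avoids the boundary fills the link of its origin, by connectedness of the link
  have hstar : ∀ {w}, w ∈ verts S → ∀ e ∈ linkOf (symmDiff P Q) w, e ∈ linkOf S w := by
    rintro w ⟨b, c, h⟩ e he
    exact hS.star hC hE h he
  have main : ∀ (v : Space) (x : Dart C P Q S), Dart.origin x = v →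
      (∀ w : {v : Space // ∃ b, CrossOn C P Q S v b}, w.1 = v → ¬ σ.SameCycle x (Sum.inr w)) →
      ∀ e ∈ linkOf (symmDiff P Q) v, ∃ h : (v, e) ∈ S ∧ (v, e) ∈ P,
        σ.SameCycle x (Sum.inl ⟨(v, e), h⟩) := by
    intro v x hxv hx
    have hor : ∀ y, σ.SameCycle x y → Dart.origin y = v := by
      rintro y ⟨n, rfl⟩
      have hn : ∀ (n : ℕ) x, Dart.origin ((σ ^ n) x) = Dart.origin x := by
        intro n
        induction n with
        | zero => intro x; rfl
        | succ n ih => intro x; rw [pow_succ, Equiv.Perm.mul_apply, ih, hσo]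
      rcases n with n | n
      · exact (hn n x).trans hxv
      · rw [zpow_negSucc]
        have := hn (n + 1) ((σ ^ (n + 1))⁻¹ x)
        rw [← Equiv.Perm.mul_apply, mul_inv_cancel, Equiv.Perm.one_apply] at this
        exact this.symm.trans hxv
    have hx' : ∀ w, ¬ σ.SameCycle x (Sum.inr w) := fun w hw => hx w (hor _ hw) hw
    refine fun e he => hE.link_connected hC (v := v)
      (U := {e | ∃ h : (v, e) ∈ S ∧ (v, e) ∈ P, σ.SameCycle x (Sum.inl ⟨(v, e), h⟩)}) ?_ ?_ ?_ he
    · rcases x with ⟨⟨a, b, c⟩, h⟩ | w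
      · obtain rfl : a = v := hxv
        exact ⟨(b, c), h, Equiv.Perm.SameCycle.refl _ _⟩
      · exact (hx' w (Equiv.Perm.SameCycle.refl _ _)).elim
    · rintro e ⟨h, -⟩
      exact hS.subset h.1
    · rintro ⟨b, c⟩ ⟨h, hcyc⟩ f hf hshare
      have hne := hC.ne_all (hP.subset h.2)
      have h1 : ∃ y, ∃ h' : (v, y, b) ∈ S ∧ (v, y, b) ∈ P,
          σ.SameCycle x (Sum.inl ⟨(v, y, b), h'⟩) := by
        have hcyc' := Equiv.Perm.sameCycle_apply_right.2 hcyc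
        rcases hσinl v b c h with ⟨y, h', h1⟩ | ⟨w, h1⟩
        · exact ⟨y, h', h1 ▸ hcyc'⟩
        · exact (hx' w (h1 ▸ hcyc')).elim
      have h2 : ∃ y, ∃ h' : (v, c, y) ∈ S ∧ (v, c, y) ∈ P,
          σ.SameCycle x (Sum.inl ⟨(v, c, y), h'⟩) := by
        rcases hσinv v b c h with ⟨y, h', h1⟩ | ⟨w, h1⟩
        · exact ⟨y, h', Equiv.Perm.sameCycle_apply_right.1 (h1 ▸ hcyc)⟩
        · exact (hx' w (Equiv.Perm.sameCycle_apply_right.1 (h1 ▸ hcyc))).elim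
      obtain ⟨y, hy, hycyc⟩ := h1
      obtain ⟨z, hz, hzcyc⟩ := h2
      have eb : (b, c) ∈ linkOf (symmDiff P Q) v := hS.subset h.1
      have ey : (y, b) ∈ linkOf (symmDiff P Q) v := hS.subset hy.1
      have ez : (c, z) ∈ linkOf (symmDiff P Q) v := hS.subset hz.1
      have hfb : f.1 = b ∨ f.2 = b ∨ f.1 = c ∨ f.2 = c := by
        rcases hshare with h | h | h | h
        exacts [Or.inl h.symm, Or.inr (Or.inl h.symm), Or.inr (Or.inr (Or.inl h.symm)),
          Or.inr (Or.inr (Or.inr h.symm))]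
      have hcase : (f.1 = b ∨ f.2 = b) ∨ (f.1 = c ∨ f.2 = c) := by tauto
      rcases hcase with hfb | hfc
      · rcases hE.eq_or_eq_of_shareNode hC eb ey hf (Or.inl rfl) (Or.inr rfl) hfb with h3 | h3 | h3
        · exact (hne.2.1 (Prod.ext_iff.1 h3).2.symm).elim
        · exact h3 ▸ ⟨h, hcyc⟩
        · exact h3 ▸ ⟨hy, hycyc⟩
      · rcases hE.eq_or_eq_of_shareNode hC eb ez hf (Or.inr rfl) (Or.inl rfl) hfc with h3 | h3 | h3
        · exact (hne.2.1 (Prod.ext_iff.1 h3).1).elim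
        · exact h3 ▸ ⟨h, hcyc⟩
        · exact h3 ▸ ⟨hz, hzcyc⟩
  -- at a boundary point the link also has edges in `Q`, so there all cycles meet the boundary
  have hbd : ∀ (w : {v : Space // ∃ b, CrossOn C P Q S v b}) (x : Dart C P Q S),
      Dart.origin x = w.1 → σ.SameCycle x (Sum.inr w) := by
    intro w x hxw
    by_contra hcon
    have h1 := main w.1 x hxw fun w' hw' => by
      rw [Subtype.ext hw']
      exact hcon
    obtain ⟨b, hb⟩ := w.2
    obtain ⟨p, q, r, -, h2, -⟩ := hb.1.triangles hP hQ
    obtain ⟨h3, -⟩ := h1 (b, q) (Or.inr h2)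
    exact h2.2 h3.2
  have hMA : ∀ w : {v : Space // ∃ b, CrossOn C P Q S v b}, w.1 ∈ verts (S ∩ P) := by
    rintro ⟨w, b, hb⟩
    obtain ⟨p, q, r, h1, -⟩ := hb.1.triangles hP hQ
    exact ⟨b, p, hstar hb.2 (b, p) (Or.inl h1), h1.1⟩
  have hvfin : Finite (verts (S ∩ P)) := by
    rw [verts_eq_image]
    exact (hC.finite.subset fun t ht => hP.subset ht.2 : (S ∩ P).Finite).image _
  have := Fintype.ofFinite (verts (S ∩ P))
  let f : Dart C P Q S → verts (S ∩ P) := fun x => ⟨Dart.origin x, by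
    rcases x with ⟨⟨a, b, c⟩, h⟩ | w
    · exact ⟨b, c, h⟩
    · exact hMA w⟩
  have hsurj : Function.Surjective f := by
    rintro ⟨v, b, c, h⟩
    exact ⟨Sum.inl ⟨(v, b, c), h⟩, rfl⟩
  have horb : ∀ x y, f x = f y ↔ σ.SameCycle x y := by
    intro x y
    constructor
    · intro h
      have hxy : Dart.origin x = Dart.origin y := Subtype.mk.inj h
      by_cases hw : ∃ b, CrossOn C P Q S (Dart.origin x) b
      · exact (hbd ⟨_, hw⟩ x rfl).trans (hbd ⟨_, hw⟩ y hxy.symm).symm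
      · have h1 := main _ x rfl fun w hw' => (hw (hw' ▸ w.2)).elim
        rcases y with ⟨⟨a, b, c⟩, hm⟩ | w
        · have hxy' : a = Dart.origin x := hxy.symm
          subst hxy'
          exact (h1 (b, c) (hS.subset hm.1)).2
        · exact (hw (hxy ▸ w.2)).elim
    · intro h
      obtain ⟨n, rfl⟩ := h
      refine Subtype.ext ?_
      have hn : ∀ (n : ℕ) x, Dart.origin ((σ ^ n) x) = Dart.origin x := by
        intro n
        induction n with
        | zero => intro x; rfl
        | succ n ih => intro x; rw [pow_succ, Equiv.Perm.mul_apply, ih, hσo]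
      rcases n with n | n
      · exact (hn n x).symm
      · rw [zpow_negSucc]
        have := hn (n + 1) ((σ ^ (n + 1))⁻¹ x)
        rw [← Equiv.Perm.mul_apply, mul_inv_cancel, Equiv.Perm.one_apply] at this
        exact this
  have hsignσ := sign_eq_of_orbits σ f hsurj horb
  have hsignσ' : Equiv.Perm.sign σ = hcur.sgn * (-1) ^ (Fintype.card (Dart C P Q S) / 2) := by
    have hφs : Equiv.Perm.sign φ = hcur.sgn := by
      have h := Equiv.Perm.sign_sumCongr ρ β⁻¹
      rw [hsignρ, Equiv.Perm.sign_inv, hsignβ, one_mul] at h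
      rw [← h]
      congr!
    rw [Equiv.Perm.sign_mul, hsignα, hφs, mul_comm]
  rw [← hcardD]
  refine ⟨heven, ?_⟩
  have hn : Fintype.card (verts (S ∩ P)) = (verts (S ∩ P)).ncard := by
    rw [← Nat.card_eq_fintype_card]
    rfl
  rw [hsignσ', hn, pow_add _ (Fintype.card _), heven.neg_one_pow, one_mul] at hsignσ
  rw [pow_add, ← hsignσ]
  have h1 : ((-1 : ℤˣ) ^ (Fintype.card (Dart C P Q S) / 2)) *
      (-1) ^ (Fintype.card (Dart C P Q S) / 2) = 1 := Int.units_mul_self _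
  rw [mul_comm, mul_assoc, h1, mul_one]

end SlFoam
end

noncomputable section
namespace SlFoam
open LabelledComplex

variable {C : LabelledComplex} {v : Space} {E P Q S : Set Triangle}

/-! ### Parities of numbers of curves -/

/-- The number of closed curves that a relation forms. -/
def numCurves {α : Type*} (r : α → α → Prop) : ℕ :=
  Nat.card (SimpleGraph.fromRel fun a b : {a : α // ∃ b, r a b ∨ r b a} =>
    r a b).ConnectedComponent

theorem IsCurve.restrict {α : Type*} {S : Set α} {r : α → α → Prop} (h : IsCurve S r)
    {W : Set α} (hW : ∀ a b, r a b → (a ∈ W ↔ b ∈ W)) :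
    IsCurve S fun a b => r a b ∧ a ∈ W where
  mem _ _ h' := h.mem _ _ h'.1
  out _ _ _ h1 h2 := h.out _ _ _ h1.1 h2.1
  into _ _ _ h1 h2 := h.into _ _ _ h1.1 h2.1
  exists_into _ _ h' := (h.exists_into _ _ h'.1).imp fun _ h1 => ⟨h1, (hW _ _ h1).2 h'.2⟩
  exists_out _ _ h' := (h.exists_out _ _ h'.1).imp fun _ h1 => ⟨h1, (hW _ _ h'.1).1 h'.2⟩

section Curve

variable {α : Type*} {S : Set α} [Finite S] {r r' : α → α → Prop}

theorem IsCurve.neg_one_pow_numCurves (h : IsCurve S r) :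
    (-1 : ℤˣ) ^ numCurves r = h.sgn * (-1) ^ {a | ∃ b, r a b}.ncard := by
  rw [h.sgn_eq, pow_add, mul_right_comm, Int.units_mul_self, one_mul]
  rfl

theorem IsCurve.numCurves_or (h : IsCurve S r) (h' : IsCurve S r')
    (hd : ∀ a b c, r a b → r' a c → False) (h'' : IsCurve S fun a b => r a b ∨ r' a b) :
    (-1 : ℤˣ) ^ numCurves (fun a b => r a b ∨ r' a b) =
      (-1) ^ numCurves r * (-1) ^ numCurves r' := by
  have hf : ∀ {r : α → α → Prop}, IsCurve S r → {a | ∃ b, r a b}.Finite := fun {r} h =>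
    (Set.toFinite S).subset fun a ⟨b, hb⟩ => h.mem _ _ hb
  have e : {a | ∃ b, r a b ∨ r' a b} = {a | ∃ b, r a b} ∪ {a | ∃ b, r' a b} := by
    ext a
    simp [exists_or]
  rw [h.neg_one_pow_numCurves, h'.neg_one_pow_numCurves, h''.neg_one_pow_numCurves,
    h.sgn_or h' hd h'', e, Set.ncard_union_eq ?_ (hf h) (hf h'), pow_add, mul_mul_mul_comm]
  rw [Set.disjoint_left]
  rintro a ⟨b, hb⟩ ⟨c, hc⟩
  exact hd _ _ _ hb hc

/-- Cutting and regluing two families of curves at the points of `W` keeps the parity of the total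
number of curves. -/
theorem IsCurve.numCurves_swap {p q p' q' : α → α → Prop} (hp : IsCurve S p)
    (hq : IsCurve S q) (hp' : IsCurve S p') (hq' : IsCurve S q') (W : Set α)
    (h1 : ∀ a ∈ W, ∀ b, (p' a b ↔ q a b) ∧ (q' a b ↔ p a b))
    (h2 : ∀ a, a ∉ W → ∀ b, (p' a b ↔ p a b) ∧ (q' a b ↔ q a b)) :
    (-1 : ℤˣ) ^ (numCurves p' + numCurves q') = (-1) ^ (numCurves p + numCurves q) := by
  have hf : ∀ {r : α → α → Prop}, IsCurve S r → {a | ∃ b, r a b}.Finite := fun {r} h =>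
    (Set.toFinite S).subset fun a ⟨b, hb⟩ => h.mem _ _ hb
  have key := hp.sgn_mul_sgn_of_swap hq hp' hq' W h1 h2
  have hc : {a | ∃ b, p' a b}.ncard + {a | ∃ b, q' a b}.ncard =
      {a | ∃ b, p a b}.ncard + {a | ∃ b, q a b}.ncard := by
    rw [← Set.ncard_inter_add_ncard_sdiff_eq_ncard _ W (hf hp),
      ← Set.ncard_inter_add_ncard_sdiff_eq_ncard _ W (hf hq),
      ← Set.ncard_inter_add_ncard_sdiff_eq_ncard _ W (hf hp'),
      ← Set.ncard_inter_add_ncard_sdiff_eq_ncard _ W (hf hq')]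
    have e1 : {a | ∃ b, p' a b} ∩ W = {a | ∃ b, q a b} ∩ W := by
      ext a
      exact and_congr_left fun ha => exists_congr fun b => (h1 a ha b).1
    have e2 : {a | ∃ b, q' a b} ∩ W = {a | ∃ b, p a b} ∩ W := by
      ext a
      exact and_congr_left fun ha => exists_congr fun b => (h1 a ha b).2
    have e3 : {a | ∃ b, p' a b} \ W = {a | ∃ b, p a b} \ W := by
      ext a
      exact and_congr_left fun ha => exists_congr fun b => (h2 a ha b).1
    have e4 : {a | ∃ b, q' a b} \ W = {a | ∃ b, q a b} \ W := by
      ext a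
      exact and_congr_left fun ha => exists_congr fun b => (h2 a ha b).2
    rw [e1, e2, e3, e4]
    ring
  rw [pow_add, pow_add, hp.neg_one_pow_numCurves, hq.neg_one_pow_numCurves,
    hp'.neg_one_pow_numCurves, hq'.neg_one_pow_numCurves, mul_mul_mul_comm, key, ← pow_add, hc,
    pow_add, mul_mul_mul_comm]

/-- Reversing the roles of two disjoint families of curves on a union `W` of components. -/
theorem IsCurve.numCurves_or_of_swap {p q p' : α → α → Prop} (hp : IsCurve S p)
    (hq : IsCurve S q) (hp' : IsCurve S p') (hd : ∀ a b c, p a b → q a c → False) (W : Set α)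
    (hWp : ∀ a b, p a b → (a ∈ W ↔ b ∈ W)) (hWq : ∀ a b, q a b → (a ∈ W ↔ b ∈ W))
    (h1 : ∀ a ∈ W, ∀ b, p' a b ↔ q a b) (h2 : ∀ a, a ∉ W → ∀ b, p' a b ↔ p a b)
    (hr : IsCurve S r) (h : ∀ a b, r a b ↔ (p a b ∨ q a b) ∧ a ∈ W) :
    (-1 : ℤˣ) ^ (numCurves p + numCurves p') = (-1) ^ numCurves r := by
  have e1 : p = fun a b => (p a b ∧ a ∈ W) ∨ (p a b ∧ a ∈ Wᶜ) := by
    ext a b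
    by_cases ha : a ∈ W <;> simp [ha]
  have e2 : p' = fun a b => (q a b ∧ a ∈ W) ∨ (p a b ∧ a ∈ Wᶜ) := by
    ext a b
    by_cases ha : a ∈ W
    · simp [ha, h1]
    · simp [ha, h2]
  have e3 : r = fun a b => (p a b ∧ a ∈ W) ∨ (q a b ∧ a ∈ W) := by
    ext a b
    rw [h]
    tauto
  have c1 := hp.restrict hWp
  have c2 := hq.restrict hWq
  have c3 : IsCurve S fun a b => p a b ∧ a ∈ Wᶜ := hp.restrict fun a b hab => not_congr (hWp a b hab)
  have k1 := c1.numCurves_or c3 (fun a b c h1 h2 => h2.2 h1.2) (e1 ▸ hp)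
  have k2 := c2.numCurves_or c3 (fun a b c h1 h2 => h2.2 h1.2) (e2 ▸ hp')
  have k3 := c1.numCurves_or c2 (fun a b c h1 h2 => hd _ _ _ h1.1 h2.1) (e3 ▸ hr)
  rw [← e1] at k1
  rw [← e2] at k2
  rw [← e3] at k3
  rw [pow_add, k1, k2, k3, mul_mul_mul_comm, Int.units_mul_self, mul_one]

end Curve

/-! ### Exchanging two sheets on components of their difference -/

theorem IsComponentUnion.comm (hS : IsComponentUnion (symmDiff P Q) S) :
    IsComponentUnion (symmDiff Q P) S := symmDiff_comm P Q ▸ hS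

theorem IsComponentUnion.mem_symmDiff_iff (hC : IsClosedFoam C) (hP : IsSheet C P)
    (hQ : IsSheet C Q) (hS : IsComponentUnion (symmDiff P Q) S) (hv : v ∈ verts S) {b c : Space} :
    (v, b, c) ∈ symmDiff P S ↔ (v, b, c) ∈ Q := by
  obtain ⟨x, y, hxy⟩ := hv
  have h1 : (v, b, c) ∈ symmDiff P Q → (v, b, c) ∈ S := hS.star hC (hP.symmDiff hQ) hxy
  have h2 : (v, b, c) ∈ S → (v, b, c) ∈ symmDiff P Q := fun h => hS.subset h
  simp only [Set.mem_symmDiff] at *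
  tauto

theorem mem_symmDiff_iff_of_notMem (hv : v ∉ verts S) {b c : Space} :
    (v, b, c) ∈ symmDiff P S ↔ (v, b, c) ∈ P := by
  have h1 : (v, b, c) ∉ S := fun h => hv ⟨_, _, h⟩
  simp only [Set.mem_symmDiff]
  tauto

theorem mem_verts_iff : v ∈ verts S ↔ (linkOf S v).Nonempty :=
  ⟨fun ⟨b, c, h⟩ => ⟨(b, c), h⟩, fun ⟨e, h⟩ => ⟨e.1, e.2, h⟩⟩

theorem IsComponentUnion.linkOf_symmDiff (hC : IsClosedFoam C) (hP : IsSheet C P)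
    (hQ : IsSheet C Q) (hS : IsComponentUnion (symmDiff P Q) S) (hv : v ∈ verts S) :
    linkOf (symmDiff P S) v = linkOf Q v := by
  ext e
  exact hS.mem_symmDiff_iff hC hP hQ hv

theorem linkOf_symmDiff_of_notMem (hv : v ∉ verts S) : linkOf (symmDiff P S) v = linkOf P v := by
  ext e
  exact mem_symmDiff_iff_of_notMem hv

/-- The exchange of two sheets on components of their difference gives a sheet. -/
theorem IsComponentUnion.isSheet (hC : IsClosedFoam C) (hP : IsSheet C P)
    (hQ : IsSheet C Q) (hS : IsComponentUnion (symmDiff P Q) S) : IsSheet C (symmDiff P S) := by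
  have hrot : ∀ {a b c}, (a, b, c) ∈ symmDiff P S ↔ (b, c, a) ∈ symmDiff P S := by
    intro a b c
    have h1 : (a, b, c) ∈ S ↔ (b, c, a) ∈ S :=
      (hS.isClosedSurface (hP.symmDiff hQ)).rotate'
    rw [Set.mem_symmDiff, Set.mem_symmDiff, hP.rotate', h1]
  have key : ∀ a, ∃ T, IsSheet C T ∧ ∀ b x, ((a, b, x) ∈ symmDiff P S ↔ (a, b, x) ∈ T) ∧
      ((b, a, x) ∈ symmDiff P S ↔ (b, a, x) ∈ T) := by
    intro a
    by_cases ha : a ∈ verts S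
    · refine ⟨Q, hQ, fun b x => ⟨hS.mem_symmDiff_iff hC hP hQ ha, ?_⟩⟩
      rw [hrot, hS.mem_symmDiff_iff hC hP hQ ha, ← hQ.rotate']
    · refine ⟨P, hP, fun b x => ⟨mem_symmDiff_iff_of_notMem ha, ?_⟩⟩
      rw [hrot, mem_symmDiff_iff_of_notMem ha, ← hP.rotate']
  refine ⟨?_, fun a b c => hrot.1, ?_, ?_⟩
  · rintro t (h | h)
    · exact hP.subset h.1
    · exact (hP.symmDiff hQ).subset (hS.subset h.1)
  · intro a b p q h
    obtain ⟨T, hT, hT'⟩ := key a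
    rw [(hT' b p).1, (hT' b q).2]
    exact hT.regular _ _ _ _ h
  · intro a b p q r h
    obtain ⟨T, hT, hT'⟩ := key a
    rw [(hT' b p).1, (hT' b q).1, (hT' b r).2]
    exact hT.binding _ _ _ _ _ h

/-- At a vertex without a crossing, the part of `P` off `Q` is the whole of each closed surface that
contains it. -/
theorem linkOf_subset_of_not_cross (hC : IsClosedFoam C) (hP : IsSheet C P) (hQ : IsSheet C Q)
    (hE : IsClosedSurface C E) (hsub : P \ Q ⊆ E) (hno : ∀ b, ¬ Cross C P Q v b)
    (hne : (linkOf (P \ Q) v).Nonempty) : linkOf E v ⊆ linkOf (P \ Q) v := by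
  have hno' : ∀ b, ¬ Cross C P Q b v := fun b h =>
    (h.exists_out hC hP hQ).elim fun c hc => hno c hc.1
  refine hE.link_connected hC hne (fun e he => hsub he) ?_
  -- the neighbor of `e` at the node `p`
  have hnb : ∀ e ∈ linkOf (P \ Q) v, ∀ p, (e.1 = p ∨ e.2 = p) →
      ∃ u ∈ linkOf (P \ Q) v, (u.1 = p ∨ u.2 = p) ∧ u ≠ e := by
    rintro ⟨a, b⟩ he p (rfl | rfl)
    · obtain ⟨y, h1, h2⟩ := (hP.exists_flip_or_cross hC hQ he.1 he.2).resolve_right (hno _)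
      refine ⟨(y, a), ⟨hP.rotate _ _ _ h1, fun h => h2 (hQ.rotate'.2 h)⟩, Or.inr rfl, ?_⟩
      rintro h
      have := (hC.ne_all (hP.subset he.1)).2.1
      exact this (Prod.mk.inj h).2
    · have he1 : (b, v, a) ∈ P := hP.rotate _ _ _ (hP.rotate _ _ _ he.1)
      have he2 : (b, v, a) ∉ Q := fun h => he.2 (hQ.rotate _ _ _ h)
      obtain ⟨y, h1, h2⟩ := (hP.exists_flip_or_cross hC hQ he1 he2).resolve_right (hno' _)
      refine ⟨(b, y), ⟨h1, h2⟩, Or.inl rfl, ?_⟩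
      rintro h
      have := (hC.ne_all (hP.subset he.1)).2.1
      exact this (Prod.mk.inj h).1.symm
  have hsh : ∀ e f : Space × Space, ShareNode e f →
      ∃ p, (e.1 = p ∨ e.2 = p) ∧ (f.1 = p ∨ f.2 = p) := by
    rintro e f (h | h | h | h)
    exacts [⟨_, Or.inl rfl, Or.inl h.symm⟩, ⟨_, Or.inl rfl, Or.inr h.symm⟩,
      ⟨_, Or.inr rfl, Or.inl h.symm⟩, ⟨_, Or.inr rfl, Or.inr h.symm⟩]
  intro e he f hf hs
  obtain ⟨p, hp1, hp2⟩ := hsh e f hs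
  obtain ⟨u, hu, hup, hne⟩ := hnb e he p hp1
  rcases hE.eq_or_eq_of_shareNode hC (hsub he) (hsub hu) hf hp1 hup hp2 with h | h | h
  · exact (hne h.symm).elim
  · exact h ▸ he
  · exact h ▸ hu

theorem linkOf_eq_empty_of_not_cross (hC : IsClosedFoam C) (hP : IsSheet C P) (hQ : IsSheet C Q)
    (hno : ∀ b, ¬ Cross C P Q v b) (hne : (linkOf (P \ Q) v).Nonempty) : linkOf Q v = ∅ := by
  have h1 := linkOf_subset_of_not_cross hC hP hQ hP.isClosedSurface Set.sdiff_subset hno hne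
  have h2 := linkOf_subset_of_not_cross hC hP hQ (hP.symmDiff hQ)
    (fun t ht => Or.inl ht) hno hne
  refine Set.eq_empty_of_forall_notMem fun e he => ?_
  by_cases hp : e ∈ linkOf P v
  · exact (h1 hp).2 he
  · exact (h2 (Or.inr ⟨he, hp⟩ : e ∈ linkOf (symmDiff P Q) v)).2 he

open Classical in
/-- Each triangle is counted at its first vertex. -/
theorem ncard_eq_sum_linkOf (hC : IsClosedFoam C) (hE : E ⊆ C.tri) :
    (E.ncard : ℤ) = ∑ v ∈ hC.finite_verts.toFinset, ((linkOf E v).ncard : ℤ) := by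
  have hfin : E.Finite := hC.finite.subset hE
  rw [Set.ncard_eq_toFinset_card _ hfin, Finset.card_eq_sum_card_fiberwise (f := fun t => t.1)
    (t := hC.finite_verts.toFinset)]
  · push_cast
    refine Finset.sum_congr rfl fun v _ => ?_
    congr 1
    rw [← Set.ncard_coe_finset]
    refine (Set.ncard_congr (fun e _ => (v, e)) ?_ ?_ ?_).symm
    · intro e he
      rw [Finset.mem_coe, Finset.mem_filter, Set.Finite.mem_toFinset]
      exact ⟨he, rfl⟩
    · intro e f _ _ h
      exact (Prod.mk.inj h).2
    · rintro ⟨a, e⟩ h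
      simp only [Finset.coe_filter, Set.Finite.mem_toFinset, Set.mem_ofPred_eq] at h
      obtain ⟨h, rfl⟩ := h
      exact ⟨e, h, rfl⟩
  · intro t ht
    simp only [Set.Finite.coe_toFinset] at ht ⊢
    exact ⟨_, _, hE ht⟩

open Classical in
theorem ncard_eq_sum_ite (hC : IsClosedFoam C) {W : Set Space} (hW : W ⊆ verts C.tri) :
    (W.ncard : ℤ) = ∑ v ∈ hC.finite_verts.toFinset, if v ∈ W then 1 else 0 := by
  rw [Finset.sum_boole, Set.ncard_eq_toFinset_card _ (hC.finite_verts.subset hW)]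
  congr 2
  ext v
  simp only [Set.Finite.mem_toFinset, Finset.mem_filter]
  exact ⟨fun h => ⟨hW h, h⟩, fun h => h.2⟩

theorem verts_mono (h : E ⊆ S) : verts E ⊆ verts S := fun _ ⟨b, c, h'⟩ => ⟨b, c, h h'⟩

open Classical in
theorem IsClosedSurface.six_mul_eulerChar_eq_sum (hC : IsClosedFoam C) (hE : IsClosedSurface C E) :
    6 * eulerChar E = ∑ v ∈ hC.finite_verts.toFinset,
      (6 * (if v ∈ verts E then 1 else 0) - ((linkOf E v).ncard : ℤ)) := by
  rw [hE.six_mul_eulerChar hC, ncard_eq_sum_linkOf hC hE.subset,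
    ncard_eq_sum_ite hC (verts_mono hE.subset), Finset.mul_sum, Finset.sum_sub_distrib]

open Classical in
theorem ite_mem_verts_congr (h : linkOf E v = linkOf S v) :
    (if v ∈ verts E then 1 else 0) = if v ∈ verts S then (1 : ℤ) else 0 := by
  refine if_congr ?_ rfl rfl
  rw [mem_verts_iff, mem_verts_iff, h]

theorem IsComponentUnion.eulerChar_add (hC : IsClosedFoam C) (hP : IsSheet C P)
    (hQ : IsSheet C Q) (hS : IsComponentUnion (symmDiff P Q) S) :
    eulerChar (symmDiff P S) + eulerChar (symmDiff Q S) = eulerChar P + eulerChar Q := by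
  have h1 := (hS.isSheet hC hP hQ).isClosedSurface.six_mul_eulerChar_eq_sum hC
  have h2 := (hS.comm.isSheet hC hQ hP).isClosedSurface.six_mul_eulerChar_eq_sum hC
  have h3 := hP.isClosedSurface.six_mul_eulerChar_eq_sum hC
  have h4 := hQ.isClosedSurface.six_mul_eulerChar_eq_sum hC
  have key : 6 * eulerChar (symmDiff P S) + 6 * eulerChar (symmDiff Q S) =
      6 * eulerChar P + 6 * eulerChar Q := by
    rw [h1, h2, h3, h4, ← Finset.sum_add_distrib, ← Finset.sum_add_distrib]
    refine Finset.sum_congr rfl fun v _ => ?_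
    by_cases hv : v ∈ verts S
    · have e1 := hS.linkOf_symmDiff hC hP hQ hv
      have e2 := hS.comm.linkOf_symmDiff hC hQ hP hv
      rw [ite_mem_verts_congr e1, ite_mem_verts_congr e2, e1, e2]
      ring
    · have e : ∀ P, linkOf (symmDiff P S) v = linkOf P v := fun P => linkOf_symmDiff_of_notMem hv
      rw [ite_mem_verts_congr (e P), ite_mem_verts_congr (e Q), e, e]
  omega

/-- The change of the Euler characteristic of `P` on `S`, by a count of vertices and of edges of
links at each vertex: the triangles of `S ∩ P` form a surface, and its boundary consists of the
crossing curves. -/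
theorem IsComponentUnion.three_mul (hC : IsClosedFoam C) (hP : IsSheet C P)
    (hQ : IsSheet C Q) (hS : IsComponentUnion (symmDiff P Q) S) :
    3 * (eulerChar P - eulerChar (symmDiff P S) + eulerChar S) =
      6 * ((verts (S ∩ P)).ncard : ℤ) - 3 * ({v | ∃ b, CrossOn C P Q S v b}.ncard : ℤ) -
        ((S ∩ P).ncard : ℤ) := by
  classical
  have h1 := (hS.isSheet hC hP hQ).isClosedSurface.six_mul_eulerChar_eq_sum hC
  have h2 := (hS.isClosedSurface (hP.symmDiff hQ)).six_mul_eulerChar_eq_sum hC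
  have h3 := hP.isClosedSurface.six_mul_eulerChar_eq_sum hC
  have hA : S ∩ P ⊆ C.tri := fun t ht => hP.subset ht.2
  have h4 := ncard_eq_sum_linkOf hC hA
  have h5 := ncard_eq_sum_ite hC (verts_mono hA)
  have h6 := ncard_eq_sum_ite hC (W := {v | ∃ b, CrossOn C P Q S v b})
    fun v ⟨b, hb⟩ => (isCurve_crossOn hC hP hQ hS).mem _ _ hb
  have key : 6 * eulerChar P - 6 * eulerChar (symmDiff P S) + 6 * eulerChar S =
      12 * ((verts (S ∩ P)).ncard : ℤ) - 6 * ({v | ∃ b, CrossOn C P Q S v b}.ncard : ℤ) -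
        2 * ((S ∩ P).ncard : ℤ) := by
    rw [h1, h2, h3, h4, h5, h6, ← Finset.sum_sub_distrib, ← Finset.sum_add_distrib,
      Finset.mul_sum, Finset.mul_sum, Finset.mul_sum, ← Finset.sum_sub_distrib,
      ← Finset.sum_sub_distrib]
    -- compare at each vertex; outside of `S` the sheets `P` and `symmDiff P S` have the same links
    refine Finset.sum_congr rfl fun v _ => ?_
    by_cases hv : v ∈ verts S
    · have hl : ∀ e, e ∈ linkOf S v ↔ e ∈ linkOf (symmDiff P Q) v := fun e =>
        ⟨fun h => hS.subset h, fun h => by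
          obtain ⟨x, y, hxy⟩ := hv
          exact hS.star hC (hP.symmDiff hQ) hxy h⟩
      have eA : linkOf (S ∩ P) v = linkOf P v \ linkOf Q v := by
        ext e
        have := hl e
        simp only [linkOf, Set.mem_ofPred_eq, Set.mem_symmDiff, Set.mem_inter_iff,
          Set.mem_sdiff] at this ⊢
        tauto
      have eS : linkOf S v = (linkOf P v \ linkOf Q v) ∪ (linkOf Q v \ linkOf P v) := by
        ext e
        exact hl e
      have fin : ∀ {P}, IsSheet C P → (linkOf P v).Finite := fun {P} hP =>
        Set.Finite.of_finite_image ((hC.finite.subset hP.subset).subset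
          (by rintro _ ⟨e, he, rfl⟩; exact he : (fun e => (v, e)) '' linkOf P v ⊆ P))
          fun e _ f _ h => (Prod.mk.inj h).2
      have c1 := Set.ncard_inter_add_ncard_sdiff_eq_ncard (linkOf P v) (linkOf Q v) (fin hP)
      have c2 := Set.ncard_inter_add_ncard_sdiff_eq_ncard (linkOf Q v) (linkOf P v) (fin hQ)
      have c3 : (linkOf S v).ncard =
          (linkOf P v \ linkOf Q v).ncard + (linkOf Q v \ linkOf P v).ncard := by
        rw [eS, Set.ncard_union_eq (Set.disjoint_left.2 fun e h h' => h'.2 h.1)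
          ((fin hP).subset Set.sdiff_subset) ((fin hQ).subset Set.sdiff_subset)]
      rw [Set.inter_comm] at c2
      have hn : (if v ∈ verts P then 1 else 0) - (if v ∈ verts Q then 1 else 0) + (1 : ℤ) =
          2 * (if v ∈ verts (S ∩ P) then 1 else 0) -
            (if v ∈ {v | ∃ b, CrossOn C P Q S v b} then 1 else 0) := by
        simp only [mem_verts_iff, eA]
        by_cases hM : ∃ b, CrossOn C P Q S v b
        · obtain ⟨b, hb⟩ := hM
          obtain ⟨p, q, r, h1, h2, -⟩ := hb.1.triangles hP hQ
          rw [if_pos ⟨(b, p), h1.1⟩, if_pos ⟨(b, q), h2.1⟩, if_pos ⟨(b, p), h1⟩, if_pos ⟨b, hb⟩]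
          norm_num
        · have hno : ∀ b, ¬ Cross C P Q v b := fun b hb => hM ⟨b, hb, hv⟩
          rw [if_neg (show v ∉ {v | ∃ b, CrossOn C P Q S v b} from hM)]
          obtain ⟨e, he⟩ := mem_verts_iff.1 hv
          rw [eS] at he
          rcases he with he | he
          · have hQ0 := linkOf_eq_empty_of_not_cross hC hP hQ hno ⟨e, he⟩
            have hP1 : (linkOf P v).Nonempty := ⟨e, he.1⟩
            simp [hQ0, hP1]
          · have hP0 := linkOf_eq_empty_of_not_cross hC hQ hP (fun b h => hno b h.symm) ⟨e, he⟩
            have hQ1 : (linkOf Q v).Nonempty := ⟨e, he.1⟩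
            simp [hP0, hQ1]
      have n1 : (if v ∈ verts (symmDiff P S) then 1 else 0) =
          if v ∈ verts Q then (1 : ℤ) else 0 := by
        simp only [mem_verts_iff, hS.linkOf_symmDiff hC hP hQ hv]
      rw [n1, if_pos hv, hS.linkOf_symmDiff hC hP hQ hv, c3, eA]
      push_cast
      zify at c1 c2
      linarith
    · have eA : linkOf (S ∩ P) v = ∅ := by
        refine Set.eq_empty_of_forall_notMem fun e he => hv ⟨_, _, he.1⟩
      have eS : linkOf S v = ∅ := by
        refine Set.eq_empty_of_forall_notMem fun e he => hv ⟨_, _, he⟩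
      have eM : ¬ v ∈ {v | ∃ b, CrossOn C P Q S v b} := fun ⟨b, hb⟩ => hv hb.2
      simp only [mem_verts_iff, linkOf_symmDiff_of_notMem hv, eA, eS, if_neg eM]
      simp
  omega

/-- Sheets are closed surfaces that are coherently oriented, so their Euler characteristic is even.
This is the parity of the number of crossing curves of `P` with the empty sheet, which is zero. -/
theorem IsSheet.even_eulerChar (hC : IsClosedFoam C) (hP : IsSheet C P) : Even (eulerChar P) := by
  have := hC.finite_verts
  have hfin : Finite (verts C.tri) := this
  have he : (_root_.symmDiff P ∅ : Set Triangle) = P := symmDiff_bot P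
  have hS : IsComponentUnion (_root_.symmDiff P ∅) P := by
    rw [he]
    exact isComponentUnion_self hP.isClosedSurface
  obtain ⟨h1, h2⟩ := sgn_crossOn hC hP (isSheet_empty C) hS
  have hno : ∀ a b, ¬ CrossOn C P ∅ P a b := by
    rintro a b ⟨⟨p, q, r, -, -, h⟩, -⟩
    exact h
  have hM : {v | ∃ b, CrossOn C P ∅ P v b} = ∅ :=
    Set.eq_empty_of_forall_notMem fun v ⟨b, hb⟩ => hno v b hb
  have hsgn : (isCurve_crossOn hC hP (isSheet_empty C) hS).sgn = 1 := by
    classical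
    have := Fintype.ofFinite (verts C.tri)
    rw [IsCurve.sgn_def]
    have : (isCurve_crossOn hC hP (isSheet_empty C) hS).perm = 1 := by
      ext1 a
      exact IsCurve.perm_eq_self _ fun ⟨b, hb⟩ => hno _ _ hb
    rw [this, map_one]
  rw [hsgn, hM, Set.inter_self, Set.ncard_empty, add_zero] at h2
  rw [hM, Set.inter_self, Set.ncard_empty, add_zero] at h1
  have h3 := hP.isClosedSurface.six_mul_eulerChar hC
  have h4 : Even (P.ncard / 2 + (verts P).ncard) := by
    by_contra hodd
    rw [Nat.not_even_iff_odd] at hodd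
    rw [hodd.neg_one_pow] at h2
    exact absurd h2 (by decide)
  obtain ⟨k, hk⟩ := h4
  obtain ⟨l, hl⟩ := h1
  rw [Int.even_iff]
  omega

theorem IsComponentUnion.even_eulerChar (hC : IsClosedFoam C) (hP : IsSheet C P)
    (hQ : IsSheet C Q) (hS : IsComponentUnion (symmDiff P Q) S) : Even (eulerChar S) := by
  have h1 := hP.even_eulerChar hC
  have h2 := (hS.isSheet hC hP hQ).even_eulerChar hC
  have h3 := hS.three_mul hC hP hQ
  obtain ⟨h4, -⟩ := sgn_crossOn hC hP hQ hS
  rw [Nat.even_iff] at h4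
  rw [Int.even_iff] at *
  omega

/-- The exchange of two sheets `P`, `Q` changes the parity of the number of positive curves
by an Euler characteristic. -/
theorem IsComponentUnion.numCurves_posCross (hC : IsClosedFoam C) (hP : IsSheet C P)
    (hQ : IsSheet C Q) (hS : IsComponentUnion (symmDiff P Q) S) :
    (-1 : ℤˣ) ^ ((numCurves (PosCross C P Q) : ℤ) +
        numCurves (PosCross C (symmDiff P S) (symmDiff Q S))) =
      (-1) ^ ((eulerChar P - eulerChar (symmDiff P S)) / 2 + eulerChar S / 2) := by
  have hfin : Finite (verts C.tri) := hC.finite_verts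
  have hcur := isCurve_crossOn hC hP hQ hS
  have hW : ∀ a b, Cross C P Q a b → (a ∈ verts S ↔ b ∈ verts S) := fun a b h =>
    ⟨fun ha => CrossOn.mem_right hC hP hQ hS ⟨h, ha⟩, fun hb => h.mem_left hC hP hQ hS hb⟩
  have h1 := (isCurve_posCross hC hP hQ).numCurves_or_of_swap (isCurve_posCross hC hQ hP)
    (isCurve_posCross hC (hS.isSheet hC hP hQ) (hS.comm.isSheet hC hQ hP))
    (fun a b c h h' => h.not_posCross hC hP hQ h') (verts S) (fun a b h => hW a b h.cross)
    (fun a b h => hW a b h.cross.symm)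
    (fun a ha b => by
      unfold PosCross
      simp only [hS.mem_symmDiff_iff hC hP hQ ha, hS.comm.mem_symmDiff_iff hC hQ hP ha])
    (fun a ha b => by
      unfold PosCross
      simp only [mem_symmDiff_iff_of_notMem ha])
    hcur (fun a b => by rw [CrossOn, cross_iff hC])
  obtain ⟨h2, h3⟩ := sgn_crossOn hC hP hQ hS
  have h4 := hS.three_mul hC hP hQ
  rw [hcur.neg_one_pow_numCurves, h3, ← pow_add] at h1
  have e1 := hP.even_eulerChar hC
  have e2 := (hS.isSheet hC hP hQ).even_eulerChar hC
  have e3 := hS.even_eulerChar hC hP hQ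
  rw [← Nat.cast_add, zpow_natCast, h1, ← zpow_natCast]
  have hpar : ∀ m n : ℤ, (m - n) % 2 = 0 → (-1 : ℤˣ) ^ m = (-1) ^ n := by
    intro m n h
    have : m = n + (m - n) := by ring
    rw [this, zpow_add, (Int.even_iff.2 h).neg_one_zpow, mul_one]
  apply hpar
  rw [Nat.even_iff] at h2
  rw [Int.even_iff] at e1 e2 e3
  push_cast
  omega

/-- The exchange of two sheets does not change the parity of their numbers of positive curves
with a third sheet. -/
theorem IsComponentUnion.numCurves_posCross_left (hC : IsClosedFoam C) (hP : IsSheet C P)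
    (hQ : IsSheet C Q) (hS : IsComponentUnion (symmDiff P Q) S) {K : Set Triangle}
    (hK : IsSheet C K) :
    (-1 : ℤˣ) ^ (numCurves (PosCross C (symmDiff P S) K) +
        numCurves (PosCross C (symmDiff Q S) K)) =
      (-1) ^ (numCurves (PosCross C P K) + numCurves (PosCross C Q K)) := by
  have hfin : Finite (verts C.tri) := hC.finite_verts
  refine (isCurve_posCross hC hP hK).numCurves_swap (isCurve_posCross hC hQ hK)
    (isCurve_posCross hC (hS.isSheet hC hP hQ) hK)
    (isCurve_posCross hC (hS.comm.isSheet hC hQ hP) hK) (verts S) (fun a ha b => ?_)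
    (fun a ha b => ?_)
  · unfold PosCross
    simp only [hS.mem_symmDiff_iff hC hP hQ ha, hS.comm.mem_symmDiff_iff hC hQ hP ha, and_self]
  · unfold PosCross
    simp only [mem_symmDiff_iff_of_notMem ha, and_self]

theorem IsComponentUnion.numCurves_posCross_right (hC : IsClosedFoam C) (hP : IsSheet C P)
    (hQ : IsSheet C Q) (hS : IsComponentUnion (symmDiff P Q) S) {K : Set Triangle}
    (hK : IsSheet C K) :
    (-1 : ℤˣ) ^ (numCurves (PosCross C K (symmDiff P S)) +
        numCurves (PosCross C K (symmDiff Q S))) =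
      (-1) ^ (numCurves (PosCross C K P) + numCurves (PosCross C K Q)) := by
  have hfin : Finite (verts C.tri) := hC.finite_verts
  refine (isCurve_posCross hC hK hP).numCurves_swap (isCurve_posCross hC hK hQ)
    (isCurve_posCross hC hK (hS.isSheet hC hP hQ))
    (isCurve_posCross hC hK (hS.comm.isSheet hC hQ hP)) (verts S) (fun a ha b => ?_)
    (fun a ha b => ?_)
  · unfold PosCross
    simp only [hS.mem_symmDiff_iff hC hP hQ ha, hS.comm.mem_symmDiff_iff hC hQ hP ha, and_self]
  · unfold PosCross
    simp only [mem_symmDiff_iff_of_notMem ha, and_self]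

end SlFoam
end

noncomputable section
namespace SlFoam
open LabelledComplex

variable {C : LabelledComplex} {v : Space} {E P Q S T : Set Triangle}

/-! ### Components of closed surfaces -/

theorem IsComponentUnion.trans (hS : IsComponentUnion E S) (hT : IsComponentUnion S T) :
    IsComponentUnion E T where
  subset := hT.subset.trans hS.subset
  rotate := hT.rotate
  same _ _ _ _ h h' := hT.same _ _ _ _ h (hS.same _ _ _ _ (hT.subset h) h')
  opposite _ _ _ _ h h' := hT.opposite _ _ _ _ h (hS.opposite _ _ _ _ (hT.subset h) h')

theorem IsComponentUnion.inter (hS : IsComponentUnion E S) (hT : IsComponentUnion E T) :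
    IsComponentUnion E (S ∩ T) where
  subset _ h := hS.subset h.1
  rotate _ _ _ h := ⟨hS.rotate _ _ _ h.1, hT.rotate _ _ _ h.2⟩
  same _ _ _ _ h h' := ⟨hS.same _ _ _ _ h.1 h', hT.same _ _ _ _ h.2 h'⟩
  opposite _ _ _ _ h h' := ⟨hS.opposite _ _ _ _ h.1 h', hT.opposite _ _ _ _ h.2 h'⟩

theorem IsComponentUnion.union (hS : IsComponentUnion E S) (hT : IsComponentUnion E T) :
    IsComponentUnion E (S ∪ T) where
  subset _ h := h.elim (hS.subset ·) (hT.subset ·)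
  rotate _ _ _ h := h.imp (hS.rotate _ _ _) (hT.rotate _ _ _)
  same _ _ _ _ h h' := h.imp (hS.same _ _ _ _ · h') (hT.same _ _ _ _ · h')
  opposite _ _ _ _ h h' := h.imp (hS.opposite _ _ _ _ · h') (hT.opposite _ _ _ _ · h')

theorem isComponentUnion_empty (E : Set Triangle) : IsComponentUnion E ∅ :=
  ⟨Set.empty_subset _, fun _ _ _ h => h, fun _ _ _ _ h _ => h, fun _ _ _ _ h _ => h⟩

theorem IsComponentUnion.sdiff (hE : ∀ a b c, (a, b, c) ∈ E → (b, c, a) ∈ E)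
    (hS : IsComponentUnion E S) : IsComponentUnion E (E \ S) where
  subset := Set.sdiff_subset
  rotate _ _ _ h := ⟨hE _ _ _ h.1, fun h' => h.2 (hS.rotate _ _ _ (hS.rotate _ _ _ h'))⟩
  same _ _ _ _ h h' := ⟨h', fun h2 => h.2 (hS.same _ _ _ _ h2 h.1)⟩
  opposite _ _ _ _ h h' := ⟨h', fun h2 => h.2 (hS.opposite _ _ _ _ h2 h.1)⟩

/-- `K` is a connected component of the surface `E`. -/
structure IsComponent (E K : Set Triangle) : Prop where
  isComponentUnion : IsComponentUnion E K
  nonempty : K.Nonempty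
  eq_of_subset : ∀ T, IsComponentUnion E T → T ⊆ K → T.Nonempty → T = K

theorem IsComponent.eq_of_inter {K L : Set Triangle} (hK : IsComponent E K) (hL : IsComponent E L)
    (h : (K ∩ L).Nonempty) : K = L :=
  (hK.eq_of_subset _ (hK.1.inter hL.1) Set.inter_subset_left h).symm.trans
    (hL.eq_of_subset _ (hK.1.inter hL.1) Set.inter_subset_right h)

theorem exists_isComponent (hE : ∀ a b c, (a, b, c) ∈ E → (b, c, a) ∈ E) {t : Triangle}
    (ht : t ∈ E) : ∃ K, IsComponent E K ∧ t ∈ K := by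
  have hself : IsComponentUnion E E :=
    ⟨subset_rfl, hE, fun _ _ _ _ _ h => h, fun _ _ _ _ _ h => h⟩
  let K : Set Triangle := {u | ∀ S, IsComponentUnion E S → t ∈ S → u ∈ S}
  have hK : IsComponentUnion E K :=
    ⟨fun u hu => hu E hself ht, fun a b c h S hS h' => hS.rotate _ _ _ (h S hS h'),
      fun a b x y h h1 S hS h' => hS.same _ _ _ _ (h S hS h') h1,
      fun a b x y h h1 S hS h' => hS.opposite _ _ _ _ (h S hS h') h1⟩
  refine ⟨K, ⟨hK, ⟨t, fun S _ h => h⟩, fun T hT hTK hne => ?_⟩, fun S _ h => h⟩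
  refine hTK.antisymm fun u hu => ?_
  by_cases htT : t ∈ T
  · exact hu T hT htT
  · obtain ⟨w, hw⟩ := hne
    exact ((hTK hw _ (hT.sdiff hE) ⟨ht, htT⟩).2 hw).elim

/-- Disjoint unions of components do not have vertices in common. -/
theorem IsComponentUnion.disjoint_verts (hC : IsClosedFoam C) (hE : IsClosedSurface C E)
    (hS : IsComponentUnion E S) (hT : IsComponentUnion E T) (hd : Disjoint S T) :
    Disjoint (verts S) (verts T) := by
  rw [Set.disjoint_left] at hd ⊢
  rintro v ⟨b, c, h⟩ ⟨b', c', h'⟩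
  exact hd (hS.star hC hE h (hT.subset h')) h'

theorem verts_union : verts (S ∪ T) = verts S ∪ verts T := by
  ext v
  constructor
  · rintro ⟨b, c, h | h⟩
    exacts [Or.inl ⟨b, c, h⟩, Or.inr ⟨b, c, h⟩]
  · rintro (⟨b, c, h⟩ | ⟨b, c, h⟩)
    exacts [⟨b, c, Or.inl h⟩, ⟨b, c, Or.inr h⟩]

theorem IsComponentUnion.eulerChar_union (hC : IsClosedFoam C) (hE : IsClosedSurface C E)
    (hS : IsComponentUnion E S) (hT : IsComponentUnion E T) (hd : Disjoint S T) :
    eulerChar (S ∪ T) = eulerChar S + eulerChar T := by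
  have h1 := (hS.isClosedSurface hE).six_mul_eulerChar hC
  have h2 := (hT.isClosedSurface hE).six_mul_eulerChar hC
  have h3 := ((hS.union hT).isClosedSurface hE).six_mul_eulerChar hC
  rw [verts_union, Set.ncard_union_eq (hS.disjoint_verts hC hE hT hd)
    ((hS.isClosedSurface hE).finite_verts hC) ((hT.isClosedSurface hE).finite_verts hC),
    Set.ncard_union_eq hd ((hS.isClosedSurface hE).finite hC)
    ((hT.isClosedSurface hE).finite hC)] at h3
  push_cast at h3
  omega

/-- The contribution of the vertex `v` to six times the Euler characteristic. -/
def localEuler (E : Set Triangle) (v : Space) : ℤ :=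
  open Classical in 6 * (if v ∈ verts E then 1 else 0) - ((linkOf E v).ncard : ℤ)

theorem localEuler_congr (h : linkOf E v = linkOf S v) : localEuler E v = localEuler S v := by
  rw [localEuler, localEuler, ite_mem_verts_congr h, h]

theorem linkOf_symmDiff_congr {K : Set Triangle} (h : linkOf E v = linkOf S v) :
    linkOf (symmDiff E K) v = linkOf (symmDiff S K) v := by
  ext e
  have := Set.ext_iff.1 h e
  change (v, e) ∈ E ↔ (v, e) ∈ S at this
  change (v, e) ∈ symmDiff E K ↔ (v, e) ∈ symmDiff S K
  rw [Set.mem_symmDiff, Set.mem_symmDiff, this]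

open Classical in
/-- The exchange of `P` and `Q` on `S` changes the Euler characteristic of the difference of `P` and
a third sheet by a sum of contributions of the vertices of `S`. -/
theorem IsComponentUnion.eulerChar_symmDiff (hC : IsClosedFoam C) (hP : IsSheet C P)
    (hQ : IsSheet C Q) (hS : IsComponentUnion (symmDiff P Q) S) {K : Set Triangle}
    (hK : IsSheet C K) :
    6 * (eulerChar (symmDiff (symmDiff P S) K) - eulerChar (symmDiff P K)) =
      ∑ v ∈ hC.finite_verts.toFinset, if v ∈ verts S then
        localEuler (symmDiff Q K) v - localEuler (symmDiff P K) v else 0 := by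
  rw [mul_sub, ((hS.isSheet hC hP hQ).symmDiff hK).six_mul_eulerChar_eq_sum hC,
    (hP.symmDiff hK).six_mul_eulerChar_eq_sum hC, ← Finset.sum_sub_distrib]
  refine Finset.sum_congr rfl fun v _ => ?_
  change localEuler _ v - localEuler _ v = _
  split_ifs with hv
  · rw [localEuler_congr (linkOf_symmDiff_congr (hS.linkOf_symmDiff hC hP hQ hv))]
  · rw [localEuler_congr (linkOf_symmDiff_congr (linkOf_symmDiff_of_notMem hv)), sub_self]

/-- Exchanges on disjoint sets of components change Euler characteristics independently. -/
theorem IsComponentUnion.eulerChar_symmDiff_union (hC : IsClosedFoam C) (hP : IsSheet C P)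
    (hQ : IsSheet C Q) (hS : IsComponentUnion (symmDiff P Q) S)
    (hT : IsComponentUnion (symmDiff P Q) T) (hd : Disjoint S T) {K : Set Triangle}
    (hK : IsSheet C K) :
    eulerChar (symmDiff (symmDiff P (S ∪ T)) K) - eulerChar (symmDiff P K) =
      (eulerChar (symmDiff (symmDiff P S) K) - eulerChar (symmDiff P K)) +
        (eulerChar (symmDiff (symmDiff P T) K) - eulerChar (symmDiff P K)) := by
  classical
  have h1 := hS.eulerChar_symmDiff hC hP hQ hK
  have h2 := hT.eulerChar_symmDiff hC hP hQ hK
  have h3 := (hS.union hT).eulerChar_symmDiff hC hP hQ hK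
  have h4 : 6 * (eulerChar (symmDiff (symmDiff P (S ∪ T)) K) - eulerChar (symmDiff P K)) =
      6 * (eulerChar (symmDiff (symmDiff P S) K) - eulerChar (symmDiff P K)) +
        6 * (eulerChar (symmDiff (symmDiff P T) K) - eulerChar (symmDiff P K)) := by
    rw [h1, h2, h3, ← Finset.sum_add_distrib]
    refine Finset.sum_congr rfl fun v _ => ?_
    have hdv : v ∈ verts S → v ∉ verts T := fun h =>
      Set.disjoint_left.1 (hS.disjoint_verts hC (hP.symmDiff hQ) hT hd) h
    rw [verts_union]
    by_cases hv : v ∈ verts S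
    · simp [hv, hdv hv]
    · by_cases hv' : v ∈ verts T
      · simp [hv, hv']
      · simp [hv, hv']
  omega

theorem IsComponentUnion.eulerChar_symmDiff_add (hC : IsClosedFoam C) (hP : IsSheet C P)
    (hQ : IsSheet C Q) (hS : IsComponentUnion (symmDiff P Q) S) {K : Set Triangle}
    (hK : IsSheet C K) :
    eulerChar (symmDiff (symmDiff Q S) K) - eulerChar (symmDiff Q K) =
      -(eulerChar (symmDiff (symmDiff P S) K) - eulerChar (symmDiff P K)) := by
  classical
  have h1 := hS.eulerChar_symmDiff hC hP hQ hK
  have h2 := hS.comm.eulerChar_symmDiff hC hQ hP hK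
  have h3 : 6 * (eulerChar (symmDiff (symmDiff Q S) K) - eulerChar (symmDiff Q K)) =
      -(6 * (eulerChar (symmDiff (symmDiff P S) K) - eulerChar (symmDiff P K))) := by
    rw [h1, h2, ← Finset.sum_neg_distrib]
    refine Finset.sum_congr rfl fun v _ => ?_
    split_ifs <;> ring
  omega

/-- The Euler characteristic of a connected closed surface is at most two. -/
theorem IsComponent.eulerChar_le (hC : IsClosedFoam C) (hE : IsClosedSurface C E)
    {K : Set Triangle} (hK : IsComponent E K) : eulerChar K ≤ 2 := by
  classical
  have hKs := hK.1.isClosedSurface hE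
  have : Finite K := hKs.finite hC
  have : Finite ((fun t : Triangle => t.1) '' K) := (hKs.finite hC).image _
  have : Finite ((fun t : Triangle => s(t.1, t.2.1)) '' K) := (hKs.finite hC).image _
  have : Finite ((fun t : Triangle => ({t.1, t.2.1, t.2.2} : Set Space)) '' K) :=
    (hKs.finite hC).image _
  have := Fintype.ofFinite K
  have := Fintype.ofFinite ((fun t : Triangle => t.1) '' K)
  have := Fintype.ofFinite ((fun t : Triangle => s(t.1, t.2.1)) '' K)
  have := Fintype.ofFinite ((fun t : Triangle => ({t.1, t.2.1, t.2.2} : Set Space)) '' K)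
  let r : Equiv.Perm K :=
    { toFun := fun t => ⟨_, hKs.rotate _ _ _ t.2⟩
      invFun := fun t => ⟨_, hKs.rotate _ _ _ (hKs.rotate _ _ _ t.2)⟩
      left_inv := fun t => rfl
      right_inv := fun t => rfl }
  -- a component has no proper nonempty subset that is closed under rotation and flips
  have hmain : ∀ A : K → Prop, (∀ t, A t → A (r t)) →
      (∀ t u : K, s(t.1.1, t.1.2.1) = s(u.1.1, u.1.2.1) → A t → A u) → (∃ t, A t) → ∀ t, A t := by
    rintro A h1 h2 ⟨t₀, h0⟩ t
    have h3 : IsComponentUnion E {t | ∃ h : t ∈ K, A ⟨t, h⟩} := hK.1.trans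
      ⟨fun t h => h.1, fun a b c h => ⟨_, h1 _ h.2⟩, fun a b x y h h' =>
        ⟨h', h2 ⟨_, h.1⟩ ⟨_, h'⟩ rfl h.2⟩, fun a b x y h h' =>
        ⟨h', h2 ⟨_, h.1⟩ ⟨_, h'⟩ Sym2.eq_swap h.2⟩⟩
    have h4 := hK.eq_of_subset _ h3 (fun t h => h.1) ⟨t₀.1, t₀.2, h0⟩
    have h5 : t.1 ∈ {t | ∃ h : t ∈ K, A ⟨t, h⟩} := h4.symm.subset t.2
    exact h5.2
  have key := card_add_card_le_of_connected r
    (fun t => (⟨t.1.1, t.1, t.2, rfl⟩ : (fun t : Triangle => t.1) '' K))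
    (fun t => (⟨s(t.1.1, t.1.2.1), t.1, t.2, rfl⟩ : (fun t : Triangle => s(t.1, t.2.1)) '' K))
    (fun t => (⟨{t.1.1, t.1.2.1, t.1.2.2}, t.1, t.2, rfl⟩ :
      (fun t : Triangle => ({t.1, t.2.1, t.2.2} : Set Space)) '' K)) ?_ ?_ ?_ ?_ ?_ ?_ ?_ ?_
  · simp only [← Nat.card_eq_fintype_card, Nat.card_coe_set_eq] at key
    unfold eulerChar
    omega
  · rintro ⟨_, t, ht, rfl⟩
    exact ⟨⟨t, ht⟩, rfl⟩
  · rintro ⟨_, t, ht, rfl⟩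
    exact ⟨⟨t, ht⟩, rfl⟩
  · rintro ⟨_, t, ht, rfl⟩
    exact ⟨⟨t, ht⟩, rfl⟩
  · rintro ⟨⟨a, b, c⟩, ht⟩
    refine Subtype.ext ?_
    change ({b, c, a} : Set Space) = {a, b, c}
    ext x
    simp only [Set.mem_insert_iff, Set.mem_singleton_iff]
    tauto
  · intro t u h
    have h1 : s(t.1.1, t.1.2.1) = s(u.1.1, u.1.2.1) := congrArg Subtype.val h
    have h2 : ∀ t : K, s((⟨t.1.1, t.1, t.2, rfl⟩ : (fun t : Triangle => t.1) '' K),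
        (⟨(r t).1.1, (r t).1, (r t).2, rfl⟩ : (fun t : Triangle => t.1) '' K)).map Subtype.val =
        s(t.1.1, t.1.2.1) := fun t => rfl
    refine Sym2.map.injective Subtype.val_injective ?_
    rw [h2, h2, h1]
  · intro t
    obtain ⟨u, hu, hne, hw⟩ := hKs.exists_flip hC t.2
    refine ⟨⟨u, hu⟩, fun h => hne (congrArg Subtype.val h), fun w => ?_⟩
    simp only [Subtype.ext_iff]
    exact hw w.1 w.2
  · rintro x hx ⟨_, t, ht, rfl⟩ ⟨_, u, hu, rfl⟩
    refine (hmain (fun w => x ⟨w.1.1, w.1, w.2, rfl⟩ = x ⟨u.1, u, hu, rfl⟩)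
      (fun w h => (hx w).symm.trans h) (fun w w' h hw => ?_) ⟨⟨u, hu⟩, rfl⟩) ⟨t, ht⟩
    rcases Sym2.eq_iff.1 h with ⟨h1, -⟩ | ⟨h1, h2⟩
    · refine Eq.trans ?_ hw
      congr 1
      exact Subtype.ext h1.symm
    · refine Eq.trans ?_ ((hx w).symm.trans hw)
      congr 1
      exact Subtype.ext h2.symm
  · rintro x hx ⟨_, t, ht, rfl⟩ ⟨_, u, hu, rfl⟩
    refine (hmain (fun w => x ⟨{w.1.1, w.1.2.1, w.1.2.2}, w.1, w.2, rfl⟩ =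
      x ⟨{u.1, u.2.1, u.2.2}, u, hu, rfl⟩)
      (fun w h => Eq.trans ?_ h) (fun w w' h hw => ?_) ⟨⟨u, hu⟩, rfl⟩) ⟨t, ht⟩
    · congr 1
      refine Subtype.ext ?_
      change ({w.1.2.1, w.1.2.2, w.1.1} : Set Space) = {w.1.1, w.1.2.1, w.1.2.2}
      ext x
      simp only [Set.mem_insert_iff, Set.mem_singleton_iff]
      tauto
    · exact (hx w' w (Subtype.ext h.symm)).trans hw

end SlFoam
end

noncomputable section
namespace SlFoam
open LabelledComplex

variable {C : LabelledComplex} {S T : Set Triangle} {N : ℕ} {c : Triangle → Finset (Fin N)}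
  {i j k : Fin N}

/-! ### Kempe moves -/

theorem IsColoring.isSheet (hC : IsClosedFoam C) (hc : IsColoring N C c) (i : Fin N) :
    IsSheet C (monochrome C c i) where
  subset t h := h.1
  rotate a b d h := ⟨hC.rotate _ _ _ h.1, by rw [hc.rotate _ _ _ h.1]; exact h.2⟩
  regular a b p q h := by
    have h1 : (a, b, p) ∈ C.tri := (h.1 ▸ rfl : p ∈ C.star a b)
    have h2 : (b, a, q) ∈ C.tri := (h.2 ▸ rfl : q ∈ C.star b a)
    simp only [monochrome, Set.mem_ofPred_eq, h1, h2, hc.regular _ _ _ _ h]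
  binding a b p q r h := by
    have h1 : (a, b, p) ∈ C.tri := (h.2.1 ▸ Or.inl rfl : p ∈ C.star a b)
    have h2 : (a, b, q) ∈ C.tri := (h.2.1 ▸ Or.inr rfl : q ∈ C.star a b)
    have h3 : (b, a, r) ∈ C.tri := (h.2.2 ▸ rfl : r ∈ C.star b a)
    have h4 := hc.binding _ _ _ _ _ h
    have h5 : Disjoint (c (a, b, p)) (c (a, b, q)) := by
      rw [← Finset.card_union_eq_card_add_card, h4, hc.card _ h1, hc.card _ h2, hc.card _ h3,
        hC.label_binding _ _ _ _ _ h]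
    simp only [monochrome, Set.mem_ofPred_eq, h1, h2, h3, true_and, ← h4, Finset.mem_union,
      not_and]
    exact fun h => Finset.disjoint_left.1 h5 h

/-- Colorings are the same as families of sheets, one for each pigment. -/
theorem isColoring_of_isSheet (hC : IsClosedFoam C) (hcard : ∀ t ∈ C.tri, (c t).card = C.label t)
    (hoff : ∀ t, t ∉ C.tri → c t = ∅) (h : ∀ i, IsSheet C (monochrome C c i)) :
    IsColoring N C c where
  card := hcard
  off := hoff
  rotate a b d ht := by
    ext i
    have := (h i).rotate' (a := a) (b := b) (c := d)
    simp only [monochrome, Set.mem_ofPred_eq, ht, hC.rotate _ _ _ ht, true_and] at this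
    exact this.symm
  regular a b p q hr := by
    have h1 : (a, b, p) ∈ C.tri := (hr.1 ▸ rfl : p ∈ C.star a b)
    have h2 : (b, a, q) ∈ C.tri := (hr.2 ▸ rfl : q ∈ C.star b a)
    ext i
    have := (h i).regular _ _ _ _ hr
    simpa only [monochrome, Set.mem_ofPred_eq, h1, h2, true_and] using this
  binding a b p q r hb := by
    have h1 : (a, b, p) ∈ C.tri := (hb.2.1 ▸ Or.inl rfl : p ∈ C.star a b)
    have h2 : (a, b, q) ∈ C.tri := (hb.2.1 ▸ Or.inr rfl : q ∈ C.star a b)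
    have h3 : (b, a, r) ∈ C.tri := (hb.2.2 ▸ rfl : r ∈ C.star b a)
    ext i
    have := ((h i).binding _ _ _ _ _ hb).1
    simp only [monochrome, Set.mem_ofPred_eq, h1, h2, h3, true_and] at this
    rw [Finset.mem_union]
    exact this.symm

theorem bichrome_eq (C : LabelledComplex) (c : Triangle → Finset (Fin N)) (i j : Fin N) :
    bichrome C c i j = symmDiff (monochrome C c i) (monochrome C c j) := by
  ext t
  simp only [bichrome, monochrome, Set.mem_symmDiff, Set.mem_ofPred_eq, Xor]
  tauto

open Classical in
/-- The coloring with the pigments `i` and `j` exchanged on the set `S`. -/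
def kempe (c : Triangle → Finset (Fin N)) (i j : Fin N) (S : Set Triangle) :
    Triangle → Finset (Fin N) :=
  fun t => if t ∈ S then (c t).map (Equiv.swap i j).toEmbedding else c t

theorem kempe_of_mem {t : Triangle} (ht : t ∈ S) :
    kempe c i j S t = (c t).map (Equiv.swap i j).toEmbedding := if_pos ht

theorem kempe_of_notMem {t : Triangle} (ht : t ∉ S) : kempe c i j S t = c t := if_neg ht

theorem mem_map_swap {s : Finset (Fin N)} :
    k ∈ s.map (Equiv.swap i j).toEmbedding ↔ Equiv.swap i j k ∈ s := by
  rw [Finset.mem_map_equiv, Equiv.symm_swap]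

theorem monochrome_kempe_left (hS : S ⊆ bichrome C c i j) :
    monochrome C (kempe c i j S) i = symmDiff (monochrome C c i) S := by
  ext t
  by_cases ht : t ∈ S
  · have h1 := hS ht
    simp only [bichrome, Set.mem_ofPred_eq, Xor] at h1
    simp only [monochrome, Set.mem_symmDiff, Set.mem_ofPred_eq, ht, kempe_of_mem, mem_map_swap,
      Equiv.swap_apply_left]
    tauto
  · simp only [monochrome, Set.mem_symmDiff, Set.mem_ofPred_eq, ht, kempe_of_notMem ht]
    tauto

theorem monochrome_kempe_right (hS : S ⊆ bichrome C c i j) :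
    monochrome C (kempe c i j S) j = symmDiff (monochrome C c j) S := by
  ext t
  by_cases ht : t ∈ S
  · have h1 := hS ht
    simp only [bichrome, Set.mem_ofPred_eq, Xor] at h1
    simp only [monochrome, Set.mem_symmDiff, Set.mem_ofPred_eq, ht, kempe_of_mem, mem_map_swap,
      Equiv.swap_apply_right]
    tauto
  · simp only [monochrome, Set.mem_symmDiff, Set.mem_ofPred_eq, ht, kempe_of_notMem ht]
    tauto

theorem monochrome_kempe_of_ne (hi : k ≠ i) (hj : k ≠ j) :
    monochrome C (kempe c i j S) k = monochrome C c k := by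
  ext t
  by_cases ht : t ∈ S
  · simp only [monochrome, Set.mem_ofPred_eq, kempe_of_mem ht, mem_map_swap,
      Equiv.swap_apply_of_ne_of_ne hi hj]
  · simp only [monochrome, Set.mem_ofPred_eq, kempe_of_notMem ht]

theorem bichrome_kempe (hS : S ⊆ bichrome C c i j) :
    bichrome C (kempe c i j S) i j = bichrome C c i j := by
  rw [bichrome_eq, bichrome_eq, monochrome_kempe_left hS, monochrome_kempe_right hS]
  ext t
  simp only [Set.mem_symmDiff]
  tauto

theorem kempe_kempe : kempe (kempe c i j S) i j S = c := by
  ext t k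
  by_cases ht : t ∈ S
  · rw [kempe_of_mem ht, mem_map_swap, kempe_of_mem ht, mem_map_swap, Equiv.swap_apply_self]
  · rw [kempe_of_notMem ht, kempe_of_notMem ht]

theorem IsComponentUnion.symmDiff_monochrome (hS : IsComponentUnion (bichrome C c i j) S) :
    IsComponentUnion (symmDiff (monochrome C c i) (monochrome C c j)) S := by
  rwa [← bichrome_eq]

theorem IsColoring.kempe (hC : IsClosedFoam C) (hc : IsColoring N C c)
    (hS : IsComponentUnion (bichrome C c i j) S) : IsColoring N C (kempe c i j S) := by
  refine isColoring_of_isSheet hC (fun t ht => ?_) (fun t ht => ?_) fun k => ?_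
  · by_cases h : t ∈ S
    · rw [kempe_of_mem h, Finset.card_map, hc.card t ht]
    · rw [kempe_of_notMem h, hc.card t ht]
  · have h : t ∉ S := fun h => ht (hS.subset h).1
    rw [kempe_of_notMem h, hc.off t ht]
  · have hS' := hS.symmDiff_monochrome
    by_cases hi : k = i
    · subst hi
      rw [monochrome_kempe_left hS.subset]
      exact hS'.isSheet hC (hc.isSheet hC _) (hc.isSheet hC _)
    · by_cases hj : k = j
      · subst hj
        rw [monochrome_kempe_right hS.subset]
        exact hS'.comm.isSheet hC (hc.isSheet hC _) (hc.isSheet hC _)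
      · rw [monochrome_kempe_of_ne hi hj]
        exact hc.isSheet hC _

theorem isPositive_iff {a b : Space} : IsPositive C c i j a b ↔
    PosCross C (monochrome C c i) (monochrome C c j) a b := by
  constructor
  · rintro ⟨p, q, r, h, h1, h2, h3⟩
    exact ⟨p, q, r, h, ⟨(h.2.1 ▸ Or.inl rfl : p ∈ C.star a b), h1⟩,
      ⟨(h.2.1 ▸ Or.inr rfl : q ∈ C.star a b), h2⟩, h3⟩
  · rintro ⟨p, q, r, h, h1, h2, h3⟩
    exact ⟨p, q, r, h, h1.2, h2.2, h3⟩

theorem theta_eq (C : LabelledComplex) (c : Triangle → Finset (Fin N)) (i j : Fin N) :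
    theta C c i j = numCurves (PosCross C (monochrome C c i) (monochrome C c j)) := by
  have : IsPositive C c i j = PosCross C (monochrome C c i) (monochrome C c j) := by
    ext a b
    exact isPositive_iff
  change numCurves _ = _
  rw [this]

/-- The pairs of pigments other than `i, i + 1` are permuted by the exchange of `i` and `i + 1`. -/
theorem swap_mem_pigmentPairs (hij : (j : ℕ) = i + 1) {p : Fin N × Fin N}
    (hp : p ∈ (pigmentPairs N).erase (i, j)) :
    (Equiv.swap i j p.1, Equiv.swap i j p.2) ∈ (pigmentPairs N).erase (i, j) := by
  obtain ⟨a, b⟩ := p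
  simp only [pigmentPairs, Finset.mem_erase, Finset.mem_filter, Finset.mem_univ, true_and, ne_eq,
    Prod.mk.injEq, Fin.lt_def, Fin.ext_iff, Equiv.swap_apply_def] at hp ⊢
  split_ifs <;> omega

theorem mem_pigmentPairs (hij : (j : ℕ) = i + 1) : (i, j) ∈ pigmentPairs N := by
  simp only [pigmentPairs, Finset.mem_filter, Finset.mem_univ, true_and, Fin.lt_def]
  omega

theorem neg_one_zpow_congr {m n : ℤ} (h : (m - n) % 2 = 0) : (-1 : ℤˣ) ^ m = (-1) ^ n := by
  have : m = n + (m - n) := by ring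
  rw [this, zpow_add, (Int.even_iff.2 h).neg_one_zpow, mul_one]

/-- A Kempe move for consecutive pigments changes the sign by half the Euler characteristic of the
surface on which the pigments are exchanged. -/
theorem neg_one_zpow_signExponent_kempe (hC : IsClosedFoam C) (hc : IsColoring N C c)
    (hij : (j : ℕ) = i + 1) (hS : IsComponentUnion (bichrome C c i j) S) :
    (-1 : ℤˣ) ^ signExponent C (kempe c i j S) =
      (-1) ^ signExponent C c * (-1) ^ (eulerChar S / 2) := by
  have hne : i ≠ j := fun h => by
    have := congrArg Fin.val h
    omega
  have hP := hc.isSheet hC i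
  have hQ := hc.isSheet hC j
  have hS' := hS.symmDiff_monochrome
  have hi := monochrome_kempe_left hS.subset
  have hj := monochrome_kempe_right hS.subset
  have ho : ∀ k, k ≠ i → k ≠ j → monochrome C (kempe c i j S) k = monochrome C c k := fun k h h' =>
    monochrome_kempe_of_ne h h'
  set c' := kempe c i j S
  -- the monochrome surfaces
  have h1 : ∑ k : Fin N, ((k : ℤ) + 1) * (eulerChar (monochrome C c' k) / 2) -
      ∑ k : Fin N, ((k : ℤ) + 1) * (eulerChar (monochrome C c k) / 2) =
      eulerChar (monochrome C c i) / 2 - eulerChar (monochrome C c' i) / 2 := by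
    rw [← Finset.sum_sub_distrib, Fintype.sum_eq_add i j hne]
    · have e := hS'.eulerChar_add hC hP hQ
      have e1 := hP.even_eulerChar hC
      have e2 := hQ.even_eulerChar hC
      have e3 := (hS'.isSheet hC hP hQ).even_eulerChar hC
      have e4 := (hS'.comm.isSheet hC hQ hP).even_eulerChar hC
      rw [← hi, ← hj] at e
      rw [← hi] at e3
      rw [← hj] at e4
      obtain ⟨a1, ha1⟩ := e1
      obtain ⟨a2, ha2⟩ := e2
      obtain ⟨a3, ha3⟩ := e3
      obtain ⟨a4, ha4⟩ := e4
      have f : ∀ a : ℤ, (a + a) / 2 = a := fun a => by omega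
      rw [ha1, ha2, ha3, ha4] at e ⊢
      simp only [f]
      have hij' : ((j : ℕ) : ℤ) = (i : ℕ) + 1 := by exact_mod_cast hij
      rw [hij']
      have : a2 = a3 + a4 - a1 := by omega
      rw [this]
      ring
    · rintro k ⟨hki, hkj⟩
      rw [ho k hki hkj, sub_self]
  -- the bindings
  have h2 : ∏ p ∈ (pigmentPairs N).erase (i, j),
      (-1 : ℤˣ) ^ (theta C c' p.1 p.2 + theta C c p.1 p.2) = 1 := by
    refine Finset.prod_involution (fun p _ => (Equiv.swap i j p.1, Equiv.swap i j p.2)) ?_ ?_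
      (fun p hp => swap_mem_pigmentPairs hij hp) fun p _ => by simp
    · rintro ⟨a, b⟩ hp
      rw [← pow_add]
      simp only [theta_eq]
      simp only [pigmentPairs, Finset.mem_erase, Finset.mem_filter, Finset.mem_univ, true_and,
        ne_eq, Prod.mk.injEq, not_and] at hp
      have comb : ∀ {x y z w : ℕ}, (-1 : ℤˣ) ^ (x + y) = (-1) ^ (z + w) →
          (-1 : ℤˣ) ^ (x + z + (y + w)) = 1 := by
        intro x y z w h
        rw [add_add_add_comm, pow_add, h, Int.units_mul_self]
      have comb' : ∀ {x y z w : ℕ}, (-1 : ℤˣ) ^ (x + y) = (-1) ^ (z + w) →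
          (-1 : ℤˣ) ^ (y + w + (x + z)) = 1 := by
        intro x y z w h
        rw [add_comm]
        exact comb h
      have hK := fun k => hc.isSheet hC k
      by_cases hai : a = i
      · subst hai
        have hbj : b ≠ j := hp.1 rfl
        have hba : b ≠ a := hp.2.ne'
        rw [Equiv.swap_apply_left, Equiv.swap_apply_of_ne_of_ne hba hbj, ho b hba hbj, hi, hj]
        exact comb (hS'.numCurves_posCross_left hC hP hQ (hK b))
      by_cases haj : a = j
      · subst haj
        have hba : b ≠ a := hp.2.ne'
        have hbi : b ≠ i := fun h => by
          have := Fin.lt_def.1 hp.2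
          rw [h] at this
          omega
        rw [Equiv.swap_apply_right, Equiv.swap_apply_of_ne_of_ne hbi hba, ho b hbi hba, hi, hj]
        exact comb' (hS'.numCurves_posCross_left hC hP hQ (hK b))
      rw [Equiv.swap_apply_of_ne_of_ne hai haj, ho a hai haj]
      by_cases hbi : b = i
      · subst hbi
        rw [Equiv.swap_apply_left, hi, hj]
        exact comb (hS'.numCurves_posCross_right hC hP hQ (hK a))
      by_cases hbj : b = j
      · subst hbj
        rw [Equiv.swap_apply_right, hi, hj]
        exact comb' (hS'.numCurves_posCross_right hC hP hQ (hK a))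
      rw [Equiv.swap_apply_of_ne_of_ne hbi hbj, ho b hbi hbj]
      exact comb rfl
    · rintro ⟨a, b⟩ hp hne' heq
      obtain ⟨h3, h4⟩ := Prod.mk.inj heq
      have hfix : ∀ k, Equiv.swap i j k = k → k ≠ i ∧ k ≠ j := by
        rintro k hk
        refine ⟨?_, ?_⟩
        · rintro rfl
          rw [Equiv.swap_apply_left] at hk
          exact hne hk.symm
        · rintro rfl
          rw [Equiv.swap_apply_right] at hk
          exact hne hk
      obtain ⟨ha, ha'⟩ := hfix a h3
      obtain ⟨hb, hb'⟩ := hfix b h4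
      apply hne'
      simp only [theta_eq]
      rw [ho a ha ha', ho b hb hb', ← two_mul, pow_mul]
      simp
  have h3 : (-1 : ℤˣ) ^ ((theta C c i j : ℤ) + theta C c' i j) =
      (-1) ^ ((eulerChar (monochrome C c i) - eulerChar (monochrome C c' i)) / 2 +
        eulerChar S / 2) := by
    rw [theta_eq, theta_eq, hi, hj]
    exact hS'.numCurves_posCross hC hP hQ
  have h4 : (-1 : ℤˣ) ^ (∑ p ∈ pigmentPairs N, (theta C c' p.1 p.2 : ℤ) +
      ∑ p ∈ pigmentPairs N, (theta C c p.1 p.2 : ℤ)) =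
      (-1) ^ ((eulerChar (monochrome C c i) - eulerChar (monochrome C c' i)) / 2 +
        eulerChar S / 2) := by
    rw [← h3, ← Finset.sum_add_distrib,
      ← Finset.add_sum_erase _ _ (mem_pigmentPairs (N := N) hij), zpow_add]
    have h5 : (-1 : ℤˣ) ^ ∑ p ∈ (pigmentPairs N).erase (i, j),
        ((theta C c' p.1 p.2 : ℤ) + theta C c p.1 p.2) = 1 := by
      rw [Finset.prod_pow_eq_pow_sum, ← zpow_natCast] at h2
      exact_mod_cast h2
    rw [h5, mul_one, add_comm]
  have e1 := hP.even_eulerChar hC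
  have e3 := (hS'.isSheet hC hP hQ).even_eulerChar hC
  rw [← hi] at e3
  have h6 : (-1 : ℤˣ) ^ (signExponent C c' + signExponent C c) = (-1) ^ (eulerChar S / 2) := by
    have e : signExponent C c' + signExponent C c =
        (∑ k : Fin N, ((k : ℤ) + 1) * (eulerChar (monochrome C c' k) / 2) -
      ∑ k : Fin N, ((k : ℤ) + 1) * (eulerChar (monochrome C c k) / 2)) +
      (∑ p ∈ pigmentPairs N, (theta C c' p.1 p.2 : ℤ) +
      ∑ p ∈ pigmentPairs N, (theta C c p.1 p.2 : ℤ)) +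
      2 * ∑ k : Fin N, ((k : ℤ) + 1) * (eulerChar (monochrome C c k) / 2) := by
      unfold signExponent
      ring
    rw [e, h1, zpow_add, zpow_add, h4, ← zpow_add, ← zpow_add]
    apply neg_one_zpow_congr
    rw [Int.even_iff] at e1 e3
    omega
  rw [← h6, zpow_add, mul_comm, mul_assoc, Int.units_mul_self, mul_one]

end SlFoam
end

noncomputable section
namespace SlFoam
open LabelledComplex

/-! ### Rational functions that are regular along `X_i = X_j` -/

section Residue

variable {N : ℕ}

/-- The substitution of `X_i` for `X_j`. -/
def identify (i j : Fin N) : MvPolynomial (Fin N) ℤ →ₐ[ℤ] MvPolynomial (Fin N) ℤ :=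
  MvPolynomial.aeval fun k => if k = j then MvPolynomial.X i else MvPolynomial.X k

theorem identify_X (i j k : Fin N) :
    identify i j (MvPolynomial.X k) = if k = j then MvPolynomial.X i else MvPolynomial.X k :=
  MvPolynomial.aeval_X _ _

theorem X_sub_X_dvd_sub_identify (i j : Fin N) (a : MvPolynomial (Fin N) ℤ) :
    (MvPolynomial.X i - MvPolynomial.X j : MvPolynomial (Fin N) ℤ) ∣ a - identify i j a := by
  set I : Ideal (MvPolynomial (Fin N) ℤ) := Ideal.span {MvPolynomial.X i - MvPolynomial.X j}
  have h : (Ideal.Quotient.mkₐ ℤ I).comp (identify i j) = Ideal.Quotient.mkₐ ℤ I := by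
    refine MvPolynomial.algHom_ext fun k => ?_
    rw [AlgHom.comp_apply, identify_X]
    split_ifs with hk
    · subst hk
      exact Ideal.Quotient.eq.2 (Ideal.mem_span_singleton_self _)
    · rfl
  rw [← Ideal.mem_span_singleton, ← Ideal.Quotient.eq]
  exact (DFunLike.congr_fun h a).symm

theorem X_sub_X_dvd_iff {i j : Fin N} {a : MvPolynomial (Fin N) ℤ} :
    (MvPolynomial.X i - MvPolynomial.X j : MvPolynomial (Fin N) ℤ) ∣ a ↔ identify i j a = 0 := by
  constructor
  · rintro ⟨b, rfl⟩
    rw [map_mul, map_sub, identify_X, identify_X, if_pos rfl]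
    simp
  · intro h
    have := X_sub_X_dvd_sub_identify i j a
    rwa [h, sub_zero] at this

theorem prime_X_sub_X {i j : Fin N} (hij : i ≠ j) :
    Prime (MvPolynomial.X i - MvPolynomial.X j : MvPolynomial (Fin N) ℤ) := by
  refine ⟨sub_ne_zero.2 fun h => hij (MvPolynomial.X_injective h), fun h => ?_, fun a b h => ?_⟩
  · have := (X_sub_X_dvd_iff (a := 1)).1 h.dvd
    rw [map_one] at this
    exact one_ne_zero this
  · rw [X_sub_X_dvd_iff, map_mul, mul_eq_zero] at h
    rwa [X_sub_X_dvd_iff, X_sub_X_dvd_iff]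

theorem algebraMap_ratFunc_injective :
    Function.Injective (algebraMap (MvPolynomial (Fin N) ℤ) (RatFunc N)) :=
  IsFractionRing.injective _ _

/-- The pairs of a rational function without pole along `X_i = X_j` and its restriction to this
locus. -/
def residuePairs (i j : Fin N) : Subring (RatFunc N × RatFunc N) where
  carrier := {x | ∃ a s, identify i j s ≠ 0 ∧ x.1 * algebraMap _ (RatFunc N) s = algebraMap _ _ a ∧
    x.2 * algebraMap _ (RatFunc N) (identify i j s) = algebraMap _ _ (identify i j a)}
  mul_mem' := by
    rintro ⟨x, x'⟩ ⟨y, y'⟩ ⟨a, s, h1, h2, h3⟩ ⟨b, t, h4, h5, h6⟩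
    refine ⟨a * b, s * t, by rw [map_mul]; exact mul_ne_zero h1 h4, ?_, ?_⟩
    · rw [map_mul, map_mul, ← h2, ← h5]
      change x * y * _ = x * _ * (y * _)
      ring
    · simp only [map_mul, ← h3, ← h6]
      change x' * y' * _ = _
      ring
  one_mem' := ⟨1, 1, by simp, by simp, by simp⟩
  add_mem' := by
    rintro ⟨x, x'⟩ ⟨y, y'⟩ ⟨a, s, h1, h2, h3⟩ ⟨b, t, h4, h5, h6⟩
    refine ⟨a * t + b * s, s * t, by rw [map_mul]; exact mul_ne_zero h1 h4, ?_, ?_⟩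
    · simp only [map_mul, map_add, ← h2, ← h5]
      change (x + y) * _ = _
      ring
    · simp only [map_mul, map_add, ← h3, ← h6]
      change (x' + y') * _ = _
      ring
  zero_mem' := ⟨0, 1, by simp, by simp, by simp⟩
  neg_mem' := by
    rintro ⟨x, x'⟩ ⟨a, s, h1, h2, h3⟩
    refine ⟨-a, s, h1, ?_, ?_⟩
    · simp only [map_neg, ← h2]
      change (-x) * _ = _
      ring
    · simp only [map_neg, ← h3]
      change (-x') * _ = _
      ring

variable {i j : Fin N} {x y : RatFunc N}

theorem algebraMap_mem_residuePairs (a : MvPolynomial (Fin N) ℤ) :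
    (algebraMap _ (RatFunc N) a, algebraMap _ (RatFunc N) (identify i j a)) ∈ residuePairs i j :=
  ⟨a, 1, by simp, by simp, by simp⟩

theorem inv_mem_residuePairs (h : (x, y) ∈ residuePairs i j) (hy : y ≠ 0) :
    (x⁻¹, y⁻¹) ∈ residuePairs i j := by
  obtain ⟨a, s, h1, h2, h3⟩ := h
  dsimp only at h2 h3
  have ha : identify i j a ≠ 0 := by
    intro ha
    rw [ha, map_zero, mul_eq_zero] at h3
    rcases h3 with h3 | h3
    · exact hy h3
    · exact h1 ((map_eq_zero_iff _ algebraMap_ratFunc_injective).1 h3)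
  have ha' : a ≠ 0 := by
    rintro rfl
    exact ha (map_zero _)
  have hx : x ≠ 0 := by
    rintro rfl
    rw [zero_mul, eq_comm, map_eq_zero_iff _ algebraMap_ratFunc_injective] at h2
    exact ha' h2
  refine ⟨s, a, ha, ?_, ?_⟩
  · rw [← h2]
    exact inv_mul_cancel_left₀ hx _
  · rw [← h3]
    exact inv_mul_cancel_left₀ hy _

theorem zpow_mem_residuePairs (h : (x, y) ∈ residuePairs i j) (hy : y ≠ 0) (n : ℤ) :
    (x ^ n, y ^ n) ∈ residuePairs i j := by
  rcases n with n | n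
  · simpa using Subring.pow_mem _ h n
  · simpa using inv_mem_residuePairs (Subring.pow_mem _ h (n + 1)) (pow_ne_zero _ hy)

theorem prod_mem_residuePairs {ι : Type*} {s : Finset ι} {f g : ι → RatFunc N}
    (h : ∀ a ∈ s, (f a, g a) ∈ residuePairs i j) :
    (∏ a ∈ s, f a, ∏ a ∈ s, g a) ∈ residuePairs i j := by
  have := Subring.prod_mem (residuePairs i j) h
  rwa [show ∏ a ∈ s, (f a, g a) = (∏ a ∈ s, f a, ∏ a ∈ s, g a) from
    Prod.ext (Prod.fst_prod ..) (Prod.snd_prod ..)] at this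

/-- A rational function that vanishes along `X_i = X_j` is divisible by `X_i - X_j`. -/
theorem div_mem_residuePairs (hij : i ≠ j) (h : (x, 0) ∈ residuePairs i j) :
    ∃ y, (x / algebraMap _ (RatFunc N) (MvPolynomial.X i - MvPolynomial.X j :
      MvPolynomial (Fin N) ℤ), y) ∈
      residuePairs i j := by
  obtain ⟨a, s, h1, h2, h3⟩ := h
  dsimp only at h2 h3
  rw [zero_mul, eq_comm, map_eq_zero_iff _ algebraMap_ratFunc_injective, ← X_sub_X_dvd_iff] at h3
  obtain ⟨b, rfl⟩ := h3
  have ht : algebraMap _ (RatFunc N) (MvPolynomial.X i - MvPolynomial.X j :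
      MvPolynomial (Fin N) ℤ) ≠ 0 := by
    rw [Ne, map_eq_zero_iff _ algebraMap_ratFunc_injective]
    exact (prime_X_sub_X hij).ne_zero
  have hs : algebraMap _ (RatFunc N) (identify i j s) ≠ 0 := by
    rwa [Ne, map_eq_zero_iff _ algebraMap_ratFunc_injective]
  refine ⟨algebraMap _ _ (identify i j b) / algebraMap _ _ (identify i j s), b, s, h1, ?_, ?_⟩
  · dsimp only
    rw [div_mul_eq_mul_div, h2, map_mul, mul_div_cancel_left₀ _ ht]
  · dsimp only
    rw [div_mul_cancel₀ _ hs]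

/-- A rational function whose denominator is a product of differences of variables, without
pole along the zeros of these differences, is a polynomial. -/
theorem exists_polynomial_of_prod {x : RatFunc N} (L : Multiset (Fin N × Fin N))
    (hL : ∀ p ∈ L, p.1 ≠ p.2 ∧ ∃ a s : MvPolynomial (Fin N) ℤ,
      ¬ (MvPolynomial.X p.1 - MvPolynomial.X p.2) ∣ s ∧ x * algebraMap _ _ s = algebraMap _ _ a)
    (hx : ∃ a : MvPolynomial (Fin N) ℤ, x * algebraMap _ _
      (L.map fun p => (MvPolynomial.X p.1 - MvPolynomial.X p.2 :
      MvPolynomial (Fin N) ℤ)).prod = algebraMap _ _ a) :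
    ∃ a : MvPolynomial (Fin N) ℤ, algebraMap _ _ a = x := by
  induction L using Multiset.induction_on with
  | empty =>
    obtain ⟨a, ha⟩ := hx
    exact ⟨a, by simpa using ha.symm⟩
  | cons p L ih =>
    refine ih (fun q hq => hL q (Multiset.mem_cons_of_mem hq)) ?_
    obtain ⟨a, ha⟩ := hx
    obtain ⟨hp, b, s, hs, hb⟩ := hL p (Multiset.mem_cons_self p L)
    have hpr := prime_X_sub_X (N := N) hp
    rw [Multiset.map_cons, Multiset.prod_cons, map_mul] at ha
    have h1 : (MvPolynomial.X p.1 - MvPolynomial.X p.2 : MvPolynomial (Fin N) ℤ) ∣ a * s := by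
      refine ⟨b * (L.map fun p => (MvPolynomial.X p.1 - MvPolynomial.X p.2 :
        MvPolynomial (Fin N) ℤ)).prod, algebraMap_ratFunc_injective ?_⟩
      rw [map_mul, map_mul, map_mul, ← ha, ← hb]
      ring
    obtain ⟨d, rfl⟩ := (hpr.dvd_or_dvd h1).resolve_right hs
    refine ⟨d, ?_⟩
    have h0 : algebraMap _ (RatFunc N) (MvPolynomial.X p.1 - MvPolynomial.X p.2 :
        MvPolynomial (Fin N) ℤ) ≠ 0 := by
      rw [Ne, map_eq_zero_iff _ algebraMap_ratFunc_injective]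
      exact hpr.ne_zero
    apply mul_left_cancel₀ h0
    rw [← map_mul, ← ha]
    ring

end Residue

/-! ### Averaging over sets of components -/

section Average

/-- Suppose that each `c` has a finite set of components `K c`, and that the moves `m c s`, for
subsets `s` of `K c`, are involutions that preserve the sets of components. Then sums over all `c`
may be averaged over the moves. -/
theorem sum_eq_sum_average {α κ F : Type*} [Field F] [CharZero F] [DecidableEq κ] (A : Finset α)
    (K : α → Finset κ) (m : α → Finset κ → α) (w : α → F)
    (h1 : ∀ c ∈ A, ∀ s ⊆ K c, m c s ∈ A) (h2 : ∀ c ∈ A, ∀ s ⊆ K c, K (m c s) = K c)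
    (h3 : ∀ c ∈ A, ∀ s ⊆ K c, m (m c s) s = c) :
    ∑ c ∈ A, w c = ∑ c ∈ A, (2 ^ (K c).card)⁻¹ * ∑ s ∈ (K c).powerset, w (m c s) := by
  have e : ∀ c ∈ A, w c = ∑ s ∈ (K c).powerset, (2 ^ (K c).card)⁻¹ * w c := by
    intro c _
    rw [Finset.sum_const, Finset.card_powerset, nsmul_eq_mul, ← mul_assoc]
    push_cast
    rw [mul_inv_cancel₀ (pow_ne_zero _ two_ne_zero), one_mul]
  rw [Finset.sum_congr rfl e]
  simp only [Finset.mul_sum]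
  rw [Finset.sum_sigma', Finset.sum_sigma']
  refine Finset.sum_bij' (fun x _ => ⟨m x.1 x.2, x.2⟩) (fun x _ => ⟨m x.1 x.2, x.2⟩) ?_ ?_ ?_ ?_ ?_
  all_goals
    rintro ⟨c, s⟩ h
    obtain ⟨hc, hs⟩ := Finset.mem_sigma.1 h
    have hs' := Finset.mem_powerset.1 hs
    dsimp only at hc hs hs'
  · exact Finset.mem_sigma.2 ⟨h1 c hc s hs', by rw [h2 c hc s hs']; exact hs⟩
  · exact Finset.mem_sigma.2 ⟨h1 c hc s hs', by rw [h2 c hc s hs']; exact hs⟩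
  · simp only [h3 c hc s hs']
  · simp only [h3 c hc s hs']
  · simp only [h3 c hc s hs', h2 c hc s hs']

end Average

end SlFoam
end

noncomputable section
namespace SlFoam
open LabelledComplex

variable {C : LabelledComplex} {S T E : Set Triangle} {N : ℕ} {c : Triangle → Finset (Fin N)}
  {i j : Fin N}

/-! ### Euler characteristics of bichrome surfaces under Kempe moves -/

theorem bichrome_comm (C : LabelledComplex) (c : Triangle → Finset (Fin N)) (i j : Fin N) :
    bichrome C c i j = bichrome C c j i := by
  rw [bichrome_eq, bichrome_eq, symmDiff_comm]

theorem IsColoring.isClosedSurface_bichrome (hC : IsClosedFoam C) (hc : IsColoring N C c)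
    (i j : Fin N) : IsClosedSurface C (bichrome C c i j) := by
  rw [bichrome_eq]
  exact (hc.isSheet hC i).symmDiff (hc.isSheet hC j)

theorem IsColoring.even_eulerChar (hC : IsClosedFoam C) (hc : IsColoring N C c)
    (hS : IsComponentUnion (bichrome C c i j) S) : Even (eulerChar S) :=
  hS.symmDiff_monochrome.even_eulerChar hC (hc.isSheet hC i) (hc.isSheet hC j)

theorem IsColoring.even_eulerChar_bichrome (hC : IsClosedFoam C) (hc : IsColoring N C c)
    (i j : Fin N) : Even (eulerChar (bichrome C c i j)) :=
  hc.even_eulerChar hC (isComponentUnion_self (hc.isClosedSurface_bichrome hC i j))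

/-- The change of the Euler characteristic of a bichrome surface under a Kempe move. -/
def eulerChange (C : LabelledComplex) (c : Triangle → Finset (Fin N)) (i j : Fin N)
    (S : Set Triangle) (p : Fin N × Fin N) : ℤ :=
  eulerChar (bichrome C (kempe c i j S) p.1 p.2) - eulerChar (bichrome C c p.1 p.2)

theorem eulerChange_swap (p : Fin N × Fin N) :
    eulerChange C c i j S p.swap = eulerChange C c i j S p := by
  simp only [eulerChange, Prod.fst_swap, Prod.snd_swap, bichrome_comm C _ p.2 p.1]

theorem eulerChange_left (hS : S ⊆ bichrome C c i j) {k : Fin N} (hi : k ≠ i) (hj : k ≠ j) :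
    eulerChange C c i j S (i, k) =
      eulerChar (symmDiff (symmDiff (monochrome C c i) S) (monochrome C c k)) -
        eulerChar (symmDiff (monochrome C c i) (monochrome C c k)) := by
  simp only [eulerChange, bichrome_eq, monochrome_kempe_left hS, monochrome_kempe_of_ne hi hj]

theorem eulerChange_right (hS : S ⊆ bichrome C c i j) {k : Fin N} (hi : k ≠ i) (hj : k ≠ j) :
    eulerChange C c i j S (j, k) =
      eulerChar (symmDiff (symmDiff (monochrome C c j) S) (monochrome C c k)) -
        eulerChar (symmDiff (monochrome C c j) (monochrome C c k)) := by
  simp only [eulerChange, bichrome_eq, monochrome_kempe_right hS, monochrome_kempe_of_ne hi hj]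

theorem eulerChange_self (hS : S ⊆ bichrome C c i j) : eulerChange C c i j S (i, j) = 0 := by
  rw [eulerChange, bichrome_kempe hS, sub_self]

theorem eulerChange_of_ne {k l : Fin N} (hi : k ≠ i) (hj : k ≠ j) (hi' : l ≠ i) (hj' : l ≠ j) :
    eulerChange C c i j S (k, l) = 0 := by
  simp only [eulerChange, bichrome_eq, monochrome_kempe_of_ne hi hj,
    monochrome_kempe_of_ne hi' hj', sub_self]

theorem IsColoring.eulerChange_right_eq (hC : IsClosedFoam C) (hc : IsColoring N C c)
    (hS : IsComponentUnion (bichrome C c i j) S) {k : Fin N} (hi : k ≠ i) (hj : k ≠ j) :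
    eulerChange C c i j S (j, k) = -eulerChange C c i j S (i, k) := by
  rw [eulerChange_left hS.subset hi hj, eulerChange_right hS.subset hi hj]
  exact hS.symmDiff_monochrome.eulerChar_symmDiff_add hC (hc.isSheet hC i) (hc.isSheet hC j)
    (hc.isSheet hC k)

theorem IsColoring.eulerChange_union_left (hC : IsClosedFoam C) (hc : IsColoring N C c)
    (hS : IsComponentUnion (bichrome C c i j) S) (hT : IsComponentUnion (bichrome C c i j) T)
    (hd : Disjoint S T) {k : Fin N} (hi : k ≠ i) (hj : k ≠ j) :
    eulerChange C c i j (S ∪ T) (i, k) =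
      eulerChange C c i j S (i, k) + eulerChange C c i j T (i, k) := by
  rw [eulerChange_left hS.subset hi hj, eulerChange_left hT.subset hi hj,
    eulerChange_left (hS.union hT).subset hi hj]
  exact hS.symmDiff_monochrome.eulerChar_symmDiff_union hC (hc.isSheet hC i) (hc.isSheet hC j)
    hT.symmDiff_monochrome hd (hc.isSheet hC k)

/-- A case distinction for pairs of pigments, up to the order. -/
theorem pair_cases {Q : Fin N × Fin N → Prop} (hne : i ≠ j) (hswap : ∀ p, Q p → Q p.swap)
    (h1 : Q (i, j)) (h2 : ∀ k, k ≠ i → k ≠ j → Q (i, k)) (h3 : ∀ k, k ≠ i → k ≠ j → Q (j, k))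
    (h4 : ∀ k l, k ≠ i → k ≠ j → l ≠ i → l ≠ j → Q (k, l)) (p : Fin N × Fin N)
    (hp : p.1 ≠ p.2) : Q p := by
  obtain ⟨k, l⟩ := p
  dsimp only at hp
  by_cases hk : k = i
  · subst hk
    by_cases hl : l = j
    · exact hl ▸ h1
    · exact h2 l hp.symm hl
  by_cases hk' : k = j
  · subst hk'
    by_cases hl : l = i
    · exact hl ▸ hswap _ h1
    · exact h3 l hl hp.symm
  by_cases hl : l = i
  · subst hl
    exact hswap _ (h2 k hk hk')
  by_cases hl' : l = j
  · subst hl'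
    exact hswap _ (h3 k hk hk')
  exact h4 k l hk hk' hl hl'

theorem IsColoring.eulerChange_union (hC : IsClosedFoam C) (hc : IsColoring N C c) (hne : i ≠ j)
    (hS : IsComponentUnion (bichrome C c i j) S) (hT : IsComponentUnion (bichrome C c i j) T)
    (hd : Disjoint S T) {p : Fin N × Fin N} (hp : p.1 ≠ p.2) :
    eulerChange C c i j (S ∪ T) p = eulerChange C c i j S p + eulerChange C c i j T p := by
  refine pair_cases (Q := fun p => eulerChange C c i j (S ∪ T) p =
    eulerChange C c i j S p + eulerChange C c i j T p) hne (fun p h => ?_) ?_ (fun k hi hj => ?_)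
    (fun k hi hj => ?_) (fun k l hi hj hi' hj' => ?_) p hp
  · simpa only [eulerChange_swap] using h
  · rw [eulerChange_self hS.subset, eulerChange_self hT.subset,
      eulerChange_self (hS.union hT).subset, add_zero]
  · exact hc.eulerChange_union_left hC hS hT hd hi hj
  · rw [hc.eulerChange_right_eq hC hS hi hj, hc.eulerChange_right_eq hC hT hi hj,
      hc.eulerChange_right_eq hC (hS.union hT) hi hj, hc.eulerChange_union_left hC hS hT hd hi hj]
    ring
  · simp only [eulerChange_of_ne hi hj hi' hj', add_zero]

theorem IsColoring.eulerChange_swap_pigments (hC : IsClosedFoam C) (hc : IsColoring N C c)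
    (hne : i ≠ j) (hS : IsComponentUnion (bichrome C c i j) S) {p : Fin N × Fin N}
    (hp : p.1 ≠ p.2) :
    eulerChange C c i j S (Equiv.swap i j p.1, Equiv.swap i j p.2) = -eulerChange C c i j S p := by
  refine pair_cases (Q := fun p =>
    eulerChange C c i j S (Equiv.swap i j p.1, Equiv.swap i j p.2) = -eulerChange C c i j S p)
    hne (fun p h => ?_) ?_ (fun k hi hj => ?_)
    (fun k hi hj => ?_) (fun k l hi hj hi' hj' => ?_) p hp
  · rw [eulerChange_swap, ← h, ← eulerChange_swap]
    rfl
  · simp only [Equiv.swap_apply_left, Equiv.swap_apply_right]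
    rw [← eulerChange_swap, Prod.swap_prod_mk, eulerChange_self hS.subset, neg_zero]
  · simp only [Equiv.swap_apply_left, Equiv.swap_apply_of_ne_of_ne hi hj]
    exact hc.eulerChange_right_eq hC hS hi hj
  · simp only [Equiv.swap_apply_right, Equiv.swap_apply_of_ne_of_ne hi hj]
    rw [hc.eulerChange_right_eq hC hS hi hj, neg_neg]
  · simp only [Equiv.swap_apply_of_ne_of_ne hi hj, Equiv.swap_apply_of_ne_of_ne hi' hj',
      eulerChange_of_ne hi hj hi' hj', neg_zero]

theorem IsColoring.even_eulerChange (hC : IsClosedFoam C) (hc : IsColoring N C c)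
    (hS : IsComponentUnion (bichrome C c i j) S) (p : Fin N × Fin N) :
    Even (eulerChange C c i j S p) :=
  ((hc.kempe hC hS).even_eulerChar_bichrome hC _ _).sub (hc.even_eulerChar_bichrome hC _ _)

/-! ### Sets of components -/

open Classical in
/-- The components of a surface. -/
def components (E : Set Triangle) : Finset (Set Triangle) :=
  if h : {K | IsComponent E K}.Finite then h.toFinset else ∅

theorem mem_components (hE : E.Finite) {K : Set Triangle} : K ∈ components E ↔ IsComponent E K := by
  have h : {K | IsComponent E K}.Finite := hE.finite_subsets.subset fun K hK => hK.1.subset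
  rw [components, dif_pos h, Set.Finite.mem_toFinset]
  rfl

theorem isComponentUnion_sUnion {s : Finset (Set Triangle)} (h : ∀ K ∈ s, IsComponent E K) :
    IsComponentUnion E (⋃₀ ↑s) := by
  classical
  induction s using Finset.induction_on with
  | empty =>
    rw [Finset.coe_empty, Set.sUnion_empty]
    exact isComponentUnion_empty E
  | insert K s hK ih =>
    rw [Finset.coe_insert, Set.sUnion_insert]
    exact (h K (Finset.mem_insert_self _ _)).1.union
      (ih fun L hL => h L (Finset.mem_insert_of_mem hL))

theorem IsComponent.disjoint_sUnion {s : Finset (Set Triangle)} (h : ∀ K ∈ s, IsComponent E K)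
    {K : Set Triangle} (hK : IsComponent E K) (hs : K ∉ s) : Disjoint K (⋃₀ ↑s) := by
  rw [Set.disjoint_sUnion_right]
  intro L hL
  rw [Set.disjoint_iff_inter_eq_empty]
  by_contra hne
  exact hs (hK.eq_of_inter (h L hL) (Set.nonempty_iff_ne_empty.2 hne) ▸ hL)

theorem sum_sUnion_components {s : Finset (Set Triangle)} (h : ∀ K ∈ s, IsComponent E K)
    (f : Set Triangle → ℤ) (h0 : f ∅ = 0) (hf : ∀ S T, IsComponentUnion E S →
      IsComponentUnion E T → Disjoint S T → f (S ∪ T) = f S + f T) :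
    f (⋃₀ ↑s) = ∑ K ∈ s, f K := by
  classical
  induction s using Finset.induction_on with
  | empty => simpa using h0
  | insert K s hK ih =>
    have h' : ∀ L ∈ s, IsComponent E L := fun L hL => h L (Finset.mem_insert_of_mem hL)
    have hK' := h K (Finset.mem_insert_self _ _)
    rw [Finset.coe_insert, Set.sUnion_insert, Finset.sum_insert hK, ← ih h',
      hf _ _ hK'.1 (isComponentUnion_sUnion h') (hK'.disjoint_sUnion h' hK)]

theorem eulerChar_sUnion (hC : IsClosedFoam C) (hE : IsClosedSurface C E)
    {s : Finset (Set Triangle)} (h : ∀ K ∈ s, IsComponent E K) :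
    eulerChar (⋃₀ ↑s) = ∑ K ∈ s, eulerChar K :=
  sum_sUnion_components h _ (by simp [eulerChar]) fun S T hS hT hd =>
    hS.eulerChar_union hC hE hT hd

theorem kempe_empty : kempe c i j ∅ = c := funext fun _ => kempe_of_notMem (Set.notMem_empty _)

theorem IsColoring.eulerChange_sUnion (hC : IsClosedFoam C) (hc : IsColoring N C c) (hne : i ≠ j)
    {s : Finset (Set Triangle)} (h : ∀ K ∈ s, IsComponent (bichrome C c i j) K)
    {p : Fin N × Fin N} (hp : p.1 ≠ p.2) :
    eulerChange C c i j (⋃₀ ↑s) p = ∑ K ∈ s, eulerChange C c i j K p :=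
  sum_sUnion_components h (fun S => eulerChange C c i j S p)
    (by simp only [eulerChange, kempe_empty, sub_self])
    fun S T hS hT hd => hc.eulerChange_union hC hne hS hT hd hp

theorem sUnion_components (hE : ∀ a b c, (a, b, c) ∈ E → (b, c, a) ∈ E) (hfin : E.Finite) :
    ⋃₀ ↑(components E) = E := by
  ext t
  rw [Set.mem_sUnion]
  constructor
  · rintro ⟨K, hK, ht⟩
    exact ((mem_components hfin).1 hK).1.subset ht
  · intro ht
    obtain ⟨K, hK, ht'⟩ := exists_isComponent hE ht
    exact ⟨K, (mem_components hfin).2 hK, ht'⟩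

theorem sum_half {ι : Type*} (s : Finset ι) (f : ι → ℤ) (hf : ∀ a ∈ s, Even (f a)) :
    (∑ a ∈ s, f a) / 2 = ∑ a ∈ s, f a / 2 := by
  have h : ∑ a ∈ s, f a = 2 * ∑ a ∈ s, f a / 2 := by
    rw [Finset.mul_sum]
    refine Finset.sum_congr rfl fun a ha => ?_
    obtain ⟨b, hb⟩ := hf a ha
    omega
  omega

end SlFoam
end

noncomputable section
namespace SlFoam
open LabelledComplex

variable {C : LabelledComplex} {S T E : Set Triangle} {N : ℕ} {c : Triangle → Finset (Fin N)}
  {i j : Fin N}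

/-! ### The evaluation as a finite sum -/

theorem finite_colorings (hC : IsClosedFoam C) : {c | IsColoring N C c}.Finite := by
  have : Finite C.tri := hC.finite
  refine Set.Finite.of_finite_image
    (f := fun (c : Triangle → Finset (Fin N)) (t : C.tri) => c t) (Set.toFinite _) ?_
  intro c hc d hd h
  funext t
  by_cases ht : t ∈ C.tri
  · exact congrFun h ⟨t, ht⟩
  · rw [hc.off t ht, hd.off t ht]

/-- The difference of the variables of two pigments, as a rational function. -/
def rootDiff (p : Fin N × Fin N) : RatFunc N :=
  algebraMap (MvPolynomial (Fin N) ℤ) (RatFunc N) (MvPolynomial.X p.1 - MvPolynomial.X p.2)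

theorem rootDiff_ne_zero {p : Fin N × Fin N} (hp : p.1 ≠ p.2) : rootDiff p ≠ 0 := by
  rw [rootDiff, Ne, map_eq_zero_iff _ algebraMap_ratFunc_injective]
  exact (prime_X_sub_X hp).ne_zero

theorem rootDiff_swap (p : Fin N × Fin N) : rootDiff p.swap = -rootDiff p := by
  rw [rootDiff, rootDiff, ← map_neg, neg_sub]
  rfl

theorem ne_of_mem_pigmentPairs {p : Fin N × Fin N} (hp : p ∈ pigmentPairs N) : p.1 ≠ p.2 :=
  (Finset.mem_filter.1 hp).2.ne

/-- The contribution of a coloring to the evaluation. -/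
def coloringTerm (C : LabelledComplex) (k : Triangle × ℕ →₀ ℕ) (c : Triangle → Finset (Fin N)) :
    RatFunc N :=
  (-1) ^ signExponent C c * algebraMap (MvPolynomial (Fin N) ℤ) (RatFunc N) (numerator c k) /
    denominator C c

theorem evaluation_eq_sum (hC : IsClosedFoam C) (k : Triangle × ℕ →₀ ℕ) :
    evaluation N C k = ∑ c ∈ (finite_colorings hC).toFinset, coloringTerm C k c :=
  finsum_mem_eq_finite_toFinset_sum _ _

theorem denominator_eq (C : LabelledComplex) (c : Triangle → Finset (Fin N)) :
    denominator C c = ∏ p ∈ pigmentPairs N, rootDiff p ^ (eulerChar (bichrome C c p.1 p.2) / 2) :=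
  rfl

theorem denominator_ne_zero (C : LabelledComplex) (c : Triangle → Finset (Fin N)) :
    denominator C c ≠ 0 := by
  rw [denominator_eq]
  exact Finset.prod_ne_zero_iff.2 fun p hp =>
    zpow_ne_zero _ (rootDiff_ne_zero (ne_of_mem_pigmentPairs hp))

/-- The elementary symmetric polynomial in the variables of a set of pigments. -/
def esymmOn (s : Finset (Fin N)) (w : ℕ) : MvPolynomial (Fin N) ℤ :=
  ∑ u ∈ s.powersetCard w, ∏ i ∈ u, MvPolynomial.X i

theorem rename_esymmOn (σ : Equiv.Perm (Fin N)) (s : Finset (Fin N)) (w : ℕ) :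
    MvPolynomial.rename σ (esymmOn s w) = esymmOn (s.map σ.toEmbedding) w := by
  rw [esymmOn, esymmOn, Finset.powersetCard_map, Finset.sum_map, map_sum]
  refine Finset.sum_congr rfl fun u _ => ?_
  rw [map_prod]
  change _ = ∏ i ∈ u.map σ.toEmbedding, _
  rw [Finset.prod_map]
  refine Finset.prod_congr rfl fun i _ => ?_
  rw [MvPolynomial.rename_X]
  rfl

theorem numerator_eq (c : Triangle → Finset (Fin N)) (k : Triangle × ℕ →₀ ℕ) :
    numerator c k = ∏ d ∈ k.support, esymmOn (c d.1) d.2 ^ k d := rfl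

theorem neg_one_zpow_cast (n : ℤ) : (-1 : RatFunc N) ^ n = (((-1 : ℤˣ) ^ n : ℤˣ) : ℤ) := by
  rcases Int.even_or_odd n with h | h
  · rw [h.neg_one_zpow, h.neg_one_zpow]
    simp
  · rw [h.neg_one_zpow, h.neg_one_zpow]
    simp

theorem neg_one_zpow_congr' {m n l : ℤ} (h : (-1 : ℤˣ) ^ m = (-1) ^ n * (-1) ^ l) :
    (-1 : RatFunc N) ^ m = (-1) ^ n * (-1) ^ l := by
  rw [neg_one_zpow_cast, h, neg_one_zpow_cast, neg_one_zpow_cast]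
  push_cast
  rfl

/-! ### Symmetry of the evaluation -/

/-- The permutation of the variables, on rational functions. -/
def permute (σ : Equiv.Perm (Fin N)) : RatFunc N ≃+* RatFunc N :=
  IsFractionRing.ringEquivOfRingEquiv (MvPolynomial.renameEquiv ℤ σ).toRingEquiv

theorem permute_algebraMap (σ : Equiv.Perm (Fin N)) (a : MvPolynomial (Fin N) ℤ) :
    permute σ (algebraMap _ (RatFunc N) a) = algebraMap _ _ (MvPolynomial.rename σ a) :=
  IsFractionRing.ringEquivOfRingEquiv_algebraMap _ _

theorem permute_mul (σ τ : Equiv.Perm (Fin N)) (x : RatFunc N) :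
    permute (σ * τ) x = permute σ (permute τ x) := by
  obtain ⟨a, s, hs, rfl⟩ := IsFractionRing.div_surjective (A := MvPolynomial (Fin N) ℤ) x
  simp only [map_div₀, permute_algebraMap, MvPolynomial.rename_rename, Equiv.Perm.coe_mul]

theorem permute_one (x : RatFunc N) : permute 1 x = x := by
  obtain ⟨a, s, hs, rfl⟩ := IsFractionRing.div_surjective (A := MvPolynomial (Fin N) ℤ) x
  simp only [map_div₀, permute_algebraMap, Equiv.Perm.coe_one, MvPolynomial.rename_id_apply]

theorem permute_rootDiff (σ : Equiv.Perm (Fin N)) (p : Fin N × Fin N) :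
    permute σ (rootDiff p) = rootDiff (σ p.1, σ p.2) := by
  rw [rootDiff, permute_algebraMap, map_sub, MvPolynomial.rename_X, MvPolynomial.rename_X]
  rfl

theorem kempe_bichrome (hc : IsColoring N C c) (i j : Fin N) :
    kempe c i j (bichrome C c i j) = fun t => (c t).map (Equiv.swap i j).toEmbedding := by
  funext t
  by_cases ht : t ∈ bichrome C c i j
  · exact kempe_of_mem ht
  · rw [kempe_of_notMem ht]
    by_cases htri : t ∈ C.tri
    · ext k
      rw [mem_map_swap]
      have h : i ∈ c t ↔ j ∈ c t := by
        simp only [bichrome, Set.mem_ofPred_eq, htri, true_and, Xor] at ht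
        tauto
      by_cases hi : k = i
      · rw [hi, Equiv.swap_apply_left, h]
      by_cases hj : k = j
      · rw [hj, Equiv.swap_apply_right, h]
      rw [Equiv.swap_apply_of_ne_of_ne hi hj]
    · rw [hc.off t htri, Finset.map_empty]

/-- The exchange of consecutive pigments in a coloring exchanges the variables in its
contribution. -/
theorem permute_coloringTerm (hC : IsClosedFoam C) (hc : IsColoring N C c) (hij : (j : ℕ) = i + 1)
    (k : Triangle × ℕ →₀ ℕ) :
    permute (Equiv.swap i j) (coloringTerm C k c) =
      coloringTerm C k (kempe c i j (bichrome C c i j)) := by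
  have hE := hc.isClosedSurface_bichrome hC i j
  have hsign := neg_one_zpow_congr' (N := N)
    (neg_one_zpow_signExponent_kempe hC hc hij (isComponentUnion_self hE))
  have hk := kempe_bichrome hc i j
  set c' := kempe c i j (bichrome C c i j)
  have hnum : MvPolynomial.rename (Equiv.swap i j) (numerator c k) = numerator c' k := by
    rw [numerator_eq, numerator_eq, map_prod, hk]
    simp only [map_pow, rename_esymmOn]
  have hmono : ∀ a, monochrome C c' a = monochrome C c (Equiv.swap i j a) := by
    intro a
    ext t
    simp only [monochrome, Set.mem_ofPred_eq, hk, mem_map_swap]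
  have hbi : ∀ a b, bichrome C c' a b =
      bichrome C c (Equiv.swap i j a) (Equiv.swap i j b) := by
    intro a b
    rw [bichrome_eq, bichrome_eq, hmono, hmono]
  have hden : permute (Equiv.swap i j) (denominator C c) =
      (-1) ^ (eulerChar (bichrome C c i j) / 2) * denominator C c' := by
    rw [denominator_eq, denominator_eq, map_prod,
      ← Finset.mul_prod_erase _ _ (mem_pigmentPairs hij),
      ← Finset.mul_prod_erase (pigmentPairs N)
        (fun p => rootDiff p ^ (eulerChar (bichrome C c' p.1 p.2) / 2)) (mem_pigmentPairs hij),
      ← mul_assoc]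
    congr 1
    · simp only [map_zpow₀, permute_rootDiff, hbi, Equiv.swap_apply_left, Equiv.swap_apply_right]
      rw [← Prod.swap_prod_mk, rootDiff_swap, bichrome_comm C c j i, ← mul_zpow, neg_one_mul]
    · refine Finset.prod_bij' (fun p _ => (Equiv.swap i j p.1, Equiv.swap i j p.2))
        (fun p _ => (Equiv.swap i j p.1, Equiv.swap i j p.2))
        (fun p hp => swap_mem_pigmentPairs hij hp) (fun p hp => swap_mem_pigmentPairs hij hp)
        (fun p _ => by simp) (fun p _ => by simp) fun p _ => ?_
      simp only [map_zpow₀, permute_rootDiff, hbi, Equiv.swap_apply_self]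
  rw [coloringTerm, coloringTerm, map_div₀, map_mul, permute_algebraMap, hnum, hden, hsign, map_zpow₀,
    map_neg, map_one]
  rcases Int.even_or_odd (eulerChar (bichrome C c i j) / 2) with h | h
  · rw [h.neg_one_zpow, one_mul, mul_one]
  · rw [h.neg_one_zpow]
    ring

theorem permute_swap_evaluation (hC : IsClosedFoam C) (hij : (j : ℕ) = i + 1)
    (k : Triangle × ℕ →₀ ℕ) :
    permute (Equiv.swap i j) (evaluation N C k) = evaluation N C k := by
  rw [evaluation_eq_sum hC, map_sum]
  have hmem : ∀ c ∈ (finite_colorings (N := N) hC).toFinset,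
      kempe c i j (bichrome C c i j) ∈ (finite_colorings hC).toFinset := by
    intro c hc
    rw [Set.Finite.mem_toFinset] at hc ⊢
    exact hc.kempe hC (isComponentUnion_self (hc.isClosedSurface_bichrome hC i j))
  refine Finset.sum_bij' (fun c _ => kempe c i j (bichrome C c i j))
    (fun c _ => kempe c i j (bichrome C c i j)) hmem hmem ?_ ?_ ?_
  · intro c hc
    rw [bichrome_kempe subset_rfl, kempe_kempe]
  · intro c hc
    rw [bichrome_kempe subset_rfl, kempe_kempe]
  · intro c hc
    exact permute_coloringTerm hC ((Set.Finite.mem_toFinset _).1 hc) hij k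

theorem permute_evaluation (hC : IsClosedFoam C) (k : Triangle × ℕ →₀ ℕ)
    (σ : Equiv.Perm (Fin N)) : permute σ (evaluation N C k) = evaluation N C k := by
  rcases N with _ | n
  · rw [Subsingleton.elim σ 1, permute_one]
  let H : Submonoid (Equiv.Perm (Fin (n + 1))) :=
    { carrier := {σ | permute σ (evaluation (n + 1) C k) = evaluation (n + 1) C k}
      one_mem' := permute_one _
      mul_mem' := fun {σ τ} h1 h2 => by
        change permute (σ * τ) _ = _
        rw [permute_mul, h2, h1] }
  have h : Submonoid.closure (Set.range fun i : Fin n => Equiv.swap i.castSucc i.succ) ≤ H := by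
    rw [Submonoid.closure_le]
    rintro _ ⟨i, rfl⟩
    exact permute_swap_evaluation hC (by simp) k
  rw [Equiv.Perm.mclosure_swap_castSucc_succ] at h
  exact h (Submonoid.mem_top σ)

/-! ### Regularity of the evaluation along `X_i = X_j` -/

theorem identify_rename_swap (a : MvPolynomial (Fin N) ℤ) :
    identify i j (MvPolynomial.rename (Equiv.swap i j) a) = identify i j a := by
  have h : (identify i j).comp (MvPolynomial.rename (Equiv.swap i j)) = identify i j := by
    refine MvPolynomial.algHom_ext fun k => ?_
    rw [AlgHom.comp_apply, MvPolynomial.rename_X, identify_X, identify_X, Equiv.swap_apply_def]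
    split_ifs <;> simp_all
  exact DFunLike.congr_fun h a

theorem prod_eq_mul_prod_components (hE : ∀ a b c, (a, b, c) ∈ E → (b, c, a) ∈ E)
    (hfin : E.Finite) {ι M : Type*} [CommMonoid M] (s : Finset ι) (t : ι → Triangle) (g : ι → M) :
    open Classical in
    ∏ d ∈ s, g d = (∏ d ∈ s, if t d ∈ E then 1 else g d) *
      ∏ K ∈ components E, ∏ d ∈ s, if t d ∈ K then g d else 1 := by
  classical
  rw [Finset.prod_comm, ← Finset.prod_mul_distrib]
  refine Finset.prod_congr rfl fun d _ => ?_
  by_cases hd : t d ∈ E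
  · obtain ⟨K, hK, hdK⟩ := exists_isComponent hE hd
    rw [if_pos hd, one_mul, Finset.prod_eq_single K]
    · rw [if_pos hdK]
    · intro L hL hne
      refine if_neg fun hdL => hne ?_
      exact ((mem_components hfin).1 hL).eq_of_inter hK ⟨_, hdL, hdK⟩
    · intro h
      exact (h ((mem_components hfin).2 hK)).elim
  · rw [if_neg hd, Finset.prod_eq_one, mul_one]
    intro K hK
    exact if_neg fun h => hd (((mem_components hfin).1 hK).1.subset h)

theorem rootDiff_mem_residuePairs (p : Fin N × Fin N) :
    (rootDiff p, algebraMap _ (RatFunc N) (identify i j (MvPolynomial.X p.1 - MvPolynomial.X p.2)))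
      ∈ residuePairs i j := algebraMap_mem_residuePairs _

theorem identify_rootDiff_ne_zero {p : Fin N × Fin N} (hp : p.1 ≠ p.2)
    (h1 : p ≠ (i, j)) (h2 : p ≠ (j, i)) : algebraMap _ (RatFunc N)
      (identify i j (MvPolynomial.X p.1 - MvPolynomial.X p.2)) ≠ 0 := by
  rw [Ne, map_eq_zero_iff _ algebraMap_ratFunc_injective, map_sub, identify_X, identify_X,
    sub_eq_zero]
  obtain ⟨a, b⟩ := p
  dsimp only at *
  split_ifs with ha hb hb
  · exact (hp (ha.trans hb.symm)).elim
  · intro h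
    exact h2 (Prod.ext ha (MvPolynomial.X_injective h).symm)
  · intro h
    exact h1 (Prod.ext (MvPolynomial.X_injective h) hb)
  · intro h
    exact hp (MvPolynomial.X_injective h)

/-- The change of the denominator by a Kempe move does not matter along `X_i = X_j`. -/
theorem prod_rootDiff_mem_residuePairs (hC : IsClosedFoam C) (hc : IsColoring N C c)
    (hij : (j : ℕ) = i + 1) (hS : IsComponentUnion (bichrome C c i j) S) :
    (∏ p ∈ pigmentPairs N, rootDiff p ^ (eulerChange C c i j S p / 2), 1) ∈ residuePairs i j := by
  have hne : i ≠ j := fun h => by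
    have := congrArg Fin.val h
    omega
  rw [← Finset.mul_prod_erase _ _ (mem_pigmentPairs hij), eulerChange_self hS.subset,
    Int.zero_ediv, zpow_zero, one_mul]
  have hnz : ∀ p ∈ (pigmentPairs N).erase (i, j), algebraMap _ (RatFunc N)
      (identify i j (MvPolynomial.X p.1 - MvPolynomial.X p.2)) ≠ 0 := by
    intro p hp
    have hp' := Finset.mem_erase.1 hp
    refine identify_rootDiff_ne_zero (ne_of_mem_pigmentPairs hp'.2) hp'.1 ?_
    rintro rfl
    have := (Finset.mem_filter.1 hp'.2).2
    rw [Fin.lt_def] at this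
    dsimp only at this
    omega
  have key := prod_mem_residuePairs (i := i) (j := j) (s := (pigmentPairs N).erase (i, j))
    (f := fun p => rootDiff p ^ (eulerChange C c i j S p / 2))
    (g := fun p => algebraMap _ (RatFunc N)
      (identify i j (MvPolynomial.X p.1 - MvPolynomial.X p.2)) ^ (eulerChange C c i j S p / 2))
    fun p hp => zpow_mem_residuePairs (rootDiff_mem_residuePairs p) (hnz p hp) _
  have h1 : ∏ p ∈ (pigmentPairs N).erase (i, j), algebraMap _ (RatFunc N)
      (identify i j (MvPolynomial.X p.1 - MvPolynomial.X p.2)) ^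
        (eulerChange C c i j S p / 2) = 1 := by
    have hexp : ∀ p ∈ (pigmentPairs N).erase (i, j), algebraMap _ (RatFunc N)
        (identify i j (MvPolynomial.X p.1 - MvPolynomial.X p.2)) ^
          (eulerChange C c i j S p / 2) *
        algebraMap _ (RatFunc N) (identify i j (MvPolynomial.X (Equiv.swap i j p.1) -
          MvPolynomial.X (Equiv.swap i j p.2))) ^
          (eulerChange C c i j S (Equiv.swap i j p.1, Equiv.swap i j p.2) / 2) = 1 := by
      intro p hp
      have e : identify i j (MvPolynomial.X (Equiv.swap i j p.1) -
          MvPolynomial.X (Equiv.swap i j p.2)) =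
          identify i j (MvPolynomial.X p.1 - MvPolynomial.X p.2) := by
        rw [← identify_rename_swap (MvPolynomial.X p.1 - MvPolynomial.X p.2),
          map_sub (MvPolynomial.rename (R := ℤ) (Equiv.swap i j)), MvPolynomial.rename_X,
          MvPolynomial.rename_X]
      rw [e, ← zpow_add₀ (hnz p hp), hc.eulerChange_swap_pigments hC hne hS
        (ne_of_mem_pigmentPairs (Finset.mem_erase.1 hp).2)]
      obtain ⟨a, ha⟩ := hc.even_eulerChange hC hS p
      have : eulerChange C c i j S p / 2 + -eulerChange C c i j S p / 2 = 0 := by omega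
      rw [this, zpow_zero]
    refine Finset.prod_involution (fun p _ => (Equiv.swap i j p.1, Equiv.swap i j p.2)) hexp ?_
      (fun p hp => swap_mem_pigmentPairs hij hp) fun p _ => by simp
    intro p hp h hfix
    apply h
    have h0 := hc.eulerChange_swap_pigments hC hne hS
        (ne_of_mem_pigmentPairs (Finset.mem_erase.1 hp).2)
    rw [hfix] at h0
    have : eulerChange C c i j S p / 2 = 0 := by omega
    rw [this, zpow_zero]
  rwa [h1] at key

end SlFoam
end

noncomputable section
namespace SlFoam
open LabelledComplex

variable {C : LabelledComplex} {S T E : Set Triangle} {N : ℕ} {c : Triangle → Finset (Fin N)}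
  {i j : Fin N}

/-! ### Averages over the Kempe moves on components -/

theorem prod_zpow_eq {ι F : Type*} [Field F] {x : F} (hx : x ≠ 0) (s : Finset ι) (f : ι → ℤ) :
    ∏ a ∈ s, x ^ f a = x ^ ∑ a ∈ s, f a := by
  classical
  induction s using Finset.induction_on with
  | empty => simp
  | insert a s ha ih => rw [Finset.prod_insert ha, Finset.sum_insert ha, ih, zpow_add₀ hx]

theorem sum_mem_residuePairs {ι : Type*} {s : Finset ι} {f g : ι → RatFunc N}
    (h : ∀ a ∈ s, (f a, g a) ∈ residuePairs i j) :
    (∑ a ∈ s, f a, ∑ a ∈ s, g a) ∈ residuePairs i j := by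
  have := Subring.sum_mem (residuePairs i j) h
  rwa [show ∑ a ∈ s, (f a, g a) = (∑ a ∈ s, f a, ∑ a ∈ s, g a) from
    Prod.ext (Prod.fst_sum ..) (Prod.snd_sum ..)] at this

/-- The sum of the contributions of the colorings that arise from `c` by exchanging the pigments
`i`, `j` on a set of components of their bichrome surface is regular along `X_i = X_j`. It is a
product over the components `K`, each of which contributes a pole of order at most `χ(K) / 2 ≤ 1`;
at a sphere the two choices cancel along `X_i = X_j`. -/
theorem sum_powerset_coloringTerm_mem (hC : IsClosedFoam C) (hc : IsColoring N C c)
    (hij : (j : ℕ) = i + 1) (k : Triangle × ℕ →₀ ℕ) :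
    ∃ y, (∑ s ∈ (components (bichrome C c i j)).powerset,
      coloringTerm C k (kempe c i j (⋃₀ ↑s)), y) ∈ residuePairs i j := by
  classical
  have hne : i ≠ j := fun h => by
    have := congrArg Fin.val h
    omega
  have hE := hc.isClosedSurface_bichrome hC i j
  have hfin := hE.finite hC
  set E := bichrome C c i j
  have hcomp : ∀ K ∈ components E, IsComponent E K := fun K hK => (mem_components hfin).1 hK
  set t : RatFunc N := rootDiff (i, j)
  have ht : t ≠ 0 := rootDiff_ne_zero hne
  -- the contributions of a component before and after the exchange of pigments
  let e : Triangle × ℕ → MvPolynomial (Fin N) ℤ := fun d => esymmOn (c d.1) d.2 ^ k d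
  let e' : Triangle × ℕ → MvPolynomial (Fin N) ℤ := fun d =>
    MvPolynomial.rename (Equiv.swap i j) (e d)
  let a : Set Triangle → MvPolynomial (Fin N) ℤ := fun K =>
    ∏ d ∈ k.support, if d.1 ∈ K then e d else 1
  let b : Set Triangle → MvPolynomial (Fin N) ℤ := fun K =>
    ∏ d ∈ k.support, if d.1 ∈ K then e' d else 1
  let r : MvPolynomial (Fin N) ℤ := ∏ d ∈ k.support, if d.1 ∈ E then 1 else e d
  let V : Set Triangle → RatFunc N := fun K =>
    ∏ p ∈ pigmentPairs N, rootDiff p ^ (eulerChange C c i j K p / 2)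
  -- the part of the denominator that does not vanish along `X_i = X_j`
  let D : RatFunc N := ∏ p ∈ (pigmentPairs N).erase (i, j),
    rootDiff p ^ (eulerChar (bichrome C c p.1 p.2) / 2)
  have hab : ∀ K, identify i j (b K) = identify i j (a K) := by
    intro K
    simp only [a, b, e', map_prod, apply_ite (identify i j), identify_rename_swap]
  have hnum : ∀ s ⊆ components E, numerator (kempe c i j (⋃₀ ↑s)) k =
      r * ((∏ K ∈ s, b K) * ∏ K ∈ components E \ s, a K) := by
    intro s hs
    rw [numerator_eq, prod_eq_mul_prod_components hE.rotate hfin _ Prod.fst]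
    congr 1
    · refine Finset.prod_congr rfl fun d _ => ?_
      split_ifs with hd
      · rfl
      · rw [kempe_of_notMem]
        rintro ⟨K, hK, hdK⟩
        exact hd ((hcomp K (hs hK)).1.subset hdK)
    · rw [← Finset.prod_sdiff hs, mul_comm]
      congr 1
      · refine Finset.prod_congr rfl fun K hK => Finset.prod_congr rfl fun d _ => ?_
        split_ifs with hd
        · rw [kempe_of_mem (Set.mem_sUnion.2 ⟨K, hK, hd⟩), ← rename_esymmOn, ← map_pow]
        · rfl
      · refine Finset.prod_congr rfl fun K hK => Finset.prod_congr rfl fun d _ => ?_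
        split_ifs with hd
        · rw [kempe_of_notMem]
          rintro ⟨L, hL, hdL⟩
          have hK' := Finset.mem_sdiff.1 hK
          rw [(hcomp L (hs hL)).eq_of_inter (hcomp K hK'.1) ⟨_, hdL, hd⟩] at hL
          exact hK'.2 hL
        · rfl
  clear_value r a b
  have hunion : ∀ s ⊆ components E, IsComponentUnion E (⋃₀ ↑s) := fun s hs =>
    isComponentUnion_sUnion fun K hK => hcomp K (hs hK)
  have hden : ∀ s ⊆ components E, denominator C (kempe c i j (⋃₀ ↑s)) =
      denominator C c * ∏ K ∈ s, V K := by
    intro s hs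
    rw [denominator_eq, denominator_eq, Finset.prod_comm, ← Finset.prod_mul_distrib]
    refine Finset.prod_congr rfl fun p hp => ?_
    have hp' := ne_of_mem_pigmentPairs hp
    rw [prod_zpow_eq (rootDiff_ne_zero hp'), ← zpow_add₀ (rootDiff_ne_zero hp')]
    congr 1
    rw [← sum_half _ _ fun K hK => hc.even_eulerChange hC (hcomp K (hs hK)).1 p,
      ← hc.eulerChange_sUnion hC hne (fun K hK => hcomp K (hs hK)) hp']
    have h1 := hc.even_eulerChar_bichrome hC p.1 p.2
    have h2 := hc.even_eulerChange hC (hunion s hs) p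
    rw [Int.even_iff] at h1 h2
    unfold eulerChange at h2 ⊢
    omega
  have hsign : ∀ s ⊆ components E, (-1 : RatFunc N) ^ signExponent C (kempe c i j (⋃₀ ↑s)) =
      (-1) ^ signExponent C c * ∏ K ∈ s, (-1) ^ (eulerChar K / 2) := by
    intro s hs
    rw [neg_one_zpow_congr' (neg_one_zpow_signExponent_kempe hC hc hij (hunion s hs)),
      prod_zpow_eq (by norm_num), eulerChar_sUnion hC hE fun K hK => hcomp K (hs hK),
      sum_half _ _ fun K hK => hc.even_eulerChar hC (hcomp K (hs hK)).1]
  have hdenc : denominator C c = D * ∏ K ∈ components E, t ^ (eulerChar K / 2) := by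
    rw [prod_zpow_eq ht,
      ← sum_half _ _ fun K hK => hc.even_eulerChar hC (hcomp K hK).1,
      ← eulerChar_sUnion hC hE hcomp, sUnion_components hE.rotate hfin, denominator_eq,
      ← Finset.mul_prod_erase _ _ (mem_pigmentPairs hij), mul_comm]
  have hsum : ∑ s ∈ (components E).powerset, coloringTerm C k (kempe c i j (⋃₀ ↑s)) =
      (-1) ^ signExponent C c * algebraMap _ (RatFunc N) r * D⁻¹ *
        ∏ K ∈ components E, (((-1) ^ (eulerChar K / 2) * algebraMap _ (RatFunc N) (b K) * (V K)⁻¹ +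
          algebraMap _ (RatFunc N) (a K)) / t ^ (eulerChar K / 2)) := by
    rw [Finset.prod_div_distrib, Finset.prod_add, Finset.sum_div, Finset.mul_sum]
    refine Finset.sum_congr rfl fun s hs => ?_
    have hs' := Finset.mem_powerset.1 hs
    rw [coloringTerm, hsign s hs', hnum s hs', hden s hs', hdenc, map_mul, map_mul, map_prod, map_prod,
      Finset.prod_mul_distrib, Finset.prod_mul_distrib, Finset.prod_inv_distrib]
    simp only [div_eq_mul_inv, mul_inv]
    ring
  rw [hsum]
  -- all factors are regular
  have hreg : ∀ {x y x' y' : RatFunc N}, (x, y) ∈ residuePairs i j → (x', y') ∈ residuePairs i j →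
      (x * x', y * y') ∈ residuePairs i j := fun h h' => Subring.mul_mem _ h h'
  have hpm : ∀ n : ℤ, ((-1 : RatFunc N) ^ n, (-1 : RatFunc N) ^ n) ∈ residuePairs i j := fun n =>
    zpow_mem_residuePairs (Subring.neg_mem _ (Subring.one_mem _)) (by norm_num) n
  have htm : (t, 0) ∈ residuePairs i j := by
    have := rootDiff_mem_residuePairs (i := i) (j := j) (i, j)
    rwa [X_sub_X_dvd_iff.1 dvd_rfl, map_zero] at this
  have hD : ∃ y, (D⁻¹, y) ∈ residuePairs i j := by
    have hnz : ∀ p ∈ (pigmentPairs N).erase (i, j), algebraMap _ (RatFunc N)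
        (identify i j (MvPolynomial.X p.1 - MvPolynomial.X p.2)) ≠ 0 := by
      intro p hp
      have hp' := Finset.mem_erase.1 hp
      refine identify_rootDiff_ne_zero (ne_of_mem_pigmentPairs hp'.2) hp'.1 ?_
      rintro rfl
      have := (Finset.mem_filter.1 hp'.2).2
      rw [Fin.lt_def] at this
      dsimp only at this
      omega
    exact ⟨_, inv_mem_residuePairs (prod_mem_residuePairs fun p hp =>
      zpow_mem_residuePairs (rootDiff_mem_residuePairs p) (hnz p hp) _)
      (Finset.prod_ne_zero_iff.2 fun p hp => zpow_ne_zero _ (hnz p hp))⟩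
  have hK : ∀ K ∈ components E, ∃ y, (((-1) ^ (eulerChar K / 2) * algebraMap _ (RatFunc N) (b K) *
      (V K)⁻¹ + algebraMap _ (RatFunc N) (a K)) / t ^ (eulerChar K / 2), y) ∈
      residuePairs i j := by
    intro K hK
    have hV := inv_mem_residuePairs
      (prod_rootDiff_mem_residuePairs hC hc hij (hcomp K hK).1) one_ne_zero
    rw [inv_one] at hV
    have h1 := Subring.add_mem _ (hreg (hreg (hpm (eulerChar K / 2))
      (algebraMap_mem_residuePairs (b K))) hV) (algebraMap_mem_residuePairs (a K))
    rw [hab K] at h1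
    have hle := (hcomp K hK).eulerChar_le hC hE
    rcases (show eulerChar K / 2 ≤ 1 by omega).eq_or_lt with h2 | h2
    · -- for a sphere the numerator is `a - b` along `X_i = X_j`, which vanishes there
      rw [h2] at h1 ⊢
      rw [zpow_one] at h1 ⊢
      rw [zpow_one]
      refine div_mem_residuePairs hne ?_
      have : (-1 : RatFunc N) * algebraMap _ (RatFunc N) (identify i j (a K)) * 1 +
        algebraMap _ (RatFunc N) (identify i j (a K)) = 0 := by ring
      rw [← this]
      exact h1
    · -- otherwise the exponent of `X_i - X_j` is not negative
      obtain ⟨n, hn⟩ := Int.eq_ofNat_of_zero_le (show 0 ≤ -(eulerChar K / 2) by omega)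
      rw [div_eq_mul_inv, ← zpow_neg, hn, zpow_natCast]
      exact ⟨_, hreg h1 (Subring.pow_mem _ htm n)⟩
  choose y hy using hK
  obtain ⟨z, hz⟩ := hD
  have hw := prod_mem_residuePairs (s := (components E).attach) fun K _ => hy K.1 K.2
  rw [Finset.prod_attach (components E) fun K =>
    ((-1) ^ (eulerChar K / 2) * algebraMap _ (RatFunc N) (b K) * (V K)⁻¹ +
      algebraMap _ (RatFunc N) (a K)) / t ^ (eulerChar K / 2)] at hw
  exact ⟨_, hreg (hreg (hreg (hpm _) (algebraMap_mem_residuePairs r)) hz) hw⟩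

/-- Averaging over the Kempe moves of each coloring does not change the sum over all colorings,
and the denominators that arise are powers of two. -/
theorem evaluation_mem_residuePairs (hC : IsClosedFoam C) (hij : (j : ℕ) = i + 1)
    (k : Triangle × ℕ →₀ ℕ) : ∃ y, (evaluation N C k, y) ∈ residuePairs i j := by
  classical
  have hcol : ∀ c ∈ (finite_colorings (N := N) hC).toFinset, IsColoring N C c := fun c hc =>
    (Set.Finite.mem_toFinset _).1 hc
  have hunion : ∀ c ∈ (finite_colorings (N := N) hC).toFinset,
      ∀ s ⊆ components (bichrome C c i j), IsComponentUnion (bichrome C c i j) (⋃₀ ↑s) := by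
    intro c hc s hs
    have hfin := ((hcol c hc).isClosedSurface_bichrome hC i j).finite hC
    exact isComponentUnion_sUnion fun K hK => (mem_components hfin).1 (hs hK)
  rw [evaluation_eq_sum hC, sum_eq_sum_average _ (fun c => components (bichrome C c i j))
    (fun c s => kempe c i j (⋃₀ ↑s)) (coloringTerm C k)
    (fun c hc s hs => (Set.Finite.mem_toFinset _).2 ((hcol c hc).kempe hC (hunion c hc s hs)))
    (fun c hc s hs => by rw [bichrome_kempe (hunion c hc s hs).subset])
    (fun c hc s hs => kempe_kempe)]
  have h2 : ∀ n : ℕ, (((2 : RatFunc N) ^ n)⁻¹, ((2 : RatFunc N) ^ n)⁻¹) ∈ residuePairs i j := by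
    intro n
    refine inv_mem_residuePairs ?_ (pow_ne_zero _ two_ne_zero)
    rw [show ((2 : RatFunc N) ^ n, (2 : RatFunc N) ^ n) =
      ((2 ^ n : ℕ) : RatFunc N × RatFunc N) from Prod.ext (by simp) (by simp)]
    exact natCast_mem _ _
  have h3 : ∀ c ∈ (finite_colorings (N := N) hC).toFinset, ∃ y,
      ((2 ^ (components (bichrome C c i j)).card)⁻¹ *
        ∑ s ∈ (components (bichrome C c i j)).powerset, coloringTerm C k (kempe c i j (⋃₀ ↑s)), y) ∈
      residuePairs i j := by
    intro c hc
    obtain ⟨y, hy⟩ := sum_powerset_coloringTerm_mem hC (hcol c hc) hij k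
    exact ⟨_, Subring.mul_mem _ (h2 _) hy⟩
  choose y hy using h3
  rw [← Finset.sum_attach]
  exact ⟨_, sum_mem_residuePairs fun c _ => hy c.1 c.2⟩

/-! ### The evaluation is a symmetric polynomial -/

/-- A common denominator of the contributions of all colorings, a product of differences of
variables. -/
theorem exists_common_denominator (hC : IsClosedFoam C) (N : ℕ) :
    ∃ (M : ℕ) (n : (Triangle → Finset (Fin N)) → Fin N × Fin N → ℕ), ∀ c, IsColoring N C c →
      algebraMap _ (RatFunc N) (∏ p ∈ pigmentPairs N,
        (MvPolynomial.X p.1 - MvPolynomial.X p.2 : MvPolynomial (Fin N) ℤ) ^ n c p) *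
        denominator C c =
      algebraMap _ (RatFunc N) (∏ p ∈ pigmentPairs N,
        (MvPolynomial.X p.1 - MvPolynomial.X p.2 : MvPolynomial (Fin N) ℤ) ^ M) := by
  let f : (Triangle → Finset (Fin N)) → Fin N × Fin N → ℤ := fun c p =>
    eulerChar (bichrome C c p.1 p.2) / 2
  let M : ℕ := ∑ c ∈ (finite_colorings (N := N) hC).toFinset, ∑ p ∈ pigmentPairs N, (f c p).natAbs
  have hM : ∀ c, IsColoring N C c → ∀ p ∈ pigmentPairs N, f c p ≤ M := by
    intro c hc p hp
    have h1 : (f c p).natAbs ≤ ∑ p ∈ pigmentPairs N, (f c p).natAbs :=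
      Finset.single_le_sum (f := fun p => (f c p).natAbs) (fun _ _ => Nat.zero_le _) hp
    have h2 : ∑ p ∈ pigmentPairs N, (f c p).natAbs ≤ M :=
      Finset.single_le_sum (f := fun c => ∑ p ∈ pigmentPairs N, (f c p).natAbs)
        (fun _ _ => Nat.zero_le _) ((Set.Finite.mem_toFinset _).2 hc)
    omega
  refine ⟨M, fun c p => (M - f c p).toNat, fun c hc => ?_⟩
  rw [denominator_eq, map_prod, map_prod, ← Finset.prod_mul_distrib]
  refine Finset.prod_congr rfl fun p hp => ?_
  rw [map_pow, map_pow]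
  change rootDiff p ^ _ * _ = rootDiff p ^ _
  rw [← zpow_natCast, ← zpow_natCast, ← zpow_add₀ (rootDiff_ne_zero (ne_of_mem_pigmentPairs hp))]
  congr 1
  have := hM c hc p hp
  change ((M - f c p).toNat : ℤ) + f c p = M
  omega

/-- The evaluation of a closed foam is a symmetric polynomial with integral coefficients: its
denominator is a product of differences `X_i - X_j`, each of which cancels by regularity. -/
theorem exists_polynomial_evaluation (hN : 2 ≤ N) (hC : IsClosedFoam C) (k : Triangle × ℕ →₀ ℕ) :
    ∃ P : MvPolynomial (Fin N) ℤ, P.IsSymmetric ∧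
      algebraMap _ (RatFunc N) P = evaluation N C k := by
  obtain ⟨P, hP⟩ : ∃ P : MvPolynomial (Fin N) ℤ, algebraMap _ (RatFunc N) P =
      evaluation N C k := by
    obtain ⟨M, n, hM⟩ := exists_common_denominator hC N
    refine exists_polynomial_of_prod (M • (pigmentPairs N).val) ?_ ?_
    · intro p hp
      have hp' := ne_of_mem_pigmentPairs (Multiset.mem_of_mem_nsmul hp)
      refine ⟨hp', ?_⟩
      let i : Fin N := ⟨0, by omega⟩
      let j : Fin N := ⟨1, by omega⟩
      have hne : i ≠ j := by simp [i, j, Fin.ext_iff]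
      obtain ⟨y, a, s, h1, h2, -⟩ := evaluation_mem_residuePairs (i := i) (j := j) hC rfl k
      -- transport to the pair `p` by a permutation
      obtain ⟨σ, hσ⟩ : ∃ σ : Equiv.Perm (Fin N), σ i = p.1 ∧ σ j = p.2 := by
        let σ := Equiv.swap i p.1
        have hj : σ j ≠ p.1 := fun h =>
          hne (σ.injective (h.trans (Equiv.swap_apply_left _ _).symm)).symm
        refine ⟨Equiv.swap (σ j) p.2 * σ, ?_, ?_⟩
        · rw [Equiv.Perm.mul_apply, Equiv.swap_apply_left, Equiv.swap_apply_of_ne_of_ne hj.symm hp']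
        · rw [Equiv.Perm.mul_apply, Equiv.swap_apply_left]
      refine ⟨MvPolynomial.rename σ a, MvPolynomial.rename σ s, ?_, ?_⟩
      · rintro h
        have h3 := map_dvd (MvPolynomial.rename (R := ℤ) σ.symm) h
        rw [map_sub, MvPolynomial.rename_X, MvPolynomial.rename_X, ← hσ.1, ← hσ.2,
          σ.symm_apply_apply, σ.symm_apply_apply, MvPolynomial.rename_rename,
          Equiv.symm_comp_self, MvPolynomial.rename_id_apply] at h3
        exact h1 (X_sub_X_dvd_iff.1 h3)
      · have := congrArg (permute σ) h2
        rwa [map_mul, permute_algebraMap, permute_algebraMap, permute_evaluation hC] at this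
    · refine ⟨∑ c ∈ (finite_colorings hC).toFinset, (-1) ^ (signExponent C c).natAbs *
        numerator c k * ∏ p ∈ pigmentPairs N, (MvPolynomial.X p.1 - MvPolynomial.X p.2) ^ n c p, ?_⟩
      rw [evaluation_eq_sum hC, map_sum, Finset.sum_mul]
      refine Finset.sum_congr rfl fun c hc => ?_
      have h1 := hM c ((Set.Finite.mem_toFinset _).1 hc)
      rw [Multiset.map_nsmul, Multiset.prod_nsmul]
      change _ * algebraMap _ _ ((∏ p ∈ pigmentPairs N, _) ^ M) = _
      rw [← Finset.prod_pow, ← h1, coloringTerm, map_mul, map_mul]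
      have h2 : algebraMap (MvPolynomial (Fin N) ℤ) (RatFunc N) ((-1) ^ (signExponent C c).natAbs) =
          (-1) ^ signExponent C c := by
        rw [map_pow, map_neg, map_one]
        rcases Int.even_or_odd (signExponent C c) with h | h
        · rw [h.neg_one_zpow, (Int.natAbs_even.2 h).neg_one_pow]
        · rw [h.neg_one_zpow, (Int.natAbs_odd.2 h).neg_one_pow]
      rw [h2]
      have := denominator_ne_zero C c
      field_simp
  refine ⟨P, fun σ => algebraMap_ratFunc_injective ?_, hP⟩
  rw [← permute_algebraMap, hP, permute_evaluation hC]

end SlFoam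
end

noncomputable section
namespace SlFoam
open LabelledComplex

/-! ### Half-planes at an edge of an embedded complex -/

theorem eq_zero_of_affineIndependent {a b p : Space} (h : AffineIndependent ℝ ![a, b, p]) {x y : ℝ}
    (hxy : x • (b - a) + y • (p - a) = 0) : x = 0 ∧ y = 0 := by
  rw [affineIndependent_iff] at h
  have := h Finset.univ ![-x - y, x, y] (by simp [Fin.sum_univ_three]; ring)
    (by
      simp only [Fin.sum_univ_three, Matrix.cons_val_zero, Matrix.cons_val_one,
        Matrix.cons_val_two, Matrix.tail_cons, Matrix.head_cons]
      rw [← hxy]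
      module)
  exact ⟨this 1 (Finset.mem_univ _), this 2 (Finset.mem_univ _)⟩

/-- Two triangles that meet exactly in their common edge `ab` do not span the same half-plane. -/
theorem not_same_halfPlane {a b p q : Space} (hp : AffineIndependent ℝ ![a, b, p])
    (h : convexHull ℝ {a, b, p} ∩ convexHull ℝ {a, b, q} ⊆ convexHull ℝ ({a, b} : Set Space))
    {s t : ℝ} (hs : 0 < s) (hq : q - a = s • (p - a) + t • (b - a)) : False := by
  have mem3 : ∀ {x y : ℝ} (r : Space), 0 ≤ x → 0 ≤ y → x + y ≤ 1 →
      a + x • (b - a) + y • (r - a) ∈ convexHull ℝ {a, b, r} := by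
    intro x y r hx hy hxy
    rw [convexHull_insert (by simp), convexHull_pair]
    by_cases h0 : x + y = 0
    · obtain rfl : x = 0 := by linarith
      obtain rfl : y = 0 := by linarith
      exact mem_convexJoin.2 ⟨a, rfl, b, left_mem_segment ℝ _ _, by
        simpa using left_mem_segment ℝ a b⟩
    · refine mem_convexJoin.2 ⟨a, rfl, (x / (x + y)) • b + (y / (x + y)) • r, ?_, ?_⟩
      · exact ⟨_, _, by positivity, by positivity, by field_simp, rfl⟩
      · refine ⟨1 - (x + y), x + y, by linarith, by linarith, by ring, ?_⟩
        rw [smul_add, smul_smul, smul_smul, mul_div_cancel₀ _ h0, mul_div_cancel₀ _ h0]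
        module
  -- a point of the half-plane close to the midpoint of `ab`
  set α : ℝ := s / (4 * (s + |t| + 1)) with hα
  have ht := abs_nonneg t
  have hpos : 0 < 4 * (s + |t| + 1) := by linarith
  have hα0 : 0 < α := by positivity
  have h1 : α ≤ 1 / 4 := by
    rw [hα, div_le_iff₀ hpos]; linarith
  have h2 : α / s = 1 / (4 * (s + |t| + 1)) := by rw [hα]; field_simp
  have h3 : α / s ≤ 1 / 4 := by
    rw [h2, div_le_iff₀ hpos]; linarith
  have h4 : |α / s * t| ≤ 1 / 4 := by
    rw [abs_mul, abs_of_pos (by positivity), h2, one_div_mul_eq_div, div_le_iff₀ hpos]; linarith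
  have h5 := abs_le.1 h4
  have hP : a + (1 / 2 : ℝ) • (b - a) + α • (p - a) =
      a + (1 / 2 - α / s * t) • (b - a) + (α / s) • (q - a) := by
    rw [hq, smul_add, smul_smul, smul_smul, div_mul_cancel₀ _ hs.ne']
    module
  have hmem := h ⟨mem3 p (by norm_num) hα0.le (by linarith), hP ▸ mem3 q (by linarith [h5.2])
    (by positivity) (by linarith [h5.1])⟩
  rw [convexHull_pair, segment_eq_image'] at hmem
  obtain ⟨θ, -, hθ⟩ := hmem
  have h0 : (1 / 2 - θ) • (b - a) + α • (p - a) = 0 := by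
    have : (1 / 2 - θ) • (b - a) + α • (p - a) =
        (a + (1 / 2 : ℝ) • (b - a) + α • (p - a)) - (a + θ • (b - a)) := by module
    rw [this, ← hθ, sub_self]
  exact hα0.ne' (eq_zero_of_affineIndependent hp h0).2

/-- Three distinct half-planes at an axis have a cyclic order. -/
theorem leftCyclic_or {u X Y Z : Space}
    (hX : ∀ x y : ℝ, x • u + y • X = 0 → x = 0 ∧ y = 0)
    (hY : ∀ x y : ℝ, x • u + y • Y = 0 → x = 0 ∧ y = 0)
    (hZ : ∀ x y : ℝ, x • u + y • Z = 0 → x = 0 ∧ y = 0)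
    (hXY : ∀ s t : ℝ, 0 < s → Y ≠ s • X + t • u) (hXZ : ∀ s t : ℝ, 0 < s → Z ≠ s • X + t • u)
    (hYZ : ∀ s t : ℝ, 0 < s → Z ≠ s • Y + t • u) :
    LeftCyclic u X Y Z ∨ LeftCyclic u Y X Z := by
  -- distinct half-planes with vanishing determinant are opposite
  have key : ∀ {X Y : Space}, (∀ x y : ℝ, x • u + y • X = 0 → x = 0 ∧ y = 0) →
      (∀ x y : ℝ, x • u + y • Y = 0 → x = 0 ∧ y = 0) →
      (∀ s t : ℝ, 0 < s → Y ≠ s • X + t • u) → Matrix.det (Matrix.of ![u, X, Y]) = 0 →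
      ∃ s t : ℝ, s < 0 ∧ Y = s • X + t • u := by
    intro X Y hX hY hXY hdet
    obtain ⟨w, hw, h0⟩ := Matrix.exists_vecMul_eq_zero_iff.2 hdet
    have h1 : w 0 • u + w 1 • X + w 2 • Y = 0 := by
      rw [← h0]
      ext i
      simp [Matrix.vecMul, dotProduct, Fin.sum_univ_three]
    have hw2 : w 2 ≠ 0 := by
      intro h2
      rw [h2, zero_smul, add_zero] at h1
      obtain ⟨h3, h4⟩ := hX _ _ h1
      exact hw (by ext i; fin_cases i <;> assumption)
    have h2 : Y = (-(w 1 / w 2)) • X + (-(w 0 / w 2)) • u := by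
      have : w 2 • Y = -(w 0 • u) - w 1 • X := by
        rw [← sub_eq_zero, ← h1]; module
      rw [← one_smul ℝ Y, ← inv_mul_cancel₀ hw2, ← smul_smul, this, div_eq_mul_inv, div_eq_mul_inv]
      module
    refine ⟨_, _, ?_, h2⟩
    rcases lt_trichotomy (-(w 1 / w 2)) 0 with h | h | h
    · exact h
    · rw [h, zero_smul, zero_add] at h2
      have := (hY (w 0 / w 2) 1 (by rw [h2]; module)).2
      norm_num at this
    · exact (hXY _ _ h h2).elim
  have anti : ∀ s t : Space, Matrix.det (Matrix.of ![u, s, t]) =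
      - Matrix.det (Matrix.of ![u, t, s]) := by
    intro s t
    simp [Matrix.det_fin_three]
    ring
  have lin : ∀ (s t : ℝ) (X Y : Space), Matrix.det (Matrix.of ![u, s • X + t • u, Y]) =
      s * Matrix.det (Matrix.of ![u, X, Y]) := by
    intro s t X Y
    simp [Matrix.det_fin_three]
    ring
  have sym : ∀ {X Y : Space}, (∀ s t : ℝ, 0 < s → Y ≠ s • X + t • u) →
      ∀ s t : ℝ, 0 < s → X ≠ s • Y + t • u := by
    intro X Y h s t hs hX
    refine h s⁻¹ (-(s⁻¹ * t)) (inv_pos.2 hs) ?_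
    rw [hX, smul_add, smul_smul, smul_smul, inv_mul_cancel₀ hs.ne']
    module
  -- if one determinant vanishes, then the other two have the same sign
  have main : ∀ {X Y Z : Space}, (∀ x y : ℝ, x • u + y • X = 0 → x = 0 ∧ y = 0) →
      (∀ x y : ℝ, x • u + y • Y = 0 → x = 0 ∧ y = 0) →
      (∀ x y : ℝ, x • u + y • Z = 0 → x = 0 ∧ y = 0) →
      (∀ s t : ℝ, 0 < s → Y ≠ s • X + t • u) → (∀ s t : ℝ, 0 < s → Z ≠ s • X + t • u) →
      (∀ s t : ℝ, 0 < s → Z ≠ s • Y + t • u) → Matrix.det (Matrix.of ![u, X, Y]) = 0 →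
      LeftCyclic u X Y Z ∨ LeftCyclic u Y X Z := by
    intro X Y Z hX hY hZ hXY hXZ hYZ h0
    obtain ⟨s, t, hs, h⟩ := key hX hY hXY h0
    have h1 : Matrix.det (Matrix.of ![u, Y, Z]) = -s * Matrix.det (Matrix.of ![u, Z, X]) := by
      rw [h, lin, anti X Z]; ring
    have hne : Matrix.det (Matrix.of ![u, Z, X]) ≠ 0 := by
      intro h2
      rw [anti, neg_eq_zero] at h2
      obtain ⟨s', t', hs', h'⟩ := key hX hZ hXZ h2
      refine hYZ (s' / s) (t' - s' / s * t) (div_pos_of_neg_of_neg hs' hs) ?_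
      rw [h', h, smul_add, smul_smul, div_mul_cancel₀ _ hs.ne]
      module
    simp only [LeftCyclic]
    rw [anti Y X, anti X Z, anti Z Y, h1]
    rcases lt_or_gt_of_ne hne with h2 | h2
    · exact Or.inl (Or.inr (Or.inl ⟨by nlinarith, h2⟩))
    · exact Or.inr (Or.inr (Or.inl ⟨by linarith, by nlinarith⟩))
  by_cases h1 : Matrix.det (Matrix.of ![u, X, Y]) = 0
  · exact main hX hY hZ hXY hXZ hYZ h1
  by_cases h2 : Matrix.det (Matrix.of ![u, Y, Z]) = 0
  · rcases main hY hZ hX hYZ (sym hXY) (sym hXZ) h2 with h | h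
    exacts [Or.inl h.rotate.rotate, Or.inr h.rotate]
  by_cases h3 : Matrix.det (Matrix.of ![u, Z, X]) = 0
  · rcases main hZ hX hY (sym hXZ) (sym hYZ) hXY h3 with h | h
    exacts [Or.inl h.rotate, Or.inr h.rotate.rotate]
  simp only [LeftCyclic]
  rw [anti Y X, anti X Z, anti Z Y]
  simp only [neg_lt_zero]
  rcases lt_or_gt_of_ne h1 with h1 | h1 <;> rcases lt_or_gt_of_ne h2 with h2 | h2 <;>
    rcases lt_or_gt_of_ne h3 with h3 | h3 <;> tauto

/-- The three sheets at a binding lie in distinct half-planes. -/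
theorem Foam.apart {N : ℕ} {Γ : PlaneGraph} (F : Foam N Γ) {a b p q r : Space}
    (h : F.IsBinding a b p q r) : LeftCyclic (b - a) (p - a) (q - a) (r - a) ∨
      LeftCyclic (b - a) (q - a) (p - a) (r - a) := by
  obtain ⟨hpq, h1, h2⟩ := h
  have tp : (a, b, p) ∈ F.tri := by
    have : p ∈ F.star a b := by rw [h1]; simp
    exact this
  have tq : (a, b, q) ∈ F.tri := by
    have : q ∈ F.star a b := by rw [h1]; simp
    exact this
  have tr : (b, a, r) ∈ F.tri := by
    have : r ∈ F.star b a := by rw [h2]; simp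
    exact this
  have hswap : ∀ {r : Space}, AffineIndependent ℝ ![b, a, r] → AffineIndependent ℝ ![a, b, r] := by
    intro r h
    have := h.comp_embedding (Equiv.swap (0 : Fin 3) 1).toEmbedding
    convert this using 1
    ext i : 1
    fin_cases i <;> rfl
  have ip := F.nondegenerate _ _ _ tp
  have iq := F.nondegenerate _ _ _ tq
  have ir := hswap (F.nondegenerate _ _ _ tr)
  have hpr : p ≠ r := by rintro rfl; exact F.oriented _ _ _ tp tr
  have hqr : q ≠ r := by rintro rfl; exact F.oriented _ _ _ tq tr
  have hinter : ∀ {p q : Space}, AffineIndependent ℝ ![a, b, p] → AffineIndependent ℝ ![a, b, q] →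
      p ≠ q → ({a, b, p} : Set Space) ∩ {a, b, q} = {a, b} := by
    intro p q hp hq hpq
    have n1 : p ≠ a := fun h => by have := hp.injective.ne (by decide : (2 : Fin 3) ≠ 0); exact this h
    have n2 : p ≠ b := fun h => by have := hp.injective.ne (by decide : (2 : Fin 3) ≠ 1); exact this h
    ext x
    simp only [Set.mem_inter_iff, Set.mem_insert_iff, Set.mem_singleton_iff]
    constructor
    · rintro ⟨rfl | rfl | rfl, h⟩ <;> tauto
    · tauto
  have hcomm : ∀ r : Space, ({b, a, r} : Set Space) = {a, b, r} := fun r => Set.insert_comm _ _ _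
  have e1 := F.embedded _ _ _ _ _ _ tp tq
  have e2 := F.embedded _ _ _ _ _ _ tp tr
  have e3 := F.embedded _ _ _ _ _ _ tq tr
  rw [hinter ip iq hpq] at e1
  rw [hcomm, hinter ip ir hpr] at e2
  rw [hcomm, hinter iq ir hqr] at e3
  exact leftCyclic_or (fun x y => eq_zero_of_affineIndependent ip)
    (fun x y => eq_zero_of_affineIndependent iq) (fun x y => eq_zero_of_affineIndependent ir)
    (fun s t hs h => not_same_halfPlane ip e1 hs h) (fun s t hs h => not_same_halfPlane ip e2 hs h)
    (fun s t hs h => not_same_halfPlane iq e3 hs h)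

end SlFoam
end

noncomputable section
namespace SlFoam
open LabelledComplex

/-! ### Mirror images -/

theorem mirror_mirror (a : Space) : mirror (mirror a) = a := by
  ext i
  fin_cases i <;> simp [mirror]

theorem mirror_injective : Function.Injective mirror :=
  Function.LeftInverse.injective mirror_mirror

@[simp] theorem mirror_two (a : Space) : mirror a 2 = -a 2 := rfl

theorem mirror_of_eq_zero {a : Space} (h : a 2 = 0) : mirror a = a := by
  ext i
  fin_cases i <;> simp [mirror, h]

theorem mirror_eq_iff {a b : Space} : mirror a = b ↔ a = mirror b :=
  ⟨fun h => by rw [← h, mirror_mirror], fun h => by rw [h, mirror_mirror]⟩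

theorem mirror_sub (a b : Space) : mirror a - mirror b = mirror (a - b) := by
  ext i
  fin_cases i <;> simp [mirror]; ring

theorem leftCyclic_mirror {u x y z : Space} :
    LeftCyclic (mirror u) (mirror x) (mirror y) (mirror z) ↔ LeftCyclic u y x z := by
  have e : ∀ s t : Space, Matrix.det (Matrix.of ![mirror u, mirror s, mirror t]) =
      Matrix.det (Matrix.of ![u, t, s]) := by
    intro s t
    simp [Matrix.det_fin_three, mirror]
    ring
  simp only [LeftCyclic, e]
  tauto

theorem mirrorTriangle_mirrorTriangle (t : Triangle) : mirrorTriangle (mirrorTriangle t) = t := by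
  simp [mirrorTriangle, mirror_mirror]

theorem mirrorTriangle_injective : Function.Injective mirrorTriangle :=
  Function.LeftInverse.injective mirrorTriangle_mirrorTriangle

/-- The mirror image of a complex, with reversed orientations. -/
def LabelledComplex.mirror (C : LabelledComplex) : LabelledComplex where
  tri := mirrorTriangle ⁻¹' C.tri
  label t := C.label (mirrorTriangle t)

namespace LabelledComplex

variable {C : LabelledComplex} {v : Space}

theorem mirror_mirror (C : LabelledComplex) : C.mirror.mirror = C := by
  cases C with
  | mk tri label =>
    simp only [LabelledComplex.mirror, LabelledComplex.mk.injEq]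
    constructor
    · ext t
      simp [mirrorTriangle_mirrorTriangle]
    · funext t
      simp [mirrorTriangle_mirrorTriangle]

theorem star_mirror {a b : Space} {s : Set Space} : C.mirror.star a b = s ↔
    C.star (SlFoam.mirror b) (SlFoam.mirror a) = SlFoam.mirror '' s := by
  have h : C.mirror.star a b = SlFoam.mirror ⁻¹' C.star (SlFoam.mirror b) (SlFoam.mirror a) := rfl
  have h2 : ∀ s : Set Space, SlFoam.mirror '' s = SlFoam.mirror ⁻¹' s := fun s =>
    congrFun (Set.image_eq_preimage_of_inverse SlFoam.mirror_mirror SlFoam.mirror_mirror) s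
  rw [h, ← h2, ← Set.image_eq_image SlFoam.mirror_injective, h2, h2, h2, ← Set.preimage_comp]
  have : SlFoam.mirror ∘ SlFoam.mirror = id := funext SlFoam.mirror_mirror
  rw [this, Set.preimage_id]

theorem isRegular_mirror {a b p q : Space} : C.mirror.IsRegular a b p q ↔
    C.IsRegular (SlFoam.mirror b) (SlFoam.mirror a) (SlFoam.mirror p) (SlFoam.mirror q) := by
  simp [IsRegular, star_mirror]

theorem isBinding_mirror {a b p q r : Space} : C.mirror.IsBinding a b p q r ↔
    C.IsBinding (SlFoam.mirror b) (SlFoam.mirror a) (SlFoam.mirror p) (SlFoam.mirror q)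
      (SlFoam.mirror r) := by
  simp [IsBinding, star_mirror, Set.image_pair, SlFoam.mirror_injective.ne_iff]

/-- The mirror image of a link edge. -/
def mirrorEdge (e : Space × Space) : Space × Space := (SlFoam.mirror e.2, SlFoam.mirror e.1)

theorem mirrorEdge_mirrorEdge (e : Space × Space) : mirrorEdge (mirrorEdge e) = e := by
  simp [mirrorEdge, SlFoam.mirror_mirror]

theorem mirror_rotate (hr : ∀ a b c, (a, b, c) ∈ C.tri → (b, c, a) ∈ C.tri) (a b c : Space)
    (h : (a, b, c) ∈ C.mirror.tri) : (b, c, a) ∈ C.mirror.tri :=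
  hr _ _ _ (hr _ _ _ h)

theorem mem_linkEdges_mirror (hr : ∀ a b c, (a, b, c) ∈ C.tri → (b, c, a) ∈ C.tri)
    {e : Space × Space} :
    e ∈ C.mirror.linkEdges v ↔ mirrorEdge e ∈ C.linkEdges (SlFoam.mirror v) :=
  ⟨fun h => hr _ _ _ h, fun h => hr _ _ _ (hr _ _ _ h)⟩

theorem LinkStep.mirror {e f : Space × Space} (h : C.mirror.LinkStep v e f) :
    C.LinkStep (SlFoam.mirror v) (mirrorEdge f) (mirrorEdge e) := by
  obtain ⟨h1, h2⟩ := h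
  obtain ⟨h3, h4⟩ := isRegular_mirror.1 h2
  refine ⟨congrArg SlFoam.mirror h1.symm, ?_⟩
  simp only [mirrorEdge, ← h1]
  exact ⟨h4, h3⟩

theorem SameSector.mirror {e f : Space × Space} (h : C.mirror.SameSector v e f) :
    C.SameSector (SlFoam.mirror v) (mirrorEdge e) (mirrorEdge f) := by
  induction h with
  | rel _ _ h => exact (Relation.EqvGen.rel _ _ h.mirror).symm
  | refl => exact Relation.EqvGen.refl _
  | symm _ _ _ ih => exact ih.symm
  | trans _ _ _ _ _ h1 h2 => exact h1.trans h2

theorem sameSector_mirror {e f : Space × Space} : C.mirror.SameSector v e f ↔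
    C.SameSector (SlFoam.mirror v) (mirrorEdge e) (mirrorEdge f) := by
  refine ⟨SameSector.mirror, fun h => ?_⟩
  rw [← mirror_mirror C] at h
  simpa only [SlFoam.mirror_mirror, mirrorEdge_mirrorEdge] using h.mirror

theorem isTrivalentNode_mirror {p : Space} : C.mirror.IsTrivalentNode v p ↔
    C.IsTrivalentNode (SlFoam.mirror v) (SlFoam.mirror p) := by
  simp only [IsTrivalentNode, isBinding_mirror]
  constructor
  · rintro ⟨x, y, z, h⟩
    exact ⟨_, _, _, h.symm⟩
  · rintro ⟨x, y, z, h⟩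
    exact ⟨SlFoam.mirror x, SlFoam.mirror y, SlFoam.mirror z, by
      simpa only [SlFoam.mirror_mirror] using h.symm⟩

theorem mirrorEdge_arm {s : Bool} {p x : Space} :
    mirrorEdge (arm s p x) = arm (!s) (SlFoam.mirror p) (SlFoam.mirror x) := by
  cases s <;> rfl

theorem isEdgeBetween_mirror (hr : ∀ a b c, (a, b, c) ∈ C.tri → (b, c, a) ∈ C.tri)
    {p x : Space} {e : Space × Space} : C.mirror.IsEdgeBetween v p x e ↔
      C.IsEdgeBetween (SlFoam.mirror v) (SlFoam.mirror p) (SlFoam.mirror x) (mirrorEdge e) := by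
  rw [isEdgeBetween_iff, isEdgeBetween_iff, mem_linkEdges_mirror hr]
  refine and_congr_right fun _ => ⟨?_, ?_⟩
  · rintro ⟨s, rfl⟩
    exact ⟨_, mirrorEdge_arm⟩
  · rintro ⟨s, h⟩
    refine ⟨!s, ?_⟩
    rw [← mirrorEdge_mirrorEdge e, h, mirrorEdge_arm, SlFoam.mirror_mirror, SlFoam.mirror_mirror]

theorem joins_mirror (hr : ∀ a b c, (a, b, c) ∈ C.tri → (b, c, a) ∈ C.tri)
    {p x q y : Space} : C.mirror.Joins v p x q y ↔ C.Joins (SlFoam.mirror v) (SlFoam.mirror p)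
      (SlFoam.mirror x) (SlFoam.mirror q) (SlFoam.mirror y) := by
  constructor
  · rintro ⟨e, f, he, hf, h⟩
    exact ⟨_, _, (isEdgeBetween_mirror hr).1 he, (isEdgeBetween_mirror hr).1 hf, h.mirror⟩
  · rintro ⟨e, f, he, hf, h⟩
    refine ⟨mirrorEdge e, mirrorEdge f, (isEdgeBetween_mirror hr).2 ?_,
      (isEdgeBetween_mirror hr).2 ?_, sameSector_mirror.2 ?_⟩ <;>
    simpa only [mirrorEdge_mirrorEdge]

theorem touches_mirror (hr : ∀ a b c, (a, b, c) ∈ C.tri → (b, c, a) ∈ C.tri)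
    {e : Space × Space} {p : Space} : C.mirror.Touches v e p ↔
      C.Touches (SlFoam.mirror v) (mirrorEdge e) (SlFoam.mirror p) := by
  constructor
  · rintro ⟨f, x, h, hf⟩
    exact ⟨_, _, h.mirror, (isEdgeBetween_mirror hr).1 hf⟩
  · rintro ⟨f, x, h, hf⟩
    refine ⟨mirrorEdge f, SlFoam.mirror x, sameSector_mirror.2 ?_, (isEdgeBetween_mirror hr).2 ?_⟩
    · simpa only [mirrorEdge_mirrorEdge]
    · simpa only [mirrorEdge_mirrorEdge, SlFoam.mirror_mirror]

theorem IsFacetPoint.mirror (hr : ∀ a b c, (a, b, c) ∈ C.tri → (b, c, a) ∈ C.tri)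
    (h : C.IsFacetPoint (SlFoam.mirror v)) : C.mirror.IsFacetPoint v :=
  ⟨fun _ hb => h.1 _ (isTrivalentNode_mirror.1 hb), fun _ he _ hf => sameSector_mirror.2
    (h.2 _ ((mem_linkEdges_mirror hr).1 he) _ ((mem_linkEdges_mirror hr).1 hf))⟩

theorem leftCyclic_mirror_sub {a b x y z : Space} :
    LeftCyclic (SlFoam.mirror a - b) (SlFoam.mirror x - b) (SlFoam.mirror y - b)
      (SlFoam.mirror z - b) ↔
    LeftCyclic (a - SlFoam.mirror b) (y - SlFoam.mirror b) (x - SlFoam.mirror b)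
      (z - SlFoam.mirror b) := by
  conv_lhs => rw [← SlFoam.mirror_mirror b]
  simp only [mirror_sub, leftCyclic_mirror]

theorem IsBindingPoint.mirror (hr : ∀ a b c, (a, b, c) ∈ C.tri → (b, c, a) ∈ C.tri)
    (h : C.IsBindingPoint (SlFoam.mirror v)) : C.mirror.IsBindingPoint v := by
  obtain ⟨p, q, hpq, htri, ht, hc⟩ := h
  refine ⟨SlFoam.mirror p, SlFoam.mirror q, SlFoam.mirror_injective.ne hpq, fun _ => ?_,
    fun e he => ?_, ?_⟩
  · rw [isTrivalentNode_mirror, htri, mirror_eq_iff, mirror_eq_iff]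
  · have := ht _ ((mem_linkEdges_mirror hr).1 he)
    rw [touches_mirror hr, touches_mirror hr]
    simpa only [SlFoam.mirror_mirror]
  · intro x₁ x₂ x₃ y₁ y₂ y₃ h1 h2 h3 h
    rw [joins_mirror hr, SlFoam.mirror_mirror, SlFoam.mirror_mirror] at h1 h2 h3
    rw [← SlFoam.mirror_mirror x₁, ← SlFoam.mirror_mirror x₂, ← SlFoam.mirror_mirror x₃,
      leftCyclic_mirror_sub] at h
    rw [← SlFoam.mirror_mirror y₁, ← SlFoam.mirror_mirror y₂, ← SlFoam.mirror_mirror y₃,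
      leftCyclic_mirror_sub]
    exact (hc _ _ _ _ _ _ h2 h1 h3 h).rotate

theorem IsSingularPoint.mirror (hr : ∀ a b c, (a, b, c) ∈ C.tri → (b, c, a) ∈ C.tri)
    (h : C.IsSingularPoint (SlFoam.mirror v)) : C.mirror.IsSingularPoint v := by
  obtain ⟨t, hinj, htri, ht, hj, hc⟩ := h
  refine ⟨fun i => SlFoam.mirror (t i), SlFoam.mirror_injective.comp hinj, fun b => ?_,
    fun e he => ?_, fun i j hij => ?_, ?_⟩
  · rw [isTrivalentNode_mirror, htri]
    simp only [mirror_eq_iff]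
  · obtain ⟨i, hi⟩ := ht _ ((mem_linkEdges_mirror hr).1 he)
    refine ⟨i, (touches_mirror hr).2 ?_⟩
    simpa only [SlFoam.mirror_mirror]
  · obtain ⟨x, y, h⟩ := hj i j hij
    refine ⟨SlFoam.mirror x, SlFoam.mirror y, (joins_mirror hr).2 ?_⟩
    simpa only [SlFoam.mirror_mirror]
  · intro i j k l hij hik hil hjk hjl hkl xj xk xl yi yk yl wk wl zk zl h1 h2 h3 h4 h5 h
    rw [joins_mirror hr, SlFoam.mirror_mirror, SlFoam.mirror_mirror] at h1 h2 h3 h4 h5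
    rw [← SlFoam.mirror_mirror xj, ← SlFoam.mirror_mirror xk, ← SlFoam.mirror_mirror xl,
      leftCyclic_mirror_sub] at h
    rw [← SlFoam.mirror_mirror yi, ← SlFoam.mirror_mirror yk, ← SlFoam.mirror_mirror yl,
      leftCyclic_mirror_sub]
    exact (hc i j l k hij hil hik hjl hjk hkl.symm _ _ _ _ _ _ _ _ _ _ h1 h3 h2 h5 h4
      h.rotate).rotate.rotate

end LabelledComplex

/-! ### The two halves of a glued foam -/

/-- Local model of a half of a closed foam at a point of the plane `z = 0`, at a trivalent vertex
of the boundary graph; `ax` is the vertical axis that points into the half. -/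
def IsTripodPoint (A : LabelledComplex) (ax v : Space) : Prop :=
  ∃ p, (∀ b, A.IsTrivalentNode v b ↔ b = p) ∧
    (∀ e ∈ A.linkEdges v, A.Touches v e p ∧ ∃ n : Space, n 2 = 0 ∧ A.Touches v e n) ∧
    ∀ x₁ x₂ x₃ n₁ n₂ n₃ y₁ y₂ y₃, n₁ 2 = 0 → n₂ 2 = 0 → n₃ 2 = 0 →
      A.Joins v p x₁ n₁ y₁ → A.Joins v p x₂ n₂ y₂ → A.Joins v p x₃ n₃ y₃ →
      LeftCyclic (p - v) (x₁ - v) (x₂ - v) (x₃ - v) →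
      LeftCyclic ax (n₁ - v) (n₂ - v) (n₃ - v)

/-- The half of a closed foam in the half-space where `ε z` is non-negative. `B` is the set of edges
in the plane `z = 0`, with the direction that this half induces. -/
structure IsHalf (B : Set (Space × Space)) (ε : ℝ) (A : LabelledComplex) : Prop where
  finite : A.tri.Finite
  rotate : ∀ a b c, (a, b, c) ∈ A.tri → (b, c, a) ∈ A.tri
  oriented : ∀ a b c, (a, b, c) ∈ A.tri → (b, a, c) ∉ A.tri
  ne : ∀ a b c, (a, b, c) ∈ A.tri → a ≠ b
  side : ∀ a b c, (a, b, c) ∈ A.tri → 0 ≤ ε * a 2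
  planar : ∀ a b, (a, b) ∈ B → a 2 = 0 ∧ b 2 = 0
  boundary : ∀ a b c, (a, b, c) ∈ A.tri → a 2 = 0 → b 2 = 0 → (a, b) ∈ B
  collar : ∀ a b, (a, b) ∈ B → ∃ c : Space, 0 < ε * c 2 ∧ A.IsBoundaryEdge a b c
  boundary_vertex : ∀ a b c, (a, b, c) ∈ A.tri → a 2 = 0 → ∃ y, (a, y) ∈ B ∨ (y, a) ∈ B
  edge : ∀ a b c, (a, b, c) ∈ A.tri → ¬ (a 2 = 0 ∧ b 2 = 0) →
    (∃ p q, A.IsRegular a b p q) ∨ (∃ p q r, A.IsBinding a b p q r) ∨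
      (∃ p q r, A.IsBinding b a p q r)
  apart : ∀ a b p q r, A.IsBinding a b p q r →
    LeftCyclic (b - a) (p - a) (q - a) (r - a) ∨ LeftCyclic (b - a) (q - a) (p - a) (r - a)
  label_binding : ∀ a b p q r, A.IsBinding a b p q r →
    A.label (a, b, p) + A.label (a, b, q) = A.label (b, a, r)
  inner_point : ∀ v b c, (v, b, c) ∈ A.tri → 0 < ε * v 2 →
    A.IsFacetPoint v ∨ A.IsBindingPoint v ∨ A.IsSingularPoint v
  boundary_point : ∀ v b c, (v, b, c) ∈ A.tri → v 2 = 0 →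
    A.IsFacetPoint v ∨ IsTripodPoint A ![0, 0, ε] v

theorem IsTripodPoint.mirror {C : LabelledComplex} {v : Space} {ε : ℝ}
    (hr : ∀ a b c, (a, b, c) ∈ C.tri → (b, c, a) ∈ C.tri)
    (h : IsTripodPoint C ![0, 0, ε] (mirror v)) : IsTripodPoint C.mirror ![0, 0, -ε] v := by
  obtain ⟨p, htri, ht, hc⟩ := h
  refine ⟨SlFoam.mirror p, fun b => ?_, fun e he => ?_, ?_⟩
  · rw [isTrivalentNode_mirror, htri, mirror_eq_iff]
  · obtain ⟨h1, n, hn, h2⟩ := ht _ ((mem_linkEdges_mirror hr).1 he)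
    refine ⟨(touches_mirror hr).2 (by simpa only [SlFoam.mirror_mirror]),
      SlFoam.mirror n, by simp [hn], (touches_mirror hr).2 (by simpa only [SlFoam.mirror_mirror])⟩
  · intro x₁ x₂ x₃ n₁ n₂ n₃ y₁ y₂ y₃ hn₁ hn₂ hn₃ h1 h2 h3 h
    rw [joins_mirror hr, SlFoam.mirror_mirror] at h1 h2 h3
    rw [← SlFoam.mirror_mirror x₁, ← SlFoam.mirror_mirror x₂, ← SlFoam.mirror_mirror x₃,
      leftCyclic_mirror_sub] at h
    have hax : (![0, 0, -ε] : Space) = SlFoam.mirror ![0, 0, ε] := by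
      ext i; fin_cases i <;> simp [SlFoam.mirror]
    have e : ∀ x, x - v = SlFoam.mirror (SlFoam.mirror x - SlFoam.mirror v) := fun x => by
      rw [mirror_sub, SlFoam.mirror_mirror]
    rw [hax, e n₁, e n₂, e n₃, leftCyclic_mirror]
    exact (hc _ _ _ _ _ _ _ _ _ (by simp [hn₂]) (by simp [hn₁]) (by simp [hn₃]) h2 h1 h3 h)

theorem IsHalf.mirror {B : Set (Space × Space)} {ε : ℝ} {A : LabelledComplex} (h : IsHalf B ε A) :
    IsHalf (Prod.swap ⁻¹' B) (-ε) A.mirror where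
  finite := h.finite.preimage mirrorTriangle_injective.injOn
  rotate := mirror_rotate h.rotate
  oriented a b c h1 h2 := h.oriented _ _ _ h1 h2
  ne a b c h1 h2 := h.ne _ _ _ h1 (congrArg _ h2.symm)
  side a b c h1 := by
    have := h.side _ _ _ (h.rotate _ _ _ (h.rotate _ _ _ (mirror_rotate h.rotate _ _ _ h1)))
    have := h.side _ _ _ (h.rotate _ _ _ h1)
    simp only [mirror_two] at this
    linarith
  planar a b h1 := (h.planar _ _ h1).symm
  boundary a b c h1 ha hb := by
    have := h.boundary _ _ _ h1 (by simp [hb]) (by simp [ha])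
    rwa [mirror_of_eq_zero ha, mirror_of_eq_zero hb] at this
  collar a b h1 := by
    obtain ⟨c, hc, h2⟩ := h.collar _ _ h1
    obtain ⟨ha, hb⟩ := h.planar _ _ h1
    refine ⟨SlFoam.mirror c, by simpa using hc, ?_⟩
    rw [IsBoundaryEdge, star_mirror, star_mirror, Set.image_singleton, SlFoam.mirror_mirror,
      Set.image_empty, mirror_of_eq_zero ha, mirror_of_eq_zero hb]
    exact h2
  boundary_vertex a b c h1 ha := by
    obtain ⟨y, hy⟩ := h.boundary_vertex _ _ _ (h.rotate _ _ _ h1) (by simp [ha])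
    rw [mirror_of_eq_zero ha] at hy
    exact ⟨y, hy.symm⟩
  edge a b c h1 hab := by
    rcases h.edge _ _ _ h1 (by simpa [and_comm] using hab) with
      ⟨p, q, hp⟩ | ⟨p, q, r, hp⟩ | ⟨p, q, r, hp⟩
    · refine Or.inl ⟨SlFoam.mirror p, SlFoam.mirror q, isRegular_mirror.2 ?_⟩
      simpa only [SlFoam.mirror_mirror]
    · refine Or.inr (Or.inl ⟨SlFoam.mirror p, SlFoam.mirror q, SlFoam.mirror r,
        isBinding_mirror.2 ?_⟩)
      simpa only [SlFoam.mirror_mirror]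
    · refine Or.inr (Or.inr ⟨SlFoam.mirror p, SlFoam.mirror q, SlFoam.mirror r,
        isBinding_mirror.2 ?_⟩)
      simpa only [SlFoam.mirror_mirror]
  apart a b p q r h1 := by
    have := h.apart _ _ _ _ _ (isBinding_mirror.1 h1)
    rw [leftCyclic_mirror_sub, leftCyclic_mirror_sub, SlFoam.mirror_mirror] at this
    exact this.imp leftCyclic_reverse.1 leftCyclic_reverse.1
  label_binding a b p q r h1 := h.label_binding _ _ _ _ _ (isBinding_mirror.1 h1)
  inner_point v b c h1 hv := by
    refine (h.inner_point _ _ _ (h.rotate _ _ _ h1) (by simpa using hv)).imp ?_ (Or.imp ?_ ?_)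
    exacts [IsFacetPoint.mirror h.rotate, IsBindingPoint.mirror h.rotate,
      IsSingularPoint.mirror h.rotate]
  boundary_point v b c h1 hv :=
    (h.boundary_point _ _ _ (h.rotate _ _ _ h1) (by simpa using hv)).imp
      (IsFacetPoint.mirror h.rotate) (IsTripodPoint.mirror h.rotate)

theorem incl_proj {a : Space} (h : a 2 = 0) : incl (proj a) = a := by
  ext i; fin_cases i <;> simp [incl, proj, h]

theorem Foam.isHalf {N : ℕ} {Γ : PlaneGraph} (F : Foam N Γ) :
    IsHalf (Prod.map incl incl '' Γ.edges) (-1) F.toLabelledComplex where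
  finite := F.finite
  rotate := F.rotate
  oriented := F.oriented
  ne a b c h h' := by
    have := (F.nondegenerate _ _ _ h).injective.ne (by decide : (0 : Fin 3) ≠ 1)
    exact this h'
  side a b c h := by linarith [F.below _ _ _ h]
  planar := by
    rintro _ _ ⟨⟨x, y⟩, -, h⟩
    obtain ⟨rfl, rfl⟩ := Prod.ext_iff.1 h
    exact ⟨rfl, rfl⟩
  boundary a b c h ha hb := by
    refine ⟨(proj a, proj b), (F.boundary _ _).2 ⟨c, ?_⟩, ?_⟩
    · rwa [incl_proj ha, incl_proj hb]
    · exact Prod.ext (incl_proj ha) (incl_proj hb)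
  collar := by
    rintro _ _ ⟨⟨x, y⟩, h, h'⟩
    obtain ⟨rfl, rfl⟩ := Prod.ext_iff.1 h'
    obtain ⟨c, hc, h1, -⟩ := F.collar x y h
    exact ⟨c, by linarith, h1⟩
  boundary_vertex a b c h ha := by
    obtain ⟨y, hy⟩ := F.boundary_vertex _ _ _ h ha
    refine ⟨incl y, hy.imp (fun h => ⟨_, h, ?_⟩) (fun h => ⟨_, h, ?_⟩)⟩
    · exact Prod.ext (incl_proj ha) rfl
    · exact Prod.ext rfl (incl_proj ha)
  edge := F.edge
  apart _ _ _ _ _ := F.apart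
  label_binding := F.label_binding
  inner_point v b c h hv := F.inner_point v b c h (by linarith)
  boundary_point v b c h hv := F.boundary_point v b c h hv

end SlFoam
end

noncomputable section
namespace SlFoam
open LabelledComplex

/-! ### Gluing two halves -/

theorem LabelledComplex.SameSector.mono {A K : LabelledComplex} {v : Space}
    (h : ∀ e f, A.LinkStep v e f → K.LinkStep v e f) {e f : Space × Space}
    (hs : A.SameSector v e f) : K.SameSector v e f :=
  Relation.EqvGen.mono h _ _ hs

/-- At a point `v` of the plane `z = 0`, the complex `A` is a part of the complex `K`, which
continues with `A'` beyond the plane. -/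
structure GlueHalf (A A' K : LabelledComplex) (v : Space) : Prop where
  link : ∀ e ∈ A.linkEdges v, e ∈ K.linkEdges v
  rotate : ∀ a b c, (a, b, c) ∈ A.tri → (b, c, a) ∈ A.tri
  step : ∀ e f, A.LinkStep v e f → K.LinkStep v e f
  trivalent : ∀ p, A.IsTrivalentNode v p → K.IsTrivalentNode v p ∧ p 2 ≠ 0
  isEnd : ∀ n : Space, n 2 = 0 → A.IsEnd v n
  unique : ∀ (n : Space) s x s' x', n 2 = 0 → arm s n x ∈ A.linkEdges v →
    arm s' n x' ∈ A.linkEdges v → s = s' ∧ x = x'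
  cross : ∀ (n : Space) s x, n 2 = 0 → arm s n x ∈ A.linkEdges v →
    ∃ y, arm (!s) n y ∈ A'.linkEdges v ∧ K.SameSector v (arm s n x) (arm (!s) n y)
  oriented : ∀ s s' p x, arm s p x ∈ A.linkEdges v → arm s' p x ∈ A.linkEdges v → s = s'

/-- The complex `K` consists of two halves near the point `v` of the plane `z = 0`. -/
structure GlueAt (A A' K : LabelledComplex) (v : Space) : Prop where
  left : GlueHalf A A' K v
  right : GlueHalf A' A K v
  cover : ∀ e ∈ K.linkEdges v, e ∈ A.linkEdges v ∨ e ∈ A'.linkEdges v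
  trivalent : ∀ p, K.IsTrivalentNode v p → A.IsTrivalentNode v p ∨ A'.IsTrivalentNode v p
  planar : ∀ s s' p x x', arm s p x ∈ A.linkEdges v → arm s' p x' ∈ A'.linkEdges v → p 2 = 0

variable {A A' K : LabelledComplex} {v : Space}

theorem GlueAt.symm (h : GlueAt A A' K v) : GlueAt A' A K v :=
  ⟨h.right, h.left, fun e he => (h.cover e he).symm, fun p hp => (h.trivalent p hp).symm,
    fun s s' p x x' h1 h2 => h.planar s' s p x' x h2 h1⟩

theorem GlueAt.isFacetPoint (h : GlueAt A A' K v) (hA : A.IsFacetPoint v) (hA' : A'.IsFacetPoint v)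
    (hn : ∃ (n : Space) (s : Bool) (x : Space), n 2 = 0 ∧ arm s n x ∈ A.linkEdges v) :
    K.IsFacetPoint v := by
  obtain ⟨n, s, x, hn, hx⟩ := hn
  obtain ⟨y, hy, hxy⟩ := h.left.cross n s x hn hx
  have key : ∀ e ∈ K.linkEdges v, K.SameSector v e (arm s n x) := by
    intro e he
    rcases h.cover e he with he | he
    · exact (hA.2 _ he _ hx).mono h.left.step
    · exact ((hA'.2 _ he _ hy).mono h.right.step).trans hxy.symm
  refine ⟨fun b hb => ?_, fun e he f hf => (key e he).trans (key f hf).symm⟩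
  exact (h.trivalent b hb).elim (hA.1 b) (hA'.1 b)

theorem LabelledComplex.Touches.exists_arm {C : LabelledComplex} {e : Space × Space} {p : Space}
    (h : C.Touches v e p) : ∃ s x, arm s p x ∈ C.linkEdges v ∧ C.SameSector v e (arm s p x) := by
  obtain ⟨f, x, hs, hf⟩ := h
  obtain ⟨hf, s, rfl⟩ := isEdgeBetween_iff.1 hf
  exact ⟨s, x, hf, hs⟩

theorem LabelledComplex.Joins.exists_arm {C : LabelledComplex} {p x q y : Space}
    (h : C.Joins v p x q y) : ∃ s s', arm s p x ∈ C.linkEdges v ∧ arm s' q y ∈ C.linkEdges v ∧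
      C.SameSector v (arm s p x) (arm s' q y) := by
  obtain ⟨e, f, he, hf, hs⟩ := h
  obtain ⟨he, s, rfl⟩ := isEdgeBetween_iff.1 he
  obtain ⟨hf, s', rfl⟩ := isEdgeBetween_iff.1 hf
  exact ⟨s, s', he, hf, hs⟩

theorem LabelledComplex.Joins.of_arm {C : LabelledComplex} {p x q y : Space} {s s' : Bool}
    (h : arm s p x ∈ C.linkEdges v) (h' : arm s' q y ∈ C.linkEdges v)
    (hs : C.SameSector v (arm s p x) (arm s' q y)) : C.Joins v p x q y :=
  ⟨_, _, isEdgeBetween_iff.2 ⟨h, _, rfl⟩, isEdgeBetween_iff.2 ⟨h', _, rfl⟩, hs⟩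

/-- A tripod cannot continue as an arc: two of its legs end in the plane with the same
direction. -/
theorem GlueAt.not_tripod_facet (h : GlueAt A A' K v) {ax : Space} (hA : IsTripodPoint A ax v)
    (hA' : A'.IsFacetPoint v) : False := by
  obtain ⟨p, htri, ht, -⟩ := hA
  have hp := (htri p).2 rfl
  obtain ⟨s, x, y, z, hf⟩ := isTrivalentNode_iff.1 hp
  have hx := (hf.mem_iff h.left.rotate).1.2 (Or.inl rfl)
  have hy := (hf.mem_iff h.left.rotate).1.2 (Or.inr rfl)
  have leg : ∀ x, arm s p x ∈ A.linkEdges v → ∃ n w, n 2 = 0 ∧ arm (!s) n w ∈ A.linkEdges v ∧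
      A.SameSector v (arm s p x) (arm (!s) n w) := by
    intro x hx
    obtain ⟨-, n, hn, ht⟩ := ht _ hx
    obtain ⟨t, w, hw, hs⟩ := ht.exists_arm
    have hpn : p ≠ n := by rintro rfl; exact (h.left.trivalent _ hp).2 hn
    obtain rfl := hs.arm_not hpn hp.isEnd (h.left.isEnd _ hn)
    exact ⟨n, w, hn, hw, hs⟩
  obtain ⟨n, w, hn, hw, hs⟩ := leg x hx
  obtain ⟨n', w', hn', hw', hs'⟩ := leg y hy
  have hnn : n = n' := by
    obtain ⟨u, hu, -⟩ := h.left.cross _ _ _ hn hw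
    obtain ⟨u', hu', -⟩ := h.left.cross _ _ _ hn' hw'
    exact ((hA'.2 _ hu _ hu').eq_of_arm' (h.right.isEnd _ hn) (h.right.isEnd _ hn')).1
  subst hnn
  obtain rfl := (h.left.unique _ _ _ _ _ hn hw hw').2
  exact hf.ne ((hs.trans hs'.symm).eq_of_arm' hp.isEnd hp.isEnd).2

theorem GlueAt.touches (h : GlueAt A A' K v) {p q : Space}
    (hp : ∀ e ∈ A.linkEdges v, A.Touches v e p ∧ ∃ n : Space, n 2 = 0 ∧ A.Touches v e n)
    (hq : ∀ e ∈ A'.linkEdges v, A'.Touches v e q) {e : Space × Space} (he : e ∈ A.linkEdges v) :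
    K.Touches v e p ∧ K.Touches v e q := by
  obtain ⟨h1, n, hn, h2⟩ := hp e he
  obtain ⟨s, x, hx, hs⟩ := h1.exists_arm
  obtain ⟨t, y, hy, hs'⟩ := h2.exists_arm
  obtain ⟨z, hz, hc⟩ := h.left.cross _ _ _ hn hy
  obtain ⟨r, w, hw, hs''⟩ := (hq _ hz).exists_arm
  exact ⟨⟨_, _, hs.mono h.left.step, isEdgeBetween_iff.2 ⟨h.left.link _ hx, _, rfl⟩⟩,
    ⟨_, _, ((hs'.mono h.left.step).trans hc).trans (hs''.mono h.right.step),
      isEdgeBetween_iff.2 ⟨h.right.link _ hw, _, rfl⟩⟩⟩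

theorem leftCyclic_of_mem_three {u w a b c X Y Z : Space}
    (h : LeftCyclic u (X - w) (Y - w) (Z - w) ∨ LeftCyclic u (Y - w) (X - w) (Z - w))
    (ha : a = X ∨ a = Y ∨ a = Z) (hb : b = X ∨ b = Y ∨ b = Z) (hc : c = X ∨ c = Y ∨ c = Z)
    (hab : a ≠ b) (hac : a ≠ c) (hbc : b ≠ c) :
    LeftCyclic u (a - w) (b - w) (c - w) ∨ LeftCyclic u (a - w) (c - w) (b - w) := by
  have rot : ∀ {x y z : Space}, LeftCyclic u x y z → LeftCyclic u y z x := fun h => h.rotate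
  rcases ha with rfl | rfl | rfl <;> rcases hb with rfl | rfl | rfl <;>
    rcases hc with rfl | rfl | rfl <;>
    first
    | exact (hab rfl).elim
    | exact (hac rfl).elim
    | exact (hbc rfl).elim
    | skip
  · exact h.imp id fun h => rot h
  · exact h.symm.imp (fun h => rot h) id
  · exact h.symm.imp id fun h => rot h
  · exact h.imp (fun h => rot h) id
  · exact h.imp (fun h => rot (rot h)) fun h => rot (rot h)
  · exact h.symm.imp (fun h => rot (rot h)) fun h => rot (rot h)

/-- Two tripods glue to a theta graph. Their cyclic orders match since both are seen at the ends of
the legs in the plane. -/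
theorem GlueAt.isBindingPoint (h : GlueAt A A' K v) {ε : ℝ} (hA : IsTripodPoint A ![0, 0, ε] v)
    (hA' : IsTripodPoint A' ![0, 0, -ε] v)
    (hapart : ∀ a b p q r, A'.IsBinding a b p q r →
      LeftCyclic (b - a) (p - a) (q - a) (r - a) ∨ LeftCyclic (b - a) (q - a) (p - a) (r - a)) :
    K.IsBindingPoint v := by
  obtain ⟨p, htri, ht, hc⟩ := hA
  obtain ⟨q, htri', ht', hc'⟩ := hA'
  have hp := (htri p).2 rfl
  have hq := (htri' q).2 rfl
  have hpK := (h.left.trivalent _ hp).1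
  have hqK := (h.right.trivalent _ hq).1
  obtain ⟨s₀, X, Y, Z, hfq⟩ := isTrivalentNode_iff.1 hq
  obtain ⟨s₁, X₁, Y₁, Z₁, hfp⟩ := isTrivalentNode_iff.1 hp
  have hpq : p ≠ q := by
    rintro rfl
    exact (h.left.trivalent _ hp).2 (h.planar _ _ _ _ _
      ((hfp.mem_iff h.left.rotate).1.2 (Or.inl rfl)) ((hfq.mem_iff h.right.rotate).1.2 (Or.inl rfl)))
  refine ⟨p, q, hpq, fun b => ⟨fun hb => (h.trivalent b hb).imp (htri b).1 (htri' b).1, ?_⟩,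
    fun e he => ?_, ?_⟩
  · rintro (rfl | rfl)
    exacts [hpK, hqK]
  · rcases h.cover e he with he | he
    · exact h.touches ht (fun e he => (ht' e he).1) he
    · exact (h.symm.touches ht' (fun e he => (ht e he).1) he).symm
  -- each edge of the theta graph crosses the plane at an end `n` of a leg of both tripods
  have joins : ∀ {x y}, K.Joins v p x q y → ∃ n z z', n 2 = 0 ∧ A.Joins v p x n z ∧
      A'.Joins v q y n z' := by
    intro x y hj
    obtain ⟨s, s', he, hf, hs⟩ := hj.exists_arm
    have he' : arm s p x ∈ A.linkEdges v := (h.cover _ he).resolve_right fun h' =>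
      (h.left.trivalent _ hp).2 (h.planar _ _ _ _ _
        ((hfp.mem_iff h.left.rotate).1.2 (Or.inl rfl)) h')
    have hf' : arm s' q y ∈ A'.linkEdges v := (h.cover _ hf).resolve_left fun h' =>
      (h.right.trivalent _ hq).2 (h.planar _ _ _ _ _ h'
        ((hfq.mem_iff h.right.rotate).1.2 (Or.inl rfl)))
    obtain ⟨-, n, hn, htn⟩ := ht _ he'
    obtain ⟨t, z, hz, hsz⟩ := htn.exists_arm
    obtain ⟨z', hz', hcr⟩ := h.left.cross _ _ _ hn hz
    obtain ⟨r, y', hy', hsy⟩ := (ht' _ hz').1.exists_arm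
    have h1 : K.SameSector v (arm s p x) (arm r q y') :=
      ((hsz.mono h.left.step).trans hcr).trans (hsy.mono h.right.step)
    obtain rfl := h1.arm_not hpq hpK.isEnd hqK.isEnd
    obtain rfl := hs.arm_not hpq hpK.isEnd hqK.isEnd
    obtain ⟨-, rfl⟩ := (hs.symm.trans h1).eq_of_arm' hqK.isEnd hqK.isEnd
    exact ⟨n, z, z', hn, .of_arm he' hz hsz, .of_arm hf' hz' hsy.symm⟩
  have distinct : ∀ {y n z y' n' z'}, n 2 = 0 → n' 2 = 0 → A'.Joins v q y n z →
      A'.Joins v q y' n' z' → n ≠ n' → y ≠ y' := by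
    rintro y n z y' n' z' hn hn' hj hj' hne rfl
    obtain ⟨s, t, h1, h2, h3⟩ := hj.exists_arm
    obtain ⟨s', t', h1', h2', h3'⟩ := hj'.exists_arm
    obtain rfl := h.right.oriented _ _ _ _ h1 h1'
    have ne : ∀ {n : Space}, n 2 = 0 → q ≠ n := by
      rintro n hn rfl; exact (h.right.trivalent _ hq).2 hn
    obtain rfl := h3.arm_not (ne hn) hq.isEnd (h.right.isEnd _ hn)
    obtain rfl := h3'.arm_not (ne hn') hq.isEnd (h.right.isEnd _ hn')
    exact hne ((h3.symm.trans h3').eq_of_arm' (h.right.isEnd _ hn) (h.right.isEnd _ hn')).1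
  have three : ∀ {y n z}, A'.Joins v q y n z → y = X ∨ y = Y ∨ y = Z := by
    intro y n z hj
    obtain ⟨s, t, h1, -, -⟩ := hj.exists_arm
    by_cases hs : s = s₀
    · subst hs
      exact ((hfq.mem_iff h.right.rotate).1.1 h1).imp id Or.inl
    · obtain rfl : s = !s₀ := by cases s <;> cases s₀ <;> simp_all
      exact Or.inr (Or.inr ((hfq.mem_iff h.right.rotate).2.1 h1))
  -- the arms at `q` have a cyclic order, and the opposite one contradicts the order of the legs:
  -- both tripods see the same ends in the plane, from opposite sides
  have cyc : LeftCyclic (q - v) (X - v) (Y - v) (Z - v) ∨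
      LeftCyclic (q - v) (Y - v) (X - v) (Z - v) := by
    cases s₀
    · exact ((hapart _ _ _ _ _ hfq).imp leftCyclic_reverse.1 leftCyclic_reverse.1).symm
    · exact hapart _ _ _ _ _ hfq
  intro x₁ x₂ x₃ y₁ y₂ y₃ h1 h2 h3 hx
  obtain ⟨n₁, z₁, z₁', hn₁, j1, j1'⟩ := joins h1
  obtain ⟨n₂, z₂, z₂', hn₂, j2, j2'⟩ := joins h2
  obtain ⟨n₃, z₃, z₃', hn₃, j3, j3'⟩ := joins h3
  have hcn := hc _ _ _ _ _ _ _ _ _ hn₁ hn₂ hn₃ j1 j2 j3 hx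
  have ne : ∀ {u x y z : Space}, LeftCyclic u x y z → x ≠ y := by
    rintro u x y z h rfl
    exact h.not_swap h
  have hn12 : n₁ ≠ n₂ := by rintro rfl; exact ne hcn rfl
  have hn23 : n₂ ≠ n₃ := by rintro rfl; exact ne hcn.rotate rfl
  have hn13 : n₁ ≠ n₃ := by rintro rfl; exact ne hcn.rotate.rotate rfl
  refine (leftCyclic_of_mem_three cyc (three j1') (three j2') (three j3')
    (distinct hn₁ hn₂ j1' j2' hn12) (distinct hn₁ hn₃ j1' j3' hn13)
    (distinct hn₂ hn₃ j2' j3' hn23)).resolve_left fun hy => ?_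
  have hcn' := hc' _ _ _ _ _ _ _ _ _ hn₁ hn₂ hn₃ j1' j2' j3' hy
  refine hcn.not_swap ?_
  have hflip : ∀ {x y z : Space}, LeftCyclic ![0, 0, -ε] x y z → LeftCyclic ![0, 0, ε] y x z := by
    intro x y z h
    have e : ∀ s t : Space, Matrix.det (Matrix.of ![![0, 0, -ε], s, t]) =
        Matrix.det (Matrix.of ![![0, 0, ε], t, s]) := by
      intro s t
      simp [Matrix.det_fin_three]
      ring
    simp only [LeftCyclic, e] at h ⊢
    tauto
  exact hflip hcn'

end SlFoam
end

noncomputable section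
namespace SlFoam
open LabelledComplex

/-! ### Complexes glued from two halves -/

/-- The complex `K` is glued from two halves, on both sides of the plane `z = 0`. -/
structure IsGluing (B : Set (Space × Space)) (ε : ℝ) (A A' K : LabelledComplex) : Prop where
  left : IsHalf B ε A
  right : IsHalf (Prod.swap ⁻¹' B) (-ε) A'
  ne_zero : ε ≠ 0
  tri : ∀ t, t ∈ K.tri ↔ t ∈ A.tri ∨ t ∈ A'.tri
  label_left : ∀ t ∈ A.tri, K.label t = A.label t
  label_right : ∀ t ∈ A'.tri, K.label t = A'.label t

namespace IsGluing

variable {B : Set (Space × Space)} {ε : ℝ} {A A' K : LabelledComplex}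

theorem symm (h : IsGluing B ε A A' K) : IsGluing (Prod.swap ⁻¹' B) (-ε) A' A K where
  left := h.right
  right := by
    rw [neg_neg]
    exact h.left
  ne_zero := neg_ne_zero.2 h.ne_zero
  tri t := (h.tri t).trans or_comm
  label_left := h.label_right
  label_right := h.label_left

theorem pos_of_ne (h : IsGluing B ε A A' K) {a b c : Space} (ht : (a, b, c) ∈ A.tri)
    (ha : a 2 ≠ 0) : 0 < ε * a 2 :=
  lt_of_le_of_ne (h.left.side _ _ _ ht) (mul_ne_zero h.ne_zero ha).symm

theorem star_left (h : IsGluing B ε A A' K) {a b : Space} (hab : 0 < ε * a 2 ∨ 0 < ε * b 2) :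
    K.star a b = A.star a b := by
  ext c
  refine ⟨fun hc => ((h.tri _).1 hc).resolve_right fun h' => ?_, fun hc => (h.tri _).2 (Or.inl hc)⟩
  have h1 := h.right.side _ _ _ h'
  have h2 := h.right.side _ _ _ (h.right.rotate _ _ _ h')
  rcases hab with h3 | h3 <;> linarith

theorem isRegular_left (h : IsGluing B ε A A' K) {a b p q : Space}
    (hab : 0 < ε * a 2 ∨ 0 < ε * b 2) : K.IsRegular a b p q ↔ A.IsRegular a b p q := by
  rw [LabelledComplex.IsRegular, LabelledComplex.IsRegular, h.star_left hab, h.star_left hab.symm]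

theorem isBinding_left (h : IsGluing B ε A A' K) {a b p q r : Space}
    (hab : 0 < ε * a 2 ∨ 0 < ε * b 2) : K.IsBinding a b p q r ↔ A.IsBinding a b p q r := by
  rw [IsBinding, IsBinding, h.star_left hab, h.star_left hab.symm]

theorem off_plane (h : IsGluing B ε A A' K) {a b c : Space} (ht : (a, b, c) ∈ A.tri)
    (hab : ¬ (a 2 = 0 ∧ b 2 = 0)) : 0 < ε * a 2 ∨ 0 < ε * b 2 := by
  by_cases ha : a 2 = 0
  · exact Or.inr (h.pos_of_ne (h.left.rotate _ _ _ ht) fun hb => hab ⟨ha, hb⟩)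
  · exact Or.inl (h.pos_of_ne ht ha)

/-- The edges in the plane `z = 0` become regular. -/
theorem isRegular_planar (h : IsGluing B ε A A' K) {a b : Space} (hab : (a, b) ∈ B) :
    ∃ c c', 0 < ε * c 2 ∧ A.IsBoundaryEdge a b c ∧ A'.IsBoundaryEdge b a c' ∧
      K.IsRegular a b c c' := by
  obtain ⟨c, hc, h1⟩ := h.left.collar _ _ hab
  obtain ⟨c', -, h2⟩ := h.right.collar b a hab
  have e : ∀ a b, K.star a b = A.star a b ∪ A'.star a b := fun a b => by
    ext c; exact h.tri _
  refine ⟨c, c', hc, h1, h2, ?_, ?_⟩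
  · rw [e, h1.1, h2.2, Set.union_empty]
  · rw [e, h1.2, h2.1, Set.empty_union]

theorem boundary_of_planar (h : IsGluing B ε A A' K) {a b c : Space} (ht : (a, b, c) ∈ A.tri)
    (ha : a 2 = 0) (hb : b 2 = 0) : (a, b) ∈ B ∧ A.IsBoundaryEdge a b c ∧ c 2 ≠ 0 := by
  have hB := h.left.boundary _ _ _ ht ha hb
  obtain ⟨d, hd, h1⟩ := h.left.collar _ _ hB
  have : c ∈ A.star a b := ht
  rw [h1.1] at this
  obtain rfl := Set.mem_singleton_iff.1 this
  exact ⟨hB, h1, fun h0 => by rw [h0, mul_zero] at hd; exact hd.false⟩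

theorem isRegular_of_left (h : IsGluing B ε A A' K) {a b p q : Space}
    (hr : A.IsRegular a b p q) : K.IsRegular a b p q := by
  have hp : (a, b, p) ∈ A.tri := by
    have : p ∈ A.star a b := by rw [hr.1]; rfl
    exact this
  refine (h.isRegular_left (h.off_plane hp ?_)).2 hr
  rintro ⟨ha, hb⟩
  have := (h.boundary_of_planar hp ha hb).2.1.2.symm.trans hr.2
  exact (Set.singleton_ne_empty _ this.symm).elim

theorem isBinding_not_planar (h : IsGluing B ε A A' K) {a b p q r : Space}
    (hr : A.IsBinding a b p q r) : 0 < ε * a 2 ∨ 0 < ε * b 2 := by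
  have hp : (a, b, p) ∈ A.tri := by
    have : p ∈ A.star a b := by rw [hr.2.1]; simp
    exact this
  refine h.off_plane hp ?_
  rintro ⟨ha, hb⟩
  have := (h.boundary_of_planar hp ha hb).2.1.2.symm.trans hr.2.2
  exact (Set.singleton_ne_empty _ this.symm).elim

theorem isBinding_of_left (h : IsGluing B ε A A' K) {a b p q r : Space}
    (hr : A.IsBinding a b p q r) : K.IsBinding a b p q r :=
  (h.isBinding_left (h.isBinding_not_planar hr)).2 hr

theorem isBinding_cases (h : IsGluing B ε A A' K) {a b p q r : Space}
    (hr : K.IsBinding a b p q r) : A.IsBinding a b p q r ∨ A'.IsBinding a b p q r := by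
  have key : ∀ {B ε A A'}, IsGluing B ε A A' K → (a, b, p) ∈ A.tri → A.IsBinding a b p q r := by
    intro B ε A A' h hp
    refine (h.isBinding_left (h.off_plane hp ?_)).1 hr
    rintro ⟨ha, hb⟩
    obtain ⟨c, c', -, -, -, h1, -⟩ := h.isRegular_planar (h.left.boundary _ _ _ hp ha hb)
    have := hr.2.1.symm.trans h1
    exact hr.1 ((this ▸ Set.mem_insert p {q} : p ∈ ({c} : Set Space)).trans
      (this ▸ Set.mem_insert_of_mem p rfl : q ∈ ({c} : Set Space)).symm)
  have hp : (a, b, p) ∈ K.tri := by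
    have : p ∈ K.star a b := by rw [hr.2.1]; simp
    exact this
  exact ((h.tri _).1 hp).imp (key h) (key h.symm)

theorem isTrivalentNode_cases (h : IsGluing B ε A A' K) {v p : Space}
    (hp : K.IsTrivalentNode v p) : A.IsTrivalentNode v p ∨ A'.IsTrivalentNode v p := by
  obtain ⟨x, y, z, hp | hp⟩ := hp
  · exact (h.isBinding_cases hp).imp (fun h => ⟨_, _, _, Or.inl h⟩) fun h => ⟨_, _, _, Or.inl h⟩
  · exact (h.isBinding_cases hp).imp (fun h => ⟨_, _, _, Or.inr h⟩) fun h => ⟨_, _, _, Or.inr h⟩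

theorem planar_isEnd (h : IsGluing B ε A A' K) {v n : Space} (hv : v 2 = 0) (hn : n 2 = 0) :
    A.IsEnd v n := by
  rintro x y ⟨h1, h2⟩
  have hp : (v, n, x) ∈ A.tri := by
    have : x ∈ A.star v n := by rw [h1]; rfl
    exact this
  have := (h.boundary_of_planar hp hv hn).2.1.2.symm.trans h2
  exact (Set.singleton_ne_empty _ this.symm).elim

theorem mem_linkEdges_arm (hr : ∀ a b c, (a, b, c) ∈ A.tri → (b, c, a) ∈ A.tri) {v p x : Space}
    {s : Bool} : arm s p x ∈ A.linkEdges v ↔ (if s then (v, p, x) ∈ A.tri else (p, v, x) ∈ A.tri) :=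
  mem_linkOf_arm hr

theorem glueHalf (h : IsGluing B ε A A' K) {v : Space} (hv : v 2 = 0) : GlueHalf A A' K v where
  link e he := (h.tri _).2 (Or.inl he)
  rotate := h.left.rotate
  step e f hs := ⟨hs.1, h.isRegular_of_left hs.2⟩
  trivalent p hp := by
    obtain ⟨x, y, z, hp | hp⟩ := hp
    · refine ⟨⟨_, _, _, Or.inl (h.isBinding_of_left hp)⟩, fun h0 => ?_⟩
      rcases h.isBinding_not_planar hp with h1 | h1
      · rw [hv, mul_zero] at h1; exact h1.false
      · rw [h0, mul_zero] at h1; exact h1.false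
    · refine ⟨⟨_, _, _, Or.inr (h.isBinding_of_left hp)⟩, fun h0 => ?_⟩
      rcases h.isBinding_not_planar hp with h1 | h1
      · rw [h0, mul_zero] at h1; exact h1.false
      · rw [hv, mul_zero] at h1; exact h1.false
  isEnd n hn := h.planar_isEnd hv hn
  unique n s x s' x' hn h1 h2 := by
    rw [mem_linkEdges_arm h.left.rotate] at h1 h2
    have key : ∀ {a b c d : Space}, a 2 = 0 → b 2 = 0 → (a, b, c) ∈ A.tri → (a, b, d) ∈ A.tri →
        c = d := by
      intro a b c d ha hb hc hd
      have : d ∈ A.star a b := hd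
      rw [(h.boundary_of_planar hc ha hb).2.1.1] at this
      exact this.symm
    have key' : ∀ {a b c d : Space}, a 2 = 0 → b 2 = 0 → (a, b, c) ∈ A.tri → (b, a, d) ∈ A.tri →
        False := by
      intro a b c d ha hb hc hd
      have : d ∈ A.star b a := hd
      rw [(h.boundary_of_planar hc ha hb).2.1.2] at this
      exact this
    cases s <;> cases s'
    · exact ⟨rfl, key hn hv h1 h2⟩
    · exact (key' hn hv h1 h2).elim
    · exact (key' hv hn h1 h2).elim
    · exact ⟨rfl, key hv hn h1 h2⟩
  cross n s x hn h1 := by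
    rw [mem_linkEdges_arm h.left.rotate] at h1
    cases s
    · obtain ⟨hB, hb, -⟩ := h.boundary_of_planar h1 hn hv
      obtain ⟨c, c', -, hc, hc', hr⟩ := h.isRegular_planar hB
      have hxc : x = c := Set.singleton_eq_singleton_iff.1 (hb.1.symm.trans hc.1)
      subst hxc
      refine ⟨c', (mem_linkEdges_arm h.right.rotate).2 ?_, ?_⟩
      · have : c' ∈ A'.star v n := by rw [hc'.1]; rfl
        exact this
      · exact Relation.EqvGen.rel _ _ ⟨rfl, hr.2, hr.1⟩
    · obtain ⟨hB, hb, -⟩ := h.boundary_of_planar h1 hv hn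
      obtain ⟨c, c', -, hc, hc', hr⟩ := h.isRegular_planar hB
      have hxc : x = c := Set.singleton_eq_singleton_iff.1 (hb.1.symm.trans hc.1)
      subst hxc
      refine ⟨c', (mem_linkEdges_arm h.right.rotate).2 ?_, ?_⟩
      · have : c' ∈ A'.star n v := by rw [hc'.1]; rfl
        exact this
      · exact (Relation.EqvGen.rel _ _ ⟨rfl, hr.1, hr.2⟩).symm
  oriented s s' p x h1 h2 := by
    rw [mem_linkEdges_arm h.left.rotate] at h1 h2
    cases s <;> cases s'
    · rfl
    · exact (h.left.oriented _ _ _ h1 h2).elim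
    · exact (h.left.oriented _ _ _ h1 h2).elim
    · rfl

theorem glueAt (h : IsGluing B ε A A' K) {v : Space} (hv : v 2 = 0) : GlueAt A A' K v where
  left := h.glueHalf hv
  right := h.symm.glueHalf hv
  cover e he := (h.tri _).1 he
  trivalent p hp := h.isTrivalentNode_cases hp
  planar s s' p x x' h1 h2 := by
    have side : ∀ {B ε A} {s : Bool} {p x : Space}, IsHalf B ε A → arm s p x ∈ A.linkEdges v →
        0 ≤ ε * p 2 := by
      intro B ε A s p x h h1
      rw [mem_linkEdges_arm h.rotate] at h1
      cases s
      · exact h.side _ _ _ h1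
      · exact h.side _ _ _ (h.rotate _ _ _ h1)
    have e1 := side h.left h1
    have e2 := side h.right h2
    exact (mul_eq_zero.1 (le_antisymm (by linarith) e1)).resolve_left h.ne_zero

/-- Points off the plane keep their local models. -/
theorem point_of_agree {v : Space} (h1 : ∀ p, K.star v p = A.star v p)
    (h2 : ∀ p, K.star p v = A.star p v)
    (h : A.IsFacetPoint v ∨ A.IsBindingPoint v ∨ A.IsSingularPoint v) :
    K.IsFacetPoint v ∨ K.IsBindingPoint v ∨ K.IsSingularPoint v := by
  have e1 : K.linkEdges v = A.linkEdges v := by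
    ext e
    exact Set.ext_iff.1 (h1 e.1) e.2
  have e2 : K.LinkStep v = A.LinkStep v := by
    funext e f
    simp only [LinkStep, LabelledComplex.IsRegular, h1, h2]
  have e3 : K.IsTrivalentNode v = A.IsTrivalentNode v := by
    funext p
    simp only [IsTrivalentNode, IsBinding, h1, h2]
  have e4 : K.SameSector v = A.SameSector v := by
    unfold SameSector
    rw [e2]
  have e5 : K.IsEdgeBetween v = A.IsEdgeBetween v := by
    unfold IsEdgeBetween
    rw [e1]
  have e6 : K.Joins v = A.Joins v := by
    unfold Joins
    rw [e4, e5]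
  have e7 : K.Touches v = A.Touches v := by
    unfold Touches
    rw [e4, e5]
  unfold IsFacetPoint IsBindingPoint IsSingularPoint at *
  rw [e1, e3, e4, e6, e7]
  exact h

theorem point (h : IsGluing B ε A A' K) {v b c : Space} (ht : (v, b, c) ∈ A.tri) :
    K.IsFacetPoint v ∨ K.IsBindingPoint v ∨ K.IsSingularPoint v := by
  by_cases hv : v 2 = 0
  · have hg := h.glueAt hv
    have hex : ∃ (n : Space) (s : Bool) (x y : Space), n 2 = 0 ∧ arm s n x ∈ A.linkEdges v ∧
        arm (!s) n y ∈ A'.linkEdges v := by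
      obtain ⟨n, hn | hn⟩ := h.left.boundary_vertex _ _ _ ht hv
      · obtain ⟨x, y, -, hx, hy, -⟩ := h.isRegular_planar hn
        refine ⟨n, true, x, y, (h.left.planar _ _ hn).2, (mem_linkEdges_arm h.left.rotate).2 ?_,
          (mem_linkEdges_arm h.right.rotate).2 ?_⟩
        · have : x ∈ A.star v n := by rw [hx.1]; rfl
          exact this
        · have : y ∈ A'.star n v := by rw [hy.1]; rfl
          exact this
      · obtain ⟨x, y, -, hx, hy, -⟩ := h.isRegular_planar hn
        refine ⟨n, false, x, y, (h.left.planar _ _ hn).1, (mem_linkEdges_arm h.left.rotate).2 ?_,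
          (mem_linkEdges_arm h.right.rotate).2 ?_⟩
        · have : x ∈ A.star n v := by rw [hx.1]; rfl
          exact this
        · have : y ∈ A'.star v n := by rw [hy.1]; rfl
          exact this
    obtain ⟨n, s, x, y, hn, hx, hy⟩ := hex
    rcases h.left.boundary_point _ _ _ ht hv with hA | hA <;>
    rcases h.right.boundary_point v _ _ hy hv with hA' | hA'
    · exact Or.inl (hg.isFacetPoint hA hA' ⟨n, s, x, hn, hx⟩)
    · exact (hg.symm.not_tripod_facet hA' hA).elim
    · exact (hg.not_tripod_facet hA hA').elim
    · exact Or.inr (Or.inl (hg.isBindingPoint hA hA' h.right.apart))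
  · have hpos := h.pos_of_ne ht hv
    exact point_of_agree (fun p => h.star_left (Or.inl hpos)) (fun p => h.star_left (Or.inr hpos))
      (h.left.inner_point _ _ _ ht hpos)

theorem edge (h : IsGluing B ε A A' K) {a b c : Space} (ht : (a, b, c) ∈ A.tri) :
    (∃ p q, K.IsRegular a b p q) ∨ (∃ p q r, K.IsBinding a b p q r) ∨
      (∃ p q r, K.IsBinding b a p q r) := by
  by_cases hab : a 2 = 0 ∧ b 2 = 0
  · obtain ⟨c, c', -, -, -, hr⟩ := h.isRegular_planar (h.left.boundary _ _ _ ht hab.1 hab.2)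
    exact Or.inl ⟨_, _, hr⟩
  · rcases h.left.edge _ _ _ ht hab with ⟨p, q, hr⟩ | ⟨p, q, r, hr⟩ | ⟨p, q, r, hr⟩
    exacts [Or.inl ⟨_, _, h.isRegular_of_left hr⟩, Or.inr (Or.inl ⟨_, _, _, h.isBinding_of_left hr⟩),
      Or.inr (Or.inr ⟨_, _, _, h.isBinding_of_left hr⟩)]

theorem not_planar (h : IsGluing B ε A A' K) {a b c : Space} (ht : (a, b, c) ∈ A.tri) :
    ¬ (a 2 = 0 ∧ b 2 = 0 ∧ c 2 = 0) := fun h0 =>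
  (h.boundary_of_planar ht h0.1 h0.2.1).2.2 h0.2.2

theorem oriented (h : IsGluing B ε A A' K) {a b c : Space} (ht : (a, b, c) ∈ A.tri) :
    (b, a, c) ∉ K.tri := by
  intro ht'
  refine ((h.tri _).1 ht').elim (h.left.oriented _ _ _ ht) fun h' => ?_
  have e1 := h.left.side _ _ _ ht
  have e2 := h.left.side _ _ _ (h.left.rotate _ _ _ ht)
  have e3 := h.left.side _ _ _ (h.left.rotate _ _ _ (h.left.rotate _ _ _ ht))
  have f2 := h.right.side _ _ _ h'
  have f1 := h.right.side _ _ _ (h.right.rotate _ _ _ h')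
  have f3 := h.right.side _ _ _ (h.right.rotate _ _ _ (h.right.rotate _ _ _ h'))
  have key : ∀ {x : ℝ}, 0 ≤ ε * x → 0 ≤ -ε * x → x = 0 := fun {x} e f =>
    (mul_eq_zero.1 (le_antisymm (by linarith) e)).resolve_left h.ne_zero
  exact h.not_planar ht ⟨key e1 f1, key e2 f2, key e3 f3⟩

theorem mem_of_isBinding {C : LabelledComplex} {a b p q r : Space} (h : C.IsBinding a b p q r) :
    (a, b, p) ∈ C.tri ∧ (a, b, q) ∈ C.tri ∧ (b, a, r) ∈ C.tri := by
  obtain ⟨-, h1, h2⟩ := h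
  have e1 : p ∈ C.star a b := by rw [h1]; simp
  have e2 : q ∈ C.star a b := by rw [h1]; simp
  have e3 : r ∈ C.star b a := by rw [h2]; simp
  exact ⟨e1, e2, e3⟩

theorem isClosedFoam (h : IsGluing B ε A A' K) : IsClosedFoam K where
  finite := (h.left.finite.union h.right.finite).subset fun t ht => (h.tri t).1 ht
  rotate a b c ht := (h.tri _).2 (((h.tri _).1 ht).imp (h.left.rotate _ _ _) (h.right.rotate _ _ _))
  oriented a b c ht := ((h.tri _).1 ht).elim (fun ht => h.oriented ht) fun ht => h.symm.oriented ht
  ne a b c ht := ((h.tri _).1 ht).elim (h.left.ne a b c) (h.right.ne a b c)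
  edge a b c ht := ((h.tri _).1 ht).elim (fun ht => h.edge ht) fun ht => h.symm.edge ht
  apart a b p q r ht := (h.isBinding_cases ht).elim (h.left.apart a b p q r)
    (h.right.apart a b p q r)
  label_binding a b p q r ht := by
    rcases h.isBinding_cases ht with ht | ht
    · obtain ⟨h1, h2, h3⟩ := mem_of_isBinding ht
      rw [h.label_left _ h1, h.label_left _ h2, h.label_left _ h3]
      exact h.left.label_binding _ _ _ _ _ ht
    · obtain ⟨h1, h2, h3⟩ := mem_of_isBinding ht
      rw [h.label_right _ h1, h.label_right _ h2, h.label_right _ h3]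
      exact h.right.label_binding _ _ _ _ _ ht
  point v b c ht := ((h.tri _).1 ht).elim (fun ht => h.point ht) fun ht => h.symm.point ht

end IsGluing

variable {N : ℕ} {Γ : PlaneGraph}

theorem isGluing_glue (F G : Foam N Γ) :
    IsGluing (Prod.map incl incl '' Γ.edges) (-1) F.toLabelledComplex G.toLabelledComplex.mirror
      (glue F.toLabelledComplex G.toLabelledComplex) where
  left := F.isHalf
  right := G.isHalf.mirror
  ne_zero := by norm_num
  tri _ := Iff.rfl
  label_left t ht := if_pos ht
  label_right := by
    rintro ⟨a, b, c⟩ ht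
    refine if_neg fun h' => ?_
    have e1 := F.below _ _ _ h'
    have e2 := F.below _ _ _ (F.rotate _ _ _ h')
    have e3 := F.below _ _ _ (F.rotate _ _ _ (F.rotate _ _ _ h'))
    have f2 := G.below _ _ _ ht
    have f1 := G.below _ _ _ (G.rotate _ _ _ ht)
    have f3 := G.below _ _ _ (G.rotate _ _ _ (G.rotate _ _ _ ht))
    rw [mirror_two] at f1 f2 f3
    have hB := F.isHalf.boundary _ _ _ h' (by linarith) (by linarith)
    obtain ⟨d, hd, h1⟩ := F.isHalf.collar _ _ hB
    have : c ∈ F.star a b := h'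
    rw [h1.1] at this
    obtain rfl := Set.mem_singleton_iff.1 this
    linarith

theorem isClosedFoam_glue (F G : Foam N Γ) :
    IsClosedFoam (glue F.toLabelledComplex G.toLabelledComplex) :=
  (isGluing_glue F G).isClosedFoam

end SlFoam
end

noncomputable section
namespace SlFoam
open LabelledComplex

/-! ### The derivation on evaluations -/

section Derivative

variable {N : ℕ} {C : LabelledComplex} {Γ : PlaneGraph}

/-- The polynomial in the variables of the pigments that a polynomial in the dots contributes to the
numerator of the coloring `c`. -/
def colorHom (C : LabelledComplex) (c : Triangle → Finset (Fin N)) :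
    MvPolynomial C.Dot ℤ →ₐ[ℤ] MvPolynomial (Fin N) ℤ :=
  MvPolynomial.aeval fun d => esymmOn (c d.1.1) d.1.2

theorem colorHom_X (c : Triangle → Finset (Fin N)) (d : C.Dot) :
    colorHom C c (MvPolynomial.X d) = esymmOn (c d.1.1) d.1.2 :=
  MvPolynomial.aeval_X _ _

theorem esymmOn_zero (s : Finset (Fin N)) : esymmOn s 0 = 1 := by
  simp [esymmOn]

theorem nabla_esymmOn_succ (s : Finset (Fin N)) {w : ℕ} (hw : w < s.card) :
    nabla ℤ (Fin N) (esymmOn s (w + 1)) = ((s.card - w : ℕ) : ℤ) • esymmOn s w :=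
  nabla_esymm ℤ id s w hw

theorem nabla_colorHom {c : Triangle → Finset (Fin N)} (hc : ∀ t ∈ C.tri, (c t).card = C.label t)
    (P : MvPolynomial C.Dot ℤ) :
    nabla ℤ (Fin N) (colorHom C c P) = colorHom C c (nablaDots ℤ C P) := by
  have hX : ∀ d : C.Dot, nabla ℤ (Fin N) (colorHom C c (MvPolynomial.X d)) =
      colorHom C c (nablaDots ℤ C (MvPolynomial.X d)) := by
    rintro ⟨⟨t, w⟩, ht, h1, hw⟩
    obtain ⟨w, rfl⟩ : ∃ v, w = v + 1 := ⟨w - 1, by simp only at h1; omega⟩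
    simp only at hw ht
    have e1 : colorHom C c (MvPolynomial.X ⟨(t, w + 1), ht, h1, hw⟩) = esymmOn (c t) (w + 1) :=
      colorHom_X c _
    have e2 : nablaDots ℤ C (MvPolynomial.X ⟨(t, w + 1), ht, h1, hw⟩) =
        ((C.label t - (w + 1) + 1 : ℕ) : ℤ) • lowerDot ℤ C ⟨(t, w + 1), ht, h1, hw⟩ :=
      MvPolynomial.mkDerivation_X _ _ _
    have hcard := hc t ht
    rw [e1, e2, nabla_esymmOn_succ _ (by omega), map_smul, hcard,
      show C.label t - (w + 1) + 1 = C.label t - w by omega]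
    congr 1
    unfold lowerDot
    rcases w with _ | w
    · simp [esymmOn_zero]
    · rw [dif_pos (by simp)]
      exact (colorHom_X c ⟨(t, w + 1), ht, by simp, by simp only; omega⟩).symm
  induction P using MvPolynomial.induction_on with
  | C a => simp [colorHom, nablaDots, nabla]
  | add p q hp hq => simp only [map_add, hp, hq]
  | mul_X p d hp => rw [Derivation.leibniz, map_mul, Derivation.leibniz, map_add, hX, hp]; simp

theorem nabla_prod_sub (S : Finset (Fin N × Fin N)) (n : Fin N × Fin N → ℕ) :
    nabla ℤ (Fin N) (∏ p ∈ S, (MvPolynomial.X p.1 - MvPolynomial.X p.2) ^ n p) = 0 := by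
  have hX : ∀ i : Fin N, nabla ℤ (Fin N) (MvPolynomial.X i) = 1 := fun i =>
    MvPolynomial.mkDerivation_X _ _ _
  induction S using Finset.induction_on with
  | empty => simp
  | insert p S hp ih =>
    rw [Finset.prod_insert hp, Derivation.leibniz, ih, Derivation.leibniz_pow, map_sub, hX, hX]
    simp

/-- An evaluation in cleared form: both the common denominator and the weights of the colorings are
products of differences of variables, which the derivation kills. -/
theorem exists_cleared (hC : IsClosedFoam C) (N : ℕ) :
    ∃ (Δ : MvPolynomial (Fin N) ℤ) (T : Finset (Triangle → Finset (Fin N)))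
      (w : (Triangle → Finset (Fin N)) → MvPolynomial (Fin N) ℤ), Δ ≠ 0 ∧
      nabla ℤ (Fin N) Δ = 0 ∧ (∀ c ∈ T, IsColoring N C c) ∧
      (∀ c ∈ T, nabla ℤ (Fin N) (w c) = 0) ∧
      ∀ k P, algebraMap _ (RatFunc N) P = evaluation N C k →
        Δ * P = ∑ c ∈ T, w c * numerator c k := by
  obtain ⟨M, n, hn⟩ := exists_common_denominator hC N
  refine ⟨∏ p ∈ pigmentPairs N, (MvPolynomial.X p.1 - MvPolynomial.X p.2) ^ M,
    (finite_colorings hC).toFinset,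
    fun c => (((-1 : ℤˣ) ^ signExponent C c : ℤˣ) : ℤ) •
      ∏ p ∈ pigmentPairs N, (MvPolynomial.X p.1 - MvPolynomial.X p.2) ^ n c p, ?_,
    nabla_prod_sub _ _, fun c hc => (Set.Finite.mem_toFinset _).1 hc, fun c _ => ?_, ?_⟩
  · refine Finset.prod_ne_zero_iff.2 fun p hp => pow_ne_zero _ ?_
    exact sub_ne_zero.2 fun h => ne_of_mem_pigmentPairs hp (MvPolynomial.X_injective h)
  · rw [Derivation.map_smul, nabla_prod_sub, smul_zero]
  · intro k P hP
    apply algebraMap_ratFunc_injective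
    rw [map_mul, hP, evaluation_eq_sum hC, map_sum, Finset.mul_sum]
    refine Finset.sum_congr rfl fun c hc => ?_
    rw [← hn c ((Set.Finite.mem_toFinset _).1 hc), coloringTerm, neg_one_zpow_cast, map_mul]
    dsimp only
    rw [zsmul_eq_mul, map_mul, map_intCast]
    have := denominator_ne_zero C c
    field_simp

/-- The exponent of the monomial that arises when `∇` lowers the dot `d`. -/
def lowerExponent (C : LabelledComplex) (k : C.Dot →₀ ℕ) (d : C.Dot) : C.Dot →₀ ℕ :=
  k - Finsupp.single d 1 + if h : 2 ≤ d.1.2 then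
    Finsupp.single ⟨(d.1.1, d.1.2 - 1), d.2.1, by omega, by have := d.2.2.2; dsimp only; omega⟩ 1
  else 0

theorem nablaDots_monomial (R : Type*) [CommRing R] (k : C.Dot →₀ ℕ) :
    nablaDots R C (MvPolynomial.monomial k 1) =
      ∑ d ∈ k.support, ((k d * (C.label d.1.1 - d.1.2 + 1) : ℕ) : R) •
        MvPolynomial.monomial (lowerExponent C k d) 1 := by
  rw [nablaDots, MvPolynomial.mkDerivation_monomial, one_smul, Finsupp.sum]
  refine Finset.sum_congr rfl fun d _ => ?_
  have h : (lowerDot R C d : MvPolynomial C.Dot R) = MvPolynomial.monomial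
      (if h : 2 ≤ d.1.2 then
        Finsupp.single ⟨(d.1.1, d.1.2 - 1), d.2.1, by omega,
          by have := d.2.2.2; dsimp only; omega⟩ 1
      else 0) 1 := by
    unfold lowerDot
    split_ifs
    exacts [rfl, rfl]
  rw [h, lowerExponent, smul_eq_mul, mul_smul_comm, MvPolynomial.monomial_mul, mul_one,
    MvPolynomial.smul_monomial, MvPolynomial.smul_monomial]
  congr 1
  push_cast
  simp [mul_comm]

theorem numerator_glueDots (c : Triangle → Finset (Fin N)) (φ ψ : DottedFoam N Γ) :
    numerator c (glueDots φ ψ) =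
      colorHom φ.1.toLabelledComplex c (MvPolynomial.monomial φ.2 1) *
      colorHom ψ.1.toLabelledComplex (c ∘ mirrorTriangle) (MvPolynomial.monomial ψ.2 1) := by
  rw [numerator, glueDots, Finsupp.prod_add_index' (by simp) (by intros; rw [pow_add]),
    Finsupp.prod_mapDomain_index (by simp) (by intros; rw [pow_add]),
    Finsupp.prod_mapDomain_index (by simp) (by intros; rw [pow_add]), colorHom, colorHom,
    MvPolynomial.aeval_monomial, MvPolynomial.aeval_monomial, map_one, one_mul, one_mul]
  rfl

/-- The evaluation of `F ∪ G'` as a symmetric polynomial. -/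
def pairingPoly (hN : 2 ≤ N) (φ ψ : DottedFoam N Γ) : MvPolynomial (Fin N) ℤ :=
  (exists_polynomial_evaluation hN (isClosedFoam_glue φ.1 ψ.1) (glueDots φ ψ)).choose

theorem pairingPoly_isSymmetric (hN : 2 ≤ N) (φ ψ : DottedFoam N Γ) :
    (pairingPoly hN φ ψ).IsSymmetric :=
  (exists_polynomial_evaluation hN (isClosedFoam_glue φ.1 ψ.1) (glueDots φ ψ)).choose_spec.1

theorem algebraMap_pairingPoly (hN : 2 ≤ N) (φ ψ : DottedFoam N Γ) :
    algebraMap _ (RatFunc N) (pairingPoly hN φ ψ) = pairing φ ψ :=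
  (exists_polynomial_evaluation hN (isClosedFoam_glue φ.1 ψ.1) (glueDots φ ψ)).choose_spec.2

end Derivative
end SlFoam
end

noncomputable section
namespace SlFoam
open LabelledComplex

variable {N : ℕ} {Γ : PlaneGraph}

/-! ### Operators and the pairing -/

/-- The derivation on the evaluations is the sum of the operators `∇` on both sides. -/
theorem nabla_pairingPoly (hN : 2 ≤ N) (F G : Foam N Γ) (k : F.Dot →₀ ℕ) (l : G.Dot →₀ ℕ) :
    nabla ℤ (Fin N) (pairingPoly hN ⟨F, k⟩ ⟨G, l⟩) =
      ∑ d ∈ k.support, ((k d * (F.label d.1.1 - d.1.2 + 1) : ℕ) : ℤ) •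
        pairingPoly hN ⟨F, lowerExponent F.toLabelledComplex k d⟩ ⟨G, l⟩ +
      ∑ d ∈ l.support, ((l d * (G.label d.1.1 - d.1.2 + 1) : ℕ) : ℤ) •
        pairingPoly hN ⟨F, k⟩ ⟨G, lowerExponent G.toLabelledComplex l d⟩ := by
  have hC := isClosedFoam_glue F G
  obtain ⟨Δ, T, w, hΔ, hΔ', hT, hw, hcl⟩ := exists_cleared hC N
  have key : ∀ k l, Δ * pairingPoly hN ⟨F, k⟩ ⟨G, l⟩ = ∑ c ∈ T, w c *
      (colorHom F.toLabelledComplex c (MvPolynomial.monomial k 1) *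
        colorHom G.toLabelledComplex (c ∘ mirrorTriangle) (MvPolynomial.monomial l 1)) := by
    intro k l
    rw [hcl (glueDots ⟨F, k⟩ ⟨G, l⟩) _ (algebraMap_pairingPoly hN _ _)]
    refine Finset.sum_congr rfl fun c _ => ?_
    rw [numerator_glueDots]
  have hF : ∀ c ∈ T, ∀ t ∈ F.tri, (c t).card = F.label t := by
    intro c hc t ht
    rw [(hT c hc).card t (Or.inl ht)]
    exact if_pos ht
  have hG : ∀ c ∈ T, ∀ t ∈ G.tri, ((c ∘ mirrorTriangle) t).card = G.label t := by
    intro c hc t ht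
    have ht' : mirrorTriangle t ∈ G.toLabelledComplex.mirror.tri := by
      change mirrorTriangle (mirrorTriangle t) ∈ G.tri
      rwa [mirrorTriangle_mirrorTriangle]
    rw [Function.comp_apply, (hT c hc).card _ (Or.inr ht'),
      (isGluing_glue F G).label_right _ ht']
    change G.label (mirrorTriangle (mirrorTriangle t)) = _
    rw [mirrorTriangle_mirrorTriangle]
  refine mul_left_cancel₀ hΔ ?_
  have h1 := congrArg (nabla ℤ (Fin N)) (key k l)
  rw [Derivation.leibniz, hΔ', smul_zero, add_zero, smul_eq_mul, map_sum] at h1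
  rw [h1, mul_add, Finset.mul_sum, Finset.mul_sum]
  simp only [mul_smul_comm, key, Finset.smul_sum]
  rw [Finset.sum_comm, Finset.sum_comm (s := l.support), ← Finset.sum_add_distrib]
  refine Finset.sum_congr rfl fun c hc => ?_
  rw [Derivation.leibniz, hw c hc, smul_zero, add_zero, Derivation.leibniz,
    nabla_colorHom (hF c hc), nabla_colorHom (hG c hc), nablaDots_monomial, nablaDots_monomial,
    map_sum, map_sum]
  simp only [map_smul, smul_eq_mul, mul_add, Finset.mul_sum, mul_smul_comm]
  rw [add_comm]
  refine congrArg₂ _ (Finset.sum_congr rfl fun d _ => ?_) rfl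
  rw [mul_comm (colorHom G.toLabelledComplex _ _)]

theorem valueAtZero_pairing (hN : 2 ≤ N) (R : Type*) [CommRing R] (φ ψ : DottedFoam N Γ) :
    valueAtZero R (pairing φ ψ) =
      ((MvPolynomial.constantCoeff (pairingPoly hN φ ψ) : ℤ) : R) := by
  have h : ∃ P : MvPolynomial (Fin N) ℤ, algebraMap _ (RatFunc N) P = pairing φ ψ :=
    ⟨_, algebraMap_pairingPoly hN φ ψ⟩
  have h2 : h.choose = pairingPoly hN φ ψ := algebraMap_ratFunc_injective
    (h.choose_spec.trans (algebraMap_pairingPoly hN φ ψ).symm)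
  rw [valueAtZero, dif_pos h, h2]

theorem constantCoeff_nabla (P : MvPolynomial (Fin N) ℤ) :
    MvPolynomial.constantCoeff (nabla ℤ (Fin N) P) =
      ∑ i, MvPolynomial.coeff (Finsupp.single i 1) P := by
  induction P using MvPolynomial.induction_on with
  | C a =>
    have : ∀ i : Fin N, (0 : Fin N →₀ ℕ) ≠ Finsupp.single i 1 := fun i h => by
      simpa using DFunLike.congr_fun h i
    have h : ∀ i : Fin N, MvPolynomial.coeff (Finsupp.single i 1)
        (MvPolynomial.C a : MvPolynomial (Fin N) ℤ) = 0 := fun i => by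
      rw [MvPolynomial.coeff_C, if_neg (this i)]
    rw [Finset.sum_eq_zero fun i _ => h i]
    simp [nabla]
  | add p q hp hq => simp only [map_add, hp, hq, MvPolynomial.coeff_add, Finset.sum_add_distrib]
  | mul_X p i hp =>
    have hX : nabla ℤ (Fin N) (MvPolynomial.X i) = 1 := MvPolynomial.mkDerivation_X _ _ _
    rw [Derivation.leibniz, hX]
    have h : ∀ j, MvPolynomial.coeff (Finsupp.single j 1) (p * MvPolynomial.X i) =
        if j = i then MvPolynomial.constantCoeff p else 0 := by
      intro j
      rw [MvPolynomial.coeff_mul_X']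
      by_cases hj : j = i
      · subst hj
        simp [MvPolynomial.constantCoeff_eq]
      · have : i ∉ (Finsupp.single j 1 : Fin N →₀ ℕ).support := by
          simp [Ne.symm hj]
        rw [if_neg this, if_neg hj]
    simp [h]

/-- The derivative of a symmetric polynomial vanishes at `0` modulo `N`. -/
theorem constantCoeff_nabla_of_isSymmetric {P : MvPolynomial (Fin N) ℤ} (hP : P.IsSymmetric)
    (R : Type*) [CommRing R] (hR : (N : R) = 0) :
    ((MvPolynomial.constantCoeff (nabla ℤ (Fin N) P) : ℤ) : R) = 0 := by
  rw [constantCoeff_nabla]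
  have h : ∀ i j : Fin N, MvPolynomial.coeff (Finsupp.single i 1) P =
      MvPolynomial.coeff (Finsupp.single j 1) P := by
    intro i j
    conv_lhs => rw [← hP (Equiv.swap i j)]
    have := MvPolynomial.coeff_rename_mapDomain (Equiv.swap i j) (Equiv.swap i j).injective P
      (Finsupp.single j 1)
    rwa [Finsupp.mapDomain_single, Equiv.swap_apply_right] at this
  rcases isEmpty_or_nonempty (Fin N) with hE | ⟨⟨i⟩⟩
  · simp
  · rw [Finset.sum_congr rfl fun j _ => h j i]
    simp [hR]

theorem basepointFoam_single (R : Type*) [CommRing R] {e : Plane × Plane} (he : e ∈ Γ.edges)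
    {w : ℕ} (h1 : 1 ≤ w) (hw : w ≤ Γ.label e) (φ : DottedFoam N Γ) (r : R) :
    basepointFoam N Γ R e he w h1 hw (Finsupp.single φ r) =
      Finsupp.single ⟨φ.1, φ.2 + Finsupp.single (φ.1.boundaryDot e he w h1 hw) 1⟩ r := by
  rw [basepointFoam, Finsupp.linearCombination_single, Finsupp.smul_single, smul_eq_mul, mul_one]

theorem decorate_monomial (R : Type*) [CommRing R] (F : Foam N Γ) (k : F.Dot →₀ ℕ) :
    decorate R F (MvPolynomial.monomial k 1) = Finsupp.single ⟨F, k⟩ 1 := by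
  rw [decorate]
  exact Module.Basis.constr_basis (MvPolynomial.basisMonomials F.Dot R) R _ k

theorem nablaFoam_single (R : Type*) [CommRing R] (F : Foam N Γ) (k : F.Dot →₀ ℕ) :
    nablaFoam R N Γ (Finsupp.single ⟨F, k⟩ 1) =
      ∑ d ∈ k.support, ((k d * (F.label d.1.1 - d.1.2 + 1) : ℕ) : R) •
        Finsupp.single ⟨F, lowerExponent F.toLabelledComplex k d⟩ 1 := by
  rw [nablaFoam, Finsupp.linearCombination_single, one_smul, nablaDots_monomial, map_sum]
  refine Finset.sum_congr rfl fun d _ => ?_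
  rw [map_smul, decorate_monomial]

/-! ### Operators on the state space -/

/-- The bilinear pairing on combinations of dotted foams. -/
def bilinearPairing (N : ℕ) (Γ : PlaneGraph) (R : Type*) [CommRing R] :
    FoamModule N Γ R →ₗ[R] FoamModule N Γ R →ₗ[R] R :=
  Finsupp.lsum R fun φ => LinearMap.toSpanSingleton R _
    (Finsupp.linearCombination R fun ψ => valueAtZero R (pairing φ ψ))

theorem bilinearPairing_single (R : Type*) [CommRing R] (φ ψ : DottedFoam N Γ) :
    bilinearPairing N Γ R (Finsupp.single φ 1) (Finsupp.single ψ 1) =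
      valueAtZero R (pairing φ ψ) := by
  simp [bilinearPairing]

theorem mem_pairingKernel_iff (R : Type*) [CommRing R] {x : FoamModule N Γ R} :
    x ∈ pairingKernel N Γ R ↔ ∀ y, bilinearPairing N Γ R x y = 0 := by
  have h : ∀ ψ : DottedFoam N Γ, Finsupp.linearCombination R
      (fun φ : DottedFoam N Γ => valueAtZero R (pairing φ ψ)) =
      (bilinearPairing N Γ R).flip (Finsupp.single ψ 1) := by
    intro ψ
    refine Finsupp.lhom_ext' fun φ => LinearMap.ext_ring ?_
    simp [bilinearPairing]
  simp only [pairingKernel, Submodule.mem_iInf, LinearMap.mem_ker, h, LinearMap.flip_apply]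
  refine ⟨fun hx y => ?_, fun hx ψ => hx _⟩
  have : bilinearPairing N Γ R x = 0 :=
    Finsupp.lhom_ext' fun ψ => LinearMap.ext_ring (by simpa using hx ψ)
  rw [this, LinearMap.zero_apply]

/-- An operator with an adjoint descends to the state space. -/
theorem descends_of_adjoint {R : Type*} [CommRing R] {f g : Module.End R (FoamModule N Γ R)}
    (h : ∀ φ ψ : DottedFoam N Γ, bilinearPairing N Γ R (f (Finsupp.single φ 1)) (Finsupp.single ψ 1) =
      bilinearPairing N Γ R (Finsupp.single φ 1) (g (Finsupp.single ψ 1))) : Descends f := by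
  have h' : (bilinearPairing N Γ R).comp f = ((bilinearPairing N Γ R).flip.comp g).flip := by
    refine Finsupp.lhom_ext' fun φ => LinearMap.ext_ring ?_
    refine Finsupp.lhom_ext' fun ψ => LinearMap.ext_ring ?_
    simpa using h φ ψ
  intro x hx
  rw [mem_pairingKernel_iff] at hx
  rw [Submodule.mem_comap, mem_pairingKernel_iff]
  intro y
  have := LinearMap.congr_fun (LinearMap.congr_fun h' x) y
  simp only [LinearMap.comp_apply, LinearMap.flip_apply] at this
  rw [this, hx]

theorem nablaFoam_descends (hN : 2 ≤ N) {R : Type*} [CommRing R] (hR : (N : R) = 0) :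
    Descends (nablaFoam R N Γ) := by
  refine descends_of_adjoint (g := -nablaFoam R N Γ) ?_
  rintro ⟨F, k⟩ ⟨G, l⟩
  rw [LinearMap.neg_apply, map_neg, eq_neg_iff_add_eq_zero, nablaFoam_single, nablaFoam_single,
    map_sum, map_sum, LinearMap.sum_apply]
  simp only [map_smul, LinearMap.smul_apply, bilinearPairing_single, valueAtZero_pairing hN]
  rw [← constantCoeff_nabla_of_isSymmetric (pairingPoly_isSymmetric hN ⟨F, k⟩ ⟨G, l⟩) R hR,
    nabla_pairingPoly, map_add, map_sum, map_sum, Int.cast_add, Int.cast_sum, Int.cast_sum]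
  refine congrArg₂ _ (Finset.sum_congr rfl fun d _ => ?_) (Finset.sum_congr rfl fun d _ => ?_)
  · rw [zsmul_eq_mul, map_mul, map_intCast, Int.cast_mul, Int.cast_natCast, smul_eq_mul]
    simp
  · rw [zsmul_eq_mul, map_mul, map_intCast, Int.cast_mul, Int.cast_natCast, smul_eq_mul]
    simp

theorem boundaryDot_fst {F : Foam N Γ} {e : Plane × Plane} (he : e ∈ Γ.edges)
    {w : ℕ} (h1 : 1 ≤ w) (hw : w ≤ Γ.label e) {c : Space}
    (hc : F.IsBoundaryEdge (incl e.1) (incl e.2) c) :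
    (F.boundaryDot e he w h1 hw).1.1 = (incl e.1, incl e.2, c) := by
  have h := (F.collar e.1 e.2 he).choose_spec.2.1
  have : c = (F.collar e.1 e.2 he).choose :=
    Set.singleton_eq_singleton_iff.1 (hc.1.symm.trans h.1)
  rw [this]
  rfl

/-- The facets of `F` and of the mirror image of `G` that meet in an edge of `Γ` form one facet. -/
theorem color_boundaryDot {F G : Foam N Γ} {e : Plane × Plane} (he : e ∈ Γ.edges)
    {w : ℕ} (h1 : 1 ≤ w) (hw : w ≤ Γ.label e) {c : Triangle → Finset (Fin N)}
    (hc : IsColoring N (glue F.toLabelledComplex G.toLabelledComplex) c) :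
    c (F.boundaryDot e he w h1 hw).1.1 = c (mirrorTriangle (G.boundaryDot e he w h1 hw).1.1) := by
  have hB : (incl e.1, incl e.2) ∈ Prod.map incl incl '' Γ.edges := ⟨e, he, rfl⟩
  obtain ⟨p, q, -, hp, hq, hr⟩ := (isGluing_glue F G).isRegular_planar hB
  obtain ⟨d, -, hd, -⟩ := G.collar e.1 e.2 he
  have m : ∀ x : Plane, mirror (incl x) = incl x := fun x => mirror_of_eq_zero rfl
  have hqd : q = mirror d := by
    have := star_mirror.1 hq.1
    rw [m, m, hd.1, Set.image_singleton] at this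
    rw [← mirror_eq_iff]
    exact (Set.singleton_eq_singleton_iff.1 this).symm
  rw [boundaryDot_fst he h1 hw hp, boundaryDot_fst he h1 hw hd, hc.regular _ _ _ _ hr, hqd]
  simp only [mirrorTriangle, m]

theorem monomial_add_single {C : LabelledComplex} (k : C.Dot →₀ ℕ) (d : C.Dot) :
    (MvPolynomial.monomial (k + Finsupp.single d 1) 1 : MvPolynomial C.Dot ℤ) =
      MvPolynomial.monomial k 1 * MvPolynomial.X d := by
  rw [MvPolynomial.X, MvPolynomial.monomial_mul, mul_one]

theorem numerator_add_left (c : Triangle → Finset (Fin N)) (φ ψ : DottedFoam N Γ) (d : φ.1.Dot) :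
    numerator c (glueDots ⟨φ.1, φ.2 + Finsupp.single d 1⟩ ψ) =
      numerator c (glueDots φ ψ) * esymmOn (c d.1.1) d.1.2 := by
  rw [numerator_glueDots, numerator_glueDots]
  dsimp only
  rw [monomial_add_single, map_mul (colorHom _ c), colorHom_X, mul_right_comm]

theorem numerator_add_right (c : Triangle → Finset (Fin N)) (φ ψ : DottedFoam N Γ) (d : ψ.1.Dot) :
    numerator c (glueDots φ ⟨ψ.1, ψ.2 + Finsupp.single d 1⟩) =
      numerator c (glueDots φ ψ) * esymmOn (c (mirrorTriangle d.1.1)) d.1.2 := by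
  rw [numerator_glueDots, numerator_glueDots]
  dsimp only
  rw [monomial_add_single, map_mul (colorHom _ (c ∘ mirrorTriangle)), colorHom_X, mul_assoc]
  rfl

theorem pairing_boundaryDot (φ ψ : DottedFoam N Γ) {e : Plane × Plane} (he : e ∈ Γ.edges)
    {w : ℕ} (h1 : 1 ≤ w) (hw : w ≤ Γ.label e) :
    pairing ⟨φ.1, φ.2 + Finsupp.single (φ.1.boundaryDot e he w h1 hw) 1⟩ ψ =
      pairing φ ⟨ψ.1, ψ.2 + Finsupp.single (ψ.1.boundaryDot e he w h1 hw) 1⟩ := by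
  unfold pairing evaluation
  refine finsum_mem_congr rfl fun c hc => ?_
  rw [numerator_add_left, numerator_add_right, color_boundaryDot he h1 hw hc]
  rfl

theorem basepointFoam_descends (R : Type*) [CommRing R] {e : Plane × Plane} (he : e ∈ Γ.edges)
    {w : ℕ} (h1 : 1 ≤ w) (hw : w ≤ Γ.label e) : Descends (basepointFoam N Γ R e he w h1 hw) := by
  refine descends_of_adjoint (g := basepointFoam N Γ R e he w h1 hw) fun φ ψ => ?_
  rw [basepointFoam_single, basepointFoam_single, bilinearPairing_single, bilinearPairing_single,
    pairing_boundaryDot]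

theorem basepointFoam_comm (R : Type*) [CommRing R] {e f : Plane × Plane} (he : e ∈ Γ.edges)
    (hf : f ∈ Γ.edges) {w u : ℕ} (h1 : 1 ≤ w) (hw : w ≤ Γ.label e) (h1' : 1 ≤ u)
    (hu : u ≤ Γ.label f) :
    basepointFoam N Γ R e he w h1 hw * basepointFoam N Γ R f hf u h1' hu =
      basepointFoam N Γ R f hf u h1' hu * basepointFoam N Γ R e he w h1 hw := by
  refine Finsupp.lhom_ext' fun φ => LinearMap.ext_ring ?_
  simp only [LinearMap.comp_apply, Module.End.mul_apply, Finsupp.lsingle_apply,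
    basepointFoam_single]
  rw [add_right_comm]

theorem nablaFoam_decorate (R : Type*) [CommRing R] (F : Foam N Γ) (P : MvPolynomial F.Dot R) :
    nablaFoam R N Γ (decorate R F P) = decorate R F (nablaDots R F.toLabelledComplex P) := by
  have : (nablaFoam R N Γ).comp (decorate R F) =
      (decorate R F).comp (nablaDots R F.toLabelledComplex).toLinearMap := by
    refine (MvPolynomial.basisMonomials F.Dot R).ext fun k => ?_
    rw [LinearMap.comp_apply, LinearMap.comp_apply, MvPolynomial.coe_basisMonomials,
      decorate_monomial, nablaFoam, Finsupp.linearCombination_single, one_smul]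
    rfl
  exact LinearMap.congr_fun this P

theorem basepointFoam_decorate (R : Type*) [CommRing R] (F : Foam N Γ) {e : Plane × Plane}
    (he : e ∈ Γ.edges) {w : ℕ} (h1 : 1 ≤ w) (hw : w ≤ Γ.label e) (P : MvPolynomial F.Dot R) :
    basepointFoam N Γ R e he w h1 hw (decorate R F P) =
      decorate R F (P * MvPolynomial.X (F.boundaryDot e he w h1 hw)) := by
  have : (basepointFoam N Γ R e he w h1 hw).comp (decorate R F) =
      (decorate R F).comp (LinearMap.mulRight R
        (MvPolynomial.X (F.boundaryDot e he w h1 hw) : MvPolynomial F.Dot R)) := by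
    refine (MvPolynomial.basisMonomials F.Dot R).ext fun k => ?_
    rw [LinearMap.comp_apply, LinearMap.comp_apply, MvPolynomial.coe_basisMonomials,
      decorate_monomial, basepointFoam_single, LinearMap.mulRight_apply, MvPolynomial.X,
      MvPolynomial.monomial_mul, mul_one, decorate_monomial]
  exact LinearMap.congr_fun this P

/-- The Heisenberg relation between `∇` and a basepoint operator. -/
theorem nablaFoam_basepointFoam (R : Type*) [CommRing R] {e : Plane × Plane} (he : e ∈ Γ.edges)
    (hl : Γ.label e = 1) :
    nablaFoam R N Γ * basepointFoam N Γ R e he 1 le_rfl hl.ge =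
      basepointFoam N Γ R e he 1 le_rfl hl.ge * nablaFoam R N Γ + 1 := by
  refine Finsupp.lhom_ext' fun φ => LinearMap.ext_ring ?_
  obtain ⟨F, k⟩ := φ
  simp only [LinearMap.comp_apply, Finsupp.lsingle_apply, LinearMap.add_apply,
    Module.End.mul_apply, Module.End.one_apply]
  rw [← decorate_monomial, basepointFoam_decorate, nablaFoam_decorate, nablaFoam_decorate,
    basepointFoam_decorate, ← map_add, Derivation.leibniz]
  have hlab : F.label (F.boundaryDot e he 1 le_rfl hl.ge).1.1 = 1 :=
    (F.collar e.1 e.2 he).choose_spec.2.2.trans hl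
  have hX : nablaDots R F.toLabelledComplex
      (MvPolynomial.X (F.boundaryDot e he 1 le_rfl hl.ge)) = 1 := by
    rw [nablaDots, MvPolynomial.mkDerivation_X, hlab, lowerDot, dif_neg]
    · simp [Foam.boundaryDot]
    · simp [Foam.boundaryDot]
  rw [hX, smul_eq_mul, smul_eq_mul, mul_one, add_comm, mul_comm]

theorem basepointFoam_pow_single (R : Type*) [CommRing R] {e : Plane × Plane} (he : e ∈ Γ.edges)
    {w : ℕ} (h1 : 1 ≤ w) (hw : w ≤ Γ.label e) (φ : DottedFoam N Γ) (n : ℕ) :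
    (basepointFoam N Γ R e he w h1 hw ^ n) (Finsupp.single φ 1) =
      Finsupp.single ⟨φ.1, φ.2 + n • Finsupp.single (φ.1.boundaryDot e he w h1 hw) 1⟩ 1 := by
  induction n with
  | zero => simp
  | succ n ih =>
    rw [pow_succ', Module.End.mul_apply, ih, basepointFoam_single, succ_nsmul, add_assoc]

theorem esymmOn_singleton (i : Fin N) : esymmOn {i} 1 = MvPolynomial.X i := by
  have : Finset.powersetCard 1 ({i} : Finset (Fin N)) = {{i}} := by
    have := Finset.powersetCard_self ({i} : Finset (Fin N))
    rwa [Finset.card_singleton] at this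
  simp [esymmOn, this]

/-- Each variable is a root of `∏ (Y - X_i)`. The coefficients of this polynomial in `Y`, other than
the leading one, have no constant term. -/
theorem exists_pow_eq_sum (N : ℕ) : ∃ q : ℕ → MvPolynomial (Fin N) ℤ,
    (∀ j < N, MvPolynomial.constantCoeff (q j) = 0) ∧
      ∀ i : Fin N, (MvPolynomial.X i : MvPolynomial (Fin N) ℤ) ^ N =
        ∑ j ∈ Finset.range N, q j * MvPolynomial.X i ^ j := by
  let Q : Polynomial (MvPolynomial (Fin N) ℤ) :=
    ∏ i : Fin N, (Polynomial.X - Polynomial.C (MvPolynomial.X i))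
  have hmonic : Q.Monic := Polynomial.monic_prod_of_monic _ _ fun i _ => Polynomial.monic_X_sub_C _
  have hdeg : Q.natDegree = N := by
    rw [Polynomial.natDegree_prod_of_monic _ _ fun i _ => Polynomial.monic_X_sub_C _]
    simp
  refine ⟨fun j => -Q.coeff j, fun j hj => ?_, fun i => ?_⟩
  · have h : Q.map MvPolynomial.constantCoeff = Polynomial.X ^ N := by
      rw [Polynomial.map_prod]
      simp
    have := congrArg (fun p => Polynomial.coeff p j) h
    simp only [Polynomial.coeff_map, Polynomial.coeff_X_pow, if_neg hj.ne] at this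
    rw [map_neg, this, neg_zero]
  · have h0 : Q.eval (MvPolynomial.X i) = 0 := by
      rw [Polynomial.eval_prod]
      exact Finset.prod_eq_zero (Finset.mem_univ i) (by simp)
    rw [Polynomial.eval_eq_sum_range, hdeg, Finset.sum_range_succ] at h0
    have hlead : Q.coeff N = 1 := (congrArg Q.coeff hdeg).symm.trans hmonic
    rw [hlead, one_mul] at h0
    simp only [neg_mul, Finset.sum_neg_distrib]
    exact eq_neg_of_add_eq_zero_right h0

theorem card_color_left {F G : Foam N Γ} {c : Triangle → Finset (Fin N)}
    (hc : IsColoring N (glue F.toLabelledComplex G.toLabelledComplex) c) {t : Triangle}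
    (ht : t ∈ F.tri) : (c t).card = F.label t := by
  rw [hc.card t (Or.inl ht)]
  exact if_pos ht

theorem numerator_add_nsmul {c : Triangle → Finset (Fin N)} {F : Foam N Γ} (k : F.Dot →₀ ℕ)
    (ψ : DottedFoam N Γ) {d : F.Dot} {i : Fin N} (hi : c d.1.1 = {i}) (hd : d.1.2 = 1) (n : ℕ) :
    numerator c (glueDots ⟨F, k + n • Finsupp.single d 1⟩ ψ) =
      numerator c (glueDots ⟨F, k⟩ ψ) * MvPolynomial.X i ^ n := by
  induction n with
  | zero => rw [zero_smul, add_zero, pow_zero, mul_one]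
  | succ n ih =>
    have h := numerator_add_left c ⟨F, k + n • Finsupp.single d 1⟩ ψ d
    rw [ih, hi, hd, esymmOn_singleton] at h
    rw [succ_nsmul, ← add_assoc, pow_succ, ← mul_assoc]
    exact h

/-- The evaluation with `N` more dots of weight `1` on a facet with label `1` has no constant
term. -/
theorem constantCoeff_pairingPoly_nsmul (hN : 2 ≤ N) {F : Foam N Γ} (k : F.Dot →₀ ℕ)
    (ψ : DottedFoam N Γ) {d : F.Dot} (hl : F.label d.1.1 = 1) (hd : d.1.2 = 1) :
    MvPolynomial.constantCoeff (pairingPoly hN ⟨F, k + N • Finsupp.single d 1⟩ ψ) = 0 := by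
  obtain ⟨q, hq, hpow⟩ := exists_pow_eq_sum N
  obtain ⟨Δ, T, w, hΔ, -, hT, -, hcl⟩ := exists_cleared (isClosedFoam_glue F ψ.1) N
  have key : ∀ n : ℕ, Δ * pairingPoly hN ⟨F, k + n • Finsupp.single d 1⟩ ψ =
      ∑ c ∈ T, w c * numerator c (glueDots ⟨F, k + n • Finsupp.single d 1⟩ ψ) := by
    intro n
    generalize k + n • Finsupp.single d 1 = k'
    exact hcl (glueDots ⟨F, k'⟩ ψ) _ (algebraMap_pairingPoly hN ⟨F, k'⟩ ψ)
  have hmain : pairingPoly hN ⟨F, k + N • Finsupp.single d 1⟩ ψ =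
      ∑ j ∈ Finset.range N, q j * pairingPoly hN ⟨F, k + j • Finsupp.single d 1⟩ ψ := by
    refine mul_left_cancel₀ hΔ ?_
    rw [key, Finset.mul_sum]
    simp only [mul_left_comm Δ, key, Finset.mul_sum]
    rw [Finset.sum_comm]
    refine Finset.sum_congr rfl fun c hc => ?_
    obtain ⟨i, hi⟩ := Finset.card_eq_one.1 ((card_color_left (hT c hc) d.2.1).trans hl)
    simp only [numerator_add_nsmul k ψ hi hd]
    rw [hpow, Finset.mul_sum, Finset.mul_sum]
    refine Finset.sum_congr rfl fun j _ => ?_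
    ring
  rw [hmain, map_sum]
  refine Finset.sum_eq_zero fun j hj => ?_
  rw [map_mul, hq j (Finset.mem_range.1 hj), zero_mul]

theorem basepointFoam_pow_mem (hN : 2 ≤ N) (R : Type*) [CommRing R] {e : Plane × Plane}
    (he : e ∈ Γ.edges) (hl : Γ.label e = 1) (x : FoamModule N Γ R) :
    (basepointFoam N Γ R e he 1 le_rfl hl.ge ^ N) x ∈ pairingKernel N Γ R := by
  rw [mem_pairingKernel_iff]
  suffices h : (bilinearPairing N Γ R).comp (basepointFoam N Γ R e he 1 le_rfl hl.ge ^ N) = 0 by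
    intro y
    exact LinearMap.congr_fun (LinearMap.congr_fun h x) y
  refine Finsupp.lhom_ext' fun φ => LinearMap.ext_ring ?_
  refine Finsupp.lhom_ext' fun ψ => LinearMap.ext_ring ?_
  simp only [LinearMap.comp_apply, Finsupp.lsingle_apply, LinearMap.zero_apply]
  rw [basepointFoam_pow_single, bilinearPairing_single, valueAtZero_pairing hN,
    constantCoeff_pairingPoly_nsmul hN _ _ _ rfl, Int.cast_zero]
  exact (φ.1.collar e.1 e.2 he).choose_spec.2.2.trans hl

/-- The class of a combination of dotted foams in the state space. -/
def StateSpace.mk (N : ℕ) (Γ : PlaneGraph) (R : Type*) [CommRing R] :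
    FoamModule N Γ R →ₗ[R] StateSpace N Γ R := (pairingKernel N Γ R).mkQ

theorem StateSpace.mk_eq_zero {R : Type*} [CommRing R] {x : FoamModule N Γ R}
    (hx : x ∈ pairingKernel N Γ R) : StateSpace.mk N Γ R x = 0 :=
  (Submodule.Quotient.mk_eq_zero _).2 hx

theorem Descends.induced_mk {R : Type*} [CommRing R] {f : Module.End R (FoamModule N Γ R)}
    (hf : Descends f) (x : FoamModule N Γ R) :
    hf.induced (StateSpace.mk N Γ R x) = StateSpace.mk N Γ R (f x) := rfl

theorem stateSpace_ext {R : Type*} [CommRing R] {f g : Module.End R (StateSpace N Γ R)}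
    (h : ∀ x, f (StateSpace.mk N Γ R x) = g (StateSpace.mk N Γ R x)) : f = g := by
  refine LinearMap.ext fun y => ?_
  obtain ⟨x, rfl⟩ := Submodule.Quotient.mk_surjective (pairingKernel N Γ R) y
  exact h x

theorem Descends.induced_pow_mk {R : Type*} [CommRing R] {f : Module.End R (FoamModule N Γ R)}
    (hf : Descends f) (n : ℕ) (x : FoamModule N Γ R) :
    (hf.induced ^ n) (StateSpace.mk N Γ R x) = StateSpace.mk N Γ R ((f ^ n) x) := by
  induction n with
  | zero => rfl
  | succ n ih =>
    rw [pow_succ', pow_succ', Module.End.mul_apply, Module.End.mul_apply, ih, hf.induced_mk]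

theorem induced_comm (R : Type*) [CommRing R] {e f : Plane × Plane} (he : e ∈ Γ.edges)
    (hf : f ∈ Γ.edges) (hle : Γ.label e = 1) (hlf : Γ.label f = 1)
    (hX : Descends (basepointFoam N Γ R e he 1 le_rfl hle.ge))
    (hY : Descends (basepointFoam N Γ R f hf 1 le_rfl hlf.ge)) :
    hX.induced * hY.induced = hY.induced * hX.induced :=
  stateSpace_ext fun x => congrArg (StateSpace.mk N Γ R)
    (LinearMap.congr_fun (basepointFoam_comm R he hf le_rfl hle.ge le_rfl hlf.ge) x)

theorem induced_heisenberg (R : Type*) [CommRing R] {e : Plane × Plane} (he : e ∈ Γ.edges)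
    (hl : Γ.label e = 1) (hX : Descends (basepointFoam N Γ R e he 1 le_rfl hl.ge))
    (hD : Descends (nablaFoam R N Γ)) :
    hD.induced * hX.induced = hX.induced * hD.induced + 1 :=
  stateSpace_ext fun x => congrArg (StateSpace.mk N Γ R)
    (LinearMap.congr_fun (nablaFoam_basepointFoam R he hl) x)

theorem induced_pow_eq_zero (hN : 2 ≤ N) (R : Type*) [CommRing R] {e : Plane × Plane}
    (he : e ∈ Γ.edges) (hl : Γ.label e = 1)
    (hX : Descends (basepointFoam N Γ R e he 1 le_rfl hl.ge)) : hX.induced ^ N = 0 :=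
  stateSpace_ext fun x => (hX.induced_pow_mk N x).trans
    (StateSpace.mk_eq_zero (basepointFoam_pow_mem hN R he hl x))

/-! ### Direct sums over the complete resolutions of a diagram -/

namespace LinkDiagram

variable {R : Type*} [CommRing R] (D : LinkDiagram)

theorem sumOperator_mul (f g : ∀ v, Module.End R (StateSpace N (D.resolve v) R)) :
    D.sumOperator f * D.sumOperator g = D.sumOperator fun v => f v * g v :=
  (DirectSum.lmap_comp g f).symm

theorem sumOperator_one :
    D.sumOperator (fun v => (1 : Module.End R (StateSpace N (D.resolve v) R))) = 1 :=
  DirectSum.lmap_id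

theorem sumOperator_add (f g : ∀ v, Module.End R (StateSpace N (D.resolve v) R)) :
    D.sumOperator (fun v => f v + g v) = D.sumOperator f + D.sumOperator g :=
  LinearMap.ext fun _ => DFinsupp.ext fun _ => rfl

theorem sumOperator_zero :
    D.sumOperator (fun v => (0 : Module.End R (StateSpace N (D.resolve v) R))) = 0 :=
  LinearMap.ext fun _ => DFinsupp.ext fun _ => rfl

theorem sumOperator_pow (f : ∀ v, Module.End R (StateSpace N (D.resolve v) R)) (n : ℕ) :
    D.sumOperator f ^ n = D.sumOperator fun v => f v ^ n := by
  induction n with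
  | zero => simp only [pow_zero, sumOperator_one]
  | succ n ih => simp only [pow_succ, ih, sumOperator_mul]

end LinkDiagram

end SlFoam
end

open SlFoam in
theorem proposition4p2 (N : ℕ) (hN : 2 ≤ N) (R : Type*) [CommRing R] (hR : ringChar R ∣ N) :
    -- MOY graphs with two basepoints on edges labelled `1`
    (∀ Γ : PlaneGraph, Γ.IsMOY N →
      (∀ φ ψ : DottedFoam N Γ, ∃ P : MvPolynomial (Fin N) ℤ,
        P.IsSymmetric ∧ algebraMap (MvPolynomial (Fin N) ℤ) (RatFunc N) P = pairing φ ψ) ∧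
      ∀ (p q : Plane × Plane) (hp : p ∈ Γ.edges) (hq : q ∈ Γ.edges)
        (lp : Γ.label p = 1) (lq : Γ.label q = 1),
        ∃ (hX : Descends (basepointFoam N Γ R p hp 1 le_rfl lp.ge))
          (hY : Descends (basepointFoam N Γ R q hq 1 le_rfl lq.ge))
          (hD : Descends (nablaFoam R N Γ)),
          let X := hX.induced
          let Y := hY.induced
          let D := hD.induced
          (N.Prime →
            transfer D Y X (N - 1) ∘ₗ transfer D X Y (N - 1) = LinearMap.id) ∧
          (¬ N.Prime →
            transfer D Y X (N - 1) ∘ₗ transfer D X Y (N - 1) = 0)) ∧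
    -- link diagrams with two basepoints
    (∀ (L : LinkDiagram) (p q : Plane × Plane) (hp : p ∈ L.arcs) (hq : q ∈ L.arcs),
      ∃ (hX : ∀ v, Descends
          (basepointFoam N (L.resolve v) R p (L.mem_edges_resolve v hp) 1 le_rfl
            (L.label_resolve v hp).ge))
        (hY : ∀ v, Descends
          (basepointFoam N (L.resolve v) R q (L.mem_edges_resolve v hq) 1 le_rfl
            (L.label_resolve v hq).ge))
        (hD : ∀ v, Descends (nablaFoam R N (L.resolve v))),
        let X := L.sumOperator fun v => (hX v).induced
        let Y := L.sumOperator fun v => (hY v).induced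
        let D := L.sumOperator fun v => (hD v).induced
        (N.Prime →
          transfer D Y X (N - 1) ∘ₗ transfer D X Y (N - 1) = LinearMap.id) ∧
        (¬ N.Prime →
          transfer D Y X (N - 1) ∘ₗ transfer D X Y (N - 1) = 0)) := by
  have hR0 : (N : R) = 0 := (ringChar.spec R N).2 hR
  refine ⟨fun Γ _ => ⟨fun φ ψ => exists_polynomial_evaluation hN (isClosedFoam_glue φ.1 ψ.1) _,
    fun p q hp hq lp lq => ?_⟩, fun L p q hp hq => ?_⟩
  · have hX := basepointFoam_descends (N := N) R hp le_rfl lp.ge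
    have hY := basepointFoam_descends (N := N) R hq le_rfl lq.ge
    have hD := nablaFoam_descends (Γ := Γ) hN hR0
    exact ⟨hX, hY, hD, transfer_comp_transfer hN hR0 (induced_heisenberg R hp lp hX hD)
      (induced_heisenberg R hq lq hY hD) (induced_comm R hp hq lp lq hX hY)
      (induced_pow_eq_zero hN R hp lp hX)⟩
  · have ep := fun v => L.mem_edges_resolve v hp
    have eq := fun v => L.mem_edges_resolve v hq
    have lp := fun v => L.label_resolve v hp
    have lq := fun v => L.label_resolve v hq
    have hX := fun v => basepointFoam_descends (N := N) R (ep v) le_rfl (lp v).ge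
    have hY := fun v => basepointFoam_descends (N := N) R (eq v) le_rfl (lq v).ge
    have hD := fun v => nablaFoam_descends (Γ := L.resolve v) hN hR0
    refine ⟨hX, hY, hD, transfer_comp_transfer hN hR0 ?_ ?_ ?_ ?_⟩
    · rw [L.sumOperator_mul, L.sumOperator_mul, ← L.sumOperator_one, ← L.sumOperator_add]
      exact congrArg _ (funext fun v => induced_heisenberg R (ep v) (lp v) (hX v) (hD v))
    · rw [L.sumOperator_mul, L.sumOperator_mul, ← L.sumOperator_one, ← L.sumOperator_add]
      exact congrArg _ (funext fun v => induced_heisenberg R (eq v) (lq v) (hY v) (hD v))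
    · rw [L.sumOperator_mul, L.sumOperator_mul]
      exact congrArg _ (funext fun v =>
        induced_comm R (ep v) (eq v) (lp v) (lq v) (hX v) (hY v))
    · rw [L.sumOperator_pow, ← L.sumOperator_zero]
      exact congrArg _ (funext fun v => induced_pow_eq_zero hN R (ep v) (lp v) (hX v))
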